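/- **Notation.** Write $\mathcal S_{1/2}(\mathbf R^d)$ for the Gelfand–Shilov space of all $f\in C^\infty(\mathbf R^d)$ such that, for some $h,C>0$, $|x^\beta\partial^\alpha f(x)|\le C h^{|\alpha|+|\beta|}(\alpha!\,\beta!)^{1/2}$ for all $\alpha,\beta,x$, and $\mathcal S_{1/2}'(\mathbf R^d)\supseteq \mathcal S_{1/2}(\mathbf R^d)$ for its dual. $\mathscr S_0$ denotes the finite linear combinations of Hermite functions. *Weights.* A weight on $\mathbf R^n$ is a positive function $\omega\in L^\infty_{loc}$ that is bounded below by a positive constant on each compact set. $\mathscr P_Q^0(\mathbf R^n)$ is the set of weights for which there are $c,C>0$ and $R\ge 2$ with $C^{-1}\omega(x)^2\le\omega(x+y)\omega(x-y)\le C\omega(x)^2$ whenever $Rc\le|x|\le c/|y|$, and for which for every $c>0$ there is $C>0$ with $C^{-1}e^{-c|x|^2}\le\omega(x)\le Ce^{c|x|^2}$ for all $x$. For a weight $\omega$ put $Q_\omega(\lambda,x)=\omega(\sqrt2\,x)\,e^{-(1-\lambda^2)|x|^2/2}/\omega(\sqrt2\,\lambda x)$. A weight $\omega\in\mathscr P_Q^0$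 is *dilated suitable* if $Q_\omega(\lambda,x)\le C$ for some $C>0$, $\theta\in(0,1)$ and all $x$ and $1-\theta<\lambda<1$; it is *narrowly dilated suitable* if moreover $\limsup_{\lambda\to1-}\sup_xQ_{\omega_0}(\lambda,x)\le1$ for some continuous weight $\omega_0$ such that $\omega/\omega_0$ and $\omega_0/\omega$ are bounded. For $p,q\in[1,\infty]$ let $L^{p,q}$ be the mixed Lebesgue space with norm $\big(\int(\int|F(x,\xi)|^p\,dx)^{q/p}d\xi\big)^{1/q}$. The pair $(L^{p,q},\omega)$ is *feasible* if (1) $p,q>1$ and $\omega$ is dilated suitable, or (2) $p,q<\infty$ and $\omega$ is dilated suitable, or (3) $p=\infty$, $q=1$ and $\omega$ is narrowly dilated suitable. *Spaces.* Let $\phi(y)=\pi^{-d/4}e^{-|y|^2/2}$ and, for $f\in\mathcal S_{1/2}'(\mathbf R^d)$, $V_\phi f(x,\xi)=(2\pi)^{-d/2}\langle f,\phi(\cdot-x)e^{-i\langle\cdot,\xi\rangle}\rangle$. For $\omega\in\mathscr P^0_Q(\mathbf R^{2d})$, $M^{p,q}_{(\omega)}(\mathbf R^d)$ is the space of all $f\in\mathcal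 S_{1/2}'(\mathbf R^d)$ with $\|f\|_{M^{p,q}_{(\omega)}}=\|V_\phi f\cdot\omega\|_{L^{p,q}}<\infty$. The *weak topology* on $M^{p,q}_{(\omega)}$ is the one given by the forms $f\mapsto(f,g)=\iint V_\phi f\,\overline{V_\phi g}\,dx\,d\xi$ with $g\in M^{p',q'}_{(1/\omega)}$, where $p',q'$ are the conjugate exponents. With $\sigma(X,Y)=\langle y,\xi\rangle-\langle x,\eta\rangle$ for $X=(x,\xi)$, $Y=(y,\eta)$, and $\Phi(X)=(2/\pi)^{d/2}e^{-|X|^2}$, let $\mathcal V_\Phi a(X,Y)=\pi^{-d}\langle a,\Phi(\cdot-X)e^{2i\sigma(Y,\cdot)}\rangle$ for $a\in\mathcal S_{1/2}'(\mathbf R^{2d})$, and for $\omega\in\mathscr P_Q^0(\mathbf R^{4d})$ let $\mathcal M^{p,q}_{(\omega)}(\mathbf R^{2d})$ be the space of all such $a$ with $\|a\|_{\mathcal M^{p,q}_{(\omega)}}=\|\mathcal V_\Phi a\cdot\omega\|_{L^{p,q}(\mathbf R^{4d})}<\infty$. The Weyl operator $\operatorname{Op}^w(a):\mathcal S_{1/2}(\mathbf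 R^d)\to\mathcal S_{1/2}'(\mathbf R^d)$ is given by $\operatorname{Op}^w(a)f(x)=(2\pi)^{-d}\iint a(\tfrac{x+y}2,\xi)f(y)e^{i\langle x-y,\xi\rangle}\,dy\,d\xi$, interpreted in the distribution sense. **Theorem.** Let $p,q,p_1,q_1,p_2,q_2\in[1,\infty]$ satisfy $$\frac1{p_2}-\frac1{p_1}=\frac1{q_2}-\frac1{q_1}=\frac1p+\frac1q-1,\qquad q\le p_2,q_2\le p.$$ Let $\omega\in\mathscr P_Q^0(\mathbf R^{4d})$ and $\omega_1,\omega_2\in\mathscr P_Q^0(\mathbf R^{2d})$ be such that $(L^{p,q}(\mathbf R^{4d}),\omega)$ and $(L^{p_j,q_j}(\mathbf R^{2d}),\omega_j)$, $j=1,2$, are feasible pairs, and such that for some $C>0$ $$\frac{\omega_2(X-Y)}{\omega_1(X+Y)}\le C\,\omega(X,Y),\qquad X,Y\in\mathbf R^{2d}.$$ Let $a\in\mathcal M^{p,q}_{(\omega)}(\mathbf R^{2d})$. Then $\mathcal S_{1/2}(\mathbf R^d)\subseteq M^{p_1,q_1}_{(\omega_1)}(\mathbf R^d)$, and $\operatorname{Op}^w(a)$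 extends to a continuous linear map $T:M^{p_1,q_1}_{(\omega_1)}(\mathbf R^d)\to M^{p_2,q_2}_{(\omega_2)}(\mathbf R^d)$, which is also continuous for the weak topologies. The extension is unique in the following sense: $T$ is the only extension that is continuous for the weak topologies, and if $p_1,q_1<\infty$, then $T$ is the only extension that is continuous for the norms. Moreover, if $a$ belongs to the closure of $\mathscr S_0(\mathbf R^{2d})$ in the norm $\|\cdot\|_{\mathcal M^{p,q}_{(\omega)}}$, then $T:M^{p_1,q_1}_{(\omega_1)}(\mathbf R^d)\to M^{p_2,q_2}_{(\omega_2)}(\mathbf R^d)$ is compact. -/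

import Mathlib

open MeasureTheory Filter Topology
open scoped ENNReal

noncomputable section

namespace WeylMod

/-! ### Euclidean spaces -/

/-- The Euclidean space with coordinates indexed by `ι`. For `ι = Fin d` this is `ℝ^d`, for
`ι = Fin d ⊕ Fin d` it is the phase space `ℝ^{2d}`. -/
abbrev E (ι : Type) [Fintype ι] : Type := EuclideanSpace ℝ ι

variable {ι κ : Type} [Fintype ι] [Fintype κ]

/-- The point `(x, y)` of `E ι × E κ = E (ι ⊕ κ)`, with the Euclidean norm. -/
def join (x : E ι) (y : E κ) : E (ι ⊕ κ) :=
  WithLp.toLp 2 (Sum.elim (fun i => x i) (fun j => y j))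

/-- The component `x` of `(x, ξ)`. -/
def left (X : E (ι ⊕ κ)) : E ι := WithLp.toLp 2 (fun i => X (Sum.inl i))

/-- The component `ξ` of `(x, ξ)`. -/
def right (X : E (ι ⊕ κ)) : E κ := WithLp.toLp 2 (fun j => X (Sum.inr j))

/-! ### Weights -/

/-- A weight: a positive function in `L^∞_loc`, bounded from below on every compact set. -/
structure IsWeight (ω : E ι → ℝ) : Prop where
  pos : ∀ x, 0 < ω x
  aemeasurable : AEMeasurable ω volume
  locally_bounded : ∀ K : Set (E ι), IsCompact K → ∃ C : ℝ, ∀ᵐ x ∂volume, x ∈ K → ω x ≤ C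
  bounded_below : ∀ K : Set (E ι), IsCompact K → ∃ c : ℝ, 0 < c ∧ ∀ x ∈ K, c ≤ ω x

/-- Weights of weakly subgaussian type. The condition `|x| ≤ c / |y|` is written as
`|x| |y| ≤ c`, so that `y = 0` is allowed for all `x`. -/
structure IsWeaklySubgaussian (ω : E ι → ℝ) : Prop extends IsWeight ω where
  relaxed_moderate : ∃ c C R : ℝ, 0 < c ∧ 0 < C ∧ 2 ≤ R ∧
    ∀ x y : E ι, R * c ≤ ‖x‖ → ‖x‖ * ‖y‖ ≤ c →
      C⁻¹ * ω x ^ 2 ≤ ω (x + y) * ω (x - y) ∧ ω (x + y) * ω (x - y) ≤ C * ω x ^ 2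
  gauss_bound : ∀ c : ℝ, 0 < c → ∃ C : ℝ, 0 < C ∧
    ∀ x : E ι, C⁻¹ * Real.exp (-c * ‖x‖ ^ 2) ≤ ω x ∧ ω x ≤ C * Real.exp (c * ‖x‖ ^ 2)

/-- The quotient `ω(√2 x) e^{-ε(1-λ²)|x|²/2} / ω(√2 λ x)`. -/
def dilationQuotient (ω : E ι → ℝ) (ε lam : ℝ) (x : E ι) : ℝ :=
  ω (Real.sqrt 2 • x) * Real.exp (-ε * (1 - lam ^ 2) * ‖x‖ ^ 2 / 2) /
    ω ((Real.sqrt 2 * lam) • x)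

/-- `ω` is dilated suitable with respect to `ε`. -/
def DilatedSuitable (ω : E ι → ℝ) (ε : ℝ) : Prop :=
  IsWeaklySubgaussian ω ∧ ∃ C θ : ℝ, 0 < C ∧ 0 < θ ∧ θ < 1 ∧
    ∀ lam : ℝ, 1 - θ < lam → lam < 1 → ∀ x : E ι, dilationQuotient ω ε lam x ≤ C

/-- `ω` is narrowly dilated suitable with respect to `ε` and the subspace `V`: it is dilated
suitable, and for some continuous weight `ω₀` equivalent to `ω` and every `x₁ ∈ V`, the supremum
over `x₂ ∈ V^⊥` of the dilation quotient of `ω₀` at `x₁ + x₂` has upper limit at most `1` as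
`λ → 1-`. -/
def NarrowlyDilatedSuitable (ω : E ι → ℝ) (ε : ℝ) (V : Submodule ℝ (E ι)) : Prop :=
  DilatedSuitable ω ε ∧ ∃ ω₀ : E ι → ℝ, IsWeight ω₀ ∧ Continuous ω₀ ∧
    (∃ C : ℝ, 0 < C ∧ ∀ x, C⁻¹ * ω₀ x ≤ ω x ∧ ω x ≤ C * ω₀ x) ∧
    ∀ x₁ ∈ V, ∀ δ : ℝ, 0 < δ → ∀ᶠ lam in 𝓝[<] (1 : ℝ),
      ∀ x₂ ∈ Vᗮ, dilationQuotient ω₀ ε lam (x₁ + x₂) ≤ 1 + δ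

/-- The pair `(L^{p,q}, ω)` is feasible, where `L^{p,q}` has the inner exponent `p` and the outer
exponent `q`. -/
def FeasiblePair (p q : ℝ≥0∞) (ω : E ι → ℝ) : Prop :=
  ((1 < p ∧ 1 < q) ∧ DilatedSuitable ω 1) ∨
  ((p < ∞ ∧ q < ∞) ∧ DilatedSuitable ω 1) ∨
  ((p = ∞ ∧ q = 1) ∧ NarrowlyDilatedSuitable ω 1 ⊥)

/-! ### The mixed norm -/

section Mixed

variable {A B : Type} [MeasureSpace A] [MeasureSpace B]

/-- The `L^{p,q}` norm: exponent `p` in the first variable (inner), `q` in the second (outer). -/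
def mixedNorm (p q : ℝ≥0∞) (F : A × B → ℂ) : ℝ≥0∞ :=
  eLpNorm (fun b => eLpNorm (fun a => F (a, b)) p volume) q volume

/-- Membership in `L^{p,q}`. -/
def MemMixed (p q : ℝ≥0∞) (F : A × B → ℂ) : Prop :=
  AEStronglyMeasurable F volume ∧ mixedNorm p q F < ∞

theorem mixedNorm_const_smul_le (p q : ℝ≥0∞) (c : ℂ) (F : A × B → ℂ) :
    mixedNorm p q (c • F) ≤ ‖c‖ₑ * mixedNorm p q F := by
  unfold mixedNorm
  have h := eLpNorm_le_nnreal_smul_eLpNorm_of_ae_le_mul'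
    (f := fun b => eLpNorm (fun a => (c • F) (a, b)) p volume)
    (g := fun b => eLpNorm (fun a => F (a, b)) p volume) (c := ‖c‖₊) (μ := (volume : Measure B))
    (ae_of_all _ fun b => by
      have h1 : eLpNorm (fun a => (c • F) (a, b)) p volume =
          ‖c‖ₑ * eLpNorm (fun a => F (a, b)) p volume :=
        eLpNorm_const_smul c (fun a => F (a, b)) p volume
      simp only [enorm_eq_self, h1]
      exact le_rfl) q
  simpa only [ENNReal.smul_def, smul_eq_mul] using! h

theorem mixedNorm_neg (p q : ℝ≥0∞) (F : A × B → ℂ) :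
    mixedNorm p q (-F) = mixedNorm p q F := by
  unfold mixedNorm
  congr 1
  funext b
  exact eLpNorm_neg (fun a => F (a, b)) p volume

variable [SFinite (volume : Measure A)] [SFinite (volume : Measure B)]

theorem aemeasurable_inner {p : ℝ≥0∞} {F : A × B → ℂ}
    (hF : AEStronglyMeasurable F volume) :
    AEMeasurable (fun b => eLpNorm (fun a => F (a, b)) p volume) volume := by
  have hmk : ∀ᵐ b : B, ∀ᵐ a : A, F (a, b) = hF.mk F (a, b) := by
    have h : ∀ᵐ z ∂((volume : Measure B).prod (volume : Measure A)).map Prod.swap,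
        F z = hF.mk F z := by
      rw [Measure.prod_swap]
      exact hF.ae_eq_mk
    exact Measure.ae_ae_of_ae_prod (ae_of_ae_map measurable_swap.aemeasurable h)
  have hsm : Measurable (hF.mk F) := hF.stronglyMeasurable_mk.measurable
  refine AEMeasurable.congr (f := fun b => eLpNorm (fun a => hF.mk F (a, b)) p volume) ?_ ?_
  · refine Measurable.aemeasurable ?_
    rcases eq_or_ne p 0 with rfl | h0
    · simp
    rcases eq_or_ne p ∞ with rfl | htop
    · simp only [eLpNorm_exponent_top, eLpNormEssSup]
      refine measurable_of_Iic fun c => ?_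
      have hset : MeasurableSet {z : A × B | c < ‖hF.mk F z‖ₑ} :=
        measurableSet_lt measurable_const hsm.enorm
      have hm := measurable_measure_prodMk_right (μ := (volume : Measure A)) hset
      have heq : ((fun b => essSup (fun a => ‖hF.mk F (a, b)‖ₑ) volume) ⁻¹' Set.Iic c) =
          (fun b => (volume : Measure A) ((fun a => (a, b)) ⁻¹' {z : A × B | c < ‖hF.mk F z‖ₑ}))
            ⁻¹' {0} := by
        ext b
        simp only [Set.mem_preimage, Set.mem_Iic, Set.mem_singleton_iff]
        constructor
        · intro h
          have := ae_le_essSup (μ := (volume : Measure A)) (f := fun a => ‖hF.mk F (a, b)‖ₑ)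
          refine measure_mono_null ?_ this
          intro a ha
          simp only [Set.mem_preimage, Set.mem_ofPred_eq] at ha
          simp only [Set.mem_compl_iff, Set.mem_ofPred_eq, not_le]
          exact lt_of_le_of_lt h ha
        · intro h
          refine essSup_le_of_ae_le c ?_
          have : ∀ᵐ a : A, ¬ (c < ‖hF.mk F (a, b)‖ₑ) := by
            rw [ae_iff]
            simpa using h
          filter_upwards [this] with a ha
          exact not_lt.mp ha
      rw [heq]
      exact hm (measurableSet_singleton 0)
    · simp only [eLpNorm_eq_lintegral_rpow_enorm_toReal h0 htop]
      refine Measurable.pow_const ?_ _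
      exact Measurable.lintegral_prod_left' (f := fun z : A × B => ‖hF.mk F z‖ₑ ^ p.toReal)
        (hsm.enorm.pow_const _)
  · filter_upwards [hmk] with b hb
    refine (eLpNorm_congr_ae ?_).symm
    filter_upwards [hb] with a ha
    exact ha

theorem ae_inner_aestronglyMeasurable {F : A × B → ℂ} (hF : AEStronglyMeasurable F volume) :
    ∀ᵐ b : B, AEStronglyMeasurable (fun a => F (a, b)) volume := by
  have h : AEStronglyMeasurable F ((volume : Measure A).prod (volume : Measure B)) := hF
  have h2 := h.prod_swap
  exact h2.prodMk_left

theorem mixedNorm_add_le {p q : ℝ≥0∞} (hp : 1 ≤ p) (hq : 1 ≤ q) {F G : A × B → ℂ}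
    (hF : AEStronglyMeasurable F volume) (hG : AEStronglyMeasurable G volume) :
    mixedNorm p q (F + G) ≤ mixedNorm p q F + mixedNorm p q G := by
  unfold mixedNorm
  refine le_trans ?_ (eLpNorm_add_le (aemeasurable_inner hF).aestronglyMeasurable
    (aemeasurable_inner hG).aestronglyMeasurable hq)
  refine eLpNorm_mono_enorm_ae ?_
  filter_upwards [ae_inner_aestronglyMeasurable hF, ae_inner_aestronglyMeasurable hG] with b h1 h2
  simpa only [enorm_eq_self, Pi.add_apply] using! eLpNorm_add_le h1 h2 hp

end Mixed

/-! ### Gelfand-Shilov spaces -/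

/-- The Gelfand-Shilov estimate with `s = 1/2` and parameter `h`:
`|x|^k |D^n f(x)| ≤ C h^{k+n} (k! n!)^{1/2}` for all `k, n, x`. The least such `C` is the norm of
`f` in `𝒮_{1/2,h}`. (The variant with `|x^β ∂^α f(x)|` and `(α! β!)^{1/2}` gives the same spaces
after replacing `h` by a multiple that depends only on the dimension, since
`α! ≤ |α|! ≤ d^{|α|} α!`; so the union over `h` and its dual are the same.) -/
def GSBound (h C : ℝ) (f : E ι → ℂ) : Prop :=
  ∀ (k n : ℕ) (x : E ι), ‖x‖ ^ k * ‖iteratedFDeriv ℝ n f x‖ ≤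
    C * h ^ (k + n) * Real.sqrt ((k.factorial : ℝ) * (n.factorial : ℝ))

theorem GSBound.nonneg {h C : ℝ} {f : E ι → ℂ} (hf : GSBound h C f) : 0 ≤ C := by
  have := hf 0 0 0
  simp at this
  exact le_trans (norm_nonneg _) this

theorem GSBound.norm_le {h C : ℝ} {f : E ι → ℂ} (hf : GSBound h C f) (x : E ι) :
    ‖f x‖ ≤ C := by
  simpa using hf 0 0 x

theorem GSBound.mono {h h' C : ℝ} {f : E ι → ℂ} (hf : GSBound h C f) (h0 : 0 < h)
    (hh : h ≤ h') : GSBound h' C f := by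
  intro k n x
  refine (hf k n x).trans ?_
  have := hf.nonneg
  gcongr

/-- The Gelfand-Shilov space `𝒮_{1/2} = ⋃_{h > 0} 𝒮_{1/2,h}`. -/
def GS (ι : Type) [Fintype ι] : Submodule ℂ (E ι → ℂ) where
  carrier := {f | ContDiff ℝ ((⊤ : ℕ∞) : WithTop ℕ∞) f ∧ ∃ h C : ℝ, 0 < h ∧ GSBound h C f}
  zero_mem' := ⟨contDiff_const, 1, 0, one_pos, fun k n x => by
    have : iteratedFDeriv ℝ n (0 : E ι → ℂ) x = 0 :=
      congrFun (iteratedFDeriv_fun_zero (𝕜 := ℝ) (E := E ι) (F := ℂ) (n := n)) x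
    simp [this]⟩
  add_mem' := by
    rintro f g ⟨hf, h₁, C₁, h₁0, hb₁⟩ ⟨hg, h₂, C₂, h₂0, hb₂⟩
    refine ⟨hf.add hg, max h₁ h₂, C₁ + C₂, lt_max_of_lt_left h₁0, fun k n x => ?_⟩
    have e₁ := (hb₁.mono h₁0 (le_max_left h₁ h₂)) k n x
    have e₂ := (hb₂.mono h₂0 (le_max_right h₁ h₂)) k n x
    have hfn : ContDiff ℝ n f := hf.of_le (by exact_mod_cast le_top)
    have hgn : ContDiff ℝ n g := hg.of_le (by exact_mod_cast le_top)
    rw [iteratedFDeriv_add_apply hfn.contDiffAt hgn.contDiffAt]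
    calc _ ≤ ‖x‖ ^ k * (‖iteratedFDeriv ℝ n f x‖ + ‖iteratedFDeriv ℝ n g x‖) := by
          gcongr; exact norm_add_le _ _
      _ ≤ _ := by rw [mul_add]; linarith
  smul_mem' := by
    rintro c f ⟨hf, h, C, h0, hb⟩
    refine ⟨contDiff_const.smul hf, h, ‖c‖ * C, h0, fun k n x => ?_⟩
    have hfn : ContDiff ℝ n f := hf.of_le (by exact_mod_cast le_top)
    rw [iteratedFDeriv_const_smul_apply hfn.contDiffAt, norm_smul]
    have := mul_le_mul_of_nonneg_left (hb k n x) (norm_nonneg c)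
    linarith

/-- The Gelfand-Shilov distribution space `𝒮'_{1/2} = ⋂_{h > 0} 𝒮'_{1/2,h}`, the dual of the
inductive limit `𝒮_{1/2}`: linear forms whose restriction to `𝒮_{1/2,h}` is bounded for every
`h > 0`. -/
def GSDual (ι : Type) [Fintype ι] : Submodule ℂ (GS ι →ₗ[ℂ] ℂ) where
  carrier := {u | ∀ h : ℝ, 0 < h → ∃ M : ℝ, ∀ (f : GS ι) (C : ℝ),
    GSBound h C (f : E ι → ℂ) → ‖u f‖ ≤ M * C}
  zero_mem' := fun h _ => ⟨0, fun f C _ => by simp⟩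
  add_mem' := by
    intro u v hu hv h h0
    obtain ⟨M, hM⟩ := hu h h0
    obtain ⟨N, hN⟩ := hv h h0
    refine ⟨M + N, fun f C hf => ?_⟩
    have := norm_add_le (u f) (v f)
    have h1 := hM f C hf
    have h2 := hN f C hf
    rw [LinearMap.add_apply, add_mul]
    linarith
  smul_mem' := by
    intro c u hu h h0
    obtain ⟨M, hM⟩ := hu h h0
    refine ⟨‖c‖ * M, fun f C hf => ?_⟩
    rw [LinearMap.smul_apply, norm_smul, mul_assoc]
    exact mul_le_mul_of_nonneg_left (hM f C hf) (norm_nonneg c)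

theorem gs_continuous (f : GS ι) : Continuous (f : E ι → ℂ) := f.2.1.continuous

theorem gs_integrable (f : GS ι) : Integrable (f : E ι → ℂ) volume := by
  obtain ⟨-, h, C, h0, hb⟩ := f.2
  set m : ℕ := Module.finrank ℝ (E ι) + 1 with hm
  have hint : Integrable (fun x : E ι => (1 + ‖x‖) ^ (-(m : ℝ))) volume :=
    integrable_one_add_norm (by simp [hm])
  refine (hint.const_mul (2 ^ m * (C + C * h ^ (m + 0) *
    Real.sqrt ((m.factorial : ℝ) * (Nat.factorial 0 : ℝ))))).mono'
    (gs_continuous f).aestronglyMeasurable (ae_of_all _ fun x => ?_)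
  have e0 := hb.norm_le x
  have e1 := hb m 0 x
  simp only [norm_iteratedFDeriv_zero] at e1
  have hpos : (0 : ℝ) < 1 + ‖x‖ := by positivity
  rw [Real.rpow_neg hpos.le, Real.rpow_natCast, ← div_eq_mul_inv, le_div_iff₀ (by positivity)]
  have hpow : (1 + ‖x‖) ^ m ≤ 2 ^ m * (1 + ‖x‖ ^ m) := by
    rcases le_total ‖x‖ 1 with hx | hx
    · calc (1 + ‖x‖) ^ m ≤ 2 ^ m := by gcongr; linarith
        _ ≤ 2 ^ m * (1 + ‖x‖ ^ m) := by
          have : (0 : ℝ) ≤ ‖x‖ ^ m := by positivity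
          nlinarith [pow_pos (two_pos : (0 : ℝ) < 2) m]
    · calc (1 + ‖x‖) ^ m ≤ (2 * ‖x‖) ^ m := by gcongr; linarith
        _ = 2 ^ m * ‖x‖ ^ m := mul_pow _ _ _
        _ ≤ 2 ^ m * (1 + ‖x‖ ^ m) := by gcongr; linarith
  calc ‖(f : E ι → ℂ) x‖ * (1 + ‖x‖) ^ m
      ≤ ‖(f : E ι → ℂ) x‖ * (2 ^ m * (1 + ‖x‖ ^ m)) := by gcongr
    _ = 2 ^ m * (‖(f : E ι → ℂ) x‖ + ‖x‖ ^ m * ‖(f : E ι → ℂ) x‖) := by ring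
    _ ≤ _ := by gcongr

theorem gs_integrable_mul (f g : GS ι) :
    Integrable (fun x => (f : E ι → ℂ) x * (g : E ι → ℂ) x) volume := by
  obtain ⟨-, h, C, h0, hb⟩ := f.2
  exact (gs_integrable g).bdd_mul (gs_continuous f).aestronglyMeasurable (ae_of_all _ hb.norm_le)

/-- The embedding `𝒮_{1/2} ⊆ 𝒮'_{1/2}`, `⟨f, g⟩ = ∫ f g`. -/
def ofGS (f : GS ι) : GSDual ι :=
  ⟨{ toFun := fun g => ∫ x, (f : E ι → ℂ) x * (g : E ι → ℂ) x
     map_add' := fun g g' => by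
      rw [← integral_add (gs_integrable_mul f g) (gs_integrable_mul f g')]
      simp [mul_add]
     map_smul' := fun c g => by
      rw [RingHom.id_apply, smul_eq_mul, ← integral_const_mul]
      congr 1
      funext x
      simp
      ring },
   fun h _ => ⟨∫ x, ‖(f : E ι → ℂ) x‖, fun g C hg => by
      rw [← integral_mul_const]
      refine norm_integral_le_of_norm_le ((gs_integrable f).norm.mul_const C) (ae_of_all _ fun x => ?_)
      rw [norm_mul]
      exact mul_le_mul_of_nonneg_left (hg.norm_le x) (norm_nonneg _)⟩⟩

open Classical in
/-- The value `⟨u, F⟩` of a distribution on a test function `F`. It is only applied below to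
functions that belong to `𝒮_{1/2}`; on other functions it is `0` by convention. -/
def pair (u : GSDual ι) (F : E ι → ℂ) : ℂ :=
  if hF : F ∈ GS ι then (u : GS ι →ₗ[ℂ] ℂ) ⟨F, hF⟩ else 0

theorem pair_add (u v : GSDual ι) (F : E ι → ℂ) : pair (u + v) F = pair u F + pair v F := by
  unfold pair
  split_ifs <;> simp

theorem pair_smul (c : ℂ) (u : GSDual ι) (F : E ι → ℂ) : pair (c • u) F = c * pair u F := by
  unfold pair
  split_ifs <;> simp

/-! ### Hermite functions -/

/-- The one-dimensional Hermite function
`h_n(t) = π^{-1/4} (-1)^n (2^n n!)^{-1/2} e^{t²/2} (d/dt)^n e^{-t²}`. -/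
def hermite1 (n : ℕ) (t : ℝ) : ℝ :=
  Real.pi ^ (-(1 / 4 : ℝ)) * (-1) ^ n * (Real.sqrt ((2 : ℝ) ^ n * (n.factorial : ℝ)))⁻¹ *
    Real.exp (t ^ 2 / 2) * iteratedDeriv n (fun r : ℝ => Real.exp (-r ^ 2)) t

/-- The Hermite function `h_α`; as `e^{-|x|²}` is a product of functions of one variable,
`π^{-d/4} (-1)^{|α|} (2^{|α|} α!)^{-1/2} e^{|x|²/2} ∂^α e^{-|x|²}` is the product of the
`h_{α_i}(x_i)`. -/
def hermiteFun (α : ι → ℕ) (x : E ι) : ℂ := ((∏ i, hermite1 (α i) (x i) : ℝ) : ℂ)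

/-- The space `𝒮_0` of finite linear combinations of Hermite functions, as a subspace of
`𝒮_{1/2}`. -/
def hermiteSpan (ι : Type) [Fintype ι] : Submodule ℂ (GS ι) :=
  (Submodule.span ℂ (Set.range (hermiteFun (ι := ι)))).comap (GS ι).subtype

/-! ### Short-time Fourier transform and modulation spaces -/

/-- `y ↦ (2π)^{-d/2} φ(y - x) e^{-i⟨y, ξ⟩}` with `φ(y) = π^{-d/4} e^{-|y|²/2}`. -/
def stftAtom (z : E ι × E ι) (y : E ι) : ℂ :=
  (((2 * Real.pi) ^ (-(Fintype.card ι : ℝ) / 2) *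
    (Real.pi ^ (-(Fintype.card ι : ℝ) / 4) * Real.exp (-‖y - z.1‖ ^ 2 / 2)) : ℝ) : ℂ) *
    Complex.exp (-Complex.I * ((inner ℝ y z.2 : ℝ) : ℂ))

/-- The short-time Fourier transform `V_φ u (x, ξ)` with window `φ(y) = π^{-d/4} e^{-|y|²/2}`. -/
def stft (u : GSDual ι) (z : E ι × E ι) : ℂ := pair u (stftAtom z)

/-- The function `V_φ u · ω`, as a function of `(x, ξ)`. -/
def wstft (ω : E (ι ⊕ ι) → ℝ) (u : GSDual ι) (z : E ι × E ι) : ℂ :=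
  stft u z * ((ω (join z.1 z.2) : ℝ) : ℂ)

theorem wstft_add (ω : E (ι ⊕ ι) → ℝ) (u v : GSDual ι) :
    wstft ω (u + v) = wstft ω u + wstft ω v := by
  funext z
  simp [wstft, stft, pair_add, add_mul]

theorem wstft_smul (ω : E (ι ⊕ ι) → ℝ) (c : ℂ) (u : GSDual ι) :
    wstft ω (c • u) = c • wstft ω u := by
  funext z
  simp [wstft, stft, pair_smul, mul_assoc]

/-- `u` belongs to the modulation space `M^{p,q}_{(ω)}`. -/
def MemMod (p q : ℝ≥0∞) (ω : E (ι ⊕ ι) → ℝ) (u : GSDual ι) : Prop :=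
  MemMixed p q (wstft ω u)

/-- The modulation space `M^{p,q}_{(ω)}(ℝ^d)`, `p, q ∈ [1, ∞]`, as a subspace of `𝒮'_{1/2}`. -/
def ModSpace (p q : ℝ≥0∞) [hp : Fact (1 ≤ p)] [hq : Fact (1 ≤ q)] (ω : E (ι ⊕ ι) → ℝ) :
    Submodule ℂ (GSDual ι) where
  carrier := {u | MemMod p q ω u}
  zero_mem' := by
    have h := wstft_smul ω 0 (0 : GSDual ι)
    rw [zero_smul, zero_smul] at h
    refine ⟨?_, ?_⟩
    · rw [h]; exact aestronglyMeasurable_zero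
    · refine lt_of_le_of_lt ?_ ENNReal.zero_lt_top
      have h2 := mixedNorm_const_smul_le p q 0 (0 : E ι × E ι → ℂ)
      rw [h]
      simpa using h2
  add_mem' := by
    intro u v hu hv
    refine ⟨?_, ?_⟩
    · rw [wstft_add]; exact hu.1.add hv.1
    · rw [wstft_add]
      exact lt_of_le_of_lt (mixedNorm_add_le hp.out hq.out hu.1 hv.1)
        (ENNReal.add_lt_top.2 ⟨hu.2, hv.2⟩)
  smul_mem' := by
    intro c u hu
    refine ⟨?_, ?_⟩
    · rw [wstft_smul]; exact hu.1.const_smul c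
    · rw [wstft_smul]
      exact lt_of_le_of_lt (mixedNorm_const_smul_le p q c _)
        (ENNReal.mul_lt_top enorm_lt_top hu.2)

section Norm

variable {p q : ℝ≥0∞} [hp : Fact (1 ≤ p)] [hq : Fact (1 ≤ q)] {ω : E (ι ⊕ ι) → ℝ}

/-- The norm `‖u‖ = ‖V_φ u · ω‖_{L^{p,q}}` of `M^{p,q}_{(ω)}`. -/
instance : Norm (ModSpace p q ω) where
  norm u := (mixedNorm p q (wstft ω (u : GSDual ι))).toReal

theorem ModSpace.norm_def (u : ModSpace p q ω) :
    ‖u‖ = (mixedNorm p q (wstft ω (u : GSDual ι))).toReal := rfl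

theorem ModSpace.norm_smul_le (c : ℂ) (u : ModSpace p q ω) : ‖c • u‖ ≤ ‖c‖ * ‖u‖ := by
  rw [ModSpace.norm_def, ModSpace.norm_def, Submodule.coe_smul, wstft_smul,
    ← toReal_enorm, ← ENNReal.toReal_mul]
  exact ENNReal.toReal_mono (ENNReal.mul_lt_top enorm_lt_top u.2.2).ne
    (mixedNorm_const_smul_le p q c _)

instance : SeminormedAddCommGroup (ModSpace p q ω) :=
  AddGroupSeminorm.toSeminormedAddCommGroup
    { toFun := fun u => ‖u‖
      map_zero' := by
        have h := ModSpace.norm_smul_le 0 (0 : ModSpace p q ω)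
        rw [zero_smul, norm_zero, zero_mul] at h
        exact le_antisymm h ENNReal.toReal_nonneg
      add_le' := fun u v => by
        simp only [ModSpace.norm_def, Submodule.coe_add, wstft_add]
        rw [← ENNReal.toReal_add u.2.2.ne v.2.2.ne]
        exact ENNReal.toReal_mono (ENNReal.add_lt_top.2 ⟨u.2.2, v.2.2⟩).ne
          (mixedNorm_add_le hp.out hq.out u.2.1 v.2.1)
      neg' := fun u => by
        have h : wstft ω ((-u : ModSpace p q ω) : GSDual ι) = -wstft ω (u : GSDual ι) := by
          rw [← neg_one_smul ℂ u, Submodule.coe_smul, wstft_smul, neg_one_smul]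
        simp only [ModSpace.norm_def, h, mixedNorm_neg] }

instance : NormedSpace ℂ (ModSpace p q ω) where
  norm_smul_le := ModSpace.norm_smul_le

end Norm

/-- The extension `(f, g) = ∫∫ V_φ f · conj (V_φ g) dx dξ` of the `L²` form. -/
def l2Form (f g : GSDual ι) : ℂ :=
  ∫ z : E ι × E ι, stft f z * (starRingEnd ℂ) (stft g z)

/-- The weak topology on `M^{p,q}_{(ω)}` given by the forms `f ↦ (f, g)` with
`g ∈ M^{p',q'}_{(1/ω)}`. -/
abbrev weakTopology (p q : ℝ≥0∞) [Fact (1 ≤ p)] [Fact (1 ≤ q)] (ω : E (ι ⊕ ι) → ℝ) :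
    TopologicalSpace (ModSpace p q ω) :=
  TopologicalSpace.induced
    (fun (f : ModSpace p q ω)
      (g : {g : GSDual ι // MemMod p.conjExponent q.conjExponent (fun X => (ω X)⁻¹) g}) =>
        l2Form (f : GSDual ι) (g : GSDual ι))
    inferInstance

/-! ### Symplectic short-time Fourier transform and symbol classes -/

/-- The symplectic form `σ(X, Y) = ⟨y, ξ⟩ - ⟨x, η⟩`, `X = (x, ξ)`, `Y = (y, η)`. -/
def sympl (X Y : E (ι ⊕ ι)) : ℝ :=
  inner ℝ (left Y) (right X) - inner ℝ (left X) (right Y)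

/-- `U ↦ π^{-d} Φ(U - X) e^{2iσ(Y, U)}` with `Φ(X) = (2/π)^{d/2} e^{-|X|²}`. -/
def symplAtom (Z : E (ι ⊕ ι) × E (ι ⊕ ι)) (U : E (ι ⊕ ι)) : ℂ :=
  ((Real.pi ^ (-(Fintype.card ι : ℝ)) *
    ((2 / Real.pi) ^ ((Fintype.card ι : ℝ) / 2) * Real.exp (-‖U - Z.1‖ ^ 2)) : ℝ) : ℂ) *
    Complex.exp (2 * Complex.I * ((sympl Z.2 U : ℝ) : ℂ))

/-- The function `𝒱_Φ a · ω` of `(X, Y)`, where `𝒱_Φ a(X, Y) = ℱ_σ(a Φ(· - X))(Y)` is the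
symplectic short-time Fourier transform. -/
def wsymplStft (ω : E ((ι ⊕ ι) ⊕ (ι ⊕ ι)) → ℝ) (a : GSDual (ι ⊕ ι))
    (Z : E (ι ⊕ ι) × E (ι ⊕ ι)) : ℂ :=
  pair a (symplAtom Z) * ((ω (join Z.1 Z.2) : ℝ) : ℂ)

/-- The symbol `a` belongs to `𝓜^{p,q}_{(ω)}(ℝ^{2d})`. -/
def MemSymbol (p q : ℝ≥0∞) (ω : E ((ι ⊕ ι) ⊕ (ι ⊕ ι)) → ℝ) (a : GSDual (ι ⊕ ι)) : Prop :=
  MemMixed p q (wsymplStft ω a)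

/-- The norm of `𝓜^{p,q}_{(ω)}(ℝ^{2d})`. -/
def symbolNorm (p q : ℝ≥0∞) (ω : E ((ι ⊕ ι) ⊕ (ι ⊕ ι)) → ℝ) (a : GSDual (ι ⊕ ι)) : ℝ≥0∞ :=
  mixedNorm p q (wsymplStft ω a)

/-! ### Weyl quantization -/

/-- `(x, ξ) ↦ (2π)^{-d} ∫ f(x - s/2) g(x + s/2) e^{i⟨s, ξ⟩} ds`. -/
def weylTest (f g : E ι → ℂ) (X : E (ι ⊕ ι)) : ℂ :=
  (((2 * Real.pi) ^ (-(Fintype.card ι : ℝ)) : ℝ) : ℂ) *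
    ∫ s : E ι, f (left X - (1 / 2 : ℝ) • s) * g (left X + (1 / 2 : ℝ) • s) *
      Complex.exp (Complex.I * ((inner ℝ s (right X) : ℝ) : ℂ))

/-- The bilinear form `⟨Op^w(a) f, g⟩`, `f, g ∈ 𝒮_{1/2}`, that defines
`Op^w(a) : 𝒮_{1/2} → 𝒮'_{1/2}`. When `a` is a function it is
`∫ (Op^w(a) f)(x) g(x) dx`, where
`(Op^w(a) f)(x) = (2π)^{-d} ∫∫ a((x + y)/2, ξ) f(y) e^{i⟨x - y, ξ⟩} dy dξ`. -/
def weylForm (a : GSDual (ι ⊕ ι)) (f g : GS ι) : ℂ := pair a (weylTest f g)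

/-- `T` extends `Op^w(a)`: every `f ∈ 𝒮_{1/2}` is in the domain of `T`, and `T f = Op^w(a) f`
in `𝒮'_{1/2}`. -/
def ExtendsWeyl {p₁ q₁ p₂ q₂ : ℝ≥0∞} [Fact (1 ≤ p₁)] [Fact (1 ≤ q₁)] [Fact (1 ≤ p₂)]
    [Fact (1 ≤ q₂)] {ω₁ ω₂ : E (ι ⊕ ι) → ℝ} (a : GSDual (ι ⊕ ι))
    (T : ModSpace p₁ q₁ ω₁ → ModSpace p₂ q₂ ω₂) : Prop :=
  ∀ f : GS ι, ∃ hf : ofGS f ∈ ModSpace p₁ q₁ ω₁,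
    ∀ g : GS ι, ((T ⟨ofGS f, hf⟩ : GSDual ι) : GS ι →ₗ[ℂ] ℂ) g = weylForm a f g

end WeylMod

end

open MeasureTheory Filter Topology
open scoped ENNReal

noncomputable section

namespace WeylMod

variable {ι κ : Type} [Fintype ι] [Fintype κ]

/-! Everything is computed on Gaussian atoms `exp (-s|y - x|² + i⟨ξ, y⟩)`. A function in `𝒮_{1/2}`
is a superposition of atoms whose coefficients have Gaussian decay in `(x, ξ)`
(`exists_gTrans_decay`, `superpos_gCoeff`). A distribution in `𝒮'_{1/2}` takes values on atoms that
grow at most like `e^{ε(|x|²+|ξ|²)}` for every `ε > 0`, and it may be applied under the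
superposition integral (`pair_superpos`). Hence distributions are determined by their short-time
Fourier transforms (`pair_eq_integral_stft`), and functions of small growth on phase space define
distributions (`mkDual`).

The Weyl test function of two atoms with `s = 1/2` is a multiple of an atom with `s = 1` on phase
space (`weylTest_gAtom`). So in phase space `Op^w(a)` is an integral operator whose kernel at `(z,
w)` has modulus `c |𝒱_Φ a(X, Y)|` with `X = (z + w)/2`, `Y = (w - z)/2` (`weylKernel_eq`). As `X - Y
= z` and `X + Y = w`, the hypothesis on the weights transfers `ω₂(z)/ω₁(w)` to the symbol. What
remains is that `F ↦ ∫ K(X, Y) F(w) dw` maps `L^{p₁,q₁}` to `L^{p₂,q₂}` for `K ∈ L^{p,q}`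
(`ennMixed_kernel_le`). Each function is bounded by its norm times powers of functions of integral
at most one. The exponent conditions place `1/p₂` and `1/q₂` in `[1/p, 1/q]`, and three applications
of Hölder's inequality finish (`ennMixed_twisted_le`). The image is again a short-time Fourier
transform because the kernel reproduces itself (`KernelBound.exists_operator`). The adjoint kernel
is of the same type, with `-Y` in place of `Y` and conjugate exponents; so `T` has an adjoint
between the spaces that define the weak topologies, and is weakly continuous.

Uniqueness is density of `𝒮_{1/2}`. By a formula of Mehler type, `V_φ u(λz)` times a Gaussian factor
is the short-time Fourier transform of a function in `𝒮_{1/2}` when `0 < λ < 1` (`exists_dilation`).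
Dilated suitability controls its weighted size, and `λ → 1` gives norm convergence for finite
exponents. Weak convergence needs tails that are small uniformly in `λ`; feasibility of the
exponents provides them (`FeasiblePair.uniformTail`).

For compactness, the kernel that belongs to an atom with `s = 1` as symbol is a product `P(z) Q(w)`,
so its operator has rank at most one. Finite sums of atoms approximate every element of `𝒮_{1/2}` in
the symbol norm (`exists_mem_atomSpan_symbolNorm_lt`), the symbol norm controls the operator norm,
and the target space is complete (`ModSpace.completeSpace`). -/

/-! ### Modulated Gaussians -/

/-- The modulated Gaussian `y ↦ exp (-s |y - x|² + i ⟨ξ, y⟩)`. -/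
def gAtom (s : ℝ) (x ξ y : E ι) : ℂ :=
  Complex.exp (((-s * ‖y - x‖ ^ 2 : ℝ) : ℂ) + Complex.I * ((inner ℝ ξ y : ℝ) : ℂ))

theorem norm_gAtom (s : ℝ) (x ξ y : E ι) : ‖gAtom s x ξ y‖ = Real.exp (-s * ‖y - x‖ ^ 2) := by
  rw [gAtom, Complex.norm_exp]
  congr 1
  simp only [Complex.add_re, Complex.ofReal_re, Complex.mul_re, Complex.I_re, Complex.I_im,
    Complex.ofReal_im]
  ring

/-- The logarithmic derivative of `gAtom s x ξ`. -/
def gLin (s : ℝ) (x ξ y : E ι) : E ι →L[ℝ] ℂ :=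
  (-2 * s) • Complex.ofRealCLM.comp (innerSL ℝ (y - x)) +
    Complex.I • Complex.ofRealCLM.comp (innerSL ℝ ξ)

theorem contDiff_gAtom (s : ℝ) (x ξ : E ι) {n : WithTop ℕ∞} : ContDiff ℝ n (gAtom s x ξ) := by
  unfold gAtom
  refine ContDiff.cexp (ContDiff.add ?_ (contDiff_const.mul ?_))
  · exact Complex.ofRealCLM.contDiff.comp
      (contDiff_const.mul ((contDiff_id.sub contDiff_const).norm_sq ℝ))
  · exact Complex.ofRealCLM.contDiff.comp (contDiff_const.inner ℝ contDiff_id)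

/-- The exponent is quadratic, so differentiation multiplies the atom by a factor that is affine in
`y`. All derivative bounds for atoms come from this. -/
theorem hasFDerivAt_gAtom (s : ℝ) (x ξ y : E ι) :
    HasFDerivAt (gAtom s x ξ) (gAtom s x ξ y • gLin s x ξ y) y := by
  have h1 : HasFDerivAt (fun y : E ι => ‖y - x‖ ^ 2) (2 • innerSL ℝ (y - x)) y := by
    have := ((hasFDerivAt_id y).sub_const x).norm_sq
    simpa using! this
  have h2 : HasFDerivAt (fun y : E ι => (inner ℝ ξ y : ℝ)) (innerSL ℝ ξ) y :=
    (innerSL ℝ ξ).hasFDerivAt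
  have h3 := Complex.ofRealCLM.hasFDerivAt.comp y (h1.const_mul (-s))
  have h4 := (Complex.ofRealCLM.hasFDerivAt.comp y h2).const_mul Complex.I
  have h5 := (h3.add h4).cexp
  convert! h5 using 1
  unfold gLin
  ext v
  simp [gAtom]
  ring

theorem fderiv_gAtom (s : ℝ) (x ξ : E ι) :
    fderiv ℝ (gAtom s x ξ) = fun y => gAtom s x ξ y • gLin s x ξ y :=
  funext fun y => (hasFDerivAt_gAtom s x ξ y).fderiv

theorem norm_gLin_le {s : ℝ} (hs : 0 ≤ s) (x ξ y : E ι) :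
    ‖gLin s x ξ y‖ ≤ 2 * s * ‖y - x‖ + ‖ξ‖ := by
  refine ContinuousLinearMap.opNorm_le_bound _ (by positivity) fun v => ?_
  simp only [gLin, add_apply, smul_apply,
    ContinuousLinearMap.comp_apply, Complex.ofRealCLM_apply, innerSL_apply_apply]
  refine (norm_add_le _ _).trans ?_
  rw [norm_smul, norm_smul, Complex.norm_real, Complex.norm_real, Complex.norm_I, one_mul, add_mul]
  have e1 := norm_inner_le_norm (𝕜 := ℝ) (y - x) v
  have e2 := norm_inner_le_norm (𝕜 := ℝ) ξ v
  have : ‖-2 * s‖ = 2 * s := by rw [Real.norm_eq_abs, abs_mul, abs_of_nonneg hs]; norm_num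
  rw [this]
  have := mul_le_mul_of_nonneg_left e1 (by positivity : 0 ≤ 2 * s)
  linarith

theorem hasFDerivAt_gLin (s : ℝ) (x ξ y : E ι) :
    HasFDerivAt (gLin s x ξ) ((-2 * s) • (ContinuousLinearMap.compL ℝ (E ι) ℝ ℂ
      Complex.ofRealCLM).comp (innerSL ℝ)) y := by
  have h : gLin s x ξ = fun y => ((-2 * s) • (ContinuousLinearMap.compL ℝ (E ι) ℝ ℂ
      Complex.ofRealCLM).comp (innerSL ℝ)) y + ((2 * s) • Complex.ofRealCLM.comp (innerSL ℝ x) +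
      Complex.I • Complex.ofRealCLM.comp (innerSL ℝ ξ)) := by
    funext y
    ext v
    simp [gLin]
    ring
  rw [h]
  exact (ContinuousLinearMap.hasFDerivAt _).add_const _

theorem contDiff_gLin (s : ℝ) (x ξ : E ι) {n : WithTop ℕ∞} : ContDiff ℝ n (gLin s x ξ) := by
  have : ContDiff ℝ n (fun y : E ι => innerSL ℝ (y - x)) :=
    (innerSL ℝ : E ι →L[ℝ] E ι →L[ℝ] ℝ).contDiff.comp (contDiff_id.sub contDiff_const)
  have h2 : ContDiff ℝ n (fun y : E ι => Complex.ofRealCLM.comp (innerSL ℝ (y - x))) :=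
    (contDiff_const (c := Complex.ofRealCLM)).clm_comp this
  exact (h2.const_smul (-2 * s)).add contDiff_const

theorem norm_iteratedFDeriv_one_gLin_le {s : ℝ} (hs : 0 ≤ s) (x ξ y : E ι) :
    ‖iteratedFDeriv ℝ 1 (gLin s x ξ) y‖ ≤ 2 * s := by
  have h0 := norm_iteratedFDeriv_fderiv (𝕜 := ℝ) (f := gLin s x ξ) (n := 0) (x := y)
  rw [zero_add] at h0
  rw [← h0, norm_iteratedFDeriv_zero, (hasFDerivAt_gLin s x ξ y).fderiv]
  refine ContinuousLinearMap.opNorm_le_bound _ (by positivity) fun v => ?_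
  refine ContinuousLinearMap.opNorm_le_bound _ (by positivity) fun w => ?_
  simp only [smul_apply, ContinuousLinearMap.comp_apply,
    ContinuousLinearMap.compL_apply, Complex.ofRealCLM_apply, innerSL_apply_apply]
  rw [norm_smul, Complex.norm_real, Real.norm_eq_abs, abs_mul, abs_of_nonneg hs]
  have := norm_inner_le_norm (𝕜 := ℝ) v w
  rw [Real.norm_eq_abs] at this
  have := mul_le_mul_of_nonneg_left this (by positivity : 0 ≤ 2 * s)
  norm_num
  linarith

theorem iteratedFDeriv_gLin_eq_zero (s : ℝ) (x ξ y : E ι) (n : ℕ) :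
    ‖iteratedFDeriv ℝ (n + 2) (gLin s x ξ) y‖ = 0 := by
  rw [← norm_iteratedFDeriv_fderiv]
  have : fderiv ℝ (gLin s x ξ) = fun _ => (-2 * s) • (ContinuousLinearMap.compL ℝ (E ι) ℝ ℂ
      Complex.ofRealCLM).comp (innerSL ℝ) := funext fun y => (hasFDerivAt_gLin s x ξ y).fderiv
  rw [this, iteratedFDeriv_const_of_ne (Nat.succ_ne_zero n)]
  simp

/-- In the Leibniz formula for `G • gLin` only the terms with at most one derivative on the affine
factor survive, which leaves a three-term recursion. The source `R` vanishes for a single atom and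
is an atom times a constant form for a difference of two. -/
theorem norm_iteratedFDeriv_succ_le_of_fderiv_eq {s : ℝ} (hs : 0 ≤ s) (x ξ : E ι) {G : E ι → ℂ}
    {R : E ι → E ι →L[ℝ] ℂ} (hG : ContDiff ℝ ((⊤ : ℕ∞) : WithTop ℕ∞) G)
    (hR : ContDiff ℝ ((⊤ : ℕ∞) : WithTop ℕ∞) R)
    (h : fderiv ℝ G = fun y => G y • gLin s x ξ y + R y) (n : ℕ) (y : E ι) :
    ‖iteratedFDeriv ℝ (n + 1) G y‖ ≤ (2 * s * ‖y - x‖ + ‖ξ‖) * ‖iteratedFDeriv ℝ n G y‖ +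
      2 * s * n * ‖iteratedFDeriv ℝ (n - 1) G y‖ + ‖iteratedFDeriv ℝ n R y‖ := by
  have hn : ((n : ℕ∞) : WithTop ℕ∞) ≤ ((⊤ : ℕ∞) : WithTop ℕ∞) := by exact_mod_cast le_top
  have hsm : ContDiff ℝ n (fun y => G y • gLin s x ξ y) :=
    (hG.of_le hn).smul (contDiff_gLin s x ξ)
  rw [← norm_iteratedFDeriv_fderiv, h,
    fun_iteratedFDeriv_add_apply hsm.contDiffAt (hR.of_le hn).contDiffAt]
  refine (norm_add_le _ _).trans ?_
  gcongr
  refine (norm_iteratedFDeriv_smul_le hG (contDiff_gLin s x ξ) y hn).trans ?_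
  rcases n with _ | m
  · simp only [zero_add, Finset.range_one, Finset.sum_singleton, norm_iteratedFDeriv_zero]
    have := mul_le_mul_of_nonneg_left (norm_gLin_le hs x ξ y) (norm_nonneg (G y))
    simp
    linarith
  · rw [Finset.sum_range_succ, Finset.sum_range_succ]
    have hz : ∑ i ∈ Finset.range m, ((m + 1).choose i : ℝ) * ‖iteratedFDeriv ℝ i G y‖ *
        ‖iteratedFDeriv ℝ (m + 1 - i) (gLin s x ξ) y‖ = 0 := by
      refine Finset.sum_eq_zero fun i hi => ?_
      have hi' := Finset.mem_range.1 hi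
      obtain ⟨j, hj⟩ : ∃ j, m + 1 - i = j + 2 := ⟨m - i - 1, by omega⟩
      rw [hj, iteratedFDeriv_gLin_eq_zero, mul_zero]
    have e1 : m + 1 - m = 1 := by omega
    have e2 := norm_iteratedFDeriv_one_gLin_le hs x ξ y
    have e3 := norm_gLin_le hs x ξ y
    rw [hz, zero_add, Nat.sub_self, norm_iteratedFDeriv_zero, e1, Nat.add_sub_cancel,
      Nat.choose_self, Nat.choose_succ_self_right]
    have f1 := mul_le_mul_of_nonneg_left e2
      (by positivity : 0 ≤ ((m + 1 : ℕ) : ℝ) * ‖iteratedFDeriv ℝ m G y‖)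
    have f2 := mul_le_mul_of_nonneg_left e3 (norm_nonneg (iteratedFDeriv ℝ (m + 1) G y))
    push_cast at *
    linarith

/-- Solution of a three-term recursive inequality. -/
theorem recursive_bound {a b : ℕ → ℝ} {c r δ η : ℝ} (hc : 1 ≤ c) (hr : 0 ≤ r) (hη : 0 ≤ η)
    (ha : ∀ n, 0 ≤ a n) (ha0 : a 0 ≤ δ)
    (hb : ∀ n : ℕ, b n ≤ η * (c + Real.sqrt (r * n)) ^ n)
    (hrec : ∀ n : ℕ, a (n + 1) ≤ c * a n + r * n * a (n - 1) + b n) (n : ℕ) :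
    a n ≤ (c + Real.sqrt (r * n)) ^ n * (δ + n * η) := by
  have hδ : 0 ≤ δ := (ha 0).trans ha0
  induction n using Nat.strong_induction_on with
  | _ n ih =>
    rcases n with _ | n
    · simpa using ha0
    set ρ := c + Real.sqrt (r * (n + 1 : ℕ)) with hρ
    have hsq : Real.sqrt (r * (n + 1 : ℕ)) ^ 2 = r * (n + 1 : ℕ) := Real.sq_sqrt (by positivity)
    have hs0 := Real.sqrt_nonneg (r * (n + 1 : ℕ))
    have hρ1 : 1 ≤ ρ := by linarith
    have hmono : ∀ m : ℕ, m ≤ n + 1 → c + Real.sqrt (r * m) ≤ ρ := fun m hm => by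
      rw [hρ]; gcongr
    have h1 : a n ≤ ρ ^ n * (δ + n * η) := by
      refine (ih n (by omega)).trans ?_
      gcongr
      exact hmono n (by omega)
    have h3 : b n ≤ η * ρ ^ n := by
      refine (hb n).trans ?_
      gcongr
      exact hmono n (by omega)
    -- At `n = 0` the truncated `n - 1` is harmless, since the factor `n` vanishes.
    have h2 : r * n * a (n - 1) ≤ r * n * (ρ ^ (n - 1) * (δ + n * η)) := by
      rcases n with _ | m
      · simp
      · refine mul_le_mul_of_nonneg_left ?_ (by positivity)
        rw [Nat.add_sub_cancel]
        refine (ih m (by omega)).trans ?_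
        have hm1 := hmono m (by omega)
        gcongr
        omega
    -- This is what `ρ` is chosen for: with `t = √(r(n+1))` one has `(ρ - c)ρ = tc + t² ≥ rn`, so
    -- the lower-order term fits between `c` and `ρ`.
    have h4 : r * n * ρ ^ (n - 1) ≤ (ρ - c) * ρ ^ n := by
      rcases n with _ | m
      · simp; linarith
      · rw [Nat.add_sub_cancel, pow_succ]
        have : r * (m + 1 : ℕ) ≤ (ρ - c) * ρ := by
          have hh : (ρ - c) * ρ = Real.sqrt (r * (m + 1 + 1 : ℕ)) * c +
              Real.sqrt (r * (m + 1 + 1 : ℕ)) ^ 2 := by rw [hρ]; ring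
          have h0 : 0 ≤ Real.sqrt (r * (m + 1 + 1 : ℕ)) * c := by positivity
          rw [hh, hsq]
          push_cast at h0 ⊢
          linarith
        have hp : 0 ≤ ρ ^ m := by positivity
        nlinarith
    have hD : 0 ≤ δ + n * η := by positivity
    have h5 := mul_le_mul_of_nonneg_right h4 hD
    have h6 : η * ρ ^ n ≤ η * ρ ^ (n + 1) := by
      gcongr
      omega
    calc a (n + 1) ≤ c * a n + r * n * a (n - 1) + b n := hrec n
      _ ≤ c * (ρ ^ n * (δ + n * η)) + r * n * (ρ ^ (n - 1) * (δ + n * η)) + η * ρ ^ n := by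
          gcongr
      _ ≤ ρ ^ (n + 1) * (δ + (n + 1 : ℕ) * η) := by
          rw [pow_succ] at *
          push_cast
          nlinarith

theorem norm_iteratedFDeriv_gAtom_le {s : ℝ} (hs : 0 ≤ s) (x ξ y : E ι) {c : ℝ} (hc1 : 1 ≤ c)
    (hc : 2 * s * ‖y - x‖ + ‖ξ‖ ≤ c) (n : ℕ) :
    ‖iteratedFDeriv ℝ n (gAtom s x ξ) y‖ ≤
      (c + Real.sqrt (2 * s * n)) ^ n * Real.exp (-s * ‖y - x‖ ^ 2) := by
  have h := recursive_bound (a := fun n => ‖iteratedFDeriv ℝ n (gAtom s x ξ) y‖) (b := fun _ => 0)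
    (c := c) (r := 2 * s) (δ := Real.exp (-s * ‖y - x‖ ^ 2)) (η := 0) hc1 (by positivity) le_rfl
    (fun n => norm_nonneg _) (by simp [norm_gAtom]) (fun n => by simp) (fun n => by
      have := norm_iteratedFDeriv_succ_le_of_fderiv_eq hs x ξ (contDiff_gAtom s x ξ)
        (R := fun _ => 0) contDiff_const (by rw [fderiv_gAtom]; simp) n y
      have h0 : iteratedFDeriv ℝ n (fun _ : E ι => (0 : E ι →L[ℝ] ℂ)) y = 0 :=
        congrFun (iteratedFDeriv_fun_zero (𝕜 := ℝ)) y
      rw [h0, norm_zero] at this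
      refine this.trans ?_
      gcongr) n
  simpa using h

/-- The logarithmic derivatives of two atoms with the same `s` differ by a form `L` that does not
depend on `y`. So the difference `D` of the atoms satisfies `D' = D • gLin + gAtom s x' ξ' • L`, and
the recursion applies with a source of size `‖L‖`. -/
theorem norm_iteratedFDeriv_gAtom_sub_le {s : ℝ} (hs : 0 ≤ s) (x ξ x' ξ' y : E ι) {c : ℝ}
    (hc1 : 1 ≤ c) (hc : 2 * s * ‖y - x‖ + ‖ξ‖ ≤ c) (hc' : 2 * s * ‖y - x'‖ + ‖ξ'‖ ≤ c) (n : ℕ) :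
    ‖iteratedFDeriv ℝ n (gAtom s x ξ - gAtom s x' ξ') y‖ ≤
      (c + Real.sqrt (2 * s * n)) ^ n * (‖gAtom s x ξ y - gAtom s x' ξ' y‖ +
        n * ((2 * s * ‖x - x'‖ + ‖ξ - ξ'‖) * Real.exp (-s * ‖y - x'‖ ^ 2))) := by
  set L : E ι →L[ℝ] ℂ := gLin s x ξ 0 - gLin s x' ξ' 0 with hL
  have hLy : ∀ y, gLin s x ξ y - gLin s x' ξ' y = L := fun y => by
    ext v
    simp [hL, gLin]
    ring
  have hLn : ‖L‖ ≤ 2 * s * ‖x - x'‖ + ‖ξ - ξ'‖ := by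
    -- The constant form is itself a value of `gLin`, whose norm is already estimated.
    have : L = gLin s x (ξ - ξ') x' := by
      ext v
      simp [hL, gLin]
      ring
    rw [this, norm_sub_rev x x']
    exact norm_gLin_le hs _ _ _
  have hR : ContDiff ℝ ((⊤ : ℕ∞) : WithTop ℕ∞) (fun y => gAtom s x' ξ' y • L) :=
    (contDiff_gAtom s x' ξ').smul contDiff_const
  have hfd : fderiv ℝ (gAtom s x ξ - gAtom s x' ξ') = fun y =>
      (gAtom s x ξ - gAtom s x' ξ') y • gLin s x ξ y + gAtom s x' ξ' y • L := by
    funext y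
    rw [((hasFDerivAt_gAtom s x ξ y).sub (hasFDerivAt_gAtom s x' ξ' y)).fderiv, ← hLy y]
    simp only [Pi.sub_apply]
    module
  refine recursive_bound (a := fun n => ‖iteratedFDeriv ℝ n (gAtom s x ξ - gAtom s x' ξ') y‖)
    (b := fun n => ‖iteratedFDeriv ℝ n (fun y => gAtom s x' ξ' y • L) y‖)
    hc1 (by positivity) (by positivity)
    (fun n => norm_nonneg _) (by simp) (fun n => ?_) (fun n => ?_) n
  · have e : (fun y => gAtom s x' ξ' y • L) =
        ((ContinuousLinearMap.toSpanSingleton ℂ L).restrictScalars ℝ) ∘ (gAtom s x' ξ') := by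
      funext y; simp
    rw [e]
    refine (ContinuousLinearMap.norm_iteratedFDeriv_comp_left _ (contDiff_gAtom s x' ξ').contDiffAt
      (N := ((⊤ : ℕ∞) : WithTop ℕ∞)) (by exact_mod_cast le_top)).trans ?_
    have h1 : ‖(ContinuousLinearMap.toSpanSingleton ℂ L).restrictScalars ℝ‖ = ‖L‖ := by
      rw [ContinuousLinearMap.norm_restrictScalars, ContinuousLinearMap.norm_toSpanSingleton]
    rw [h1]
    have h2 := norm_iteratedFDeriv_gAtom_le hs x' ξ' y hc1 hc' n
    calc _ ≤ (2 * s * ‖x - x'‖ + ‖ξ - ξ'‖) *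
          ((c + Real.sqrt (2 * s * n)) ^ n * Real.exp (-s * ‖y - x'‖ ^ 2)) := by gcongr
      _ = _ := by ring
  · have := norm_iteratedFDeriv_succ_le_of_fderiv_eq hs x ξ
      (G := gAtom s x ξ - gAtom s x' ξ')
      ((contDiff_gAtom s x ξ).sub (contDiff_gAtom s x' ξ')) hR hfd n y
    refine this.trans ?_
    gcongr

/-! ### Gelfand-Shilov estimates for modulated Gaussians -/

/-- After squaring, this bounds one term of the exponential series of `δt²` by the whole series. -/
theorem pow_le_sqrt_factorial_mul_exp {δ t : ℝ} (hδ : 0 < δ) (ht : 0 ≤ t) (n : ℕ) :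
    t ^ n ≤ Real.sqrt δ⁻¹ ^ n * Real.sqrt n.factorial * Real.exp (δ * t ^ 2) := by
  rw [← pow_le_pow_iff_left₀ (by positivity) (by positivity) two_ne_zero]
  have h := Real.pow_div_factorial_le_exp (δ * t ^ 2) (by positivity) n
  rw [div_le_iff₀ (by positivity)] at h
  have e1 : (Real.sqrt δ⁻¹ ^ n) ^ 2 = δ⁻¹ ^ n := by
    rw [← pow_mul, mul_comm, pow_mul, Real.sq_sqrt (by positivity)]
  rw [mul_pow, mul_pow, e1, Real.sq_sqrt (by positivity)]
  have h1 : Real.exp (δ * t ^ 2) ≤ Real.exp (δ * t ^ 2) ^ 2 := by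
    have : 1 ≤ Real.exp (δ * t ^ 2) := Real.one_le_exp (by positivity)
    nlinarith
  calc (t ^ n) ^ 2 = δ⁻¹ ^ n * (δ * t ^ 2) ^ n := by
        rw [mul_pow, ← mul_assoc, ← mul_pow, inv_mul_cancel₀ hδ.ne', one_pow, one_mul]; ring
    _ ≤ δ⁻¹ ^ n * (Real.exp (δ * t ^ 2) * n.factorial) := by gcongr
    _ ≤ δ⁻¹ ^ n * (Real.exp (δ * t ^ 2) ^ 2 * n.factorial) := by gcongr
    _ = _ := by ring

/-- Follows from `n^n ≤ e^n n!`. -/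
theorem sqrt_mul_pow_le_sqrt_factorial {r : ℝ} (hr : 0 ≤ r) (n : ℕ) :
    Real.sqrt (r * n) ^ n ≤ Real.sqrt (r * Real.exp 1) ^ n * Real.sqrt n.factorial := by
  rw [← pow_le_pow_iff_left₀ (by positivity) (by positivity) two_ne_zero]
  have h := Real.pow_div_factorial_le_exp (n : ℝ) (by positivity) n
  rw [div_le_iff₀ (by positivity)] at h
  have e : ∀ a : ℝ, 0 ≤ a → (Real.sqrt a ^ n) ^ 2 = a ^ n := fun a ha => by
    rw [← pow_mul, mul_comm, pow_mul, Real.sq_sqrt ha]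
  rw [mul_pow, e _ (by positivity), e _ (by positivity), Real.sq_sqrt (by positivity), mul_pow,
    mul_pow, ← Real.exp_nat_mul, mul_one]
  calc r ^ n * (n : ℝ) ^ n ≤ r ^ n * (Real.exp n * n.factorial) := by gcongr
    _ = _ := by ring

/-- Converts the output of the recursion into Gelfand-Shilov form: the larger of `t` and `√(rn)`
dominates, and each is traded for `√n!`, with a Gaussian loss in `t` whose rate `δ` is free. -/
theorem add_sqrt_pow_le {δ r t : ℝ} (hδ : 0 < δ) (hr : 0 ≤ r) (ht : 0 ≤ t) (n : ℕ) :
    (t + Real.sqrt (r * n)) ^ n ≤ (2 * (Real.sqrt δ⁻¹ + Real.sqrt (r * Real.exp 1))) ^ n *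
      Real.sqrt n.factorial * Real.exp (δ * t ^ 2) := by
  have h1 : 1 ≤ Real.exp (δ * t ^ 2) := Real.one_le_exp (by positivity)
  rw [mul_pow]
  rcases le_total t (Real.sqrt (r * n)) with h | h
  · calc (t + Real.sqrt (r * n)) ^ n ≤ (2 * Real.sqrt (r * n)) ^ n := by gcongr; linarith
      _ = 2 ^ n * Real.sqrt (r * n) ^ n := mul_pow _ _ _
      _ ≤ 2 ^ n * (Real.sqrt (r * Real.exp 1) ^ n * Real.sqrt n.factorial) := by
          gcongr; exact sqrt_mul_pow_le_sqrt_factorial hr n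
      _ ≤ 2 ^ n * ((Real.sqrt δ⁻¹ + Real.sqrt (r * Real.exp 1)) ^ n * Real.sqrt n.factorial) := by
          gcongr; linarith [Real.sqrt_nonneg δ⁻¹]
      _ = 2 ^ n * (Real.sqrt δ⁻¹ + Real.sqrt (r * Real.exp 1)) ^ n * Real.sqrt n.factorial * 1 := by
          ring
      _ ≤ _ := by gcongr
  · calc (t + Real.sqrt (r * n)) ^ n ≤ (2 * t) ^ n := by gcongr; linarith
      _ = 2 ^ n * t ^ n := mul_pow _ _ _
      _ ≤ 2 ^ n * (Real.sqrt δ⁻¹ ^ n * Real.sqrt n.factorial * Real.exp (δ * t ^ 2)) := by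
          gcongr; exact pow_le_sqrt_factorial_mul_exp hδ ht n
      _ ≤ 2 ^ n * ((Real.sqrt δ⁻¹ + Real.sqrt (r * Real.exp 1)) ^ n * Real.sqrt n.factorial *
          Real.exp (δ * t ^ 2)) := by
          gcongr; linarith [Real.sqrt_nonneg (r * Real.exp 1)]
      _ = _ := by ring

/-- The powers and the linear factor are each traded for factorials and a slowly growing Gaussian.
The factor `e^{-s|y-x|²}` absorbs the growth in `y`, because `|y| ≤ |y - x| + Q`, and only `e^{εQ²}`
is left. The parameter `h` depends on `ε` but not on the centre `x`. -/
theorem exists_gauss_poly_bound {s c ε : ℝ} (hs : 0 < s) (hc : 0 ≤ c) (hε : 0 < ε) :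
    ∃ h M : ℝ, 0 < h ∧ 0 < M ∧ ∀ (k n : ℕ) (y x : E ι) (Q : ℝ), ‖x‖ ≤ Q →
      ‖y‖ ^ k * ((c * (‖y‖ + Q) + Real.sqrt (2 * s * n)) ^ n * ((1 + n) * (‖y‖ + Q) *
        Real.exp (-s * ‖y - x‖ ^ 2))) ≤
      M * h ^ (k + n) * Real.sqrt ((k.factorial : ℝ) * (n.factorial : ℝ)) *
        Real.exp (ε * Q ^ 2) := by
  -- `D` is such that `|y|² + c²(|y|+Q)² + (|y|+Q)² ≤ D(|y|² + Q²)`. With `|y|² ≤ 2|y-x|² + 2Q²`,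
  -- the requirement `2δD ≤ s` pays for `|y-x|²` and `3δD ≤ ε` pays for `Q²`.
  set D : ℝ := 3 + 2 * c ^ 2 with hD
  have hD0 : 0 < D := by positivity
  set δ : ℝ := min (s / (2 * D)) (ε / (3 * D)) with hδ'
  have hδ : 0 < δ := by positivity
  have hδ1 : δ * D * 2 ≤ s := by
    have : δ ≤ s / (2 * D) := min_le_left _ _
    rw [le_div_iff₀ (by positivity)] at this
    linarith
  have hδ2 : δ * D * 3 ≤ ε := by
    have : δ ≤ ε / (3 * D) := min_le_right _ _
    rw [le_div_iff₀ (by positivity)] at this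
    linarith
  set A : ℝ := Real.sqrt δ⁻¹ with hA
  have hA0 : 0 < A := Real.sqrt_pos.2 (by positivity)
  set B : ℝ := 2 * (A + Real.sqrt (2 * s * Real.exp 1)) with hB
  have hB0 : 0 < B := by positivity
  refine ⟨A + 2 * B, A, by positivity, hA0, fun k n y x Q hxQ => ?_⟩
  have hQ : 0 ≤ Q := (norm_nonneg x).trans hxQ
  have e1 := pow_le_sqrt_factorial_mul_exp hδ (norm_nonneg y) k
  have e2 := add_sqrt_pow_le (r := 2 * s) hδ (by positivity)
    (by positivity : 0 ≤ c * (‖y‖ + Q)) n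
  have e3 := pow_le_sqrt_factorial_mul_exp hδ (by positivity : 0 ≤ ‖y‖ + Q) 1
  simp only [pow_one, Nat.factorial_one, Nat.cast_one, Real.sqrt_one, mul_one] at e3
  have e4 : (1 + n : ℝ) ≤ 2 ^ n := by
    have := one_add_mul_le_pow (show (-2 : ℝ) ≤ 1 by norm_num) n
    norm_num at this
    linarith
  have hexp : δ * ‖y‖ ^ 2 + δ * (c * (‖y‖ + Q)) ^ 2 + δ * (‖y‖ + Q) ^ 2 - s * ‖y - x‖ ^ 2 ≤
      ε * Q ^ 2 := by
    have hy : ‖y‖ ≤ ‖y - x‖ + Q := by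
      calc ‖y‖ = ‖(y - x) + x‖ := by rw [sub_add_cancel]
        _ ≤ ‖y - x‖ + ‖x‖ := norm_add_le _ _
        _ ≤ _ := by gcongr
    have hy2 : ‖y‖ ^ 2 ≤ 2 * ‖y - x‖ ^ 2 + 2 * Q ^ 2 := by
      nlinarith [norm_nonneg y, sq_nonneg (‖y - x‖ - Q), norm_nonneg (y - x)]
    have hq : (‖y‖ + Q) ^ 2 ≤ 2 * ‖y‖ ^ 2 + 2 * Q ^ 2 := by nlinarith [sq_nonneg (‖y‖ - Q)]
    have h5 : δ * ‖y‖ ^ 2 + δ * (c * (‖y‖ + Q)) ^ 2 + δ * (‖y‖ + Q) ^ 2 ≤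
        δ * D * (‖y‖ ^ 2 + Q ^ 2) := by
      have := mul_le_mul_of_nonneg_left hq (by positivity : 0 ≤ δ * (c ^ 2 + 1))
      have h6 : 0 ≤ δ * Q ^ 2 := by positivity
      rw [hD]; linarith
    have h7 := mul_le_mul_of_nonneg_left hy2 (by positivity : 0 ≤ δ * D)
    have h8 := mul_le_mul_of_nonneg_right hδ1 (sq_nonneg ‖y - x‖)
    have h9 := mul_le_mul_of_nonneg_right hδ2 (sq_nonneg Q)
    linarith
  have hsq : Real.sqrt ((k.factorial : ℝ) * (n.factorial : ℝ)) =
      Real.sqrt k.factorial * Real.sqrt n.factorial := Real.sqrt_mul (by positivity) _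
  have hpow : A ^ k * (B ^ n * 2 ^ n) ≤ (A + 2 * B) ^ (k + n) := by
    rw [pow_add, ← mul_pow]
    gcongr <;> linarith
  calc _ ≤ (A ^ k * Real.sqrt k.factorial * Real.exp (δ * ‖y‖ ^ 2)) *
        ((B ^ n * Real.sqrt n.factorial * Real.exp (δ * (c * (‖y‖ + Q)) ^ 2)) *
          (2 ^ n * (A * Real.exp (δ * (‖y‖ + Q) ^ 2)) * Real.exp (-s * ‖y - x‖ ^ 2))) := by gcongr
    _ = A * (A ^ k * (B ^ n * 2 ^ n)) * (Real.sqrt k.factorial * Real.sqrt n.factorial) *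
        Real.exp (δ * ‖y‖ ^ 2 + δ * (c * (‖y‖ + Q)) ^ 2 + δ * (‖y‖ + Q) ^ 2 - s * ‖y - x‖ ^ 2) := by
        rw [show ∀ u : ℝ, u - s * ‖y - x‖ ^ 2 = u + -s * ‖y - x‖ ^ 2 by intro u; ring,
          Real.exp_add, Real.exp_add, Real.exp_add]
        ring
    _ ≤ _ := by
        rw [hsq]
        gcongr

/-- Mean value inequality on the half plane `re z ≤ max (re a) (re b)`, which is convex and on which
`|exp|` is at most the larger of the two end values. -/
theorem norm_cexp_sub_cexp_le (a b : ℂ) :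
    ‖Complex.exp a - Complex.exp b‖ ≤ ‖a - b‖ * (‖Complex.exp a‖ + ‖Complex.exp b‖) := by
  have hconv : Convex ℝ {z : ℂ | z.re ≤ max a.re b.re} := convex_halfSpace_re_le _
  have h := hconv.norm_image_sub_le_of_norm_hasDerivWithin_le (f := Complex.exp)
    (f' := Complex.exp) (C := ‖Complex.exp a‖ + ‖Complex.exp b‖) (x := b) (y := a)
    (fun z _ => (Complex.hasDerivAt_exp z).hasDerivWithinAt) (fun z hz => ?_)
    (le_max_right a.re b.re) (le_max_left a.re b.re)
  · rw [mul_comm]; exact h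
  · rw [Complex.norm_exp, Complex.norm_exp, Complex.norm_exp]
    have hz' : z.re ≤ max a.re b.re := hz
    rcases le_max_iff.1 hz' with h | h
    · exact (Real.exp_le_exp.2 h).trans (le_add_of_nonneg_right (Real.exp_pos _).le)
    · exact (Real.exp_le_exp.2 h).trans (le_add_of_nonneg_left (Real.exp_pos _).le)

theorem norm_gAtom_sub_le {s : ℝ} (hs : 0 ≤ s) (x ξ x' ξ' y : E ι) {Q : ℝ}
    (hx : ‖x‖ ≤ Q) (hx' : ‖x'‖ ≤ Q) :
    ‖gAtom s x ξ y - gAtom s x' ξ' y‖ ≤ (2 * s + 1) * (‖x - x'‖ + ‖ξ - ξ'‖) * (‖y‖ + Q) *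
      (Real.exp (-s * ‖y - x‖ ^ 2) + Real.exp (-s * ‖y - x'‖ ^ 2)) := by
  have h := norm_cexp_sub_cexp_le
    (((-s * ‖y - x‖ ^ 2 : ℝ) : ℂ) + Complex.I * ((inner ℝ ξ y : ℝ) : ℂ))
    (((-s * ‖y - x'‖ ^ 2 : ℝ) : ℂ) + Complex.I * ((inner ℝ ξ' y : ℝ) : ℂ))
  have hQ : 0 ≤ Q := (norm_nonneg x).trans hx
  change _ ≤ _ * (‖gAtom s x ξ y‖ + ‖gAtom s x' ξ' y‖) at h
  rw [norm_gAtom, norm_gAtom] at h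
  refine h.trans ?_
  gcongr
  have e : (((-s * ‖y - x‖ ^ 2 : ℝ) : ℂ) + Complex.I * ((inner ℝ ξ y : ℝ) : ℂ)) -
      (((-s * ‖y - x'‖ ^ 2 : ℝ) : ℂ) + Complex.I * ((inner ℝ ξ' y : ℝ) : ℂ)) =
      ((s * ((‖y - x'‖ - ‖y - x‖) * (‖y - x'‖ + ‖y - x‖)) : ℝ) : ℂ) +
        Complex.I * ((inner ℝ (ξ - ξ') y : ℝ) : ℂ) := by
    rw [inner_sub_left]
    push_cast
    ring
  rw [e]
  refine (norm_add_le _ _).trans ?_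
  rw [norm_mul, Complex.norm_I, one_mul, Complex.norm_real, Complex.norm_real, norm_mul, norm_mul]
  have h1 : ‖‖y - x'‖ - ‖y - x‖‖ ≤ ‖x - x'‖ := by
    have := abs_norm_sub_norm_le (y - x') (y - x)
    rw [sub_sub_sub_cancel_left] at this
    exact this
  have h2 : ‖‖y - x'‖ + ‖y - x‖‖ ≤ 2 * (‖y‖ + Q) := by
    rw [Real.norm_of_nonneg (by positivity)]
    have := norm_sub_le y x
    have := norm_sub_le y x'
    linarith
  have h3 : ‖(inner ℝ (ξ - ξ') y : ℝ)‖ ≤ ‖ξ - ξ'‖ * (‖y‖ + Q) := by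
    refine (norm_inner_le_norm _ _).trans ?_
    gcongr
    linarith
  rw [Real.norm_of_nonneg hs]
  have h4 := mul_le_mul_of_nonneg_left (mul_le_mul h1 h2 (norm_nonneg _) (norm_nonneg _)) hs
  have h5 : 0 ≤ ‖x - x'‖ * (‖y‖ + Q) := by positivity
  have h6 : 0 ≤ s * (‖ξ - ξ'‖ * (‖y‖ + Q)) := by positivity
  nlinarith

theorem sq_add_five_le (a b c d : ℝ) :
    (1 + a + b + c + d) ^ 2 ≤ 5 * (1 + (a ^ 2 + b ^ 2 + (c ^ 2 + d ^ 2))) := by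
  have h : 5 * (1 + (a ^ 2 + b ^ 2 + (c ^ 2 + d ^ 2))) - (1 + a + b + c + d) ^ 2 =
      (1 - a) ^ 2 + (1 - b) ^ 2 + (1 - c) ^ 2 + (1 - d) ^ 2 + (a - b) ^ 2 + (a - c) ^ 2 +
      (a - d) ^ 2 + (b - c) ^ 2 + (b - d) ^ 2 + (c - d) ^ 2 := by ring
  have : 0 ≤ 5 * (1 + (a ^ 2 + b ^ 2 + (c ^ 2 + d ^ 2))) - (1 + a + b + c + d) ^ 2 := by
    rw [h]; positivity
  linarith

/-- The order of quantifiers matters: `ε` comes first and `h` may depend on it. Elements of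
`𝒮'_{1/2}` are bounded on `𝒮_{1/2,h}` for every `h`, so they grow slower than every Gaussian along
the atoms. The Lipschitz estimate in the parameters serves for continuity and for approximation by
finite sums. -/
theorem exists_GSBound_gAtom {s ε : ℝ} (hs : 0 < s) (hε : 0 < ε) :
    ∃ h M : ℝ, 0 < h ∧ 0 < M ∧
      (∀ x ξ : E ι, GSBound h (M * Real.exp (ε * (‖x‖ ^ 2 + ‖ξ‖ ^ 2))) (gAtom s x ξ)) ∧
      ∀ x ξ x' ξ' : E ι, GSBound h (M * (‖x - x'‖ + ‖ξ - ξ'‖) *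
        Real.exp (ε * (‖x‖ ^ 2 + ‖ξ‖ ^ 2 + (‖x'‖ ^ 2 + ‖ξ'‖ ^ 2))))
          (gAtom s x ξ - gAtom s x' ξ') := by
  -- The loss `ε / 5` is prepared for `Q = 1 + ‖x‖ + ‖ξ‖ + ‖x'‖ + ‖ξ'‖`, whose square is at most
  -- five times the sum of the squares of its five terms.
  obtain ⟨h, M, h0, M0, hb⟩ := exists_gauss_poly_bound (ι := ι) (s := s) (c := 2 * s + 1)
    (ε := ε / 5) hs (by positivity) (by positivity)
  have hc1 : ∀ {y x ξ : E ι} {Q : ℝ}, ‖x‖ + ‖ξ‖ + 1 ≤ Q →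
      2 * s * ‖y - x‖ + ‖ξ‖ ≤ (2 * s + 1) * (‖y‖ + Q) ∧ 1 ≤ (2 * s + 1) * (‖y‖ + Q) := by
    intro y x ξ Q hQ
    have h1 := norm_sub_le y x
    have := norm_nonneg x
    have := norm_nonneg ξ
    have := norm_nonneg y
    have h2 := mul_le_mul_of_nonneg_left h1 (by positivity : 0 ≤ 2 * s)
    constructor
    · nlinarith
    · nlinarith
  refine ⟨h, 2 * (2 * s + 1) * (M * Real.exp ε), h0, by positivity, fun x ξ k n y => ?_,
    fun x ξ x' ξ' k n y => ?_⟩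
  · set Q := 1 + ‖x‖ + ‖ξ‖ with hQ
    have hxQ : ‖x‖ ≤ Q := by linarith [norm_nonneg ξ]
    obtain ⟨c1, c2⟩ := hc1 (y := y) (x := x) (ξ := ξ) (Q := Q) (by linarith)
    have e1 := norm_iteratedFDeriv_gAtom_le hs.le x ξ y c2 c1 n
    have e2 := hb k n y x Q hxQ
    have hQ2 : ε / 5 * Q ^ 2 ≤ ε + ε * (‖x‖ ^ 2 + ‖ξ‖ ^ 2) := by
      have : Q ^ 2 ≤ 5 * (1 + (‖x‖ ^ 2 + ‖ξ‖ ^ 2)) := by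
        nlinarith [sq_nonneg (‖x‖ - 1), sq_nonneg (‖ξ‖ - 1), sq_nonneg (‖x‖ - ‖ξ‖)]
      have := mul_le_mul_of_nonneg_left this (by positivity : 0 ≤ ε / 5)
      linarith
    have h1 : (1 : ℝ) ≤ (1 + n) * (‖y‖ + Q) := by
      have : 1 ≤ ‖y‖ + Q := by linarith [norm_nonneg y, norm_nonneg ξ, norm_nonneg x]
      have : (0 : ℝ) ≤ n := n.cast_nonneg
      nlinarith
    have hb1 := norm_nonneg (iteratedFDeriv ℝ n (gAtom s x ξ) y)
    calc ‖y‖ ^ k * ‖iteratedFDeriv ℝ n (gAtom s x ξ) y‖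
        ≤ ‖y‖ ^ k * (((2 * s + 1) * (‖y‖ + Q) + Real.sqrt (2 * s * n)) ^ n *
          (1 * Real.exp (-s * ‖y - x‖ ^ 2))) := by rw [one_mul]; gcongr
      _ ≤ ‖y‖ ^ k * (((2 * s + 1) * (‖y‖ + Q) + Real.sqrt (2 * s * n)) ^ n *
          ((1 + n) * (‖y‖ + Q) * Real.exp (-s * ‖y - x‖ ^ 2))) := by gcongr
      _ ≤ _ := e2
      _ ≤ M * h ^ (k + n) * Real.sqrt ((k.factorial : ℝ) * (n.factorial : ℝ)) *
          Real.exp (ε + ε * (‖x‖ ^ 2 + ‖ξ‖ ^ 2)) := by gcongr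
      _ = 1 * (M * Real.exp ε * Real.exp (ε * (‖x‖ ^ 2 + ‖ξ‖ ^ 2)) * h ^ (k + n) *
          Real.sqrt ((k.factorial : ℝ) * (n.factorial : ℝ))) := by rw [Real.exp_add]; ring
      _ ≤ 2 * (2 * s + 1) * (M * Real.exp ε * Real.exp (ε * (‖x‖ ^ 2 + ‖ξ‖ ^ 2)) * h ^ (k + n) *
          Real.sqrt ((k.factorial : ℝ) * (n.factorial : ℝ))) := by gcongr; linarith
      _ = _ := by ring
  · set Q := 1 + ‖x‖ + ‖ξ‖ + ‖x'‖ + ‖ξ'‖ with hQ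
    set d := ‖x - x'‖ + ‖ξ - ξ'‖ with hd
    have n1 := norm_nonneg x
    have n2 := norm_nonneg ξ
    have n3 := norm_nonneg x'
    have n4 := norm_nonneg ξ'
    have hxQ : ‖x‖ ≤ Q := by linarith
    have hxQ' : ‖x'‖ ≤ Q := by linarith
    obtain ⟨c1, c2⟩ := hc1 (y := y) (x := x) (ξ := ξ) (Q := Q) (by linarith)
    obtain ⟨c3, -⟩ := hc1 (y := y) (x := x') (ξ := ξ') (Q := Q) (by linarith)
    have e1 := norm_iteratedFDeriv_gAtom_sub_le hs.le x ξ x' ξ' y c2 c1 c3 n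
    have e2 := hb k n y x Q hxQ
    have e3 := hb k n y x' Q hxQ'
    have e4 := norm_gAtom_sub_le hs.le x ξ x' ξ' y hxQ hxQ'
    have hQ2 : ε / 5 * Q ^ 2 ≤ ε + ε * (‖x‖ ^ 2 + ‖ξ‖ ^ 2 + (‖x'‖ ^ 2 + ‖ξ'‖ ^ 2)) := by
      have : Q ^ 2 ≤ 5 * (1 + (‖x‖ ^ 2 + ‖ξ‖ ^ 2 + (‖x'‖ ^ 2 + ‖ξ'‖ ^ 2))) := by
        exact sq_add_five_le _ _ _ _
      have := mul_le_mul_of_nonneg_left this (by positivity : 0 ≤ ε / 5)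
      linarith
    set a := Real.exp (-s * ‖y - x‖ ^ 2) with ha
    set a' := Real.exp (-s * ‖y - x'‖ ^ 2) with ha'
    have hy := norm_nonneg y
    have hy1 : 1 ≤ ‖y‖ + Q := by linarith
    have key : ‖gAtom s x ξ y - gAtom s x' ξ' y‖ + n * ((2 * s * ‖x - x'‖ + ‖ξ - ξ'‖) * a') ≤
        (2 * s + 1) * d * ((1 + n) * (‖y‖ + Q) * a + (1 + n) * (‖y‖ + Q) * a') := by
      have h1 : 2 * s * ‖x - x'‖ + ‖ξ - ξ'‖ ≤ (2 * s + 1) * d * (‖y‖ + Q) := by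
        have : 2 * s * ‖x - x'‖ + ‖ξ - ξ'‖ ≤ (2 * s + 1) * d := by
          have := norm_nonneg (x - x')
          have : 0 ≤ 2 * s * ‖ξ - ξ'‖ := by positivity
          rw [hd]; linarith
        refine this.trans (le_mul_of_one_le_right (by positivity) hy1)
      have h2 : (n : ℝ) * ((2 * s * ‖x - x'‖ + ‖ξ - ξ'‖) * a') ≤
          n * ((2 * s + 1) * d * (‖y‖ + Q) * a') := by gcongr
      have h3 : 0 ≤ n * ((2 * s + 1) * d * (‖y‖ + Q) * a) := by positivity
      linarith
    calc ‖y‖ ^ k * ‖iteratedFDeriv ℝ n (gAtom s x ξ - gAtom s x' ξ') y‖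
        ≤ ‖y‖ ^ k * (((2 * s + 1) * (‖y‖ + Q) + Real.sqrt (2 * s * n)) ^ n *
          ((2 * s + 1) * d * ((1 + n) * (‖y‖ + Q) * a + (1 + n) * (‖y‖ + Q) * a'))) := by
          refine mul_le_mul_of_nonneg_left (e1.trans ?_) (by positivity)
          gcongr
      _ = (2 * s + 1) * d * (‖y‖ ^ k * (((2 * s + 1) * (‖y‖ + Q) + Real.sqrt (2 * s * n)) ^ n *
          ((1 + n) * (‖y‖ + Q) * a)) + ‖y‖ ^ k * (((2 * s + 1) * (‖y‖ + Q) +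
            Real.sqrt (2 * s * n)) ^ n * ((1 + n) * (‖y‖ + Q) * a'))) := by ring
      _ ≤ (2 * s + 1) * d * (M * h ^ (k + n) * Real.sqrt ((k.factorial : ℝ) * (n.factorial : ℝ)) *
          Real.exp (ε / 5 * Q ^ 2) + M * h ^ (k + n) *
            Real.sqrt ((k.factorial : ℝ) * (n.factorial : ℝ)) * Real.exp (ε / 5 * Q ^ 2)) := by
          gcongr
      _ = 2 * (2 * s + 1) * d * (M * h ^ (k + n) *
          Real.sqrt ((k.factorial : ℝ) * (n.factorial : ℝ)) * Real.exp (ε / 5 * Q ^ 2)) := by ring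
      _ ≤ 2 * (2 * s + 1) * d * (M * h ^ (k + n) *
          Real.sqrt ((k.factorial : ℝ) * (n.factorial : ℝ)) *
          Real.exp (ε + ε * (‖x‖ ^ 2 + ‖ξ‖ ^ 2 + (‖x'‖ ^ 2 + ‖ξ'‖ ^ 2)))) := by gcongr
      _ = _ := by rw [Real.exp_add]; ring

theorem gAtom_mem_GS {s : ℝ} (hs : 0 < s) (x ξ : E ι) : gAtom s x ξ ∈ GS ι := by
  obtain ⟨h, M, h0, -, hb, -⟩ := exists_GSBound_gAtom (ι := ι) hs one_pos
  exact ⟨contDiff_gAtom s x ξ, h, _, h0, hb x ξ⟩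

/-! ### Superpositions of modulated Gaussians -/

section Superposition

variable {P : Type*} [MeasurableSpace P] {μ : Measure P}

/-- The superposition `∫ A(p) gAtom s (x p) (ξ p) dμ(p)`. -/
def superpos (s : ℝ) (μ : Measure P) (A : P → ℂ) (x ξ : P → E ι) (y : E ι) : ℂ :=
  ∫ p, A p * gAtom s (x p) (ξ p) y ∂μ

theorem continuous_of_lipschitz_on_bounded {F V : Type*} [SeminormedAddCommGroup F]
    [SeminormedAddCommGroup V] {f : F → V} {B : F → F → ℝ} (hB : Continuous (Function.uncurry B))
    (h : ∀ w w', ‖f w - f w'‖ ≤ B w w' * ‖w - w'‖) : Continuous f := by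
  rw [continuous_iff_continuousAt]
  intro w'
  have h1 : Tendsto (fun w => B w w' * ‖w - w'‖) (𝓝 w') (𝓝 (B w' w' * ‖w' - w'‖)) := by
    refine Continuous.tendsto (Continuous.mul ?_ (by fun_prop)) w'
    exact hB.comp (by fun_prop : Continuous fun w : F => (w, w'))
  rw [sub_self, norm_zero, mul_zero] at h1
  exact tendsto_iff_norm_sub_tendsto_zero.2 (squeeze_zero (fun _ => norm_nonneg _)
    (fun w => h w w') h1)

theorem continuous_iteratedFDeriv_gAtom_param {s : ℝ} (hs : 0 < s) (n : ℕ) (y : E ι) :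
    Continuous fun w : E ι × E ι => iteratedFDeriv ℝ n (gAtom s w.1 w.2) y := by
  obtain ⟨h, M, h0, M0, -, hb⟩ := exists_GSBound_gAtom (ι := ι) hs one_pos
  refine continuous_of_lipschitz_on_bounded (B := fun w w' => M * 2 * Real.exp (1 *
    (‖w.1‖ ^ 2 + ‖w.2‖ ^ 2 + (‖w'.1‖ ^ 2 + ‖w'.2‖ ^ 2))) * h ^ n * Real.sqrt n.factorial)
    (by unfold Function.uncurry; fun_prop) fun w w' => ?_
  have e := hb w.1 w.2 w'.1 w'.2 0 n y
  rw [iteratedFDeriv_sub_apply (contDiff_gAtom _ _ _).contDiffAt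
    (contDiff_gAtom _ _ _).contDiffAt] at e
  simp only [pow_zero, one_mul, zero_add, Nat.factorial_zero, Nat.cast_one] at e
  refine e.trans ?_
  have h1 : ‖w.1 - w'.1‖ ≤ ‖w - w'‖ := norm_fst_le (w - w')
  have h2 : ‖w.2 - w'.2‖ ≤ ‖w - w'‖ := norm_snd_le (w - w')
  calc _ ≤ M * (‖w - w'‖ + ‖w - w'‖) *
        Real.exp (‖w.1‖ ^ 2 + ‖w.2‖ ^ 2 + (‖w'.1‖ ^ 2 + ‖w'.2‖ ^ 2)) *
        h ^ n * Real.sqrt n.factorial := by gcongr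
    _ = _ := by ring_nf

/-! ### Derivatives of all orders of parameter integrals -/

section IteratedDerivative

variable {V : Type*} [NormedAddCommGroup V] [NormedSpace ℝ V] {G : P → V → ℂ} {A : P → ℂ}
  {B : ℕ → P → ℝ}

theorem aestronglyMeasurable_smul_multilinear {n : ℕ}
    {f : P → ContinuousMultilinearMap ℝ (fun _ : Fin n => V) ℂ}
    (hA : AEStronglyMeasurable A μ) (hf : AEStronglyMeasurable f μ) :
    AEStronglyMeasurable (fun p => A p • f p) μ := by
  have : Continuous fun z : ℂ × ContinuousMultilinearMap ℝ (fun _ : Fin n => V) ℂ =>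
    z.1 • z.2 := continuous_smul
  exact this.comp_aestronglyMeasurable (hA.prodMk hf)

theorem integrable_smul_iteratedFDeriv
    (hmeas : ∀ n y, AEStronglyMeasurable (fun p => iteratedFDeriv ℝ n (G p) y) μ)
    (hA : AEStronglyMeasurable A μ) (hB : ∀ n, Integrable (B n) μ)
    (hbd : ∀ n p y, ‖A p‖ * ‖iteratedFDeriv ℝ n (G p) y‖ ≤ B n p) (n : ℕ) (y : V) :
    Integrable (fun p => A p • iteratedFDeriv ℝ n (G p) y) μ :=
  (hB n).mono' (aestronglyMeasurable_smul_multilinear hA (hmeas n y))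
    (ae_of_all _ fun p => by rw [norm_smul]; exact hbd n p y)

/-- Each order is one differentiation under a dominated integral; currying is continuous and linear,
so it commutes with the integral. Treating the Taylor series as a whole yields smoothness and the
formula for every iterated derivative together. -/
theorem hasFTaylorSeriesUpTo_integral
    (hG : ∀ p, ContDiff ℝ ((⊤ : ℕ∞) : WithTop ℕ∞) (G p))
    (hmeas : ∀ n y, AEStronglyMeasurable (fun p => iteratedFDeriv ℝ n (G p) y) μ)
    (hA : AEStronglyMeasurable A μ) (hB : ∀ n, Integrable (B n) μ)
    (hbd : ∀ n p y, ‖A p‖ * ‖iteratedFDeriv ℝ n (G p) y‖ ≤ B n p) :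
    HasFTaylorSeriesUpTo ((⊤ : ℕ∞) : WithTop ℕ∞) (fun y => ∫ p, A p * G p y ∂μ)
      (fun y n => ∫ p, A p • iteratedFDeriv ℝ n (G p) y ∂μ) := by
  have hint := integrable_smul_iteratedFDeriv hmeas hA hB hbd
  have hderiv : ∀ (m : ℕ) (y : V), HasFDerivAt
      (fun y => ∫ p, A p • iteratedFDeriv ℝ m (G p) y ∂μ)
      ((∫ p, A p • iteratedFDeriv ℝ (m + 1) (G p) y ∂μ).curryLeft) y := by
    intro m y
    let L := (continuousMultilinearCurryLeftEquiv ℝ (fun _ : Fin (m + 1) => V)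
      ℂ).toContinuousLinearEquiv.toContinuousLinearMap
    have hcurry : (∫ p, A p • iteratedFDeriv ℝ (m + 1) (G p) y ∂μ).curryLeft =
        ∫ p, A p • (iteratedFDeriv ℝ (m + 1) (G p) y).curryLeft ∂μ :=
      by
        have e := ContinuousLinearMap.integral_comp_comm (𝕜 := ℝ)
          (Fₗ := V →L[ℝ] (ContinuousMultilinearMap ℝ (fun _ : Fin m => V) ℂ)) L (hint (m + 1) y)
        exact e.symm
    rw [hcurry]
    refine hasFDerivAt_integral_of_dominated_of_fderiv_le (s := Set.univ) (x₀ := y)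
      (bound := B (m + 1))
      (F' := fun y p => A p • (iteratedFDeriv ℝ (m + 1) (G p) y).curryLeft)
      Filter.univ_mem ?_ (hint m y) ?_ ?_ (hB (m + 1)) ?_
    · exact Eventually.of_forall fun y => (hint m y).aestronglyMeasurable
    · exact L.continuous.comp_aestronglyMeasurable (hint (m + 1) y).aestronglyMeasurable
    · refine ae_of_all _ fun p y _ => ?_
      rw [norm_smul, ContinuousMultilinearMap.curryLeft_norm]
      exact hbd (m + 1) p y
    · refine ae_of_all _ fun p y _ => ?_
      have ht := (hG p).ftaylorSeries.fderiv m (by exact_mod_cast ENat.natCast_lt_top m) y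
      exact ht.const_smul (A p)
  refine ⟨fun y => ?_, fun m _ y => hderiv m y, fun m _ => ?_⟩
  · let L := (continuousMultilinearCurryFin0 ℝ V ℂ).toContinuousLinearEquiv.toContinuousLinearMap
    exact (L.integral_comp_comm (hint 0 y)).symm
  · exact continuous_iff_continuousAt.2 fun y => (hderiv m y).continuousAt

end IteratedDerivative

theorem norm_mul_iteratedFDeriv_gAtom_le {s ε h M : ℝ} (a : ℂ) (x ξ : E ι) (k n : ℕ) (y : E ι)
    (hb : ∀ x ξ : E ι, GSBound h (M * Real.exp (ε * (‖x‖ ^ 2 + ‖ξ‖ ^ 2))) (gAtom s x ξ)) :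
    ‖y‖ ^ k * (‖a‖ * ‖iteratedFDeriv ℝ n (gAtom s x ξ) y‖) ≤
      (M * h ^ (k + n) * Real.sqrt ((k.factorial : ℝ) * (n.factorial : ℝ))) *
        (‖a‖ * Real.exp (ε * (‖x‖ ^ 2 + ‖ξ‖ ^ 2))) := by
  have := mul_le_mul_of_nonneg_left (hb x ξ k n y) (norm_nonneg a)
  calc _ = _ := by ring
    _ ≤ _ := this
    _ = _ := by ring

variable {s ε h M : ℝ} {A : P → ℂ} {x ξ : P → E ι}


theorem aestronglyMeasurable_of_continuous_comp {X W : Type*} [TopologicalSpace X]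
    [TopologicalSpace W] {f : X → W} (hf : Continuous f) {g : P → X}
    (hg : AEStronglyMeasurable g μ) {k : P → W} (h : ∀ p, k p = f (g p)) :
    AEStronglyMeasurable k μ := by
  have := hf.comp_aestronglyMeasurable hg
  rwa [show k = fun p => f (g p) from funext h]

theorem aestronglyMeasurable_iteratedFDeriv_gAtom (hs : 0 < s) (hx : Measurable x)
    (hξ : Measurable ξ) (n : ℕ) (y : E ι) :
    AEStronglyMeasurable (fun p => iteratedFDeriv ℝ n (gAtom s (x p) (ξ p)) y) μ := by
  have h1 := continuous_iteratedFDeriv_gAtom_param (ι := ι) hs n y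
  have h2 : AEStronglyMeasurable (fun p => (x p, ξ p)) μ := (hx.prodMk hξ).aestronglyMeasurable
  refine aestronglyMeasurable_of_continuous_comp h1 h2 fun p => rfl

theorem integrable_iteratedFDeriv_gAtom (hs : 0 < s) (hx : Measurable x) (hξ : Measurable ξ)
    (hA : AEStronglyMeasurable A μ)
    (hb : ∀ x ξ : E ι, GSBound h (M * Real.exp (ε * (‖x‖ ^ 2 + ‖ξ‖ ^ 2))) (gAtom s x ξ))
    (hI : Integrable (fun p => ‖A p‖ * Real.exp (ε * (‖x p‖ ^ 2 + ‖ξ p‖ ^ 2))) μ) (n : ℕ)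
    (y : E ι) :
    Integrable (fun p => A p • iteratedFDeriv ℝ n (gAtom s (x p) (ξ p)) y) μ :=
  integrable_smul_iteratedFDeriv (G := fun p => gAtom s (x p) (ξ p))
    (aestronglyMeasurable_iteratedFDeriv_gAtom hs hx hξ) hA (fun _ => hI.const_mul _)
    (fun n p y => by
      have := norm_mul_iteratedFDeriv_gAtom_le (A p) (x p) (ξ p) 0 n y hb
      rw [pow_zero, one_mul] at this
      exact this) n y

theorem hasFTaylorSeriesUpTo_superpos (hs : 0 < s) (hx : Measurable x) (hξ : Measurable ξ)
    (hA : AEStronglyMeasurable A μ)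
    (hb : ∀ x ξ : E ι, GSBound h (M * Real.exp (ε * (‖x‖ ^ 2 + ‖ξ‖ ^ 2))) (gAtom s x ξ))
    (hI : Integrable (fun p => ‖A p‖ * Real.exp (ε * (‖x p‖ ^ 2 + ‖ξ p‖ ^ 2))) μ) :
    HasFTaylorSeriesUpTo ((⊤ : ℕ∞) : WithTop ℕ∞) (superpos s μ A x ξ)
      (fun y n => ∫ p, A p • iteratedFDeriv ℝ n (gAtom s (x p) (ξ p)) y ∂μ) :=
  hasFTaylorSeriesUpTo_integral (G := fun p => gAtom s (x p) (ξ p))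
    (fun p => contDiff_gAtom _ _ _)
    (aestronglyMeasurable_iteratedFDeriv_gAtom hs hx hξ) hA (fun _ => hI.const_mul _)
    (fun n p y => by
      have := norm_mul_iteratedFDeriv_gAtom_le (A p) (x p) (ξ p) 0 n y hb
      rw [pow_zero, one_mul] at this
      exact this)

theorem iteratedFDeriv_superpos (hs : 0 < s) (hx : Measurable x) (hξ : Measurable ξ)
    (hA : AEStronglyMeasurable A μ)
    (hb : ∀ x ξ : E ι, GSBound h (M * Real.exp (ε * (‖x‖ ^ 2 + ‖ξ‖ ^ 2))) (gAtom s x ξ))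
    (hI : Integrable (fun p => ‖A p‖ * Real.exp (ε * (‖x p‖ ^ 2 + ‖ξ p‖ ^ 2))) μ)
    (n : ℕ) (y : E ι) :
    iteratedFDeriv ℝ n (superpos s μ A x ξ) y =
      ∫ p, A p • iteratedFDeriv ℝ n (gAtom s (x p) (ξ p)) y ∂μ :=
  ((hasFTaylorSeriesUpTo_superpos hs hx hξ hA hb hI).eq_iteratedFDeriv
    (by exact_mod_cast le_top) y).symm

theorem GSBound_superpos (hs : 0 < s) (hx : Measurable x) (hξ : Measurable ξ)
    (hA : AEStronglyMeasurable A μ)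
    (hb : ∀ x ξ : E ι, GSBound h (M * Real.exp (ε * (‖x‖ ^ 2 + ‖ξ‖ ^ 2))) (gAtom s x ξ))
    (hI : Integrable (fun p => ‖A p‖ * Real.exp (ε * (‖x p‖ ^ 2 + ‖ξ p‖ ^ 2))) μ) :
    GSBound h (M * ∫ p, ‖A p‖ * Real.exp (ε * (‖x p‖ ^ 2 + ‖ξ p‖ ^ 2)) ∂μ)
      (superpos s μ A x ξ) := by
  intro k n y
  rw [iteratedFDeriv_superpos hs hx hξ hA hb hI]
  have h1 : ‖y‖ ^ k * ‖∫ p, A p • iteratedFDeriv ℝ n (gAtom s (x p) (ξ p)) y ∂μ‖ =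
      ‖∫ p, (‖y‖ ^ k : ℝ) • (A p • iteratedFDeriv ℝ n (gAtom s (x p) (ξ p)) y) ∂μ‖ := by
    rw [integral_smul, norm_smul, Real.norm_of_nonneg (by positivity)]
  rw [h1]
  refine (norm_integral_le_of_norm_le (hI.const_mul (M * h ^ (k + n) *
    Real.sqrt ((k.factorial : ℝ) * (n.factorial : ℝ)))) (ae_of_all _ fun p => ?_)).trans ?_
  · rw [norm_smul, norm_smul, Real.norm_of_nonneg (by positivity)]
    exact norm_mul_iteratedFDeriv_gAtom_le (A p) (x p) (ξ p) k n y hb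
  · rw [integral_const_mul]
    exact le_of_eq (by ring)

theorem superpos_mem_GS (hs : 0 < s) (hε : 0 < ε) (hx : Measurable x) (hξ : Measurable ξ)
    (hA : AEStronglyMeasurable A μ)
    (hI : Integrable (fun p => ‖A p‖ * Real.exp (ε * (‖x p‖ ^ 2 + ‖ξ p‖ ^ 2))) μ) :
    superpos s μ A x ξ ∈ GS ι := by
  obtain ⟨h, M, h0, -, hb, -⟩ := exists_GSBound_gAtom (ι := ι) hs hε
  exact ⟨(hasFTaylorSeriesUpTo_superpos hs hx hξ hA hb hI).contDiff, h, _, h0,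
    GSBound_superpos hs hx hξ hA hb hI⟩

/-- Two superpositions with the same coefficients are close if the parameters are close. -/
theorem GSBound_superpos_sub {x' ξ' : P → E ι} {g : P → ℝ} (hs : 0 < s) (hx : Measurable x)
    (hξ : Measurable ξ) (hx' : Measurable x') (hξ' : Measurable ξ')
    (hA : AEStronglyMeasurable A μ)
    (hb : ∀ x ξ : E ι, GSBound h (M * Real.exp (ε * (‖x‖ ^ 2 + ‖ξ‖ ^ 2))) (gAtom s x ξ))
    (hb' : ∀ x ξ x' ξ' : E ι, GSBound h (M * (‖x - x'‖ + ‖ξ - ξ'‖) *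
        Real.exp (ε * (‖x‖ ^ 2 + ‖ξ‖ ^ 2 + (‖x'‖ ^ 2 + ‖ξ'‖ ^ 2))))
          (gAtom s x ξ - gAtom s x' ξ')) (h0 : 0 < h) (M0 : 0 < M)
    (hI : Integrable (fun p => ‖A p‖ * Real.exp (ε * (‖x p‖ ^ 2 + ‖ξ p‖ ^ 2))) μ)
    (hI' : Integrable (fun p => ‖A p‖ * Real.exp (ε * (‖x' p‖ ^ 2 + ‖ξ' p‖ ^ 2))) μ)
    (hg : Integrable g μ) (hAg : ∀ p, ‖A p‖ * ((‖x p - x' p‖ + ‖ξ p - ξ' p‖) *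
      Real.exp (ε * (‖x p‖ ^ 2 + ‖ξ p‖ ^ 2 + (‖x' p‖ ^ 2 + ‖ξ' p‖ ^ 2)))) ≤ g p) :
    GSBound h (M * ∫ p, g p ∂μ) (superpos s μ A x ξ - superpos s μ A x' ξ') := by
  intro k n y
  have hn : ((n : ℕ∞) : WithTop ℕ∞) ≤ ((⊤ : ℕ∞) : WithTop ℕ∞) := by exact_mod_cast le_top
  rw [iteratedFDeriv_sub_apply
    ((hasFTaylorSeriesUpTo_superpos hs hx hξ hA hb hI).contDiff.of_le hn).contDiffAt
    ((hasFTaylorSeriesUpTo_superpos hs hx' hξ' hA hb hI').contDiff.of_le hn).contDiffAt,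
    iteratedFDeriv_superpos hs hx hξ hA hb hI, iteratedFDeriv_superpos hs hx' hξ' hA hb hI',
    ← integral_sub (integrable_iteratedFDeriv_gAtom hs hx hξ hA hb hI n y)
      (integrable_iteratedFDeriv_gAtom hs hx' hξ' hA hb hI' n y)]
  have h1 : ∀ z : ContinuousMultilinearMap ℝ (fun _ : Fin n => E ι) ℂ,
      ‖y‖ ^ k * ‖z‖ = ‖(‖y‖ ^ k : ℝ) • z‖ := fun z => by
    rw [norm_smul, Real.norm_of_nonneg (by positivity)]
  rw [h1, ← integral_smul]
  refine (norm_integral_le_of_norm_le (hg.const_mul (M * h ^ (k + n) *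
    Real.sqrt ((k.factorial : ℝ) * (n.factorial : ℝ)))) (ae_of_all _ fun p => ?_)).trans ?_
  · rw [← h1, ← smul_sub, norm_smul]
    have e := hb' (x p) (ξ p) (x' p) (ξ' p) k n y
    rw [iteratedFDeriv_sub_apply (contDiff_gAtom _ _ _).contDiffAt
      (contDiff_gAtom _ _ _).contDiffAt] at e
    have e2 := mul_le_mul_of_nonneg_left e (norm_nonneg (A p))
    have e3 := mul_le_mul_of_nonneg_left (hAg p)
      (by positivity : 0 ≤ M * h ^ (k + n) * Real.sqrt ((k.factorial : ℝ) * (n.factorial : ℝ)))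
    calc _ = _ := by ring
      _ ≤ _ := e2
      _ = _ := by ring
      _ ≤ _ := e3
  · rw [integral_const_mul]
    exact le_of_eq (by ring)

end Superposition

/-! ### Pairing distributions with superpositions -/

theorem pair_of_mem (u : GSDual ι) {F : E ι → ℂ} (hF : F ∈ GS ι) :
    pair u F = (u : GS ι →ₗ[ℂ] ℂ) ⟨F, hF⟩ := dif_pos hF

theorem pair_coe (u : GSDual ι) (f : GS ι) : pair u (f : E ι → ℂ) = (u : GS ι →ₗ[ℂ] ℂ) f :=
  pair_of_mem u f.2

theorem pair_add_right (u : GSDual ι) {F G : E ι → ℂ} (hF : F ∈ GS ι) (hG : G ∈ GS ι) :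
    pair u (F + G) = pair u F + pair u G := by
  rw [pair_of_mem u hF, pair_of_mem u hG, pair_of_mem u ((GS ι).add_mem hF hG), ← map_add]
  rfl

theorem pair_sub_right (u : GSDual ι) {F G : E ι → ℂ} (hF : F ∈ GS ι) (hG : G ∈ GS ι) :
    pair u (F - G) = pair u F - pair u G := by
  rw [pair_of_mem u hF, pair_of_mem u hG, pair_of_mem u ((GS ι).sub_mem hF hG), ← map_sub]
  rfl

theorem pair_smul_right (u : GSDual ι) (c : ℂ) {F : E ι → ℂ} (hF : F ∈ GS ι) :
    pair u (c • F) = c * pair u F := by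
  rw [pair_of_mem u hF, pair_of_mem u ((GS ι).smul_mem c hF), ← smul_eq_mul, ← map_smul]
  rfl

theorem pair_sum_smul (u : GSDual ι) {W : Type*} (t : Finset W) (c : W → ℂ) (F : W → E ι → ℂ)
    (hF : ∀ w, F w ∈ GS ι) : pair u (∑ w ∈ t, c w • F w) = ∑ w ∈ t, c w * pair u (F w) := by
  classical
  induction t using Finset.induction_on with
  | empty =>
    simp only [Finset.sum_empty]
    rw [pair_of_mem u (GS ι).zero_mem]
    exact map_zero _
  | insert a t ha ih =>
    rw [Finset.sum_insert ha, Finset.sum_insert ha, pair_add_right u ((GS ι).smul_mem _ (hF a))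
      ((GS ι).sum_mem fun w _ => (GS ι).smul_mem _ (hF w)), pair_smul_right u _ (hF a), ih]

theorem exists_pair_bound (u : GSDual ι) {h : ℝ} (h0 : 0 < h) :
    ∃ N : ℝ, 0 < N ∧ ∀ F ∈ GS ι, ∀ C, GSBound h C F → ‖pair u F‖ ≤ N * C := by
  obtain ⟨M, hM⟩ := u.2 h h0
  refine ⟨|M| + 1, by positivity, fun F hF C hC => ?_⟩
  rw [pair_of_mem u hF]
  refine (hM ⟨F, hF⟩ C hC).trans (mul_le_mul_of_nonneg_right ?_ hC.nonneg)
  linarith [le_abs_self M]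

/-- The functional is applied with the `h` that belongs to the given `ε`. That `ε` is arbitrary is
what makes all phase space integrals against Gaussian coefficients converge. -/
theorem exists_norm_pair_gAtom_le (u : GSDual ι) {s ε : ℝ} (hs : 0 < s) (hε : 0 < ε) :
    ∃ M : ℝ, 0 < M ∧ ∀ x ξ : E ι,
      ‖pair u (gAtom s x ξ)‖ ≤ M * Real.exp (ε * (‖x‖ ^ 2 + ‖ξ‖ ^ 2)) := by
  obtain ⟨h, M, h0, M0, hb, -⟩ := exists_GSBound_gAtom (ι := ι) hs hε
  obtain ⟨N, N0, hN⟩ := exists_pair_bound u h0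
  refine ⟨N * M, by positivity, fun x ξ => ?_⟩
  rw [mul_assoc]
  exact hN _ (gAtom_mem_GS hs x ξ) _ (hb x ξ)

theorem continuous_pair_gAtom (u : GSDual ι) {s : ℝ} (hs : 0 < s) :
    Continuous fun w : E ι × E ι => pair u (gAtom s w.1 w.2) := by
  obtain ⟨h, M, h0, M0, -, hb⟩ := exists_GSBound_gAtom (ι := ι) hs one_pos
  obtain ⟨N, N0, hN⟩ := exists_pair_bound u h0
  refine continuous_of_lipschitz_on_bounded (B := fun w w' => N * (M * 2 * Real.exp (1 *
    (‖w.1‖ ^ 2 + ‖w.2‖ ^ 2 + (‖w'.1‖ ^ 2 + ‖w'.2‖ ^ 2)))))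
    (by unfold Function.uncurry; fun_prop) fun w w' => ?_
  rw [← pair_sub_right u (gAtom_mem_GS hs _ _) (gAtom_mem_GS hs _ _)]
  refine (hN _ ((GS ι).sub_mem (gAtom_mem_GS hs _ _) (gAtom_mem_GS hs _ _)) _
    (hb w.1 w.2 w'.1 w'.2)).trans ?_
  have h1 : ‖w.1 - w'.1‖ ≤ ‖w - w'‖ := norm_fst_le (w - w')
  have h2 : ‖w.2 - w'.2‖ ≤ ‖w - w'‖ := norm_snd_le (w - w')
  calc _ ≤ N * (M * (‖w - w'‖ + ‖w - w'‖) *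
        Real.exp (1 * (‖w.1‖ ^ 2 + ‖w.2‖ ^ 2 + (‖w'.1‖ ^ 2 + ‖w'.2‖ ^ 2)))) := by gcongr
    _ = _ := by ring

section Superposition

variable {P : Type*} [MeasurableSpace P] {μ : Measure P}

theorem integral_mul_simpleFunc {W : Type*} {A : P → ℂ} (hA : Integrable A μ)
    (S : SimpleFunc P W) (Φ : W → ℂ) :
    ∫ p, A p * Φ (S p) ∂μ = ∑ w ∈ S.range, (∫ p in S ⁻¹' {w}, A p ∂μ) * Φ w := by
  classical
  have h : ∀ p, A p * Φ (S p) = ∑ w ∈ S.range, (S ⁻¹' {w}).indicator A p * Φ w := by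
    intro p
    rw [Finset.sum_eq_single (S p)]
    · rw [Set.indicator_of_mem (by simp)]
    · intro w _ hw
      rw [Set.indicator_of_notMem (by simpa using hw.symm), zero_mul]
    · intro h
      exact absurd (S.mem_range_self p) h
  simp_rw [h]
  rw [integral_finsetSum _ fun w _ => (hA.indicator (S.measurableSet_fiber w)).mul_const _]
  refine Finset.sum_congr rfl fun w _ => ?_
  rw [integral_mul_const, integral_indicator (S.measurableSet_fiber w)]

variable {s ε : ℝ} {A : P → ℂ} {x ξ : P → E ι}

theorem integrable_of_mul_exp (hε : 0 < ε) (hA : AEStronglyMeasurable A μ)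
    (hI : Integrable (fun p => ‖A p‖ * Real.exp (ε * (‖x p‖ ^ 2 + ‖ξ p‖ ^ 2))) μ) :
    Integrable A μ :=
  hI.mono' hA (ae_of_all _ fun p => le_mul_of_one_le_right (norm_nonneg _)
    (Real.one_le_exp (by positivity)))

theorem superpos_simpleFunc (hA : Integrable A μ) (S : SimpleFunc P (E ι × E ι)) :
    superpos s μ A (fun p => (S p).1) (fun p => (S p).2) =
      ∑ w ∈ S.range, (∫ p in S ⁻¹' {w}, A p ∂μ) • gAtom s w.1 w.2 := by
  funext y
  simp only [superpos, Finset.sum_apply, Pi.smul_apply, smul_eq_mul]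
  exact integral_mul_simpleFunc hA S fun w => gAtom s w.1 w.2 y

/-- The exponent on the left is `εr/2`; the other half of `εr` absorbs the factor `d`, which grows
at most linearly in `r`. -/
theorem exp_decay_aux {ε r d : ℝ} (hε : 0 < ε) (hr : 0 ≤ r) (hd : d ≤ 4 + 9 * r) :
    d * Real.exp (ε / 18 * (9 * r)) ≤ (4 + 18 / ε) * Real.exp (ε * r) := by
  have h1 : 1 ≤ Real.exp (ε / 2 * r) := Real.one_le_exp (by positivity)
  have h2 : ε / 2 * r ≤ Real.exp (ε / 2 * r) := by
    linarith [Real.add_one_le_exp (ε / 2 * r)]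
  have h3 : d ≤ (4 + 18 / ε) * Real.exp (ε / 2 * r) := by
    have : 9 * r ≤ 18 / ε * Real.exp (ε / 2 * r) := by
      calc 9 * r = 18 / ε * (ε / 2 * r) := by field_simp; ring
        _ ≤ _ := by gcongr
    linarith
  calc d * Real.exp (ε / 18 * (9 * r))
      ≤ (4 + 18 / ε) * Real.exp (ε / 2 * r) * Real.exp (ε / 18 * (9 * r)) := by gcongr
    _ = _ := by rw [mul_assoc, ← Real.exp_add]; ring_nf

/-- A superposition is approximated, in a fixed Gelfand-Shilov norm, by finite sums of modulated
Gaussians. -/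
theorem exists_approx_superpos (hs : 0 < s) (hε : 0 < ε) (hx : Measurable x) (hξ : Measurable ξ)
    (hA : AEStronglyMeasurable A μ)
    (hI : Integrable (fun p => ‖A p‖ * Real.exp (ε * (‖x p‖ ^ 2 + ‖ξ p‖ ^ 2))) μ) :
    ∃ (h : ℝ) (S : ℕ → SimpleFunc P (E ι × E ι)) (C : ℕ → ℝ), 0 < h ∧ Tendsto C atTop (𝓝 0) ∧
      (∀ n, GSBound h (C n) (superpos s μ A x ξ -
        superpos s μ A (fun p => (S n p).1) (fun p => (S n p).2))) ∧
      (∀ p, Tendsto (fun n => S n p) atTop (𝓝 (x p, ξ p))) ∧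
      ∀ n p, ‖(S n p).1‖ ^ 2 + ‖(S n p).2‖ ^ 2 ≤ 8 * (‖x p‖ ^ 2 + ‖ξ p‖ ^ 2) := by
  -- The approximating simple functions have squared norm up to `8r` where the true parameters have
  -- `r`, so both points together contribute `9r`. The rate `ε / 18` then uses half of the available
  -- decay and leaves the rest for the distance of the points.
  obtain ⟨h, M, h0, M0, hb, hb'⟩ := exists_GSBound_gAtom (ι := ι) (ε := ε / 18) hs (by positivity)
  have hW : Measurable fun p => (x p, ξ p) := hx.prodMk hξ
  set S : ℕ → SimpleFunc P (E ι × E ι) := fun n =>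
    SimpleFunc.approxOn (fun p => (x p, ξ p)) hW Set.univ 0 (Set.mem_univ _) n with hS
  have hlim : ∀ p, Tendsto (fun n => S n p) atTop (𝓝 (x p, ξ p)) := fun p =>
    SimpleFunc.tendsto_approxOn hW (Set.mem_univ _) (by simp)
  have hbd : ∀ n p, ‖(S n p).1‖ ^ 2 + ‖(S n p).2‖ ^ 2 ≤ 8 * (‖x p‖ ^ 2 + ‖ξ p‖ ^ 2) := by
    intro n p
    have h1 := SimpleFunc.norm_approxOn_zero_le hW (Set.mem_univ (0 : E ι × E ι)) p n
    have h2 : ‖(S n p).1‖ ≤ 2 * ‖(x p, ξ p)‖ := (norm_fst_le _).trans (h1.trans (by linarith))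
    have h3 : ‖(S n p).2‖ ≤ 2 * ‖(x p, ξ p)‖ := (norm_snd_le _).trans (h1.trans (by linarith))
    have h4 : ‖(x p, ξ p)‖ ^ 2 ≤ ‖x p‖ ^ 2 + ‖ξ p‖ ^ 2 := by
      rw [Prod.norm_mk]
      rcases max_choice ‖x p‖ ‖ξ p‖ with e | e <;> rw [e] <;> nlinarith [norm_nonneg (x p)]
    nlinarith [norm_nonneg (S n p).1, norm_nonneg (S n p).2, norm_nonneg (x p, ξ p)]
  set r : P → ℝ := fun p => ‖x p‖ ^ 2 + ‖ξ p‖ ^ 2 with hr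
  have hIε : ∀ (z : P → ℝ), Measurable z → (∀ p, z p ≤ Real.exp (ε * r p)) → (∀ p, 0 ≤ z p) →
      Integrable (fun p => ‖A p‖ * z p) μ := fun z hz hle hz0 => by
    refine hI.mono' (hA.norm.mul hz.aestronglyMeasurable) (ae_of_all _ fun p => ?_)
    rw [norm_mul, norm_norm, Real.norm_of_nonneg (hz0 p)]
    exact mul_le_mul_of_nonneg_left (hle p) (norm_nonneg _)
  have hSm1 : ∀ n, Measurable fun p => (S n p).1 := fun n => (S n).measurable.fst
  have hSm2 : ∀ n, Measurable fun p => (S n p).2 := fun n => (S n).measurable.snd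
  set g : ℕ → P → ℝ := fun n p => ‖A p‖ * ((‖x p - (S n p).1‖ + ‖ξ p - (S n p).2‖) *
    Real.exp (ε / 18 * (‖x p‖ ^ 2 + ‖ξ p‖ ^ 2 + (‖(S n p).1‖ ^ 2 + ‖(S n p).2‖ ^ 2)))) with hg
  have hgm : ∀ n, AEStronglyMeasurable (g n) μ := fun n => by
    refine hA.norm.mul (Measurable.aestronglyMeasurable ?_)
    have := hSm1 n
    have := hSm2 n
    fun_prop
  have hgle : ∀ n p, ‖g n p‖ ≤ (4 + 18 / ε) * (‖A p‖ * Real.exp (ε * r p)) := by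
    intro n p
    have h0 : 0 ≤ g n p := by positivity
    rw [Real.norm_of_nonneg h0]
    have h1 := norm_sub_le (x p) (S n p).1
    have h2 := norm_sub_le (ξ p) (S n p).2
    have h3 := hbd n p
    have h4 : ‖x p - (S n p).1‖ + ‖ξ p - (S n p).2‖ ≤ 4 + 9 * r p := by
      have q : ∀ t : ℝ, t ≤ 1 + t ^ 2 := fun t => by nlinarith [sq_nonneg (t - 1), sq_nonneg t]
      have := q ‖x p‖
      have := q ‖ξ p‖
      have := q ‖(S n p).1‖
      have := q ‖(S n p).2‖
      simp only [hr]
      linarith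
    have h5 := exp_decay_aux hε (by positivity : 0 ≤ r p) h4
    have h6 : ε / 18 * (‖x p‖ ^ 2 + ‖ξ p‖ ^ 2 + (‖(S n p).1‖ ^ 2 + ‖(S n p).2‖ ^ 2)) ≤
        ε / 18 * (9 * r p) := by
      gcongr
      simp only [hr]
      linarith
    calc g n p ≤ ‖A p‖ * ((‖x p - (S n p).1‖ + ‖ξ p - (S n p).2‖) *
          Real.exp (ε / 18 * (9 * r p))) := by simp only [hg]; gcongr
      _ ≤ ‖A p‖ * ((4 + 18 / ε) * Real.exp (ε * r p)) := by gcongr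
      _ = _ := by ring
  have hgint : ∀ n, Integrable (g n) μ := fun n =>
    (hI.const_mul (4 + 18 / ε)).mono' (hgm n) (ae_of_all _ (hgle n))
  refine ⟨h, S, fun n => M * ∫ p, g n p ∂μ, h0, ?_, fun n => ?_, hlim, hbd⟩
  · have : Tendsto (fun n => ∫ p, g n p ∂μ) atTop (𝓝 (∫ _, (0 : ℝ) ∂μ)) := by
      refine tendsto_integral_of_dominated_convergence
        (fun p => (4 + 18 / ε) * (‖A p‖ * Real.exp (ε * r p))) hgm (hI.const_mul _)
        (fun n => ae_of_all _ (hgle n)) (ae_of_all _ fun p => ?_)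
      have h1 : Continuous fun w : E ι × E ι => ‖A p‖ * ((‖x p - w.1‖ + ‖ξ p - w.2‖) *
        Real.exp (ε / 18 * (‖x p‖ ^ 2 + ‖ξ p‖ ^ 2 + (‖w.1‖ ^ 2 + ‖w.2‖ ^ 2)))) := by fun_prop
      have h2 := (h1.tendsto (x p, ξ p)).comp (hlim p)
      simpa using! h2
    simpa using this.const_mul M
  · have hxm : Measurable fun p => Real.exp (ε / 18 * r p) := by fun_prop
    refine GSBound_superpos_sub hs hx hξ (hSm1 n) (hSm2 n) hA hb hb' h0 M0 ?_ ?_ (hgint n)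
      (fun p => le_rfl)
    · refine hIε _ hxm (fun p => ?_) (fun p => (Real.exp_pos _).le)
      gcongr
      linarith
    · have := hSm1 n
      have := hSm2 n
      refine hIε _ (by fun_prop) (fun p => ?_) (fun p => (Real.exp_pos _).le)
      refine Real.exp_le_exp.2 ?_
      have := hbd n p
      have hr0 : 0 ≤ r p := by positivity
      calc _ ≤ ε / 18 * (8 * r p) := by gcongr
        _ ≤ _ := by nlinarith

/-- For simple parameter functions the superposition is a finite sum of atoms and the identity is
linearity. Simple approximations converge in one fixed `𝒮_{1/2,h}`, on which `u` is bounded, while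
the integral on the right converges by domination. -/
theorem pair_superpos (u : GSDual ι) (hs : 0 < s) (hε : 0 < ε) (hx : Measurable x)
    (hξ : Measurable ξ) (hA : AEStronglyMeasurable A μ)
    (hI : Integrable (fun p => ‖A p‖ * Real.exp (ε * (‖x p‖ ^ 2 + ‖ξ p‖ ^ 2))) μ) :
    pair u (superpos s μ A x ξ) = ∫ p, A p * pair u (gAtom s (x p) (ξ p)) ∂μ := by
  obtain ⟨h, S, C, h0, hC, hb, hlim, hbd⟩ := exists_approx_superpos hs hε hx hξ hA hI
  obtain ⟨N, N0, hN⟩ := exists_pair_bound u h0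
  have hAi := integrable_of_mul_exp hε hA hI
  have hmem := superpos_mem_GS hs hε hx hξ hA hI
  have hSmem : ∀ n, superpos s μ A (fun p => (S n p).1) (fun p => (S n p).2) ∈ GS ι := fun n => by
    rw [superpos_simpleFunc hAi]
    exact (GS ι).sum_mem fun w _ => (GS ι).smul_mem _ (gAtom_mem_GS hs _ _)
  have hval : ∀ n, pair u (superpos s μ A (fun p => (S n p).1) (fun p => (S n p).2)) =
      ∫ p, A p * pair u (gAtom s (S n p).1 (S n p).2) ∂μ := fun n => by
    rw [superpos_simpleFunc hAi, pair_sum_smul u _ _ _ fun w => gAtom_mem_GS hs _ _]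
    exact (integral_mul_simpleFunc hAi (S n) fun w => pair u (gAtom s w.1 w.2)).symm
  have h1 : Tendsto (fun n => pair u (superpos s μ A (fun p => (S n p).1) (fun p => (S n p).2)))
      atTop (𝓝 (pair u (superpos s μ A x ξ))) := by
    rw [tendsto_iff_norm_sub_tendsto_zero]
    have hz : Tendsto (fun n => N * C n) atTop (𝓝 0) := by simpa using hC.const_mul N
    refine squeeze_zero (fun _ => norm_nonneg _) (fun n => ?_) hz
    rw [norm_sub_rev, ← pair_sub_right u hmem (hSmem n)]
    exact hN _ ((GS ι).sub_mem hmem (hSmem n)) _ (hb n)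
  refine tendsto_nhds_unique h1 ?_
  simp_rw [hval]
  -- The rate `ε / 8` compensates the factor `8` in the squared norms of the simple approximations.
  obtain ⟨K, K0, hK⟩ := exists_norm_pair_gAtom_le u hs (by positivity : 0 < ε / 8)
  have hcont := continuous_pair_gAtom u hs
  refine tendsto_integral_of_dominated_convergence
    (fun p => K * (‖A p‖ * Real.exp (ε * (‖x p‖ ^ 2 + ‖ξ p‖ ^ 2)))) (fun n => ?_)
    (hI.const_mul _) (fun n => ae_of_all _ fun p => ?_) (ae_of_all _ fun p => ?_)
  · exact hA.mul (hcont.comp_aestronglyMeasurable (S n).measurable.aestronglyMeasurable)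
  · rw [norm_mul]
    have h2 := hK (S n p).1 (S n p).2
    have h3 := hbd n p
    calc _ ≤ ‖A p‖ * (K * Real.exp (ε / 8 * (‖(S n p).1‖ ^ 2 + ‖(S n p).2‖ ^ 2))) := by gcongr
      _ ≤ ‖A p‖ * (K * Real.exp (ε / 8 * (8 * (‖x p‖ ^ 2 + ‖ξ p‖ ^ 2)))) := by gcongr
      _ = _ := by rw [show ε / 8 * (8 * (‖x p‖ ^ 2 + ‖ξ p‖ ^ 2)) =
                    ε * (‖x p‖ ^ 2 + ‖ξ p‖ ^ 2) by ring]; ring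
  · exact ((hcont.tendsto (x p, ξ p)).comp (hlim p)).const_mul (A p)

end Superposition

/-! ### The Gaussian transform of Gelfand-Shilov functions -/

/-- The transform `∫ f(y) gAtom s x ξ y dy`. -/
def gTrans (s : ℝ) (f : E ι → ℂ) (x ξ : E ι) : ℂ := ∫ y, f y * gAtom s x ξ y

/-- `(2j)! = C(2j, j) j!²`, and the binomial coefficient is at most `4^j`. -/
theorem factorial_two_mul_le (j : ℕ) : Real.sqrt ((2 * j).factorial : ℝ) ≤ 2 ^ j * j.factorial := by
  rw [Real.sqrt_le_left (by positivity)]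
  have h1 : (2 * j).choose j * j.factorial * (2 * j - j).factorial = (2 * j).factorial :=
    Nat.choose_mul_factorial_mul_factorial (by omega)
  have h2 : (2 * j).choose j ≤ 2 ^ (2 * j) := Nat.choose_le_two_pow _ _
  have h3 : 2 * j - j = j := by omega
  rw [h3] at h1
  have h4 : (2 * j).factorial ≤ 2 ^ (2 * j) * j.factorial * j.factorial := by
    rw [← h1]; gcongr
  have h5 : ((2 * j).factorial : ℝ) ≤ 2 ^ (2 * j) * j.factorial * j.factorial := by
    exact_mod_cast h4
  refine h5.trans (le_of_eq ?_)
  rw [pow_mul']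
  ring

/-- Moment bounds of Gelfand-Shilov type imply Gaussian decay. -/
theorem gauss_decay_of_moments {h t b C : ℝ} (hh : 0 < h) (hb : 0 ≤ b)
    (H : ∀ k : ℕ, t ^ k * b ≤ C * h ^ k * Real.sqrt k.factorial) :
    b ≤ 2 * C * Real.exp (-(1 / (4 * h ^ 2)) * t ^ 2) := by
  -- Even moments suffice: the moment of order `2j`, scaled by `(4h²)^{-j}/j!`, is at most `C
  -- 2^{-j}`, and summation over `j` produces the exponential series on the left and `2C` on the
  -- right.
  have hterm : ∀ j : ℕ, ((1 / (4 * h ^ 2)) * t ^ 2) ^ j / j.factorial * b ≤ C * (1 / 2) ^ j := by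
    intro j
    have hC : 0 ≤ C := by
      have := H 0
      simp at this
      linarith
    have h1 := H (2 * j)
    have h2 := factorial_two_mul_le j
    have h3 : t ^ (2 * j) * b ≤ C * h ^ (2 * j) * (2 ^ j * j.factorial) :=
      h1.trans (by gcongr)
    rw [div_mul_eq_mul_div, div_le_iff₀ (by positivity)]
    have e1 : (1 / (4 * h ^ 2) * t ^ 2) ^ j * b =
        (1 / (4 * h ^ 2)) ^ j * (t ^ (2 * j) * b) := by
      rw [mul_pow, pow_mul]; ring
    rw [e1]
    calc _ ≤ (1 / (4 * h ^ 2)) ^ j * (C * h ^ (2 * j) * (2 ^ j * j.factorial)) := by gcongr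
      _ = C * (1 / (4 * h ^ 2) * h ^ 2 * 2) ^ j * j.factorial := by
          rw [mul_pow, mul_pow, pow_mul h]; ring
      _ = _ := by
          congr 3
          field_simp
          norm_num
  have hs1 := (NormedSpace.expSeries_div_hasSum_exp ((1 / (4 * h ^ 2)) * t ^ 2)).mul_right b
  have hs2 := (hasSum_geometric_of_lt_one (by norm_num : (0 : ℝ) ≤ 1 / 2) (by norm_num)).mul_left C
  have h4 := hasSum_le hterm hs1 hs2
  rw [← Real.exp_eq_exp_ℝ] at h4
  rw [neg_mul, Real.exp_neg, ← div_eq_mul_inv, le_div_iff₀ (Real.exp_pos _)]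
  norm_num at h4 ⊢
  linarith

theorem GSBound.norm_le_gauss {h C : ℝ} {f : E ι → ℂ} (hf : GSBound h C f) (hh : 0 < h) (y : E ι) :
    ‖f y‖ ≤ 2 * C * Real.exp (-(1 / (4 * h ^ 2)) * ‖y‖ ^ 2) :=
  gauss_decay_of_moments hh (norm_nonneg _) fun k => by simpa using hf k 0 y

theorem one_add_pow_le (t : ℝ) (ht : 0 ≤ t) (m : ℕ) : (1 + t) ^ m ≤ 2 ^ m * (1 + t ^ m) := by
  rcases le_total t 1 with hx | hx
  · calc (1 + t) ^ m ≤ 2 ^ m := by gcongr; linarith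
      _ ≤ 2 ^ m * (1 + t ^ m) := by
        have : (0 : ℝ) ≤ t ^ m := by positivity
        nlinarith [pow_pos (two_pos : (0 : ℝ) < 2) m]
  · calc (1 + t) ^ m ≤ (2 * t) ^ m := by gcongr; linarith
      _ = 2 ^ m * t ^ m := mul_pow _ _ _
      _ ≤ 2 ^ m * (1 + t ^ m) := by gcongr; linarith

/-- The moments of order `0` and `dim + 1` are traded for an integrable weight. The loss is
independent of the order `n` of the derivative and is put into `w`. -/
theorem exists_integrable_decay (ι : Type) [Fintype ι] {h : ℝ} (hh : 0 < h) :
    ∃ w : E ι → ℝ, Integrable w volume ∧ (∀ y, 0 ≤ w y) ∧ ∀ (f : E ι → ℂ) (C : ℝ), GSBound h C f →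
      ∀ (n : ℕ) (y : E ι), ‖iteratedFDeriv ℝ n f y‖ ≤
        C * h ^ n * Real.sqrt n.factorial * w y := by
  set m : ℕ := Module.finrank ℝ (E ι) + 1 with hm
  have hint : Integrable (fun x : E ι => (1 + ‖x‖) ^ (-(m : ℝ))) volume :=
    integrable_one_add_norm (by simp [hm])
  refine ⟨fun y => 2 ^ m * (1 + h ^ m * Real.sqrt m.factorial) * (1 + ‖y‖) ^ (-(m : ℝ)),
    hint.const_mul _, fun y => by positivity, fun f C hf n y => ?_⟩
  have e0 := hf 0 n y
  have e1 := hf m n y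
  have hpos : (0 : ℝ) < 1 + ‖y‖ := by positivity
  beta_reduce
  rw [Real.rpow_neg hpos.le, Real.rpow_natCast, ← mul_assoc, ← div_eq_mul_inv,
    le_div_iff₀ (by positivity)]
  rw [Real.sqrt_mul (by positivity)] at e0 e1
  simp only [pow_zero, one_mul, zero_add, Nat.factorial_zero, Nat.cast_one, Real.sqrt_one] at e0
  calc ‖iteratedFDeriv ℝ n f y‖ * (1 + ‖y‖) ^ m
      ≤ ‖iteratedFDeriv ℝ n f y‖ * (2 ^ m * (1 + ‖y‖ ^ m)) := by
        gcongr; exact one_add_pow_le _ (norm_nonneg _) _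
    _ = 2 ^ m * (‖iteratedFDeriv ℝ n f y‖ + ‖y‖ ^ m * ‖iteratedFDeriv ℝ n f y‖) := by ring
    _ ≤ 2 ^ m * (C * h ^ n * Real.sqrt n.factorial +
        C * h ^ (m + n) * (Real.sqrt m.factorial * Real.sqrt n.factorial)) := by gcongr
    _ = _ := by rw [pow_add]; ring

/-- Without modulation the bound is uniform in the centre: the polynomial growth in `|y - x|` is
absorbed by `e^{-s|y-x|²}`. The value `δ = 1/(8s)` makes `δ · 8s²|y-x|²` equal to `s|y-x|²`. -/
theorem exists_iteratedFDeriv_gAtom_uniform {s : ℝ} (hs : 0 < s) :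
    ∃ B K : ℝ, 0 < B ∧ 0 < K ∧ ∀ (n : ℕ) (x y : E ι),
      ‖iteratedFDeriv ℝ n (gAtom s x 0) y‖ ≤ K * B ^ n * Real.sqrt n.factorial := by
  set δ : ℝ := 1 / (8 * s) with hδ
  have hδ0 : 0 < δ := by positivity
  refine ⟨2 * (Real.sqrt δ⁻¹ + Real.sqrt (2 * s * Real.exp 1)), Real.exp (2 * δ), by positivity,
    by positivity, fun n x y => ?_⟩
  have h1 := norm_iteratedFDeriv_gAtom_le hs.le x 0 y (c := 2 * s * ‖y - x‖ + 1)
    (by have := norm_nonneg (y - x); nlinarith) (by simp) n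
  have h2 := add_sqrt_pow_le (δ := δ) (r := 2 * s) (t := 2 * s * ‖y - x‖ + 1) hδ0 (by positivity)
    (by positivity) n
  have h3 : δ * (2 * s * ‖y - x‖ + 1) ^ 2 + -s * ‖y - x‖ ^ 2 ≤ 2 * δ := by
    have e : δ * (8 * s) = 1 := by rw [hδ]; field_simp
    have : (2 * s * ‖y - x‖ + 1) ^ 2 ≤ 8 * s ^ 2 * ‖y - x‖ ^ 2 + 2 := by
      nlinarith [sq_nonneg (2 * s * ‖y - x‖ - 1)]
    have h4 := mul_le_mul_of_nonneg_left this hδ0.le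
    have h5 : δ * (8 * s ^ 2 * ‖y - x‖ ^ 2) = s * ‖y - x‖ ^ 2 := by
      calc _ = (δ * (8 * s)) * (s * ‖y - x‖ ^ 2) := by ring
        _ = _ := by rw [e, one_mul]
    linarith
  calc _ ≤ _ := h1
    _ ≤ ((2 * (Real.sqrt δ⁻¹ + Real.sqrt (2 * s * Real.exp 1))) ^ n * Real.sqrt n.factorial *
        Real.exp (δ * (2 * s * ‖y - x‖ + 1) ^ 2)) * Real.exp (-s * ‖y - x‖ ^ 2) := by gcongr
    _ = (2 * (Real.sqrt δ⁻¹ + Real.sqrt (2 * s * Real.exp 1))) ^ n * Real.sqrt n.factorial *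
        Real.exp (δ * (2 * s * ‖y - x‖ + 1) ^ 2 + -s * ‖y - x‖ ^ 2) := by
          rw [Real.exp_add]; ring
    _ ≤ (2 * (Real.sqrt δ⁻¹ + Real.sqrt (2 * s * Real.exp 1))) ^ n * Real.sqrt n.factorial *
        Real.exp (2 * δ) := by gcongr
    _ = _ := by ring

theorem sum_choose_sqrt_factorial_le {h B : ℝ} (hh : 0 ≤ h) (hB : 0 ≤ B) (n : ℕ) :
    ∑ i ∈ Finset.range (n + 1), (n.choose i : ℝ) * (h ^ i * Real.sqrt i.factorial) *
      (B ^ (n - i) * Real.sqrt (n - i).factorial) ≤ (h + B) ^ n * Real.sqrt n.factorial := by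
  rw [add_pow, Finset.sum_mul]
  refine Finset.sum_le_sum fun i hi => ?_
  have hi' : i ≤ n := Nat.lt_succ_iff.1 (Finset.mem_range.1 hi)
  have h1 : (i.factorial * (n - i).factorial : ℝ) ≤ n.factorial := by
    have := Nat.factorial_mul_factorial_dvd_factorial hi'
    exact_mod_cast Nat.le_of_dvd (Nat.factorial_pos n) this
  have h2 : Real.sqrt i.factorial * Real.sqrt (n - i).factorial ≤ Real.sqrt n.factorial := by
    rw [← Real.sqrt_mul (by positivity)]
    exact Real.sqrt_le_sqrt h1
  calc _ = h ^ i * B ^ (n - i) * n.choose i *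
        (Real.sqrt i.factorial * Real.sqrt (n - i).factorial) := by ring
    _ ≤ _ := by gcongr

open scoped FourierTransform in
theorem gTrans_eq_fourier (s : ℝ) (f : E ι → ℂ) (x ξ : E ι) :
    gTrans s f x ξ = 𝓕 (fun y => f y * gAtom s x 0 y) (-((2 * Real.pi)⁻¹ • ξ)) := by
  rw [Real.fourier_eq']
  unfold gTrans
  congr 1
  funext y
  rw [smul_eq_mul, gAtom, gAtom, inner_neg_right, real_inner_smul_right, inner_zero_left,
    mul_left_comm, ← Complex.exp_add]
  congr 2
  rw [real_inner_comm]
  have : (Real.pi : ℂ) ≠ 0 := by exact_mod_cast Real.pi_ne_zero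
  push_cast
  field_simp
  ring

-- The transform is the Fourier transform of `f · gAtom s x 0`, whose derivatives have `L¹` norms
-- `O(b^n √n!)` uniformly in `x`. So the moments in `ξ` have Gelfand-Shilov bounds, and
-- `gauss_decay_of_moments` turns these into Gaussian decay.
open scoped FourierTransform in
theorem exists_gTrans_decay_freq {s h : ℝ} (hs : 0 < s) (hh : 0 < h) :
    ∃ r M : ℝ, 0 < r ∧ 0 < M ∧ ∀ f ∈ GS ι, ∀ C, GSBound h C f → ∀ x ξ,
      ‖gTrans s f x ξ‖ ≤ M * C * Real.exp (-r * ‖ξ‖ ^ 2) := by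
  obtain ⟨w, hwi, hw0, hw⟩ := exists_integrable_decay ι hh
  obtain ⟨B, K, B0, K0, hB⟩ := exists_iteratedFDeriv_gAtom_uniform (ι := ι) hs
  set b : ℝ := h + B + 1 with hb
  have hb1 : 1 ≤ b := by linarith
  set I : ℝ := ∫ y, w y with hI
  have hI0 : 0 ≤ I := integral_nonneg hw0
  -- The factor `4` stands for two powers `2^n`, one from the estimate of the Fourier transform and
  -- one from the number `n + 1` of summands; `2π` comes from the normalization of frequencies.
  set b' : ℝ := 4 * b * (2 * Real.pi) with hb'
  have hb'0 : 0 < b' := by positivity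
  refine ⟨1 / (4 * b' ^ 2), 2 * (K * I + 1), by positivity, by positivity,
    fun f hf C hC x ξ => ?_⟩
  have hC0 := hC.nonneg
  set G : E ι → ℂ := fun y => f y * gAtom s x 0 y with hG
  have hGs : ContDiff ℝ ((⊤ : ℕ∞) : WithTop ℕ∞) G := hf.1.mul (contDiff_gAtom s x 0)
  have hGb : ∀ (n : ℕ) (y : E ι), ‖iteratedFDeriv ℝ n G y‖ ≤
      (C * K * b ^ n * Real.sqrt n.factorial) * w y := by
    intro n y
    refine (norm_iteratedFDeriv_mul_le hf.1 (contDiff_gAtom s x 0) y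
      (by exact_mod_cast le_top)).trans ?_
    have hwy := hw0 y
    calc _ ≤ ∑ i ∈ Finset.range (n + 1), (n.choose i : ℝ) *
          (C * h ^ i * Real.sqrt i.factorial * w y) *
          (K * B ^ (n - i) * Real.sqrt (n - i).factorial) := by
          gcongr with i hi
          · exact hw f C hC i y
          · exact hB (n - i) x y
      _ = C * K * w y * ∑ i ∈ Finset.range (n + 1), (n.choose i : ℝ) *
          (h ^ i * Real.sqrt i.factorial) * (B ^ (n - i) * Real.sqrt (n - i).factorial) := by
          rw [Finset.mul_sum]
          exact Finset.sum_congr rfl fun i _ => by ring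
      _ ≤ C * K * w y * ((h + B) ^ n * Real.sqrt n.factorial) := by
          gcongr
          exact sum_choose_sqrt_factorial_le hh.le B0.le n
      _ ≤ C * K * w y * (b ^ n * Real.sqrt n.factorial) := by gcongr; linarith
      _ = _ := by ring
  have hGint : ∀ n : ℕ, Integrable (fun y => ‖iteratedFDeriv ℝ n G y‖) volume := fun n => by
    refine (hwi.const_mul (C * K * b ^ n * Real.sqrt n.factorial)).mono'
      (hGs.continuous_iteratedFDeriv (by exact_mod_cast le_top)).norm.aestronglyMeasurable
      (ae_of_all _ fun y => ?_)
    rw [norm_norm]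
    exact hGb n y
  rw [gTrans_eq_fourier]
  set η := -((2 * Real.pi)⁻¹ • ξ) with hη
  have hηn : ‖ξ‖ = 2 * Real.pi * ‖η‖ := by
    rw [hη, norm_neg, norm_smul, Real.norm_of_nonneg (by positivity)]
    field_simp
  refine (gauss_decay_of_moments (t := ‖ξ‖) (C := C * (K * I + 1)) hb'0 (norm_nonneg _)
    fun n => ?_).trans (le_of_eq (by ring))
  have h1 := Real.pow_mul_norm_iteratedFDeriv_fourier_le (K := 0) (N := ⊤) hGs
    (fun k n hk _ => by
      have : k = 0 := by simpa using hk
      subst this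
      simpa using hGint n) (k := 0) (n := n) (by simp) le_top η
  simp only [norm_iteratedFDeriv_zero, pow_zero, one_mul, Nat.cast_zero, mul_zero, zero_add,
    Finset.range_one, Finset.singleton_product, Finset.sum_map, Function.Embedding.coeFn_mk] at h1
  have h2 : ∑ j ∈ Finset.range (n + 1), ∫ v, ‖iteratedFDeriv ℝ j G v‖ ≤
      2 ^ n * (C * (K * I + 1) * b ^ n * Real.sqrt n.factorial) := by
    calc _ ≤ ∑ j ∈ Finset.range (n + 1), C * (K * I + 1) * b ^ n * Real.sqrt n.factorial := by
          refine Finset.sum_le_sum fun j hj => ?_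
          have hj' : j ≤ n := Nat.lt_succ_iff.1 (Finset.mem_range.1 hj)
          calc _ ≤ ∫ v, (C * K * b ^ j * Real.sqrt j.factorial) * w v :=
                integral_mono (hGint j) (hwi.const_mul _) (hGb j)
            _ = C * (K * I) * b ^ j * Real.sqrt j.factorial := by
                rw [integral_const_mul]; ring
            _ ≤ C * (K * I + 1) * b ^ n * Real.sqrt n.factorial := by
                have e1 : b ^ j ≤ b ^ n := pow_le_pow_right₀ hb1 hj'
                have e2 : Real.sqrt j.factorial ≤ Real.sqrt n.factorial :=
                  Real.sqrt_le_sqrt (by exact_mod_cast Nat.factorial_le hj')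
                gcongr
                linarith
      _ = (n + 1) * (C * (K * I + 1) * b ^ n * Real.sqrt n.factorial) := by simp
      _ ≤ _ := by
          have e4 : (n + 1 : ℝ) ≤ 2 ^ n := by
            have := one_add_mul_le_pow (show (-2 : ℝ) ≤ 1 by norm_num) n
            norm_num at this
            linarith
          gcongr
  rw [hηn, mul_pow, mul_assoc]
  calc _ ≤ (2 * Real.pi) ^ n * (2 ^ n * (2 ^ n *
        (C * (K * I + 1) * b ^ n * Real.sqrt n.factorial))) := by
        exact mul_le_mul_of_nonneg_left (h1.trans (mul_le_mul_of_nonneg_left h2 (by positivity)))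
          (by positivity)
    _ = C * (K * I + 1) * ((2 * Real.pi) ^ n * 2 ^ n * 2 ^ n * b ^ n) *
        Real.sqrt n.factorial := by ring
    _ = _ := by rw [← mul_pow, ← mul_pow, ← mul_pow, hb']; ring_nf

theorem integrable_gauss {r : ℝ} (hr : 0 < r) :
    Integrable (fun y : E ι => Real.exp (-r * ‖y‖ ^ 2)) volume := by
  have h := (GaussianFourier.integrable_cexp_neg_mul_sq_norm_add (V := E ι) (b := (r : ℂ))
    (by simpa using hr) 0 0).norm
  refine h.congr (ae_of_all _ fun y => ?_)
  simp [Complex.norm_exp, ← Complex.ofReal_pow]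

/-- `f` decays like a Gaussian about `0` and the atom about `x`. As `|x|² ≤ 2|y|² + 2|y - x|²`, the
product gains decay in `x` and half of the decay of `f` remains for integrability. -/
theorem exists_gTrans_decay_space {s h : ℝ} (hs : 0 < s) (hh : 0 < h) :
    ∃ r M : ℝ, 0 < r ∧ 0 < M ∧ ∀ f ∈ GS ι, ∀ C, GSBound h C f → ∀ x ξ,
      ‖gTrans s f x ξ‖ ≤ M * C * Real.exp (-r * ‖x‖ ^ 2) := by
  set q : ℝ := 1 / (4 * h ^ 2) with hq
  have hq0 : 0 < q := by positivity
  set r : ℝ := min (q / 2) s / 2 with hr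
  have hr0 : 0 < r := by positivity
  have hint := integrable_gauss (ι := ι) (by positivity : 0 < q / 2)
  set I : ℝ := ∫ y : E ι, Real.exp (-(q / 2) * ‖y‖ ^ 2) with hI
  have hI0 : 0 ≤ I := integral_nonneg fun _ => (Real.exp_pos _).le
  refine ⟨r, 2 * (I + 1), hr0, by positivity, fun f hf C hC x ξ => ?_⟩
  have hC0 := hC.nonneg
  unfold gTrans
  refine (norm_integral_le_of_norm_le (hint.const_mul (2 * C * Real.exp (-r * ‖x‖ ^ 2)))
    (ae_of_all _ fun y => ?_)).trans ?_
  · rw [norm_mul, norm_gAtom]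
    have h1 := hC.norm_le_gauss hh y
    rw [← hq] at h1
    have h2 : -q * ‖y‖ ^ 2 + -s * ‖y - x‖ ^ 2 ≤ -r * ‖x‖ ^ 2 + -(q / 2) * ‖y‖ ^ 2 := by
      have e1 : ‖x‖ ^ 2 ≤ 2 * ‖y‖ ^ 2 + 2 * ‖y - x‖ ^ 2 := by
        have : ‖x‖ ≤ ‖y‖ + ‖y - x‖ := by
          calc ‖x‖ = ‖y - (y - x)‖ := by rw [sub_sub_cancel]
            _ ≤ _ := norm_sub_le _ _
        nlinarith [norm_nonneg x, norm_nonneg y, norm_nonneg (y - x), sq_nonneg (‖y‖ - ‖y - x‖)]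
      have e2 : r * 2 ≤ q / 2 := by rw [hr]; linarith [min_le_left (q / 2) s]
      have e3 : r * 2 ≤ s := by rw [hr]; linarith [min_le_right (q / 2) s]
      have f1 := mul_le_mul_of_nonneg_left e1 hr0.le
      have f2 := mul_le_mul_of_nonneg_right e2 (sq_nonneg ‖y‖)
      have f3 := mul_le_mul_of_nonneg_right e3 (sq_nonneg ‖y - x‖)
      linarith
    calc _ ≤ 2 * C * Real.exp (-q * ‖y‖ ^ 2) * Real.exp (-s * ‖y - x‖ ^ 2) := by gcongr
      _ = 2 * C * Real.exp (-q * ‖y‖ ^ 2 + -s * ‖y - x‖ ^ 2) := by rw [Real.exp_add]; ring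
      _ ≤ 2 * C * Real.exp (-r * ‖x‖ ^ 2 + -(q / 2) * ‖y‖ ^ 2) := by gcongr
      _ = _ := by rw [Real.exp_add]; ring
  · rw [integral_const_mul, ← hI]
    calc _ = 2 * I * C * Real.exp (-r * ‖x‖ ^ 2) := by ring
      _ ≤ _ := by gcongr; linarith

/-- The Gaussian transform of Gelfand-Shilov functions has Gaussian decay. -/
theorem exists_gTrans_decay {s h : ℝ} (hs : 0 < s) (hh : 0 < h) :
    ∃ r M : ℝ, 0 < r ∧ 0 < M ∧ ∀ f ∈ GS ι, ∀ C, GSBound h C f → ∀ x ξ,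
      ‖gTrans s f x ξ‖ ≤ M * C * Real.exp (-r * (‖x‖ ^ 2 + ‖ξ‖ ^ 2)) := by
  obtain ⟨r₁, M₁, r₁0, M₁0, h₁⟩ := exists_gTrans_decay_freq (ι := ι) hs hh
  obtain ⟨r₂, M₂, r₂0, M₂0, h₂⟩ := exists_gTrans_decay_space (ι := ι) hs hh
  refine ⟨min r₁ r₂ / 2, max M₁ M₂, by positivity, by positivity, fun f hf C hC x ξ => ?_⟩
  have hC0 := hC.nonneg
  have e1 : min r₁ r₂ / 2 * 2 ≤ r₁ := by linarith [min_le_left r₁ r₂]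
  have e2 : min r₁ r₂ / 2 * 2 ≤ r₂ := by linarith [min_le_right r₁ r₂]
  have e0 : 0 ≤ min r₁ r₂ / 2 := by positivity
  have hx := sq_nonneg ‖x‖
  have hξ := sq_nonneg ‖ξ‖
  -- Each estimate decays in one variable only; the one for the larger variable gives half of its
  -- rate in both.
  rcases le_total (‖x‖ ^ 2) (‖ξ‖ ^ 2) with h | h
  · refine (h₁ f hf C hC x ξ).trans ?_
    gcongr ?_ * _ * Real.exp ?_
    · exact le_max_left _ _
    · nlinarith [mul_le_mul_of_nonneg_right e1 hξ]
  · refine (h₂ f hf C hC x ξ).trans ?_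
    gcongr ?_ * _ * Real.exp ?_
    · exact le_max_right _ _
    · nlinarith [mul_le_mul_of_nonneg_right e2 hx]

/-! ### Inversion formula -/

theorem pair_ofGS (f : GS ι) {G : E ι → ℂ} (hG : G ∈ GS ι) :
    pair (ofGS f) G = ∫ y, (f : E ι → ℂ) y * G y := pair_of_mem _ hG

theorem gTrans_eq_pair {s : ℝ} (hs : 0 < s) (f : GS ι) (x ξ : E ι) :
    gTrans s f x ξ = pair (ofGS f) (gAtom s x ξ) := (pair_ofGS f (gAtom_mem_GS hs x ξ)).symm

theorem continuous_gTrans {s : ℝ} (hs : 0 < s) (f : GS ι) :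
    Continuous fun w : E ι × E ι => gTrans s f w.1 w.2 := by
  simp_rw [gTrans_eq_pair hs]
  exact continuous_pair_gAtom _ hs

theorem continuous_gAtom (s : ℝ) (y : E ι) : Continuous fun w : E ι × E ι => gAtom s w.1 w.2 y := by
  unfold gAtom
  fun_prop

/-- The normalizing constant of the inversion formula. -/
def gConst (ι : Type) [Fintype ι] (s : ℝ) : ℝ :=
  ((2 * Real.pi) ^ Fintype.card ι)⁻¹ * ((Real.pi / (2 * s)) ^ ((Fintype.card ι : ℝ) / 2))⁻¹

/-- The squared Euclidean norm of `(x, ξ)`. -/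
def nsq (z : E ι × E ι) : ℝ := ‖z.1‖ ^ 2 + ‖z.2‖ ^ 2

theorem nsq_nonneg (z : E ι × E ι) : 0 ≤ nsq z := by unfold nsq; positivity

theorem continuous_nsq : Continuous (nsq : E ι × E ι → ℝ) := by unfold nsq; fun_prop

theorem integrable_exp_nsq {r : ℝ} (hr : 0 < r) :
    Integrable (fun z : E ι × E ι => Real.exp (-r * nsq z)) volume := by
  refine ((integrable_gauss hr).mul_prod (integrable_gauss hr)).congr (ae_of_all _ fun z => ?_)
  simp only [nsq, mul_add, Real.exp_add]

theorem exists_gTrans_decay_GS {s : ℝ} (hs : 0 < s) (f : GS ι) :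
    ∃ r M : ℝ, 0 < r ∧ 0 < M ∧ ∀ x ξ : E ι,
      ‖gTrans s f x ξ‖ ≤ M * Real.exp (-r * (‖x‖ ^ 2 + ‖ξ‖ ^ 2)) := by
  obtain ⟨h, C, h0, hC⟩ := f.2.2
  obtain ⟨r, M, r0, M0, hM⟩ := exists_gTrans_decay (ι := ι) hs h0
  refine ⟨r, M * (C + 1), r0, by have := hC.nonneg; positivity, fun x ξ => ?_⟩
  refine (hM f f.2 C hC x ξ).trans ?_
  gcongr
  linarith

-- Fourier inversion in the frequency alone, for `f · gAtom s x 0` with the centre fixed. The window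
-- occurs in the analysis and again in the synthesis, whence the exponent `2s`.
open scoped FourierTransform in
theorem integral_gTrans_mul_gAtom {s : ℝ} (hs : 0 < s) (f : GS ι) (x y : E ι) :
    ∫ ξ, gTrans s f x (-ξ) * gAtom s x ξ y =
      (((2 * Real.pi) ^ Fintype.card ι * Real.exp (-(2 * s) * ‖y - x‖ ^ 2) : ℝ) : ℂ) *
        (f : E ι → ℂ) y := by
  set G : E ι → ℂ := fun y => (f : E ι → ℂ) y * gAtom s x 0 y with hG
  have hpi : (0 : ℝ) < 2 * Real.pi := by positivity
  obtain ⟨r, M, r0, M0, hM⟩ := exists_gTrans_decay_GS hs f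
  have hFG : ∀ η, 𝓕 G η = gTrans s f x (-((2 * Real.pi) • η)) := fun η => by
    rw [gTrans_eq_fourier, smul_neg, smul_smul, inv_mul_cancel₀ hpi.ne', one_smul, neg_neg]
  have hGc : Continuous G := (gs_continuous f).mul (contDiff_gAtom s x 0 (n := 0)).continuous
  have hGi : Integrable G volume := by
    refine (gs_integrable f).norm.mono' hGc.aestronglyMeasurable (ae_of_all _ fun y => ?_)
    rw [norm_mul, norm_gAtom]
    refine mul_le_of_le_one_right (norm_nonneg _) (Real.exp_le_one_iff.2 ?_)
    have : 0 ≤ s * ‖y - x‖ ^ 2 := by positivity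
    linarith
  have hFi : Integrable (𝓕 G) volume := by
    have hq : 0 < r * (2 * Real.pi) ^ 2 := by positivity
    refine ((integrable_gauss hq).const_mul M).mono' ?_ (ae_of_all _ fun η => ?_)
    · have : 𝓕 G = fun η => gTrans s f x (-((2 * Real.pi) • η)) := funext hFG
      rw [this]
      exact ((continuous_gTrans hs f).comp (by fun_prop :
        Continuous fun η : E ι => (x, -((2 * Real.pi) • η)))).aestronglyMeasurable
    · rw [hFG]
      refine (hM _ _).trans (mul_le_mul_of_nonneg_left (Real.exp_le_exp.2 ?_) M0.le)
      rw [norm_neg, norm_smul, Real.norm_of_nonneg hpi.le, mul_pow]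
      have : 0 ≤ r * ‖x‖ ^ 2 := by positivity
      linarith
  have hinv : 𝓕⁻ (𝓕 G) y = G y := hGi.fourierInv_fourier_eq hFi hGc.continuousAt
  rw [Real.fourierInv_eq'] at hinv
  have hsub := Measure.integral_comp_smul_of_nonneg (μ := (volume : Measure (E ι)))
    (fun ξ => gTrans s f x (-ξ) * gAtom s x ξ y) (2 * Real.pi) (hR := hpi.le)
  have hcomp : ∀ η : E ι, gTrans s f x (-((2 * Real.pi) • η)) * gAtom s x ((2 * Real.pi) • η) y =
      (Complex.exp (((2 * Real.pi * inner ℝ η y : ℝ) : ℂ) * Complex.I) • 𝓕 G η) *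
        (Real.exp (-s * ‖y - x‖ ^ 2) : ℝ) := fun η => by
    rw [hFG, smul_eq_mul, gAtom, Complex.exp_add, real_inner_smul_left, Complex.ofReal_exp]
    ring_nf
  simp_rw [hcomp] at hsub
  rw [integral_mul_const, hinv, finrank_euclideanSpace, hG] at hsub
  have hpow : ((2 * Real.pi) ^ Fintype.card ι : ℝ) ≠ 0 := by positivity
  have h3 : ∫ ξ, gTrans s f x (-ξ) * gAtom s x ξ y = (((2 * Real.pi) ^ Fintype.card ι : ℝ) : ℂ) *
      (((f : E ι → ℂ) y * gAtom s x 0 y) * (Real.exp (-s * ‖y - x‖ ^ 2) : ℝ)) := by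
    rw [hsub, Complex.real_smul, ← mul_assoc, ← Complex.ofReal_mul, mul_inv_cancel₀ hpow,
      Complex.ofReal_one, one_mul]
  rw [h3, gAtom, inner_zero_left, Complex.ofReal_zero, mul_zero, add_zero, ← Complex.ofReal_exp]
  have h4 : Real.exp (-(2 * s) * ‖y - x‖ ^ 2) =
      Real.exp (-s * ‖y - x‖ ^ 2) * Real.exp (-s * ‖y - x‖ ^ 2) := by
    rw [← Real.exp_add]; ring_nf
  rw [h4]
  push_cast
  ring

theorem integral_gauss_sub {s : ℝ} (hs : 0 < s) (y : E ι) :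
    ∫ x, Real.exp (-(2 * s) * ‖y - x‖ ^ 2) =
      (Real.pi / (2 * s)) ^ ((Fintype.card ι : ℝ) / 2) := by
  have h := integral_sub_left_eq_self (fun x : E ι => Real.exp (-(2 * s) * ‖x‖ ^ 2)) volume y
  rw [h, GaussianFourier.integral_rexp_neg_mul_sq_norm (by positivity), finrank_euclideanSpace]

/-- The coefficients of a Gelfand-Shilov function as a superposition of modulated Gaussians. -/
def gCoeff (s : ℝ) (f : GS ι) (z : E ι × E ι) : ℂ := (gConst ι s : ℂ) * gTrans s f z.1 (-z.2)

theorem continuous_gCoeff {s : ℝ} (hs : 0 < s) (f : GS ι) : Continuous (gCoeff s f) :=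
  continuous_const.mul ((continuous_gTrans hs f).comp (by fun_prop :
    Continuous fun z : E ι × E ι => (z.1, -z.2)))

theorem gConst_pos {s : ℝ} (hs : 0 < s) : 0 < gConst ι s := by
  unfold gConst; positivity

theorem exists_gCoeff_decay {s h : ℝ} (hs : 0 < s) (h0 : 0 < h) :
    ∃ r M : ℝ, 0 < r ∧ 0 < M ∧ ∀ (f : GS ι) (C : ℝ), GSBound h C (f : E ι → ℂ) → ∀ z,
      ‖gCoeff s f z‖ ≤ M * C * Real.exp (-r * nsq z) := by
  obtain ⟨r, M, r0, M0, hM⟩ := exists_gTrans_decay (ι := ι) hs h0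
  refine ⟨r, gConst ι s * M, r0, mul_pos (gConst_pos hs) M0, fun f C hC z => ?_⟩
  rw [gCoeff, norm_mul, Complex.norm_real, Real.norm_of_nonneg (gConst_pos hs).le, mul_assoc,
    mul_assoc]
  refine mul_le_mul_of_nonneg_left ?_ (gConst_pos hs).le
  have := hM f f.2 C hC z.1 (-z.2)
  rwa [norm_neg, mul_assoc] at this

theorem integrable_gCoeff_mul_exp {s : ℝ} (hs : 0 < s) (f : GS ι) :
    ∃ ε : ℝ, 0 < ε ∧
      Integrable (fun z => ‖gCoeff s f z‖ * Real.exp (ε * (‖z.1‖ ^ 2 + ‖z.2‖ ^ 2))) volume := by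
  obtain ⟨h, C, h0, hC⟩ := f.2.2
  obtain ⟨r, M, r0, M0, hM⟩ := exists_gCoeff_decay (ι := ι) hs h0
  refine ⟨r / 2, by positivity, ?_⟩
  refine ((integrable_exp_nsq (by positivity : 0 < r / 2)).const_mul (M * C)).mono' ?_
    (ae_of_all _ fun z => ?_)
  · have := continuous_gCoeff hs f
    exact Continuous.aestronglyMeasurable (by fun_prop)
  · rw [norm_mul, norm_norm, Real.norm_of_nonneg (Real.exp_pos _).le]
    calc _ ≤ M * C * Real.exp (-r * nsq z) * Real.exp (r / 2 * nsq z) := by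
          refine mul_le_mul_of_nonneg_right (hM f C hC z) (Real.exp_pos _).le
      _ = _ := by rw [mul_assoc, ← Real.exp_add]; ring_nf

/-- The frequency integral returns `f(y)` times a Gaussian in `y - x`, the integral over centres is
then explicit, and `gConst` is the inverse of the product of the two constants. -/
theorem superpos_gCoeff {s : ℝ} (hs : 0 < s) (f : GS ι) :
    superpos s volume (gCoeff s f) Prod.fst Prod.snd = (f : E ι → ℂ) := by
  funext y
  obtain ⟨ε, ε0, hI⟩ := integrable_gCoeff_mul_exp hs f
  have hint : Integrable (fun z : E ι × E ι => gCoeff s f z * gAtom s z.1 z.2 y) volume := by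
    refine (integrable_of_mul_exp ε0 (continuous_gCoeff hs f).aestronglyMeasurable hI).norm.mono'
      ((continuous_gCoeff hs f).mul (continuous_gAtom s y)).aestronglyMeasurable
      (ae_of_all _ fun z => ?_)
    rw [norm_mul, norm_gAtom]
    refine mul_le_of_le_one_right (norm_nonneg _) (Real.exp_le_one_iff.2 ?_)
    have : 0 ≤ s * ‖y - z.1‖ ^ 2 := by positivity
    linarith
  unfold superpos
  rw [Measure.volume_eq_prod] at hint ⊢
  rw [integral_prod _ hint]
  simp only [gCoeff, mul_assoc]
  simp_rw [integral_const_mul, integral_gTrans_mul_gAtom hs f]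
  rw [integral_mul_const, integral_complex_ofReal, integral_const_mul, integral_gauss_sub hs]
  have h1 : gConst ι s * ((2 * Real.pi) ^ Fintype.card ι *
      (Real.pi / (2 * s)) ^ ((Fintype.card ι : ℝ) / 2)) = 1 := by
    unfold gConst
    have e1 : ((2 * Real.pi) ^ Fintype.card ι : ℝ) ≠ 0 := by positivity
    have e2 : ((Real.pi / (2 * s)) ^ ((Fintype.card ι : ℝ) / 2) : ℝ) ≠ 0 := by positivity
    field_simp
  rw [← mul_assoc, ← Complex.ofReal_mul, h1, Complex.ofReal_one, one_mul]

theorem pair_eq_integral_gCoeff {s : ℝ} (hs : 0 < s) (u : GSDual ι) (f : GS ι) :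
    pair u (f : E ι → ℂ) = ∫ z : E ι × E ι, gCoeff s f z * pair u (gAtom s z.1 z.2) := by
  obtain ⟨ε, ε0, hI⟩ := integrable_gCoeff_mul_exp hs f
  conv_lhs => rw [← superpos_gCoeff hs f]
  exact pair_superpos u hs ε0 measurable_fst measurable_snd
    (continuous_gCoeff hs f).aestronglyMeasurable hI

/-! ### Splitting phase space -/

@[simp] theorem left_join (x : E ι) (y : E κ) : left (join x y) = x := rfl

@[simp] theorem right_join (x : E ι) (y : E κ) : right (join x y) = y := rfl

@[simp] theorem join_left_right (X : E (ι ⊕ κ)) : join (left X) (right X) = X := by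
  ext i
  rcases i with i | i <;> rfl

theorem inner_join (x x' : E ι) (y y' : E κ) :
    inner ℝ (join x y) (join x' y') = (inner ℝ x x' + inner ℝ y y' : ℝ) := by
  simp [PiLp.inner_apply, join]

theorem inner_eq_left_right (X Y : E (ι ⊕ κ)) :
    inner ℝ X Y = (inner ℝ (left X) (left Y) + inner ℝ (right X) (right Y) : ℝ) := by
  rw [← inner_join, join_left_right, join_left_right]

theorem norm_sq_join (x : E ι) (y : E κ) : ‖join x y‖ ^ 2 = ‖x‖ ^ 2 + ‖y‖ ^ 2 := by
  rw [← real_inner_self_eq_norm_sq, inner_join, real_inner_self_eq_norm_sq,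
    real_inner_self_eq_norm_sq]

theorem norm_sq_eq_left_right (X : E (ι ⊕ κ)) : ‖X‖ ^ 2 = ‖left X‖ ^ 2 + ‖right X‖ ^ 2 := by
  rw [← norm_sq_join, join_left_right]

theorem join_add (x x' : E ι) (y y' : E κ) : join (x + x') (y + y') = join x y + join x' y' := by
  ext i
  rcases i with i | i <;> rfl

theorem join_smul (c : ℝ) (x : E ι) (y : E κ) : join (c • x) (c • y) = c • join x y := by
  ext i
  rcases i with i | i <;> rfl

theorem continuous_join : Continuous fun z : E ι × E κ => join z.1 z.2 := by
  unfold join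
  refine (PiLp.continuous_toLp 2 _).comp (continuous_pi fun i => ?_)
  rcases i with i | i
  · exact (PiLp.continuous_apply 2 _ i).comp continuous_fst
  · exact (PiLp.continuous_apply 2 _ i).comp continuous_snd

theorem continuous_left : Continuous (left : E (ι ⊕ κ) → E ι) :=
  (PiLp.continuous_toLp 2 _).comp (continuous_pi fun _ => PiLp.continuous_apply 2 _ _)

theorem continuous_right : Continuous (right : E (ι ⊕ κ) → E κ) :=
  (PiLp.continuous_toLp 2 _).comp (continuous_pi fun _ => PiLp.continuous_apply 2 _ _)

/-- The homeomorphism `(x, ξ) ↦ join x ξ`. -/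
def joinHomeo (ι κ : Type) [Fintype ι] [Fintype κ] : E ι × E κ ≃ₜ E (ι ⊕ κ) where
  toFun z := join z.1 z.2
  invFun X := (left X, right X)
  left_inv _ := rfl
  right_inv X := join_left_right X
  continuous_toFun := continuous_join
  continuous_invFun := continuous_left.prodMk continuous_right

theorem measurePreserving_join :
    MeasurePreserving (joinHomeo ι κ).toMeasurableEquiv volume volume := by
  have h1 : MeasurePreserving (fun z : E ι × E κ => (WithLp.ofLp z.1, WithLp.ofLp z.2))
      volume volume :=
    (PiLp.volume_preserving_ofLp ι).prod (PiLp.volume_preserving_ofLp κ)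
  have h2 := volume_measurePreserving_sumPiEquivProdPi_symm (fun _ : ι ⊕ κ => ℝ)
  have h3 := PiLp.volume_preserving_toLp (ι ⊕ κ)
  have h4 := h3.comp (h2.comp h1)
  convert! h4 using 1

/-! ### The short-time Fourier transform -/

/-- The normalizing constant of the short-time Fourier transform. -/
def stftConst (ι : Type) [Fintype ι] : ℝ :=
  (2 * Real.pi) ^ (-(Fintype.card ι : ℝ) / 2) * Real.pi ^ (-(Fintype.card ι : ℝ) / 4)

theorem stftConst_pos : 0 < stftConst ι := by unfold stftConst; positivity

/-- The window is normalized in `L²`, so the inversion constant for `s = 1/2` is the product of the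
constants of two short-time Fourier transforms. This makes the formula `pair_eq_integral_stft` free
of constants. -/
theorem stftConst_sq : stftConst ι * stftConst ι = gConst ι (1 / 2) := by
  unfold stftConst gConst
  have h1 : ((2 * Real.pi) ^ (-(Fintype.card ι : ℝ) / 2) : ℝ) *
      (2 * Real.pi) ^ (-(Fintype.card ι : ℝ) / 2) = ((2 * Real.pi) ^ Fintype.card ι)⁻¹ := by
    rw [← Real.rpow_add (by positivity), ← Real.rpow_natCast, ← Real.rpow_neg (by positivity)]
    ring_nf
  have h2 : (Real.pi ^ (-(Fintype.card ι : ℝ) / 4) : ℝ) * Real.pi ^ (-(Fintype.card ι : ℝ) / 4) =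
      ((Real.pi / (2 * (1 / 2))) ^ ((Fintype.card ι : ℝ) / 2))⁻¹ := by
    rw [← Real.rpow_add (by positivity), ← Real.rpow_neg (by positivity)]
    ring_nf
  rw [← h1, ← h2]
  ring

theorem stftAtom_eq (z : E ι × E ι) :
    stftAtom z = (stftConst ι : ℂ) • gAtom (1 / 2) z.1 (-z.2) := by
  funext y
  simp only [stftAtom, Pi.smul_apply, smul_eq_mul, gAtom, stftConst, inner_neg_left,
    real_inner_comm, Complex.exp_add]
  rw [← mul_assoc ((2 * Real.pi) ^ (-(Fintype.card ι : ℝ) / 2))]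
  push_cast
  rw [mul_assoc]
  congr 3
  · ring_nf
  · ring_nf

theorem stftAtom_mem (z : E ι × E ι) : stftAtom z ∈ GS ι := by
  rw [stftAtom_eq]
  exact (GS ι).smul_mem _ (gAtom_mem_GS (by norm_num) _ _)

theorem stft_eq (u : GSDual ι) (z : E ι × E ι) :
    stft u z = (stftConst ι : ℂ) * pair u (gAtom (1 / 2) z.1 (-z.2)) := by
  rw [stft, stftAtom_eq, pair_smul_right u _ (gAtom_mem_GS (by norm_num) _ _)]

theorem continuous_stft (u : GSDual ι) : Continuous (stft u) := by
  have : stft u = fun z => (stftConst ι : ℂ) * pair u (gAtom (1 / 2) z.1 (-z.2)) :=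
    funext (stft_eq u)
  rw [this]
  exact continuous_const.mul ((continuous_pair_gAtom u (by norm_num)).comp (by fun_prop :
    Continuous fun z : E ι × E ι => (z.1, -z.2)))

theorem exists_norm_stft_le (u : GSDual ι) {ε : ℝ} (hε : 0 < ε) :
    ∃ M : ℝ, 0 < M ∧ ∀ z, ‖stft u z‖ ≤ M * Real.exp (ε * nsq z) := by
  obtain ⟨M, M0, hM⟩ := exists_norm_pair_gAtom_le u (by norm_num : (0 : ℝ) < 1 / 2) hε
  refine ⟨stftConst ι * M, mul_pos stftConst_pos M0, fun z => ?_⟩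
  rw [stft_eq, norm_mul, Complex.norm_real, Real.norm_of_nonneg stftConst_pos.le, mul_assoc]
  refine mul_le_mul_of_nonneg_left ?_ stftConst_pos.le
  have := hM z.1 (-z.2)
  rwa [norm_neg] at this

theorem gCoeff_eq_stft (f : GS ι) (z : E ι × E ι) :
    gCoeff (1 / 2) f z = (stftConst ι : ℂ) * stft (ofGS f) z := by
  rw [stft_eq, gCoeff, ← stftConst_sq, gTrans_eq_pair (by norm_num)]
  push_cast
  ring

/-- The reflection `(x, ξ) ↦ (x, -ξ)`. -/
def flipFreq (z : E ι × E ι) : E ι × E ι := (z.1, -z.2)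

@[simp] theorem flipFreq_flipFreq (z : E ι × E ι) : flipFreq (flipFreq z) = z := by
  simp [flipFreq]

@[simp] theorem nsq_flipFreq (z : E ι × E ι) : nsq (flipFreq z) = nsq z := by
  simp [flipFreq, nsq]

theorem continuous_flipFreq : Continuous (flipFreq : E ι × E ι → E ι × E ι) := by
  unfold flipFreq; fun_prop

theorem measurePreserving_flipFreq :
    MeasurePreserving (flipFreq : E ι × E ι → E ι × E ι) volume volume :=
  (MeasurePreserving.id volume).prod (Measure.measurePreserving_neg volume)

/-- The reflection as a measurable equivalence. -/
def flipEquiv (ι : Type) [Fintype ι] : E ι × E ι ≃ᵐ E ι × E ι where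
  toFun := flipFreq
  invFun := flipFreq
  left_inv := flipFreq_flipFreq
  right_inv := flipFreq_flipFreq
  measurable_toFun := continuous_flipFreq.measurable
  measurable_invFun := continuous_flipFreq.measurable

theorem integral_flipFreq {F : E ι × E ι → ℂ} : ∫ z, F (flipFreq z) = ∫ z, F z :=
  measurePreserving_flipFreq.integral_comp (flipEquiv ι).measurableEmbedding F

theorem stft_flipFreq (u : GSDual ι) (z : E ι × E ι) :
    stft u (flipFreq z) = (stftConst ι : ℂ) * pair u (gAtom (1 / 2) z.1 z.2) := by
  rw [stft_eq]
  simp [flipFreq]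

/-- A distribution is determined by its short-time Fourier transform. -/
theorem pair_eq_integral_stft (u : GSDual ι) (f : GS ι) :
    pair u (f : E ι → ℂ) = ∫ z, stft u z * stft (ofGS f) (flipFreq z) := by
  rw [pair_eq_integral_gCoeff (by norm_num : (0 : ℝ) < 1 / 2) u f, ← integral_flipFreq]
  congr 1
  funext z
  rw [gCoeff_eq_stft, stft_eq u z]
  simp only [flipFreq]
  ring

theorem exists_stft_decay {h : ℝ} (h0 : 0 < h) :
    ∃ r M : ℝ, 0 < r ∧ 0 < M ∧ ∀ (f : GS ι) (C : ℝ), GSBound h C (f : E ι → ℂ) → ∀ z,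
      ‖stft (ofGS f) z‖ ≤ M * C * Real.exp (-r * nsq z) := by
  obtain ⟨r, M, r0, M0, hM⟩ := exists_gTrans_decay (ι := ι) (s := 1 / 2) (by norm_num) h0
  refine ⟨r, stftConst ι * M, r0, mul_pos stftConst_pos M0, fun f C hC z => ?_⟩
  rw [stft_eq, norm_mul, Complex.norm_real, Real.norm_of_nonneg stftConst_pos.le, mul_assoc,
    mul_assoc, ← gTrans_eq_pair (by norm_num)]
  refine mul_le_mul_of_nonneg_left ?_ stftConst_pos.le
  have := hM f f.2 C hC z.1 (-z.2)
  rwa [norm_neg, mul_assoc] at this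

theorem exists_stft_ofGS_decay (f : GS ι) :
    ∃ r M : ℝ, 0 < r ∧ 0 < M ∧ ∀ z, ‖stft (ofGS f) z‖ ≤ M * Real.exp (-r * nsq z) := by
  obtain ⟨h, C, h0, hC⟩ := f.2.2
  obtain ⟨r, M, r0, M0, hM⟩ := exists_stft_decay (ι := ι) h0
  refine ⟨r, M * (C + 1), r0, by have := hC.nonneg; positivity, fun z => ?_⟩
  refine (hM f C hC z).trans ?_
  gcongr
  linarith

theorem GSDual.ext_pair {u v : GSDual ι} (h : ∀ f : GS ι, pair u (f : E ι → ℂ) = pair v f) :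
    u = v := by
  refine Subtype.ext (LinearMap.ext fun f => ?_)
  rw [← pair_coe, ← pair_coe, h]

theorem GSDual.ext_stft {u v : GSDual ι} (h : stft u =ᵐ[volume] stft v) : u = v := by
  refine GSDual.ext_pair fun f => ?_
  rw [pair_eq_integral_stft, pair_eq_integral_stft]
  refine integral_congr_ae ?_
  filter_upwards [h] with z hz
  rw [hz]

theorem ofGS_add (f g : GS ι) : ofGS (f + g) = ofGS f + ofGS g := by
  refine Subtype.ext (LinearMap.ext fun k => ?_)
  change ∫ x, ((f : E ι → ℂ) x + (g : E ι → ℂ) x) * (k : E ι → ℂ) x =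
    (∫ x, (f : E ι → ℂ) x * (k : E ι → ℂ) x) + ∫ x, (g : E ι → ℂ) x * (k : E ι → ℂ) x
  rw [← integral_add (gs_integrable_mul f k) (gs_integrable_mul g k)]
  simp only [add_mul]

theorem ofGS_smul (c : ℂ) (f : GS ι) : ofGS (c • f) = c • ofGS f := by
  refine Subtype.ext (LinearMap.ext fun k => ?_)
  change ∫ x, (c * (f : E ι → ℂ) x) * (k : E ι → ℂ) x =
    c * ∫ x, (f : E ι → ℂ) x * (k : E ι → ℂ) x
  rw [← integral_const_mul]
  simp only [mul_assoc]

theorem stft_add (u v : GSDual ι) : stft (u + v) = stft u + stft v :=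
  funext fun _ => pair_add u v _

theorem stft_smul (c : ℂ) (u : GSDual ι) : stft (c • u) = c • stft u :=
  funext fun _ => pair_smul c u _

/-! ### Distributions defined by functions on phase space -/

theorem integrable_mul_stft_ofGS {U : E ι × E ι → ℂ} (hUm : AEStronglyMeasurable U volume)
    (hU : ∀ ε : ℝ, 0 < ε → Integrable (fun z => ‖U z‖ * Real.exp (-ε * nsq z)) volume)
    (f : GS ι) : Integrable (fun z => U z * stft (ofGS f) (flipFreq z)) volume := by
  obtain ⟨r, M, r0, M0, hM⟩ := exists_stft_ofGS_decay f
  refine ((hU r r0).const_mul M).mono'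
    (hUm.mul ((continuous_stft _).comp continuous_flipFreq).aestronglyMeasurable)
    (ae_of_all _ fun z => ?_)
  rw [norm_mul]
  have := hM (flipFreq z)
  rw [nsq_flipFreq] at this
  calc _ ≤ ‖U z‖ * (M * Real.exp (-r * nsq z)) := by gcongr
    _ = _ := by ring

/-- The distribution `f ↦ ∫ U(z) V_φ f(x, -ξ) dz` for `U` of subgaussian growth. -/
def mkDual (U : E ι × E ι → ℂ) (hUm : AEStronglyMeasurable U volume)
    (hU : ∀ ε : ℝ, 0 < ε → Integrable (fun z => ‖U z‖ * Real.exp (-ε * nsq z)) volume) :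
    GSDual ι :=
  ⟨{ toFun := fun f => ∫ z, U z * stft (ofGS f) (flipFreq z)
     map_add' := fun f g => by
      rw [← integral_add (integrable_mul_stft_ofGS hUm hU f) (integrable_mul_stft_ofGS hUm hU g)]
      simp only [ofGS_add, stft_add, Pi.add_apply, mul_add]
     map_smul' := fun c f => by
      rw [RingHom.id_apply, smul_eq_mul, ← integral_const_mul]
      simp only [ofGS_smul, stft_smul, Pi.smul_apply, smul_eq_mul]
      congr 1
      funext z
      ring },
   fun h h0 => by
    obtain ⟨r, M, r0, M0, hM⟩ := exists_stft_decay (ι := ι) h0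
    refine ⟨M * ∫ z, ‖U z‖ * Real.exp (-r * nsq z), fun f C hC => ?_⟩
    refine (norm_integral_le_of_norm_le ((hU r r0).const_mul (M * C))
      (ae_of_all _ fun z => ?_)).trans (le_of_eq ?_)
    · rw [norm_mul]
      have := hM f C hC (flipFreq z)
      rw [nsq_flipFreq] at this
      calc _ ≤ ‖U z‖ * (M * C * Real.exp (-r * nsq z)) := by gcongr
        _ = _ := by ring
    · rw [integral_const_mul]
      ring⟩

theorem pair_mkDual {U : E ι × E ι → ℂ} (hUm : AEStronglyMeasurable U volume)
    (hU : ∀ ε : ℝ, 0 < ε → Integrable (fun z => ‖U z‖ * Real.exp (-ε * nsq z)) volume) (f : GS ι) :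
    pair (mkDual U hUm hU) (f : E ι → ℂ) = ∫ z, U z * stft (ofGS f) (flipFreq z) :=
  pair_coe _ f

/-! ### The Weyl test function of two Gaussian atoms -/

/-- The constant in `weylTest_gAtom`. -/
def weylConst (ι : Type) [Fintype ι] : ℂ :=
  (((2 * Real.pi) ^ (-(Fintype.card ι : ℝ)) : ℝ) : ℂ) *
    ((Real.pi : ℂ) / (1 / 4 : ℂ)) ^ ((Fintype.card ι : ℂ) / 2)

/-- The phase in `weylTest_gAtom`. -/
def weylPhase (x ξ y η : E ι) : ℂ := Complex.exp (Complex.I * ((inner ℝ (y - x) (η - ξ) / 2 : ℝ) : ℂ))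

theorem norm_weylPhase (x ξ y η : E ι) : ‖weylPhase x ξ y η‖ = 1 := by
  rw [weylPhase, mul_comm, Complex.norm_exp_ofReal_mul_I]

/-- The position of the atom in `weylTest_gAtom`. -/
def weylCenter (x ξ y η : E ι) : E (ι ⊕ ι) := join ((1 / 2 : ℝ) • (x + y)) ((1 / 2 : ℝ) • (ξ - η))

/-- The frequency of the atom in `weylTest_gAtom`. -/
def weylFreq (x ξ y η : E ι) : E (ι ⊕ ι) := join (ξ + η) (y - x)

/-- Shifting the integration variable by `y - x` completes the square: the quadratic terms in `s`
and `u` decouple, and the linear terms in `s` collect into the single frequency `v - (ξ - η)/2`. -/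
theorem weyl_integrand_gAtom (x ξ y η u v s : E ι) :
    gAtom (1 / 2) x ξ (u - (1 / 2 : ℝ) • (s + (y - x))) *
      gAtom (1 / 2) y η (u + (1 / 2 : ℝ) • (s + (y - x))) *
      Complex.exp (Complex.I * ((inner ℝ (s + (y - x)) v : ℝ) : ℂ)) =
    weylPhase x ξ y η *
      Complex.exp (((-1 * ‖u - (1 / 2 : ℝ) • (x + y)‖ ^ 2 : ℝ) : ℂ) +
        Complex.I * ((inner ℝ (ξ + η) u + inner ℝ (y - x) v : ℝ) : ℂ)) *
      Complex.exp (-(1 / 4 : ℂ) * (‖s‖ : ℂ) ^ 2 +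
        Complex.I * ((inner ℝ (v - (1 / 2 : ℝ) • (ξ - η)) s : ℝ) : ℂ)) := by
  simp only [gAtom, weylPhase, ← Complex.exp_add]
  congr 1
  have key : ∀ a b c d : ℝ, a = c → b = d → (a : ℂ) + Complex.I * b = c + Complex.I * d := by
    rintro a b c d rfl rfl; rfl
  have h1 : (-(1 / 2) * ‖u - (1 / 2 : ℝ) • (s + (y - x)) - x‖ ^ 2 +
      -(1 / 2) * ‖u + (1 / 2 : ℝ) • (s + (y - x)) - y‖ ^ 2 : ℝ) =
      -1 * ‖u - (1 / 2 : ℝ) • (x + y)‖ ^ 2 + -(1 / 4) * ‖s‖ ^ 2 := by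
    simp only [← real_inner_self_eq_norm_sq, inner_add_left, inner_add_right, inner_sub_left,
      inner_sub_right, real_inner_smul_left, real_inner_smul_right]
    rw [real_inner_comm x u, real_inner_comm y u, real_inner_comm s u, real_inner_comm s x,
      real_inner_comm s y, real_inner_comm x y]
    ring
  have h2 : (inner ℝ ξ (u - (1 / 2 : ℝ) • (s + (y - x))) +
      inner ℝ η (u + (1 / 2 : ℝ) • (s + (y - x))) + inner ℝ (s + (y - x)) v : ℝ) =
      inner ℝ (y - x) (η - ξ) / 2 + (inner ℝ (ξ + η) u + inner ℝ (y - x) v) +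
        inner ℝ (v - (1 / 2 : ℝ) • (ξ - η)) s := by
    simp only [inner_add_left, inner_add_right, inner_sub_left,
      inner_sub_right, real_inner_smul_left, real_inner_smul_right]
    rw [real_inner_comm v s, real_inner_comm y η, real_inner_comm x η, real_inner_comm y ξ,
      real_inner_comm x ξ]
    ring
  have := key _ _ _ _ h1 h2
  push_cast at this ⊢
  linear_combination this

/-- The remaining integral is the Fourier transform of `e^{-|s|²/4}` at `v - (ξ - η)/2`, that is, a
multiple of `e^{-|v - (ξ-η)/2|²}`. It has the same rate `1` as the Gaussian in the position, which
is why the result is an atom on phase space, with the Gaussian of the window `Φ`. -/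
theorem weylTest_gAtom (x ξ y η : E ι) :
    weylTest (gAtom (1 / 2) x ξ) (gAtom (1 / 2) y η) =
      (weylConst ι * weylPhase x ξ y η) • gAtom 1 (weylCenter x ξ y η) (weylFreq x ξ y η) := by
  funext X
  rw [weylTest, ← integral_add_right_eq_self _ (y - x)]
  simp_rw [weyl_integrand_gAtom x ξ y η (left X) (right X), integral_const_mul]
  have h := GaussianFourier.integral_cexp_neg_mul_sq_norm_add_of_euclideanSpace
    (b := 1 / 4) (by norm_num) Complex.I (right X - (1 / 2 : ℝ) • (ξ - η))
  rw [h, Pi.smul_apply, smul_eq_mul, weylConst, gAtom]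
  have h3 : ‖X - weylCenter x ξ y η‖ ^ 2 = ‖left X - (1 / 2 : ℝ) • (x + y)‖ ^ 2 +
      ‖right X - (1 / 2 : ℝ) • (ξ - η)‖ ^ 2 := by
    rw [norm_sq_eq_left_right]; rfl
  have h4 : inner ℝ (weylFreq x ξ y η) X =
      (inner ℝ (ξ + η) (left X) + inner ℝ (y - x) (right X) : ℝ) := by
    rw [inner_eq_left_right]; rfl
  rw [h3, h4]
  have h5 : Complex.exp (((-1 * (‖left X - (1 / 2 : ℝ) • (x + y)‖ ^ 2 +
      ‖right X - (1 / 2 : ℝ) • (ξ - η)‖ ^ 2) : ℝ) : ℂ) +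
        Complex.I * ((inner ℝ (ξ + η) (left X) + inner ℝ (y - x) (right X) : ℝ) : ℂ)) =
      Complex.exp (((-1 * ‖left X - (1 / 2 : ℝ) • (x + y)‖ ^ 2 : ℝ) : ℂ) +
        Complex.I * ((inner ℝ (ξ + η) (left X) + inner ℝ (y - x) (right X) : ℝ) : ℂ)) *
      Complex.exp (Complex.I ^ 2 * (‖right X - (1 / 2 : ℝ) • (ξ - η)‖ : ℂ) ^ 2 / (4 * (1 / 4))) := by
    rw [← Complex.exp_add]
    congr 1
    rw [Complex.I_sq]
    push_cast
    ring
  rw [h5]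
  ring

theorem norm_sq_weylCenter_add_le (x ξ y η : E ι) :
    ‖weylCenter x ξ y η‖ ^ 2 + ‖weylFreq x ξ y η‖ ^ 2 ≤
      3 * ((‖x‖ ^ 2 + ‖ξ‖ ^ 2) + (‖y‖ ^ 2 + ‖η‖ ^ 2)) := by
  rw [weylCenter, weylFreq, norm_sq_join, norm_sq_join, norm_smul, norm_smul]
  have e1 := parallelogram_law_with_norm ℝ x y
  have e2 := parallelogram_law_with_norm ℝ ξ η
  have e3 := norm_sub_rev x y
  norm_num
  rw [e3] at e1
  nlinarith [sq_nonneg ‖x + y‖, sq_nonneg ‖ξ - η‖, sq_nonneg ‖y - x‖, sq_nonneg ‖ξ + η‖]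

theorem continuous_weylCenter :
    Continuous fun w : (E ι × E ι) × (E ι × E ι) => weylCenter w.1.1 w.1.2 w.2.1 w.2.2 :=
  continuous_join.comp (by fun_prop : Continuous fun w : (E ι × E ι) × (E ι × E ι) =>
    ((1 / 2 : ℝ) • (w.1.1 + w.2.1), (1 / 2 : ℝ) • (w.1.2 - w.2.2)))

theorem continuous_weylFreq :
    Continuous fun w : (E ι × E ι) × (E ι × E ι) => weylFreq w.1.1 w.1.2 w.2.1 w.2.2 :=
  continuous_join.comp (by fun_prop : Continuous fun w : (E ι × E ι) × (E ι × E ι) =>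
    (w.1.2 + w.2.2, w.2.1 - w.1.1))

theorem continuous_weylPhase :
    Continuous fun w : (E ι × E ι) × (E ι × E ι) => weylPhase w.1.1 w.1.2 w.2.1 w.2.2 := by
  unfold weylPhase; fun_prop

/-! ### Weyl test functions of superpositions -/

section Superposition

variable {P Q : Type} [MeasurableSpace P] [MeasurableSpace Q] {μ : Measure P} {ν : Measure Q}
  [SFinite μ] [SFinite ν] {A : P → ℂ} {B : Q → ℂ} {x ξ : P → E ι} {y η : Q → E ι} {ε : ℝ}

/-- For fixed parameters the first atom is a Gaussian in `s` whose integral does not depend on its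
centre, and the second atom is bounded by `1`. So the integral over `s` is at most a constant times
`‖A‖ ‖B‖`, which is integrable. -/
theorem integrable_weyl_integrand (hx : Measurable x) (hξ : Measurable ξ) (hy : Measurable y)
    (hη : Measurable η) (hA : Integrable A μ) (hB : Integrable B ν) (X : E (ι ⊕ ι)) :
    Integrable (fun w : E ι × (P × Q) =>
      (A w.2.1 * gAtom (1 / 2) (x w.2.1) (ξ w.2.1) (left X - (1 / 2 : ℝ) • w.1)) *
      (B w.2.2 * gAtom (1 / 2) (y w.2.2) (η w.2.2) (left X + (1 / 2 : ℝ) • w.1)) *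
      Complex.exp (Complex.I * ((inner ℝ w.1 (right X) : ℝ) : ℂ)))
      (volume.prod (μ.prod ν)) := by
  have hAB : Integrable (fun w : P × Q => A w.1 * B w.2) (μ.prod ν) := hA.mul_prod hB
  have hcont : Continuous fun w : E ι × ((E ι × E ι) × (E ι × E ι)) =>
      gAtom (1 / 2) w.2.1.1 w.2.1.2 (left X - (1 / 2 : ℝ) • w.1) *
      gAtom (1 / 2) w.2.2.1 w.2.2.2 (left X + (1 / 2 : ℝ) • w.1) *
      Complex.exp (Complex.I * ((inner ℝ w.1 (right X) : ℝ) : ℂ)) := by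
    unfold gAtom; fun_prop
  have hm : Measurable fun w : E ι × (P × Q) =>
      (w.1, ((x w.2.1, ξ w.2.1), (y w.2.2, η w.2.2))) := by fun_prop
  have hmeas : AEStronglyMeasurable (fun w : E ι × (P × Q) =>
      (A w.2.1 * gAtom (1 / 2) (x w.2.1) (ξ w.2.1) (left X - (1 / 2 : ℝ) • w.1)) *
      (B w.2.2 * gAtom (1 / 2) (y w.2.2) (η w.2.2) (left X + (1 / 2 : ℝ) • w.1)) *
      Complex.exp (Complex.I * ((inner ℝ w.1 (right X) : ℝ) : ℂ)))
      (volume.prod (μ.prod ν)) := by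
    refine ((hAB.aestronglyMeasurable.comp_snd (μ := (volume : Measure (E ι)))).mul
      (hcont.measurable.comp hm).aestronglyMeasurable).congr (ae_of_all _ fun w => ?_)
    simp only [Function.comp, Pi.mul_apply]
    ring
  have hnorm : ∀ (s : E ι) (r : P × Q), ‖(A r.1 * gAtom (1 / 2) (x r.1) (ξ r.1)
        (left X - (1 / 2 : ℝ) • s)) *
      (B r.2 * gAtom (1 / 2) (y r.2) (η r.2) (left X + (1 / 2 : ℝ) • s)) *
      Complex.exp (Complex.I * ((inner ℝ s (right X) : ℝ) : ℂ))‖ ≤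
      ‖A r.1 * B r.2‖ * Real.exp (-(1 / 8) * ‖s - (2 : ℝ) • (left X - x r.1)‖ ^ 2) := by
    intro s r
    rw [mul_comm Complex.I]
    simp only [norm_mul, norm_gAtom, Complex.norm_exp_ofReal_mul_I, mul_one]
    have h1 : (‖left X - (1 / 2 : ℝ) • s - x r.1‖) = (1 / 2) * ‖s - (2 : ℝ) • (left X - x r.1)‖ := by
      rw [show left X - (1 / 2 : ℝ) • s - x r.1 =
        (-(1 / 2) : ℝ) • (s - (2 : ℝ) • (left X - x r.1)) by module, norm_smul]
      norm_num
    rw [h1]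
    have h2 : Real.exp (-(1 / 2) * ‖left X + (1 / 2 : ℝ) • s - y r.2‖ ^ 2) ≤ 1 :=
      Real.exp_le_one_iff.2 (by nlinarith [sq_nonneg ‖left X + (1 / 2 : ℝ) • s - y r.2‖])
    have h3 : -(1 / 2) * ((1 / 2) * ‖s - (2 : ℝ) • (left X - x r.1)‖) ^ 2 =
      -(1 / 8) * ‖s - (2 : ℝ) • (left X - x r.1)‖ ^ 2 := by ring
    rw [h3]
    calc _ = ‖A r.1‖ * ‖B r.2‖ * Real.exp (-(1 / 8) * ‖s - (2 : ℝ) • (left X - x r.1)‖ ^ 2) *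
          Real.exp (-(1 / 2) * ‖left X + (1 / 2 : ℝ) • s - y r.2‖ ^ 2) := by ring
      _ ≤ _ := mul_le_of_le_one_right (by positivity) h2
  have hg : Integrable (fun s : E ι => Real.exp (-(1 / 8) * ‖s‖ ^ 2)) volume :=
    integrable_gauss (by norm_num)
  have hgt : ∀ r : P × Q, Integrable (fun s : E ι => ‖A r.1 * B r.2‖ *
      Real.exp (-(1 / 8) * ‖s - (2 : ℝ) • (left X - x r.1)‖ ^ 2)) volume := fun r =>
    (hg.comp_sub_right ((2 : ℝ) • (left X - x r.1))).const_mul _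
  refine (integrable_prod_iff' hmeas).2 ⟨?_, ?_⟩
  · filter_upwards [hmeas.prod_swap.prodMk_left] with r hr
    exact (hgt r).mono' hr (ae_of_all _ fun s => hnorm s r)
  · refine (hAB.norm.mul_const (∫ s : E ι, Real.exp (-(1 / 8) * ‖s‖ ^ 2))).mono'
      hmeas.norm.prod_swap.integral_prod_right' (ae_of_all _ fun r => ?_)
    rw [Real.norm_of_nonneg (integral_nonneg fun _ => norm_nonneg _)]
    refine (integral_mono_of_nonneg (ae_of_all _ fun _ => norm_nonneg _) (hgt r)
      (ae_of_all _ fun s => hnorm s r)).trans (le_of_eq ?_)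
    rw [integral_const_mul]
    congr 1
    exact integral_sub_right_eq_self (fun s : E ι => Real.exp (-(1 / 8) * ‖s‖ ^ 2)) _

/-- The Weyl test function of two superpositions of atoms is a superposition of atoms. -/
theorem weylTest_superpos (hx : Measurable x) (hξ : Measurable ξ) (hy : Measurable y)
    (hη : Measurable η) (hA : Integrable A μ) (hB : Integrable B ν) :
    weylTest (superpos (1 / 2) μ A x ξ) (superpos (1 / 2) ν B y η) =
      superpos 1 (μ.prod ν) (fun w => A w.1 * B w.2 *
          (weylConst ι * weylPhase (x w.1) (ξ w.1) (y w.2) (η w.2)))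
        (fun w => weylCenter (x w.1) (ξ w.1) (y w.2) (η w.2))
        (fun w => weylFreq (x w.1) (ξ w.1) (y w.2) (η w.2)) := by
  funext X
  have hF := integrable_weyl_integrand hx hξ hy hη hA hB X
  have h1 : ∀ s : E ι, superpos (1 / 2) μ A x ξ (left X - (1 / 2 : ℝ) • s) *
      superpos (1 / 2) ν B y η (left X + (1 / 2 : ℝ) • s) *
      Complex.exp (Complex.I * ((inner ℝ s (right X) : ℝ) : ℂ)) =
      ∫ r, (A r.1 * gAtom (1 / 2) (x r.1) (ξ r.1) (left X - (1 / 2 : ℝ) • s)) *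
      (B r.2 * gAtom (1 / 2) (y r.2) (η r.2) (left X + (1 / 2 : ℝ) • s)) *
      Complex.exp (Complex.I * ((inner ℝ s (right X) : ℝ) : ℂ)) ∂(μ.prod ν) := by
    intro s
    rw [integral_mul_const, superpos, superpos, integral_prod_mul
      (fun p => A p * gAtom (1 / 2) (x p) (ξ p) (left X - (1 / 2 : ℝ) • s))
      (fun q => B q * gAtom (1 / 2) (y q) (η q) (left X + (1 / 2 : ℝ) • s))]
  rw [weylTest]
  simp_rw [h1]
  rw [integral_integral_swap hF, superpos, ← integral_const_mul]
  congr 1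
  funext r
  have h2 := congrFun (weylTest_gAtom (x r.1) (ξ r.1) (y r.2) (η r.2)) X
  rw [weylTest, Pi.smul_apply, smul_eq_mul] at h2
  rw [mul_assoc (A r.1 * B r.2), ← h2]
  have h3 : ∀ s : E ι, (A r.1 * gAtom (1 / 2) (x r.1) (ξ r.1) (left X - (1 / 2 : ℝ) • s)) *
      (B r.2 * gAtom (1 / 2) (y r.2) (η r.2) (left X + (1 / 2 : ℝ) • s)) *
      Complex.exp (Complex.I * ((inner ℝ s (right X) : ℝ) : ℂ)) =
      (A r.1 * B r.2) * (gAtom (1 / 2) (x r.1) (ξ r.1) (left X - (1 / 2 : ℝ) • s) *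
      gAtom (1 / 2) (y r.2) (η r.2) (left X + (1 / 2 : ℝ) • s) *
      Complex.exp (Complex.I * ((inner ℝ s (right X) : ℝ) : ℂ))) := fun s => by ring
  simp_rw [h3, integral_const_mul]
  ring

theorem measurable_weylCenter_comp (hx : Measurable x) (hξ : Measurable ξ) (hy : Measurable y)
    (hη : Measurable η) :
    Measurable fun w : P × Q => weylCenter (x w.1) (ξ w.1) (y w.2) (η w.2) :=
  continuous_weylCenter.measurable.comp (f := fun w : P × Q => ((x w.1, ξ w.1), (y w.2, η w.2)))
    (by fun_prop)

theorem measurable_weylFreq_comp (hx : Measurable x) (hξ : Measurable ξ) (hy : Measurable y)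
    (hη : Measurable η) :
    Measurable fun w : P × Q => weylFreq (x w.1) (ξ w.1) (y w.2) (η w.2) :=
  continuous_weylFreq.measurable.comp (f := fun w : P × Q => ((x w.1, ξ w.1), (y w.2, η w.2)))
    (by fun_prop)

theorem measurable_weylPhase_comp (hx : Measurable x) (hξ : Measurable ξ) (hy : Measurable y)
    (hη : Measurable η) :
    Measurable fun w : P × Q => weylPhase (x w.1) (ξ w.1) (y w.2) (η w.2) :=
  continuous_weylPhase.measurable.comp (f := fun w : P × Q => ((x w.1, ξ w.1), (y w.2, η w.2)))
    (by fun_prop)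

theorem aestronglyMeasurable_weyl_coeff (hx : Measurable x) (hξ : Measurable ξ)
    (hy : Measurable y) (hη : Measurable η) (hA : Integrable A μ) (hB : Integrable B ν) :
    AEStronglyMeasurable (fun w : P × Q => A w.1 * B w.2 *
      (weylConst ι * weylPhase (x w.1) (ξ w.1) (y w.2) (η w.2))) (μ.prod ν) :=
  (hA.mul_prod hB).aestronglyMeasurable.mul
    ((measurable_weylPhase_comp hx hξ hy hη).const_mul _).aestronglyMeasurable

theorem integrable_weyl_coeff_mul_exp (hε : 0 < ε) (hx : Measurable x)
    (hξ : Measurable ξ) (hy : Measurable y) (hη : Measurable η)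
    (hA : AEStronglyMeasurable A μ) (hB : AEStronglyMeasurable B ν)
    (hIA : Integrable (fun p => ‖A p‖ * Real.exp (ε * (‖x p‖ ^ 2 + ‖ξ p‖ ^ 2))) μ)
    (hIB : Integrable (fun p => ‖B p‖ * Real.exp (ε * (‖y p‖ ^ 2 + ‖η p‖ ^ 2))) ν) :
    Integrable (fun w : P × Q => ‖A w.1 * B w.2 *
      (weylConst ι * weylPhase (x w.1) (ξ w.1) (y w.2) (η w.2))‖ *
      Real.exp (ε / 3 * (‖weylCenter (x w.1) (ξ w.1) (y w.2) (η w.2)‖ ^ 2 +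
        ‖weylFreq (x w.1) (ξ w.1) (y w.2) (η w.2)‖ ^ 2))) (μ.prod ν) := by
  have hAi := integrable_of_mul_exp hε hA hIA
  have hBi := integrable_of_mul_exp hε hB hIB
  refine ((hIA.mul_prod hIB).const_mul ‖weylConst ι‖).mono' ?_ (ae_of_all _ fun w => ?_)
  · exact (aestronglyMeasurable_weyl_coeff hx hξ hy hη hAi hBi).norm.mul
      ((((measurable_weylCenter_comp hx hξ hy hη).norm.pow_const 2).add
        ((measurable_weylFreq_comp hx hξ hy hη).norm.pow_const 2)).const_mul
          (ε / 3)).exp.aestronglyMeasurable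
  · rw [norm_mul, norm_norm, Real.norm_of_nonneg (Real.exp_pos _).le]
    have h := norm_sq_weylCenter_add_le (x w.1) (ξ w.1) (y w.2) (η w.2)
    have h2 : ε / 3 * (‖weylCenter (x w.1) (ξ w.1) (y w.2) (η w.2)‖ ^ 2 +
        ‖weylFreq (x w.1) (ξ w.1) (y w.2) (η w.2)‖ ^ 2) ≤
        ε * (‖x w.1‖ ^ 2 + ‖ξ w.1‖ ^ 2) + ε * (‖y w.2‖ ^ 2 + ‖η w.2‖ ^ 2) := by
      refine (mul_le_mul_of_nonneg_left h (by positivity)).trans (le_of_eq ?_)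
      ring
    have h3 : ‖A w.1 * B w.2 * (weylConst ι * weylPhase (x w.1) (ξ w.1) (y w.2) (η w.2))‖ =
        ‖weylConst ι‖ * (‖A w.1‖ * ‖B w.2‖) := by
      rw [norm_mul, norm_mul, norm_mul, norm_weylPhase]; ring
    rw [h3]
    refine (mul_le_mul_of_nonneg_left (Real.exp_le_exp.2 h2) (by positivity)).trans (le_of_eq ?_)
    rw [Real.exp_add]
    ring

/-- Evaluating a symbol on the Weyl test function of two superpositions of atoms. -/
theorem pair_weylTest_superpos (a : GSDual (ι ⊕ ι)) (hε : 0 < ε) (hx : Measurable x)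
    (hξ : Measurable ξ) (hy : Measurable y) (hη : Measurable η)
    (hA : AEStronglyMeasurable A μ) (hB : AEStronglyMeasurable B ν)
    (hIA : Integrable (fun p => ‖A p‖ * Real.exp (ε * (‖x p‖ ^ 2 + ‖ξ p‖ ^ 2))) μ)
    (hIB : Integrable (fun p => ‖B p‖ * Real.exp (ε * (‖y p‖ ^ 2 + ‖η p‖ ^ 2))) ν) :
    pair a (weylTest (superpos (1 / 2) μ A x ξ) (superpos (1 / 2) ν B y η)) =
      ∫ w, A w.1 * B w.2 * pair a (weylTest (gAtom (1 / 2) (x w.1) (ξ w.1))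
        (gAtom (1 / 2) (y w.2) (η w.2))) ∂(μ.prod ν) := by
  have hAi := integrable_of_mul_exp hε hA hIA
  have hBi := integrable_of_mul_exp hε hB hIB
  rw [weylTest_superpos hx hξ hy hη hAi hBi]
  refine (pair_superpos a one_pos (by positivity : 0 < ε / 3)
    (measurable_weylCenter_comp hx hξ hy hη) (measurable_weylFreq_comp hx hξ hy hη)
    (aestronglyMeasurable_weyl_coeff hx hξ hy hη hAi hBi)
    (integrable_weyl_coeff_mul_exp hε hx hξ hy hη hA hB hIA hIB)).trans ?_
  congr 1
  funext w
  rw [weylTest_gAtom, pair_smul_right a _ (gAtom_mem_GS one_pos _ _)]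
  ring

end Superposition

/-! ### The symplectic atoms -/

/-- The normalizing constant of the symplectic short-time Fourier transform. -/
def symplConst (ι : Type) [Fintype ι] : ℝ :=
  Real.pi ^ (-(Fintype.card ι : ℝ)) * (2 / Real.pi) ^ ((Fintype.card ι : ℝ) / 2)

theorem symplConst_pos : 0 < symplConst ι := by unfold symplConst; positivity

/-- The frequency of the atom `U ↦ e^{2iσ(Y, U)}`. -/
def symplFreq (Y : E (ι ⊕ ι)) : E (ι ⊕ ι) := join ((2 : ℝ) • right Y) (-(2 : ℝ) • left Y)

theorem continuous_symplFreq : Continuous (symplFreq : E (ι ⊕ ι) → E (ι ⊕ ι)) :=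
  continuous_join.comp ((continuous_right.const_smul (2 : ℝ)).prodMk
    (continuous_left.const_smul (-(2 : ℝ))))

theorem norm_sq_symplFreq (Y : E (ι ⊕ ι)) : ‖symplFreq Y‖ ^ 2 = 4 * ‖Y‖ ^ 2 := by
  rw [symplFreq, norm_sq_join, norm_sq_eq_left_right Y, norm_smul, norm_smul]
  norm_num
  ring

theorem inner_symplFreq (Y U : E (ι ⊕ ι)) : inner ℝ (symplFreq Y) U = 2 * sympl Y U := by
  rw [inner_eq_left_right]
  simp only [symplFreq, left_join, right_join, sympl, real_inner_smul_left]
  rw [real_inner_comm (left U) (right Y)]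
  ring

theorem symplAtom_eq (Z : E (ι ⊕ ι) × E (ι ⊕ ι)) :
    symplAtom Z = (symplConst ι : ℂ) • gAtom 1 Z.1 (symplFreq Z.2) := by
  funext U
  simp only [symplAtom, Pi.smul_apply, smul_eq_mul, gAtom, symplConst, inner_symplFreq,
    Complex.exp_add]
  push_cast
  ring_nf

theorem pair_symplAtom (a : GSDual (ι ⊕ ι)) (Z : E (ι ⊕ ι) × E (ι ⊕ ι)) :
    pair a (symplAtom Z) = (symplConst ι : ℂ) * pair a (gAtom 1 Z.1 (symplFreq Z.2)) := by
  rw [symplAtom_eq, pair_smul_right a _ (gAtom_mem_GS one_pos _ _)]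

theorem continuous_pair_symplAtom (a : GSDual (ι ⊕ ι)) :
    Continuous fun Z => pair a (symplAtom Z) := by
  simp only [pair_symplAtom]
  exact continuous_const.mul ((continuous_pair_gAtom a one_pos).comp
    (continuous_fst.prodMk (continuous_symplFreq.comp continuous_snd)))

theorem exists_symplStft_decay {h : ℝ} (h0 : 0 < h) :
    ∃ r M : ℝ, 0 < r ∧ 0 < M ∧ ∀ (f : GS (ι ⊕ ι)) (C : ℝ), GSBound h C (f : E (ι ⊕ ι) → ℂ) →
      ∀ Z, ‖pair (ofGS f) (symplAtom Z)‖ ≤ M * C * Real.exp (-r * nsq Z) := by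
  obtain ⟨r, M, r0, M0, hM⟩ := exists_gTrans_decay (ι := ι ⊕ ι) (s := 1) one_pos h0
  refine ⟨r, symplConst ι * M, r0, mul_pos symplConst_pos M0, fun f C hC Z => ?_⟩
  rw [pair_symplAtom, norm_mul, Complex.norm_real, Real.norm_of_nonneg symplConst_pos.le,
    mul_assoc, mul_assoc, ← gTrans_eq_pair one_pos]
  refine mul_le_mul_of_nonneg_left ?_ symplConst_pos.le
  refine (hM f f.2 C hC Z.1 (symplFreq Z.2)).trans ?_
  rw [norm_sq_symplFreq, mul_assoc, nsq]
  have := hC.nonneg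
  gcongr M * (C * Real.exp ?_)
  have : 0 ≤ r * ‖Z.2‖ ^ 2 := by positivity
  nlinarith

/-! ### The kernel of a Weyl operator in the time-frequency plane -/

theorem weylTest_smul_smul (c d : ℂ) (f g : E ι → ℂ) :
    weylTest (c • f) (d • g) = (c * d) • weylTest f g := by
  funext X
  simp only [weylTest, Pi.smul_apply, smul_eq_mul]
  have : ∀ s : E ι, c * f (left X - (1 / 2 : ℝ) • s) * (d * g (left X + (1 / 2 : ℝ) • s)) *
      Complex.exp (Complex.I * ((inner ℝ s (right X) : ℝ) : ℂ)) =
      c * d * (f (left X - (1 / 2 : ℝ) • s) * g (left X + (1 / 2 : ℝ) • s) *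
      Complex.exp (Complex.I * ((inner ℝ s (right X) : ℝ) : ℂ))) := fun s => by ring
  simp_rw [this, integral_const_mul]
  ring

/-- The kernel `⟨Op^w(a) conj(φ_w), φ_z⟩`, where `φ_z` are the atoms of the short-time Fourier
transform. -/
def weylKernel (a : GSDual (ι ⊕ ι)) (z w : E ι × E ι) : ℂ :=
  pair a (weylTest (stftAtom (flipFreq w)) (stftAtom z))

theorem weylTest_gAtom_mem (x ξ y η : E ι) :
    weylTest (gAtom (1 / 2) x ξ) (gAtom (1 / 2) y η) ∈ GS (ι ⊕ ι) := by
  rw [weylTest_gAtom]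
  exact (GS _).smul_mem _ (gAtom_mem_GS one_pos _ _)

theorem weylKernel_eq_gAtom (a : GSDual (ι ⊕ ι)) (z w : E ι × E ι) :
    weylKernel a z w = (stftConst ι : ℂ) * (stftConst ι : ℂ) *
      pair a (weylTest (gAtom (1 / 2) w.1 w.2) (gAtom (1 / 2) z.1 (-z.2))) := by
  rw [weylKernel, stftAtom_eq, stftAtom_eq, weylTest_smul_smul,
    pair_smul_right a _ (weylTest_gAtom_mem _ _ _ _)]
  simp [flipFreq]

/-- The point of the symplectic time-frequency plane that corresponds to `(z, w)`. -/
def symplPoint (z w : E ι × E ι) : E (ι ⊕ ι) × E (ι ⊕ ι) :=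
  ((1 / 2 : ℝ) • (join z.1 z.2 + join w.1 w.2), (1 / 2 : ℝ) • (join w.1 w.2 - join z.1 z.2))

theorem continuous_symplPoint :
    Continuous fun v : (E ι × E ι) × (E ι × E ι) => symplPoint v.1 v.2 := by
  have h1 : Continuous fun v : (E ι × E ι) × (E ι × E ι) => join v.1.1 v.1.2 :=
    continuous_join.comp continuous_fst
  have h2 : Continuous fun v : (E ι × E ι) × (E ι × E ι) => join v.2.1 v.2.2 :=
    continuous_join.comp continuous_snd
  exact ((h1.add h2).const_smul (1 / 2 : ℝ)).prodMk ((h2.sub h1).const_smul (1 / 2 : ℝ))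

theorem weylCenter_eq (z w : E ι × E ι) :
    weylCenter w.1 w.2 z.1 (-z.2) = (symplPoint z w).1 := by
  rw [weylCenter, symplPoint, join_smul, sub_neg_eq_add, join_add, add_comm]

theorem weylFreq_eq (z w : E ι × E ι) :
    weylFreq w.1 w.2 z.1 (-z.2) = symplFreq (symplPoint z w).2 := by
  ext i
  rcases i with i | i <;> simp [weylFreq, symplFreq, symplPoint, join, left, right]
  ring

/-- The constant factor in `weylKernel_eq`. -/
def kernelConst (ι : Type) [Fintype ι] : ℂ :=
  (stftConst ι : ℂ) * (stftConst ι : ℂ) * weylConst ι * (symplConst ι : ℂ)⁻¹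

/-- Centre and frequency of the Weyl test function of two atoms are those of the symplectic atom at
`symplPoint z w`. So, up to a phase, the kernel of the operator is the symplectic short-time Fourier
transform of its symbol in other linear coordinates. -/
theorem weylKernel_eq (a : GSDual (ι ⊕ ι)) (z w : E ι × E ι) :
    weylKernel a z w = kernelConst ι * weylPhase w.1 w.2 z.1 (-z.2) *
      pair a (symplAtom (symplPoint z w)) := by
  have h2 : (symplConst ι : ℂ) ≠ 0 := Complex.ofReal_ne_zero.2 symplConst_pos.ne'
  rw [weylKernel_eq_gAtom, weylTest_gAtom, pair_smul_right a _ (gAtom_mem_GS one_pos _ _),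
    pair_symplAtom, weylCenter_eq, weylFreq_eq, kernelConst]
  field_simp

theorem norm_weylKernel (a : GSDual (ι ⊕ ι)) (z w : E ι × E ι) :
    ‖weylKernel a z w‖ = ‖kernelConst ι‖ * ‖pair a (symplAtom (symplPoint z w))‖ := by
  rw [weylKernel_eq, norm_mul, norm_mul, norm_weylPhase, mul_one]

theorem continuous_weylKernel (a : GSDual (ι ⊕ ι)) :
    Continuous fun v : (E ι × E ι) × (E ι × E ι) => weylKernel a v.1 v.2 := by
  simp only [weylKernel_eq]
  refine (continuous_const.mul ?_).mul ((continuous_pair_symplAtom a).comp continuous_symplPoint)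
  exact continuous_weylPhase.comp (f := fun v : (E ι × E ι) × (E ι × E ι) =>
    ((v.2.1, v.2.2), (v.1.1, -v.1.2))) (by fun_prop)

theorem exists_norm_weylKernel_le (a : GSDual (ι ⊕ ι)) {ε : ℝ} (hε : 0 < ε) :
    ∃ M : ℝ, 0 < M ∧ ∀ z w, ‖weylKernel a z w‖ ≤ M * Real.exp (ε * (nsq z + nsq w)) := by
  obtain ⟨M, M0, hM⟩ := exists_norm_pair_gAtom_le a one_pos (by positivity : 0 < ε / 3)
  have hc := norm_nonneg (kernelConst ι)
  refine ⟨(‖kernelConst ι‖ + 1) * symplConst ι * M, mul_pos (mul_pos (by positivity)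
    symplConst_pos) M0, fun z w => ?_⟩
  rw [norm_weylKernel, pair_symplAtom, ← weylCenter_eq, ← weylFreq_eq, norm_mul, Complex.norm_real,
    Real.norm_of_nonneg symplConst_pos.le, ← mul_assoc, mul_assoc (_ * _) M]
  have h := norm_sq_weylCenter_add_le w.1 w.2 z.1 (-z.2)
  rw [norm_neg] at h
  have h1 : ε / 3 * (‖weylCenter w.1 w.2 z.1 (-z.2)‖ ^ 2 + ‖weylFreq w.1 w.2 z.1 (-z.2)‖ ^ 2) ≤
      ε * (nsq z + nsq w) := by
    refine (mul_le_mul_of_nonneg_left h (by positivity)).trans (le_of_eq ?_)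
    unfold nsq
    ring
  have h2 := (hM (weylCenter w.1 w.2 z.1 (-z.2)) (weylFreq w.1 w.2 z.1 (-z.2))).trans
    (mul_le_mul_of_nonneg_left (Real.exp_le_exp.2 h1) M0.le)
  have := (symplConst_pos (ι := ι)).le
  gcongr
  linarith

/-- Viewing one atom as a superposition over a point allows `pair_weylTest_superpos` to be used when
only one of the two functions is expanded. -/
theorem superpos_dirac (x ξ : E ι) :
    superpos (1 / 2) (Measure.dirac ()) (fun _ => 1) (fun _ => x) (fun _ => ξ) =
      gAtom (1 / 2) x ξ := by
  funext y
  simp [superpos]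

theorem integrable_stft_mul_weylKernel (a : GSDual (ι ⊕ ι)) (f g : GS ι) :
    Integrable (fun v : (E ι × E ι) × (E ι × E ι) =>
      weylKernel a v.1 v.2 * stft (ofGS f) v.2 * stft (ofGS g) (flipFreq v.1)) volume := by
  obtain ⟨r, M, r0, M0, hM⟩ := exists_stft_ofGS_decay f
  obtain ⟨r', M', r0', M0', hM'⟩ := exists_stft_ofGS_decay g
  obtain ⟨N, N0, hN⟩ := exists_norm_weylKernel_le a (by positivity : 0 < min r r' / 2)
  have hr0 : 0 < min r r' / 2 := by positivity
  have hi := ((integrable_exp_nsq (ι := ι) hr0).mul_prod (integrable_exp_nsq (ι := ι) hr0))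
  refine (hi.const_mul (N * M * M')).mono' ?_ (ae_of_all _ fun v => ?_)
  · exact (((continuous_weylKernel a).mul ((continuous_stft _).comp continuous_snd)).mul
      ((continuous_stft _).comp (continuous_flipFreq.comp continuous_fst))).aestronglyMeasurable
  · have h1 := hM v.2
    have h2 := hM' (flipFreq v.1)
    rw [nsq_flipFreq] at h2
    rw [norm_mul, norm_mul]
    calc _ ≤ (N * Real.exp (min r r' / 2 * (nsq v.1 + nsq v.2))) * (M * Real.exp (-r * nsq v.2)) *
          (M' * Real.exp (-r' * nsq v.1)) := by gcongr; exact hN _ _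
      _ = N * M * M' * Real.exp (min r r' / 2 * (nsq v.1 + nsq v.2) + -r * nsq v.2 +
          -r' * nsq v.1) := by rw [Real.exp_add, Real.exp_add]; ring
      _ ≤ N * M * M' * Real.exp (-(min r r' / 2) * nsq v.1 + -(min r r' / 2) * nsq v.2) := by
          have := mul_le_mul_of_nonneg_right (min_le_left r r') (nsq_nonneg v.2)
          have := mul_le_mul_of_nonneg_right (min_le_right r r') (nsq_nonneg v.1)
          refine mul_le_mul_of_nonneg_left (Real.exp_le_exp.2 ?_) (by positivity)
          linarith
      _ = _ := by rw [Real.exp_add]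

/-- Both functions are expanded into atoms by the inversion formula and the symbol is applied under
the double integral; Gaussian decay of the coefficients beats the growth of the kernel. -/
theorem weylForm_eq_integral (a : GSDual (ι ⊕ ι)) (f g : GS ι) :
    weylForm a f g =
      ∫ z, (∫ w, weylKernel a z w * stft (ofGS f) w) * stft (ofGS g) (flipFreq z) := by
  obtain ⟨ε, ε0, hI⟩ := integrable_gCoeff_mul_exp (by norm_num : (0 : ℝ) < 1 / 2) f
  obtain ⟨ε', ε0', hI'⟩ := integrable_gCoeff_mul_exp (by norm_num : (0 : ℝ) < 1 / 2) g
  have hmono : ∀ {k : GS ι} {δ : ℝ}, min ε ε' ≤ δ → Integrable (fun z => ‖gCoeff (1 / 2) k z‖ *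
      Real.exp (δ * (‖z.1‖ ^ 2 + ‖z.2‖ ^ 2))) volume →
      Integrable (fun z => ‖gCoeff (1 / 2) k z‖ *
      Real.exp (min ε ε' * (‖z.1‖ ^ 2 + ‖z.2‖ ^ 2))) volume := by
    intro k δ hδ h
    have := continuous_gCoeff (by norm_num : (0 : ℝ) < 1 / 2) k
    refine h.mono' (Continuous.aestronglyMeasurable (by fun_prop)) (ae_of_all _ fun z => ?_)
    rw [norm_mul, norm_norm, Real.norm_of_nonneg (Real.exp_pos _).le]
    gcongr
  have h := pair_weylTest_superpos (μ := volume) (ν := volume) a (lt_min ε0 ε0')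
    measurable_fst measurable_snd measurable_fst measurable_snd
    (continuous_gCoeff (by norm_num) f).aestronglyMeasurable
    (continuous_gCoeff (by norm_num) g).aestronglyMeasurable
    (hmono (min_le_left _ _) hI) (hmono (min_le_right _ _) hI')
  rw [superpos_gCoeff (by norm_num), superpos_gCoeff (by norm_num)] at h
  rw [weylForm, h]
  have hint := integrable_stft_mul_weylKernel a f g
  have h2 := integral_prod _ hint
  simp only [integral_mul_const] at h2
  rw [← h2]
  -- The atoms in the variable `z` of the kernel carry the frequency `-z.2`, so the variable of `g`
  -- is reflected before the two variables are exchanged.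
  have h3 := ((MeasurePreserving.id (volume : Measure (E ι × E ι))).prod
    (measurePreserving_flipFreq (ι := ι))).integral_comp
    ((MeasurableEquiv.refl _).prodCongr (flipEquiv ι)).measurableEmbedding
    (fun v : (E ι × E ι) × (E ι × E ι) => gCoeff (1 / 2) f v.1 * gCoeff (1 / 2) g v.2 *
      pair a (weylTest (gAtom (1 / 2) v.1.1 v.1.2) (gAtom (1 / 2) v.2.1 v.2.2)))
  rw [← h3, ← integral_prod_swap]
  congr 1
  funext v
  simp only [Prod.map, Prod.swap, id]
  rw [gCoeff_eq_stft, gCoeff_eq_stft, weylKernel_eq_gAtom]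
  simp only [flipFreq]
  ring

theorem pair_weylTest_gAtom_stftAtom (a : GSDual (ι ⊕ ι)) (z w : E ι × E ι) :
    weylKernel a z w = (stftConst ι : ℂ) *
      pair a (weylTest (gAtom (1 / 2) w.1 w.2) (stftAtom z)) := by
  have h := weylTest_smul_smul 1 (stftConst ι : ℂ) (gAtom (1 / 2) w.1 w.2)
    (gAtom (1 / 2) z.1 (-z.2))
  rw [one_smul, one_mul] at h
  rw [weylKernel_eq_gAtom, stftAtom_eq z, h, pair_smul_right a _ (weylTest_gAtom_mem _ _ _ _),
    mul_assoc]

theorem pair_weylTest_stftAtom_gAtom (a : GSDual (ι ⊕ ι)) (z w : E ι × E ι) :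
    weylKernel a z w = (stftConst ι : ℂ) *
      pair a (weylTest (stftAtom (flipFreq w)) (gAtom (1 / 2) z.1 (-z.2))) := by
  have h := weylTest_smul_smul (stftConst ι : ℂ) 1 (gAtom (1 / 2) w.1 w.2)
    (gAtom (1 / 2) z.1 (-z.2))
  rw [one_smul, mul_one] at h
  rw [weylKernel_eq_gAtom, stftAtom_eq (flipFreq w)]
  simp only [flipFreq, neg_neg]
  rw [h, pair_smul_right a _ (weylTest_gAtom_mem _ _ _ _), mul_assoc]

/-- Reproducing property of the kernel in the first variable. -/
theorem weylKernel_eq_integral_left (a : GSDual (ι ⊕ ι)) (z₀ w : E ι × E ι) :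
    weylKernel a z₀ w =
      ∫ z, weylKernel a z w * stft (ofGS ⟨stftAtom z₀, stftAtom_mem z₀⟩) (flipFreq z) := by
  set g : GS ι := ⟨stftAtom z₀, stftAtom_mem z₀⟩ with hg
  obtain ⟨ε, ε0, hI⟩ := integrable_gCoeff_mul_exp (by norm_num : (0 : ℝ) < 1 / 2) g
  have h := pair_weylTest_superpos (μ := Measure.dirac ()) (ν := volume) a ε0
    (x := fun _ => w.1) (ξ := fun _ => w.2) (A := fun _ => 1)
    measurable_const measurable_const measurable_fst measurable_snd
    aestronglyMeasurable_const
    (continuous_gCoeff (by norm_num) g).aestronglyMeasurable (by simp) hI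
  rw [superpos_gCoeff (by norm_num), superpos_dirac, Measure.dirac_prod,
    (measurableEmbedding_prodMk_left ()).integral_map] at h
  rw [pair_weylTest_gAtom_stftAtom, h, ← integral_flipFreq, ← integral_const_mul]
  congr 1
  funext z
  rw [gCoeff_eq_stft, weylKernel_eq_gAtom]
  simp only [flipFreq]
  ring

/-- Reproducing property of the kernel in the second variable. -/
theorem weylKernel_eq_integral_right (a : GSDual (ι ⊕ ι)) (z w₀ : E ι × E ι) :
    weylKernel a z w₀ = ∫ w, weylKernel a z w *
      stft (ofGS ⟨stftAtom (flipFreq w₀), stftAtom_mem (flipFreq w₀)⟩) w := by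
  set f : GS ι := ⟨stftAtom (flipFreq w₀), stftAtom_mem (flipFreq w₀)⟩
  obtain ⟨ε, ε0, hI⟩ := integrable_gCoeff_mul_exp (by norm_num : (0 : ℝ) < 1 / 2) f
  have h := pair_weylTest_superpos (μ := volume) (ν := Measure.dirac ()) a ε0
    (y := fun _ => z.1) (η := fun _ => -z.2) (B := fun _ => 1)
    measurable_fst measurable_snd measurable_const measurable_const
    (continuous_gCoeff (by norm_num) f).aestronglyMeasurable
    aestronglyMeasurable_const hI (by simp)
  rw [superpos_gCoeff (by norm_num), superpos_dirac, Measure.prod_dirac,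
    (measurableEmbedding_prod_mk_right ()).integral_map] at h
  rw [pair_weylTest_stftAtom_gAtom, h, ← integral_const_mul]
  congr 1
  funext w
  rw [gCoeff_eq_stft, weylKernel_eq_gAtom]
  ring

/-! ### Mixed norms of functions with values in `[0, ∞]` -/

section ENNMixed

variable {A B : Type} [MeasureSpace A] [MeasureSpace B]

/-- The mixed norm of a function with values in `[0, ∞]`. -/
def ennMixed (p q : ℝ≥0∞) (F : A × B → ℝ≥0∞) : ℝ≥0∞ :=
  eLpNorm (fun b => eLpNorm (fun a => F (a, b)) p volume) q volume

theorem mixedNorm_eq_ennMixed (p q : ℝ≥0∞) (F : A × B → ℂ) :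
    mixedNorm p q F = ennMixed p q fun z => ‖F z‖ₑ := by
  simp only [mixedNorm, ennMixed, eLpNorm_enorm]

theorem eLpNorm_const_mul_enn {α : Type*} [MeasurableSpace α] {μ : Measure α} (p c : ℝ≥0∞)
    (hc : c ≠ ∞) (f : α → ℝ≥0∞) : eLpNorm (fun x => c * f x) p μ = c * eLpNorm f p μ := by
  lift c to NNReal using hc
  rcases eq_or_ne p 0 with rfl | h0
  · simp
  rcases eq_or_ne p ∞ with rfl | htop
  · simp only [eLpNorm_exponent_top, eLpNormEssSup, enorm_eq_self]
    exact ENNReal.essSup_const_mul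
  · rw [eLpNorm_eq_lintegral_rpow_enorm_toReal h0 htop,
      eLpNorm_eq_lintegral_rpow_enorm_toReal h0 htop]
    have hp := ENNReal.toReal_pos h0 htop
    simp only [enorm_eq_self, ENNReal.mul_rpow_of_nonneg _ _ hp.le]
    rw [lintegral_const_mul' _ _ (ENNReal.rpow_ne_top_of_nonneg hp.le ENNReal.coe_ne_top),
      ENNReal.mul_rpow_of_nonneg _ _ (by positivity), ← ENNReal.rpow_mul, mul_one_div_cancel hp.ne',
      ENNReal.rpow_one]

theorem ennMixed_const_mul (p q c : ℝ≥0∞) (hc : c ≠ ∞) (F : A × B → ℝ≥0∞) :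
    ennMixed p q (fun z => c * F z) = c * ennMixed p q F := by
  simp only [ennMixed, eLpNorm_const_mul_enn _ c hc]

theorem ennMixed_mono (p q : ℝ≥0∞) {F G : A × B → ℝ≥0∞} (h : ∀ z, F z ≤ G z) :
    ennMixed p q F ≤ ennMixed p q G :=
  eLpNorm_mono_enorm fun b => eLpNorm_mono_enorm fun a => h (a, b)

variable [SFinite (volume : Measure A)] [SFinite (volume : Measure B)]

theorem ae_ae_of_ae_prod_right {P : A × B → Prop} (h : ∀ᵐ z, P z) :
    ∀ᵐ b : B, ∀ᵐ a : A, P (a, b) := by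
  have h' : ∀ᵐ z ∂((volume : Measure B).prod (volume : Measure A)).map Prod.swap, P z := by
    rw [Measure.prod_swap]
    exact h
  exact Measure.ae_ae_of_ae_prod (ae_of_ae_map measurable_swap.aemeasurable h')

theorem ennMixed_mono_ae (p q : ℝ≥0∞) {F G : A × B → ℝ≥0∞} (h : ∀ᵐ z, F z ≤ G z) :
    ennMixed p q F ≤ ennMixed p q G := by
  refine eLpNorm_mono_enorm_ae ?_
  filter_upwards [ae_ae_of_ae_prod_right h] with b hb
  refine eLpNorm_mono_enorm_ae ?_
  filter_upwards [hb] with a ha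
  exact ha

theorem ennMixed_congr_ae (p q : ℝ≥0∞) {F G : A × B → ℝ≥0∞} (h : F =ᵐ[volume] G) :
    ennMixed p q F = ennMixed p q G :=
  le_antisymm (ennMixed_mono_ae p q h.le) (ennMixed_mono_ae p q h.symm.le)

theorem measurable_eLpNorm_inner {p : ℝ≥0∞} {F : A × B → ℝ≥0∞} (hF : Measurable F) :
    Measurable fun b => eLpNorm (fun a => F (a, b)) p (volume : Measure A) := by
  rcases eq_or_ne p 0 with rfl | h0
  · simp
  rcases eq_or_ne p ∞ with rfl | htop
  · simp only [eLpNorm_exponent_top, eLpNormEssSup, enorm_eq_self]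
    refine measurable_of_Iic fun c => ?_
    have hset : MeasurableSet {z : A × B | c < F z} := measurableSet_lt measurable_const hF
    have hm := measurable_measure_prodMk_right (μ := (volume : Measure A)) hset
    have heq : ((fun b => essSup (fun a => F (a, b)) volume) ⁻¹' Set.Iic c) =
        (fun b => (volume : Measure A) ((fun a => (a, b)) ⁻¹' {z : A × B | c < F z})) ⁻¹' {0} := by
      ext b
      simp only [Set.mem_preimage, Set.mem_Iic, Set.mem_singleton_iff]
      constructor
      · intro h
        refine measure_mono_null ?_ (ae_le_essSup (μ := (volume : Measure A))
          (f := fun a => F (a, b)))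
        intro a ha
        exact not_le.2 (lt_of_le_of_lt h ha)
      · intro h
        refine essSup_le_of_ae_le c ?_
        have : ∀ᵐ a : A, ¬ (c < F (a, b)) := by
          rw [ae_iff]
          simpa using! h
        filter_upwards [this] with a ha
        exact not_lt.mp ha
    rw [heq]
    exact hm (measurableSet_singleton 0)
  · simp only [eLpNorm_eq_lintegral_rpow_enorm_toReal h0 htop, enorm_eq_self]
    exact (Measurable.lintegral_prod_left' (f := fun z : A × B => F z ^ p.toReal)
      (hF.pow_const _)).pow_const _

/-! ### Factorization of mixed-norm functions and Hölder's inequality -/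

/-- Normalizing the slices of a function in `L^p`. -/
theorem exists_slice_factor {p : ℝ≥0∞} (hp : 1 ≤ p) {F : A × B → ℝ≥0∞} (hF : Measurable F) :
    ∃ g : A × B → ℝ≥0∞, Measurable g ∧ (∀ b, ∫⁻ a, g (a, b) ≤ 1) ∧
      ∀ b, eLpNorm (fun a => F (a, b)) p (volume : Measure A) ≠ ∞ → ∀ᵐ a : A,
        F (a, b) ≤ eLpNorm (fun a => F (a, b)) p (volume : Measure A) *
          g (a, b) ^ p⁻¹.toReal := by
  rcases eq_or_ne p ∞ with rfl | htop
  -- For `p = ∞` the exponent `1/p` is `0` and `g ^ 0 = 1` whatever `g` is, so the zero function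
  -- serves.
  · refine ⟨fun _ => 0, measurable_const, by simp, fun b _ => ?_⟩
    simp only [ENNReal.inv_top, ENNReal.toReal_zero, ENNReal.rpow_zero, mul_one,
      eLpNorm_exponent_top, eLpNormEssSup, enorm_eq_self]
    exact ae_le_essSup
  have h0 : p ≠ 0 := (one_pos.trans_le hp).ne'
  have hp0 := ENNReal.toReal_pos h0 htop
  set n : B → ℝ≥0∞ := fun b => eLpNorm (fun a => F (a, b)) p (volume : Measure A) with hn
  have hnm : Measurable n := measurable_eLpNorm_inner hF
  have hnp : ∀ b, n b ^ p.toReal = ∫⁻ a, F (a, b) ^ p.toReal := fun b => by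
    simp only [hn, eLpNorm_eq_lintegral_rpow_enorm_toReal h0 htop, enorm_eq_self]
    rw [← ENNReal.rpow_mul, one_div, inv_mul_cancel₀ hp0.ne', ENNReal.rpow_one]
  -- Where the slice norm is `0` the inverse is `∞`, but `F` vanishes almost everywhere on that
  -- slice and `0 * ∞ = 0`.
  refine ⟨fun z => F z ^ p.toReal * ((n z.2) ^ p.toReal)⁻¹, by fun_prop, fun b => ?_,
    fun b hb => ?_⟩
  · simp only
    rw [lintegral_mul_const _ (by fun_prop), ← hnp]
    exact ENNReal.mul_inv_le_one _
  · change ∀ᵐ a : A, F (a, b) ≤ n b * (F (a, b) ^ p.toReal * ((n b) ^ p.toReal)⁻¹) ^ p⁻¹.toReal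
    rcases eq_or_ne (n b) 0 with h | h
    · have h2 : ∫⁻ a, F (a, b) ^ p.toReal = 0 := by
        rw [← hnp, h, ENNReal.zero_rpow_of_pos hp0]
      rw [lintegral_eq_zero_iff (by fun_prop)] at h2
      filter_upwards [h2] with a ha
      rw [Pi.zero_apply, ENNReal.rpow_eq_zero_iff_of_pos hp0] at ha
      simp [ha]
    · refine ae_of_all _ fun a => ?_
      rw [ENNReal.toReal_inv, ENNReal.mul_rpow_of_nonneg _ _ (by positivity), ENNReal.inv_rpow,
        ← ENNReal.rpow_mul, ← ENNReal.rpow_mul, mul_inv_cancel₀ hp0.ne', ENNReal.rpow_one,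
        ENNReal.rpow_one, mul_left_comm, ENNReal.mul_inv_cancel h hb, mul_one]

theorem ae_ne_top_of_eLpNorm_ne_top {α : Type*} [MeasurableSpace α] {μ : Measure α} {q : ℝ≥0∞}
    (hq : 1 ≤ q) {n : α → ℝ≥0∞} (hn : Measurable n) (h : eLpNorm n q μ ≠ ∞) :
    ∀ᵐ b ∂μ, n b ≠ ∞ := by
  rcases eq_or_ne q ∞ with rfl | htop
  · simp only [eLpNorm_exponent_top, eLpNormEssSup, enorm_eq_self] at h
    filter_upwards [ae_le_essSup (μ := μ) (f := n)] with b hb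
    exact (hb.trans_lt h.lt_top).ne
  · have h0 : q ≠ 0 := (one_pos.trans_le hq).ne'
    have hq0 := ENNReal.toReal_pos h0 htop
    rw [eLpNorm_eq_lintegral_rpow_enorm_toReal h0 htop] at h
    simp only [enorm_eq_self] at h
    have h2 : ∫⁻ b, n b ^ q.toReal ∂μ ≠ ∞ := by
      intro h'
      rw [h', ENNReal.top_rpow_of_pos (by positivity)] at h
      exact h rfl
    filter_upwards [ae_lt_top (by fun_prop) h2] with b hb hb'
    rw [hb', ENNReal.top_rpow_of_pos hq0] at hb
    exact lt_irrefl _ hb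

/-- A function in `L^{p,q}` is bounded by `‖F‖ g(a, b)^{1/p} n(b)^{1/q}` with normalized
functions `g` and `n`. -/
theorem exists_mixed_factor {p q : ℝ≥0∞} (hp : 1 ≤ p) (hq : 1 ≤ q) {F : A × B → ℝ≥0∞}
    (hF : AEMeasurable F volume) (hN : ennMixed p q F ≠ ∞) :
    ∃ (g : A × B → ℝ≥0∞) (n : B → ℝ≥0∞), Measurable g ∧ Measurable n ∧
      (∀ b, ∫⁻ a, g (a, b) ≤ 1) ∧ ∫⁻ b, n b ≤ 1 ∧
      ∀ᵐ z, F z ≤ ennMixed p q F * (g z ^ p⁻¹.toReal * n z.2 ^ q⁻¹.toReal) := by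
  obtain ⟨G, hG, hFG⟩ : ∃ G : A × B → ℝ≥0∞, Measurable G ∧ F =ᵐ[volume] G :=
    ⟨hF.mk F, hF.measurable_mk, hF.ae_eq_mk⟩
  rw [ennMixed_congr_ae p q hFG] at hN ⊢
  obtain ⟨g, hg, hg1, hg2⟩ := exists_slice_factor hp hG
  set ν : B → ℝ≥0∞ := fun b => eLpNorm (fun a => G (a, b)) p (volume : Measure A) with hν
  have hνm : Measurable ν := measurable_eLpNorm_inner hG
  -- The outer norm is normalized by the same lemma, applied with a one-point space as second
  -- factor.
  let _ : MeasureSpace Unit := ⟨Measure.dirac ()⟩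
  have : SFinite (volume : Measure Unit) := inferInstanceAs (SFinite (Measure.dirac ()))
  obtain ⟨n, hn, hn1, hn2⟩ := exists_slice_factor (A := B) (B := Unit) hq
    (F := fun z => ν z.1) (hνm.comp measurable_fst)
  have hn2' := hn2 () hN
  refine ⟨g, fun b => n (b, ()), hg, by fun_prop, hg1, hn1 (), ?_⟩
  have key : ∀ᵐ z : A × B, G z ≤ ennMixed p q G *
      (g z ^ p⁻¹.toReal * n (z.2, ()) ^ q⁻¹.toReal) := by
    have hset : MeasurableSet {z : A × B | G z ≤ ennMixed p q G *
      (g z ^ p⁻¹.toReal * n (z.2, ()) ^ q⁻¹.toReal)} := measurableSet_le hG (by fun_prop)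
    have h1 : ∀ᵐ w ∂((volume : Measure B).prod (volume : Measure A)),
        G w.swap ≤ ennMixed p q G *
          (g w.swap ^ p⁻¹.toReal * n (w.swap.2, ()) ^ q⁻¹.toReal) := by
      refine (Measure.ae_prod_iff_ae_ae (measurable_swap hset)).2 ?_
      filter_upwards [hn2', ae_ne_top_of_eLpNorm_ne_top hq hνm hN] with b hb hb2
      filter_upwards [hg2 b hb2] with a ha
      refine ha.trans ?_
      calc ν b * g (a, b) ^ p⁻¹.toReal
          ≤ (ennMixed p q G * n (b, ()) ^ q⁻¹.toReal) * g (a, b) ^ p⁻¹.toReal := by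
            gcongr; exact hb
        _ = _ := by simp only [Prod.swap]; ring
    have h2 : (volume : Measure (A × B)) =
        ((volume : Measure B).prod (volume : Measure A)).map Prod.swap := by
      rw [Measure.prod_swap]; rfl
    rw [h2]
    exact (ae_map_iff measurable_swap.aemeasurable hset).2 h1
  filter_upwards [hFG, key] with z hz hz2
  rw [hz]
  exact hz2

/-- Hölder's inequality with the exponents `rp`, `sp`, `tp`, whose sum is `1`. For `p = ∞` all three
exponents vanish. -/
theorem eLpNorm_prod_three_le {α : Type*} [MeasurableSpace α] {μ : Measure α} {p : ℝ≥0∞}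
    (hp : 1 ≤ p) {f g h : α → ℝ≥0∞} (hf : AEMeasurable f μ) (hg : AEMeasurable g μ)
    (hh : AEMeasurable h μ) {r s t : ℝ} (hr : 0 ≤ r) (hs : 0 ≤ s) (ht : 0 ≤ t)
    (hsum : r + s + t = p⁻¹.toReal) :
    eLpNorm (fun x => f x ^ r * g x ^ s * h x ^ t) p μ ≤
      (∫⁻ x, f x ∂μ) ^ r * (∫⁻ x, g x ∂μ) ^ s * (∫⁻ x, h x ∂μ) ^ t := by
  rcases eq_or_ne p ∞ with rfl | htop
  · simp only [ENNReal.inv_top, ENNReal.toReal_zero] at hsum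
    obtain rfl : r = 0 := by linarith
    obtain rfl : s = 0 := by linarith
    obtain rfl : t = 0 := by linarith
    simp only [ENNReal.rpow_zero, mul_one, eLpNorm_exponent_top, eLpNormEssSup, enorm_eq_self]
    exact essSup_le_of_ae_le _ (ae_of_all _ fun _ => le_rfl)
  have h0 : p ≠ 0 := (one_pos.trans_le hp).ne'
  have hp0 := ENNReal.toReal_pos h0 htop
  rw [ENNReal.toReal_inv] at hsum
  rw [eLpNorm_eq_lintegral_rpow_enorm_toReal h0 htop]
  simp only [enorm_eq_self]
  have hH := ENNReal.lintegral_prod_norm_pow_le (μ := μ) (Finset.univ : Finset (Fin 3))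
    (f := ![f, g, h]) (p := ![r * p.toReal, s * p.toReal, t * p.toReal])
    (by intro i _; fin_cases i <;> assumption)
    (by simp only [Fin.sum_univ_three]
        change r * p.toReal + s * p.toReal + t * p.toReal = 1
        rw [← add_mul, ← add_mul, hsum, inv_mul_cancel₀ hp0.ne'])
    (by intro i _; fin_cases i <;> simp <;> positivity)
  simp only [Fin.prod_univ_three] at hH
  change ∫⁻ a, f a ^ (r * p.toReal) * g a ^ (s * p.toReal) * h a ^ (t * p.toReal) ∂μ ≤
    (∫⁻ x, f x ∂μ) ^ (r * p.toReal) * (∫⁻ x, g x ∂μ) ^ (s * p.toReal) *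
    (∫⁻ x, h x ∂μ) ^ (t * p.toReal) at hH
  simp only [ENNReal.rpow_mul, ← ENNReal.mul_rpow_of_nonneg _ _ hp0.le] at hH
  calc _ ≤ _ := ENNReal.rpow_le_rpow hH (by positivity : 0 ≤ 1 / p.toReal)
    _ = _ := by rw [← ENNReal.rpow_mul, mul_one_div_cancel hp0.ne', ENNReal.rpow_one]

theorem lintegral_mul_le_eLpNorm_mul {α : Type*} [MeasurableSpace α] {μ : Measure α} {p q : ℝ≥0∞}
    [hpq : p.HolderConjugate q] {f g : α → ℝ≥0∞} (hf : AEMeasurable f μ) (hg : AEMeasurable g μ) :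
    ∫⁻ x, f x * g x ∂μ ≤ eLpNorm f p μ * eLpNorm g q μ := by
  have hess : ∀ {u v : α → ℝ≥0∞}, AEMeasurable u μ →
      ∫⁻ x, u x * v x ∂μ ≤ eLpNorm u 1 μ * eLpNorm v ∞ μ := by
    intro u v hu
    rw [eLpNorm_one_eq_lintegral_enorm, eLpNorm_exponent_top, eLpNormEssSup]
    simp only [enorm_eq_self]
    rw [← lintegral_mul_const'' _ hu]
    refine lintegral_mono_ae ?_
    filter_upwards [ae_le_essSup (μ := μ) (f := v)] with x hx
    gcongr
  have h0p : p ≠ 0 := hpq.ne_zero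
  have h0q : q ≠ 0 := hpq.symm.ne_zero
  rcases eq_or_ne p ∞ with rfl | hp
  · have : q = 1 := by
      have := hpq.inv_add_inv_eq_one
      simpa using this
    subst this
    rw [mul_comm]
    simp only [mul_comm (f _)]
    exact hess hg
  rcases eq_or_ne q ∞ with rfl | hq
  · have : p = 1 := by
      have := hpq.inv_add_inv_eq_one
      simpa using this
    subst this
    exact hess hf
  have hr : p.toReal.HolderConjugate q.toReal := by
    refine Real.holderConjugate_iff.2 ⟨?_, ?_⟩
    · have h1 : 1 < p := by
        refine lt_of_le_of_ne hpq.one_le ?_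
        rintro rfl
        have := hpq.inv_add_inv_eq_one
        simp at this
        exact hq this
      simpa using (ENNReal.toReal_lt_toReal ENNReal.one_ne_top hp).2 h1
    · rw [← ENNReal.toReal_inv, ← ENNReal.toReal_inv, ← ENNReal.toReal_add
        (ENNReal.inv_ne_top.2 h0p) (ENNReal.inv_ne_top.2 h0q), hpq.inv_add_inv_eq_one]
      rfl
  rw [eLpNorm_eq_lintegral_rpow_enorm_toReal h0p hp, eLpNorm_eq_lintegral_rpow_enorm_toReal h0q hq]
  exact ENNReal.lintegral_mul_le_Lp_mul_Lq μ hr hf hg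

/-- Hölder's inequality for mixed norms. -/
theorem lintegral_mul_le_ennMixed_mul {p q p' q' : ℝ≥0∞} [p.HolderConjugate p']
    [q.HolderConjugate q'] {F G : A × B → ℝ≥0∞} (hF : AEMeasurable F volume)
    (hG : AEMeasurable G volume) :
    ∫⁻ z, F z * G z ≤ ennMixed p q F * ennMixed p' q' G := by
  have e1 : ∫⁻ z, F z * G z = ∫⁻ z, hF.mk F z * hG.mk G z := by
    refine lintegral_congr_ae ?_
    filter_upwards [hF.ae_eq_mk, hG.ae_eq_mk] with z h1 h2
    rw [h1, h2]
  have m1 := hF.measurable_mk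
  have m2 := hG.measurable_mk
  rw [e1, ennMixed_congr_ae p q hF.ae_eq_mk, ennMixed_congr_ae p' q' hG.ae_eq_mk]
  have e2 : ∫⁻ z, hF.mk F z * hG.mk G z = ∫⁻ b, ∫⁻ a, hF.mk F (a, b) * hG.mk G (a, b) :=
    lintegral_prod_symm _ (m1.mul m2).aemeasurable
  rw [e2]
  refine le_trans (lintegral_mono fun b => lintegral_mul_le_eLpNorm_mul (p := p) (q := p')
    (m1.comp measurable_prodMk_right).aemeasurable
    (m2.comp measurable_prodMk_right).aemeasurable) ?_
  exact lintegral_mul_le_eLpNorm_mul (measurable_eLpNorm_inner m1).aemeasurable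
    (measurable_eLpNorm_inner m2).aemeasurable

end ENNMixed

/-! ### Boundedness of twisted kernel operators on mixed norm spaces -/

instance : (volume : Measure (E ι × E ι)).IsAddHaarMeasure :=
  inferInstanceAs ((volume : Measure (E ι)).prod (volume : Measure (E ι))).IsAddHaarMeasure

/-- Hölder's inequality with six factors, for the integrand of a twisted kernel operator. -/
theorem lintegral_six_factors_le {α : Type*} [MeasurableSpace α] {μ : Measure α}
    {h k f m : α → ℝ≥0∞} (hh : Measurable h) (hk : Measurable k) (hf : Measurable f)
    (hm : Measurable m) {a b s t : ℝ} (ha : 0 ≤ a) (hab : a ≤ b) (hb : b ≤ 1) (hs0 : 0 ≤ s)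
    (hs1 : s ≤ 1) (ht0 : 0 ≤ t) (ht1 : t ≤ 1) :
    ∫⁻ v, h v ^ a * k v ^ b * (f v ^ (1 - b + (b - a) * s) * m v ^ (1 - b + (b - a) * t)) ∂μ ≤
      (∫⁻ v, f v * m v ∂μ) ^ (1 - b) * (∫⁻ v, h v * k v ∂μ) ^ a *
      (∫⁻ v, k v * (f v * m v) ∂μ) ^ ((b - a) * (s * t)) *
      (∫⁻ v, k v * f v ∂μ) ^ ((b - a) * (s * (1 - t))) *
      (∫⁻ v, k v * m v ∂μ) ^ ((b - a) * ((1 - s) * t)) *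
      (∫⁻ v, k v ∂μ) ^ ((b - a) * ((1 - s) * (1 - t))) := by
  have hba : 0 ≤ b - a := by linarith
  have hs1' : 0 ≤ 1 - s := by linarith
  have ht1' : 0 ≤ 1 - t := by linarith
  have hb' : 0 ≤ 1 - b := by linarith
  have n2 : 0 ≤ (b - a) * (s * t) := by positivity
  have n3 : 0 ≤ (b - a) * (s * (1 - t)) := by positivity
  have n4 : 0 ≤ (b - a) * ((1 - s) * t) := by positivity
  have n5 : 0 ≤ (b - a) * ((1 - s) * (1 - t)) := by positivity
  -- The Hölder weights are `1 - b` for `f m`, `a` for `h k`, and the rest `b - a` spread bilinearly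
  -- over the four corners of the `(s, t)` square: `k f m`, `k f`, `k m` and `k`.
  have hH := ENNReal.lintegral_prod_norm_pow_le (μ := μ) (Finset.univ : Finset (Fin 6))
    (f := ![fun v => f v * m v, fun v => h v * k v, fun v => k v * (f v * m v),
      fun v => k v * f v, fun v => k v * m v, k])
    (p := ![1 - b, a, (b - a) * (s * t), (b - a) * (s * (1 - t)), (b - a) * ((1 - s) * t),
      (b - a) * ((1 - s) * (1 - t))])
    (by intro i _; fin_cases i <;> simp <;> fun_prop)
    (by simp only [Fin.sum_univ_six]
        change 1 - b + a + (b - a) * (s * t) + (b - a) * (s * (1 - t)) + (b - a) * ((1 - s) * t) +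
          (b - a) * ((1 - s) * (1 - t)) = 1
        ring)
    (by intro i _; fin_cases i <;> assumption)
  simp only [Fin.prod_univ_six] at hH
  refine le_trans (le_of_eq (lintegral_congr fun v => ?_)) hH
  change h v ^ a * k v ^ b * (f v ^ (1 - b + (b - a) * s) * m v ^ (1 - b + (b - a) * t)) =
    (f v * m v) ^ (1 - b) * (h v * k v) ^ a * (k v * (f v * m v)) ^ ((b - a) * (s * t)) *
    (k v * f v) ^ ((b - a) * (s * (1 - t))) * (k v * m v) ^ ((b - a) * ((1 - s) * t)) *
    (k v) ^ ((b - a) * ((1 - s) * (1 - t)))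
  rw [show k v ^ b = k v ^ (a + (b - a) * (s * t) + (b - a) * (s * (1 - t)) +
      (b - a) * ((1 - s) * t) + (b - a) * ((1 - s) * (1 - t))) by congr 1; ring,
    show f v ^ (1 - b + (b - a) * s) = f v ^ (1 - b + (b - a) * (s * t) +
      (b - a) * (s * (1 - t))) by congr 1; ring,
    show m v ^ (1 - b + (b - a) * t) = m v ^ (1 - b + (b - a) * (s * t) +
      (b - a) * ((1 - s) * t)) by congr 1; ring]
  rw [ENNReal.rpow_add_of_nonneg _ _ (by positivity) n5,
    ENNReal.rpow_add_of_nonneg _ _ (by positivity) n4,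
    ENNReal.rpow_add_of_nonneg _ _ (by positivity) n3,
    ENNReal.rpow_add_of_nonneg _ _ (by positivity) n2,
    ENNReal.rpow_add_of_nonneg (x := f v) _ _ (by positivity) n3,
    ENNReal.rpow_add_of_nonneg (x := f v) _ _ hb' n2,
    ENNReal.rpow_add_of_nonneg (x := m v) _ _ (by positivity) n4,
    ENNReal.rpow_add_of_nonneg (x := m v) _ _ hb' n2]
  simp only [ENNReal.mul_rpow_of_nonneg _ _ hb', ENNReal.mul_rpow_of_nonneg _ _ ha,
    ENNReal.mul_rpow_of_nonneg _ _ n2, ENNReal.mul_rpow_of_nonneg _ _ n3,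
    ENNReal.mul_rpow_of_nonneg _ _ n4]
  ring

/-- After Hölder in `v`, the factors from `f m` and `k` are constants; here `1 ≤ D` is used. The
other four integrals have total mass at most `D`: `J2` and `J3` over both variables, `J4` over the
inner variable on every slice, and `J5` over the outer variable, on which alone it depends. Hölder
in the inner norm takes `J2`, `J3`, `J4`, with exponents of sum `a + (b - a)s = 1/p₂`, and in the
outer norm `J2`, `J3`, `J5`, with sum `a + (b - a)t = 1/q₂`. The powers of `D` then add up to `1`.
This takes the place of an interpolation theorem. -/
theorem ennMixed_twisted_le {p₂ q₂ : ℝ≥0∞} (hp₂ : 1 ≤ p₂) (hq₂ : 1 ≤ q₂)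
    {h : (E ι × E ι) × (E ι × E ι) → ℝ≥0∞} {k f : E ι × E ι → ℝ≥0∞} {m : E ι → ℝ≥0∞}
    (hh : Measurable h) (hk : Measurable k) (hf : Measurable f) (hm : Measurable m)
    {D : ℝ≥0∞} (hD : 1 ≤ D) (hD' : D ≠ ∞) (hkD : ∫⁻ v, k v ≤ D) (hh1 : ∀ v, ∫⁻ z, h (z, v) ≤ 1)
    (hf1 : ∀ b, ∫⁻ a, f (a, b) ≤ 1) (hm1 : ∫⁻ b, m b ≤ 1)
    {a b s t : ℝ} (ha : 0 ≤ a) (hab : a ≤ b) (hb : b ≤ 1) (hs0 : 0 ≤ s) (hs1 : s ≤ 1)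
    (ht0 : 0 ≤ t) (ht1 : t ≤ 1) (hp : p₂⁻¹.toReal = a + (b - a) * s)
    (hq : q₂⁻¹.toReal = a + (b - a) * t) :
    ennMixed p₂ q₂ (fun z : E ι × E ι => ∫⁻ v, h (z, v) ^ a * k v ^ b *
      (f (z + v) ^ (1 - b + (b - a) * s) * m (z.2 + v.2) ^ (1 - b + (b - a) * t))) ≤ D := by
  have hba : 0 ≤ b - a := by linarith
  have hs1' : 0 ≤ 1 - s := by linarith
  have ht1' : 0 ≤ 1 - t := by linarith
  have hb' : 0 ≤ 1 - b := by linarith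
  have n2 : 0 ≤ (b - a) * (s * t) := by positivity
  have n3 : 0 ≤ (b - a) * (s * (1 - t)) := by positivity
  have n4 : 0 ≤ (b - a) * ((1 - s) * t) := by positivity
  have n5 : 0 ≤ (b - a) * ((1 - s) * (1 - t)) := by positivity
  have mul1 : ∫⁻ v : E ι × E ι, f v * m v.2 ≤ 1 := by
    have e : ∫⁻ v : E ι × E ι, f v * m v.2 = ∫⁻ y, ∫⁻ x, f (x, y) * m y :=
      lintegral_prod_symm _ (by fun_prop)
    rw [e]
    refine le_trans (lintegral_mono fun y => ?_) hm1
    simp only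
    rw [lintegral_mul_const _ (by fun_prop)]
    exact mul_le_of_le_one_left zero_le (hf1 y)
  set J2 : E ι × E ι → ℝ≥0∞ := fun z => ∫⁻ v, h (z, v) * k v with hJ2
  set J3 : E ι × E ι → ℝ≥0∞ := fun z => ∫⁻ v, k v * (f (z + v) * m (z.2 + v.2)) with hJ3
  set J4 : E ι × E ι → ℝ≥0∞ := fun z => ∫⁻ v, k v * f (z + v) with hJ4
  set J5 : E ι → ℝ≥0∞ := fun y => ∫⁻ v : E ι × E ι, k v * m (y + v.2) with hJ5
  have mJ2 : Measurable J2 := by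
    refine Measurable.lintegral_prod_right' (f := fun w : (E ι × E ι) × (E ι × E ι) =>
      h w * k w.2) (by fun_prop)
  have mJ3 : Measurable J3 := by
    refine Measurable.lintegral_prod_right' (f := fun w : (E ι × E ι) × (E ι × E ι) =>
      k w.2 * (f (w.1 + w.2) * m (w.1.2 + w.2.2))) (by fun_prop)
  have mJ4 : Measurable J4 := by
    refine Measurable.lintegral_prod_right' (f := fun w : (E ι × E ι) × (E ι × E ι) =>
      k w.2 * f (w.1 + w.2)) (by fun_prop)
  have mJ5 : Measurable J5 := by
    refine Measurable.lintegral_prod_right' (f := fun w : (E ι) × (E ι × E ι) =>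
      k w.2 * m (w.1 + w.2.2)) (by fun_prop)
  have iJ2 : ∫⁻ z, J2 z ≤ D := by
    rw [hJ2, lintegral_lintegral_swap (by fun_prop)]
    refine le_trans (lintegral_mono fun v => ?_) hkD
    rw [lintegral_mul_const _ (by fun_prop)]
    exact mul_le_of_le_one_left zero_le (hh1 v)
  have iJ3 : ∫⁻ z, J3 z ≤ D := by
    rw [hJ3, lintegral_lintegral_swap (by fun_prop)]
    refine le_trans (lintegral_mono fun v => ?_) hkD
    rw [lintegral_const_mul _ (by fun_prop)]
    refine mul_le_of_le_one_right zero_le ?_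
    refine le_trans (le_of_eq ?_) mul1
    exact lintegral_add_right_eq_self (fun z : E ι × E ι => f z * m z.2) v
  have iJ4 : ∀ y, ∫⁻ x, J4 (x, y) ≤ D := by
    intro y
    simp only [hJ4]
    rw [lintegral_lintegral_swap (by fun_prop)]
    refine le_trans (lintegral_mono fun v => ?_) hkD
    rw [lintegral_const_mul _ (by fun_prop)]
    refine mul_le_of_le_one_right zero_le ?_
    refine le_trans (le_of_eq ?_) (hf1 (y + v.2))
    exact lintegral_add_right_eq_self (fun x : E ι => f (x, y + v.2)) v.1
  have iJ5 : ∫⁻ y, J5 y ≤ D := by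
    rw [hJ5, lintegral_lintegral_swap (by fun_prop)]
    refine le_trans (lintegral_mono fun v => ?_) hkD
    rw [lintegral_const_mul _ (by fun_prop)]
    refine mul_le_of_le_one_right zero_le ?_
    exact (lintegral_add_right_eq_self m v.2).trans_le hm1
  set c : ℝ≥0∞ := D ^ (1 - b) * D ^ ((b - a) * ((1 - s) * (1 - t))) with hc
  have hctop : c ≠ ∞ := ENNReal.mul_ne_top (ENNReal.rpow_ne_top_of_nonneg hb' hD')
    (ENNReal.rpow_ne_top_of_nonneg n5 hD')
  have hpt : ∀ z : E ι × E ι, (∫⁻ v, h (z, v) ^ a * k v ^ b *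
      (f (z + v) ^ (1 - b + (b - a) * s) * m (z.2 + v.2) ^ (1 - b + (b - a) * t))) ≤
      c * (J5 z.2 ^ ((b - a) * ((1 - s) * t)) * (J2 z ^ a * J3 z ^ ((b - a) * (s * t)) *
        J4 z ^ ((b - a) * (s * (1 - t))))) := by
    intro z
    refine (lintegral_six_factors_le (by fun_prop) hk (by fun_prop) (by fun_prop) ha hab hb hs0 hs1
      ht0 ht1).trans ?_
    have e1 : ∫⁻ v, f (z + v) * m (z.2 + v.2) ≤ D := by
      refine le_trans (le_of_eq ?_) (mul1.trans hD)
      exact lintegral_add_left_eq_self (fun w : E ι × E ι => f w * m w.2) z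
    calc _ ≤ D ^ (1 - b) * J2 z ^ a * J3 z ^ ((b - a) * (s * t)) *
          J4 z ^ ((b - a) * (s * (1 - t))) * J5 z.2 ^ ((b - a) * ((1 - s) * t)) *
          D ^ ((b - a) * ((1 - s) * (1 - t))) := by gcongr
      _ = _ := by rw [hc]; ring
  refine (ennMixed_mono p₂ q₂ hpt).trans ?_
  rw [ennMixed_const_mul p₂ q₂ c hctop]
  have hinner : ∀ᵐ y, ‖eLpNorm (fun x => J5 y ^ ((b - a) * ((1 - s) * t)) *
      (J2 (x, y) ^ a * J3 (x, y) ^ ((b - a) * (s * t)) *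
        J4 (x, y) ^ ((b - a) * (s * (1 - t))))) p₂ volume‖ₑ ≤
      ‖D ^ ((b - a) * (s * (1 - t))) * ((∫⁻ x, J2 (x, y)) ^ a * (∫⁻ x, J3 (x, y)) ^
        ((b - a) * (s * t)) * J5 y ^ ((b - a) * ((1 - s) * t)))‖ₑ := by
    filter_upwards [ae_lt_top mJ5 (iJ5.trans_lt hD'.lt_top).ne] with y hy
    simp only [enorm_eq_self]
    rw [eLpNorm_const_mul_enn p₂ _ (ENNReal.rpow_ne_top_of_nonneg n4 hy.ne)]
    have h3 := eLpNorm_prod_three_le (μ := (volume : Measure (E ι))) hp₂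
      (f := fun x => J2 (x, y)) (g := fun x => J3 (x, y)) (h := fun x => J4 (x, y))
      (mJ2.comp (measurable_prodMk_right (y := y))).aemeasurable
      (mJ3.comp (measurable_prodMk_right (y := y))).aemeasurable
      (mJ4.comp (measurable_prodMk_right (y := y))).aemeasurable ha n2 n3 (by rw [hp]; ring)
    refine (mul_le_mul_right h3 _).trans ?_
    calc _ ≤ J5 y ^ ((b - a) * ((1 - s) * t)) * ((∫⁻ x, J2 (x, y)) ^ a *
          (∫⁻ x, J3 (x, y)) ^ ((b - a) * (s * t)) * D ^ ((b - a) * (s * (1 - t)))) := by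
          gcongr; exact iJ4 y
      _ = _ := by ring
  refine (mul_le_mul_right (eLpNorm_mono_enorm_ae hinner) c).trans ?_
  rw [eLpNorm_const_mul_enn q₂ _ (ENNReal.rpow_ne_top_of_nonneg n3 hD')]
  have mj2 : Measurable fun y => ∫⁻ x, J2 (x, y) := Measurable.lintegral_prod_left' mJ2
  have mj3 : Measurable fun y => ∫⁻ x, J3 (x, y) := Measurable.lintegral_prod_left' mJ3
  have h3 := eLpNorm_prod_three_le (μ := (volume : Measure (E ι))) hq₂ mj2.aemeasurable
    mj3.aemeasurable mJ5.aemeasurable ha n2 n4 (by rw [hq]; ring)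
  have s2 : ∫⁻ y, ∫⁻ x, J2 (x, y) ≤ D :=
    (lintegral_prod_symm (μ := volume) (ν := volume) J2 mJ2.aemeasurable).symm.trans_le iJ2
  have s3 : ∫⁻ y, ∫⁻ x, J3 (x, y) ≤ D :=
    (lintegral_prod_symm (μ := volume) (ν := volume) J3 mJ3.aemeasurable).symm.trans_le iJ3
  calc _ ≤ c * (D ^ ((b - a) * (s * (1 - t))) * (D ^ a * D ^ ((b - a) * (s * t)) *
        D ^ ((b - a) * ((1 - s) * t)))) := by
        gcongr
        refine h3.trans ?_
        gcongr
    _ = D ^ (1 - b + (b - a) * ((1 - s) * (1 - t)) + (b - a) * (s * (1 - t)) + a +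
        (b - a) * (s * t) + (b - a) * ((1 - s) * t)) := by
        rw [ENNReal.rpow_add_of_nonneg _ _ (by positivity) (by positivity),
          ENNReal.rpow_add_of_nonneg _ _ (by positivity) (by positivity),
          ENNReal.rpow_add_of_nonneg _ _ (by positivity) (by positivity),
          ENNReal.rpow_add_of_nonneg _ _ (by positivity) (by positivity),
          ENNReal.rpow_add_of_nonneg _ _ (by positivity) (by positivity), hc]
        ring
    _ = D := by
        rw [show 1 - b + (b - a) * ((1 - s) * (1 - t)) + (b - a) * (s * (1 - t)) + a +
          (b - a) * (s * t) + (b - a) * ((1 - s) * t) = 1 by ring, ENNReal.rpow_one]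

/-! ### The change of variables to symplectic coordinates -/

theorem lintegral_join (f : E (ι ⊕ κ) → ℝ≥0∞) :
    ∫⁻ z : E ι × E κ, f (join z.1 z.2) = ∫⁻ X, f X :=
  measurePreserving_join.lintegral_comp_emb (joinHomeo ι κ).toMeasurableEquiv.measurableEmbedding f

/-- The constant in the estimate of twisted kernel operators. -/
def dilConst (ι : Type) [Fintype ι] : ℝ≥0∞ :=
  max 1 (ENNReal.ofReal |((1 / 2 : ℝ) ^ Module.finrank ℝ (E (ι ⊕ ι)))⁻¹|)

theorem one_le_dilConst : 1 ≤ dilConst ι := le_max_left _ _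

theorem dilConst_ne_top : dilConst ι ≠ ∞ := by simp [dilConst]

theorem lintegral_half_join_le {k : E (ι ⊕ ι) → ℝ≥0∞} (hk : Measurable k) (h1 : ∫⁻ Y, k Y ≤ 1) :
    ∫⁻ v : E ι × E ι, k ((1 / 2 : ℝ) • join v.1 v.2) ≤ dilConst ι := by
  rw [lintegral_join (fun Y => k ((1 / 2 : ℝ) • Y))]
  have h2 : ∫⁻ Y : E (ι ⊕ ι), k ((1 / 2 : ℝ) • Y) =
      ∫⁻ Y, k Y ∂(volume : Measure (E (ι ⊕ ι))).map ((1 / 2 : ℝ) • ·) :=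
    (lintegral_map hk (measurable_const_smul _)).symm
  rw [h2, Measure.map_addHaar_smul _ (by norm_num), lintegral_smul_measure, smul_eq_mul]
  exact (mul_le_of_le_one_right zero_le h1).trans (le_max_right _ _)

/-- With `w = z + v` the second component depends on `v` alone, so the outer normalized factor of
the symbol becomes a function `k(v)`, as `ennMixed_twisted_le` requires. -/
theorem symplPoint_add (z v : E ι × E ι) :
    symplPoint z (z + v) = (join z.1 z.2 + (1 / 2 : ℝ) • join v.1 v.2,
      (1 / 2 : ℝ) • join v.1 v.2) := by
  simp only [symplPoint, Prod.fst_add, Prod.snd_add, join_add]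
  refine Prod.ext ?_ ?_
  · simp only; module
  · simp only; module

/-- Transports almost-everywhere bounds of the symbol to almost all `(z, v)`. The map consists of
the identification of phase space, a dilation of one variable and a shear, none of which affects
null sets. -/
theorem quasiMeasurePreserving_symplPoint_add :
    Measure.QuasiMeasurePreserving (fun w : (E ι × E ι) × (E ι × E ι) =>
      symplPoint w.1 (w.1 + w.2)) volume volume := by
  have hj : MeasurePreserving (fun z : E ι × E ι => join z.1 z.2) volume volume :=
    measurePreserving_join
  have h1 := (hj.prod hj).quasiMeasurePreserving
  have h2 := MeasureTheory.QuasiMeasurePreserving.prodMap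
    (Measure.QuasiMeasurePreserving.id (volume : Measure (E (ι ⊕ ι))))
    (Measure.quasiMeasurePreserving_smul (volume : Measure (E (ι ⊕ ι)))
      (by norm_num : (1 / 2 : ℝ) ≠ 0))
  have h3 := (measurePreserving_add_prod (volume : Measure (E (ι ⊕ ι)))
    (volume : Measure (E (ι ⊕ ι)))).quasiMeasurePreserving
  have h4 := h3.comp (h2.comp h1)
  have h5 : (fun w : (E ι × E ι) × (E ι × E ι) => symplPoint w.1 (w.1 + w.2)) =
      (fun z : E (ι ⊕ ι) × E (ι ⊕ ι) => (z.1 + z.2, z.2)) ∘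
      (Prod.map id fun x => (1 / 2 : ℝ) • x) ∘
      Prod.map (fun z : E ι × E ι => join z.1 z.2) fun z : E ι × E ι => join z.1 z.2 := by
    funext w
    rw [symplPoint_add]
    rfl
  rw [h5]
  exact h4

theorem exists_interpolation {a b c : ℝ} (hac : a ≤ c) (hcb : c ≤ b) :
    ∃ s : ℝ, 0 ≤ s ∧ s ≤ 1 ∧ c = a + (b - a) * s := by
  rcases eq_or_lt_of_le (hac.trans hcb) with h | h
  · exact ⟨0, le_rfl, zero_le_one, by linarith⟩
  · have hb : 0 < b - a := by linarith
    refine ⟨(c - a) / (b - a), by have : 0 ≤ c - a := by linarith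
                                  positivity, ?_, ?_⟩
    · rw [div_le_one hb]; linarith
    · field_simp; ring

/-- The exponents of the main theorem. -/
structure WeylExponents (p q p₁ q₁ p₂ q₂ : ℝ≥0∞) : Prop where
  hp : 1 ≤ p
  hq : 1 ≤ q
  hp₁ : 1 ≤ p₁
  hq₁ : 1 ≤ q₁
  hp₂ : 1 ≤ p₂
  hq₂ : 1 ≤ q₂
  hexp₁ : p₂⁻¹.toReal - p₁⁻¹.toReal = p⁻¹.toReal + q⁻¹.toReal - 1
  hexp₂ : q₂⁻¹.toReal - q₁⁻¹.toReal = p⁻¹.toReal + q⁻¹.toReal - 1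
  hqp₂ : q⁻¹.toReal ≥ p₂⁻¹.toReal
  hqq₂ : q⁻¹.toReal ≥ q₂⁻¹.toReal
  hp₂p : p₂⁻¹.toReal ≥ p⁻¹.toReal
  hq₂p : q₂⁻¹.toReal ≥ p⁻¹.toReal

theorem toReal_inv_le_one {p : ℝ≥0∞} (hp : 1 ≤ p) : p⁻¹.toReal ≤ 1 := by
  have : p⁻¹ ≤ 1 := ENNReal.inv_le_one.2 hp
  simpa using ENNReal.toReal_mono ENNReal.one_ne_top this

/-- The twisted kernel operator with kernel in `L^{p,q}` maps `L^{p₁,q₁}` to `L^{p₂,q₂}`. -/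
theorem ennMixed_kernel_le {p q p₁ q₁ p₂ q₂ : ℝ≥0∞} (h : WeylExponents p q p₁ q₁ p₂ q₂)
    {K : E (ι ⊕ ι) × E (ι ⊕ ι) → ℝ≥0∞} {F : E ι × E ι → ℝ≥0∞} (hK : AEMeasurable K volume)
    (hF : AEMeasurable F volume) (hKN : ennMixed p q K ≠ ∞) (hFN : ennMixed p₁ q₁ F ≠ ∞) :
    ennMixed p₂ q₂ (fun z => ∫⁻ w, K (symplPoint z w) * F w) ≤
      dilConst ι * (ennMixed p q K * ennMixed p₁ q₁ F) := by
  obtain ⟨g, n, hg, hn, hg1, hn1, hKle⟩ := exists_mixed_factor h.hp h.hq hK hKN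
  obtain ⟨f, m, hf, hm, hf1, hm1, hFle⟩ := exists_mixed_factor h.hp₁ h.hq₁ hF hFN
  obtain ⟨s, hs0, hs1, hs⟩ := exists_interpolation h.hp₂p h.hqp₂
  obtain ⟨t, ht0, ht1, ht⟩ := exists_interpolation h.hq₂p h.hqq₂
  set a := p⁻¹.toReal with ha
  set b := q⁻¹.toReal with hb
  -- The exponent relation gives `1/p₁ = 1/p₂ + 1 - a - b`, into which `1/p₂ = a + (b - a)s` is
  -- inserted; likewise for `q₁`.
  have hp1 : p₁⁻¹.toReal = 1 - b + (b - a) * s := by have := h.hexp₁; linarith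
  have hq1 : q₁⁻¹.toReal = 1 - b + (b - a) * t := by have := h.hexp₂; linarith
  have hj : Continuous fun v : E ι × E ι => join v.1 v.2 := continuous_join
  have hmeas : Measurable fun w : (E ι × E ι) × (E ι × E ι) => g (symplPoint w.1 (w.1 + w.2)) :=
    hg.comp (continuous_symplPoint.comp (continuous_fst.prodMk
      (continuous_fst.add continuous_snd))).measurable
  have hmk : Measurable fun v : E ι × E ι => n ((1 / 2 : ℝ) • join v.1 v.2) :=
    hn.comp (hj.const_smul (1 / 2 : ℝ)).measurable
  have key := ennMixed_twisted_le (ι := ι) h.hp₂ h.hq₂ hmeas hmk hf hm one_le_dilConst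
    dilConst_ne_top (lintegral_half_join_le hn hn1)
    (fun v => by
      simp only [symplPoint_add]
      rw [lintegral_join (fun X => g (X + (1 / 2 : ℝ) • join v.1 v.2, (1 / 2 : ℝ) • join v.1 v.2)),
        lintegral_add_right_eq_self (fun X => g (X, (1 / 2 : ℝ) • join v.1 v.2))]
      exact hg1 _)
    hf1 hm1 ENNReal.toReal_nonneg (h.hp₂p.trans h.hqp₂) (toReal_inv_le_one h.hq) hs0 hs1 ht0 ht1 hs ht
  have hNtop : ennMixed p q K * ennMixed p₁ q₁ F ≠ ∞ := ENNReal.mul_ne_top hKN hFN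
  rw [mul_comm]
  refine le_trans ?_ (mul_le_mul_right key _)
  rw [← ennMixed_const_mul _ _ _ hNtop]
  refine ennMixed_mono_ae _ _ ?_
  have hKle' := Measure.ae_ae_of_ae_prod (quasiMeasurePreserving_symplPoint_add.ae hKle)
  filter_upwards [hKle'] with z hz
  have hFz : ∀ᵐ v : E ι × E ι, F (z + v) ≤ ennMixed p₁ q₁ F *
      (f (z + v) ^ p₁⁻¹.toReal * m (z + v).2 ^ q₁⁻¹.toReal) :=
    (measurePreserving_add_left volume z).quasiMeasurePreserving.ae hFle
  rw [← lintegral_add_left_eq_self _ z, ← lintegral_const_mul' _ _ hNtop]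
  refine lintegral_mono_ae ?_
  filter_upwards [hz, hFz] with v h1 h2
  refine (mul_le_mul' h1 h2).trans (le_of_eq ?_)
  rw [hp1, hq1]
  simp only [symplPoint_add, Prod.snd_add]
  ring

/-! ### Subgaussian weights and Gaussians in mixed norm spaces -/

/-- Weights with subgaussian upper and lower bounds. -/
structure SubgaussianWeight (ω : E ι → ℝ) : Prop where
  pos : ∀ x, 0 < ω x
  aemeasurable : AEMeasurable ω volume
  gauss_bound : ∀ c : ℝ, 0 < c → ∃ C : ℝ, 0 < C ∧
    ∀ x : E ι, C⁻¹ * Real.exp (-c * ‖x‖ ^ 2) ≤ ω x ∧ ω x ≤ C * Real.exp (c * ‖x‖ ^ 2)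

theorem IsWeaklySubgaussian.subgaussianWeight {ω : E ι → ℝ} (h : IsWeaklySubgaussian ω) :
    SubgaussianWeight ω := ⟨h.pos, h.aemeasurable, h.gauss_bound⟩

theorem SubgaussianWeight.inv {ω : E ι → ℝ} (h : SubgaussianWeight ω) :
    SubgaussianWeight fun x => (ω x)⁻¹ := by
  refine ⟨fun x => inv_pos.2 (h.pos x), h.aemeasurable.inv, fun c hc => ?_⟩
  obtain ⟨C, C0, hC⟩ := h.gauss_bound c hc
  refine ⟨C, C0, fun x => ⟨?_, ?_⟩⟩
  · rw [neg_mul, Real.exp_neg, ← mul_inv]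
    exact inv_anti₀ (h.pos x) (hC x).2
  · have := inv_anti₀ (by positivity) (hC x).1
    rwa [neg_mul, Real.exp_neg, ← mul_inv, inv_inv] at this

theorem SubgaussianWeight.aemeasurable_join {ω : E (ι ⊕ κ) → ℝ} (h : SubgaussianWeight ω) :
    AEMeasurable (fun z : E ι × E κ => ω (join z.1 z.2)) volume :=
  h.aemeasurable.comp_quasiMeasurePreserving measurePreserving_join.quasiMeasurePreserving

theorem SubgaussianWeight.exists_le {ω : E (ι ⊕ ι) → ℝ} (h : SubgaussianWeight ω) {c : ℝ}
    (hc : 0 < c) : ∃ C : ℝ, 0 < C ∧ ∀ z : E ι × E ι, ω (join z.1 z.2) ≤ C * Real.exp (c * nsq z) := by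
  obtain ⟨C, C0, hC⟩ := h.gauss_bound c hc
  refine ⟨C, C0, fun z => ?_⟩
  have := (hC (join z.1 z.2)).2
  rwa [norm_sq_join] at this

theorem eLpNorm_gauss_ne_top {p : ℝ≥0∞} (hp : 1 ≤ p) {r : ℝ} (hr : 0 < r) :
    eLpNorm (fun x : E ι => ENNReal.ofReal (Real.exp (-r * ‖x‖ ^ 2))) p volume ≠ ∞ := by
  rcases eq_or_ne p ∞ with rfl | htop
  · refine ne_of_lt (lt_of_le_of_lt (?_ : _ ≤ (1 : ℝ≥0∞)) ENNReal.one_lt_top)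
    simp only [eLpNorm_exponent_top, eLpNormEssSup, enorm_eq_self]
    refine essSup_le_of_ae_le _ (ae_of_all _ fun x => ?_)
    rw [ENNReal.ofReal_le_one, Real.exp_le_one_iff]
    nlinarith [sq_nonneg ‖x‖]
  have h0 : p ≠ 0 := (one_pos.trans_le hp).ne'
  have hp0 := ENNReal.toReal_pos h0 htop
  rw [eLpNorm_eq_lintegral_rpow_enorm_toReal h0 htop]
  refine ENNReal.rpow_ne_top_of_nonneg (by positivity) ?_
  have h1 : ∀ x : E ι, ‖ENNReal.ofReal (Real.exp (-r * ‖x‖ ^ 2))‖ₑ ^ p.toReal =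
      ENNReal.ofReal (Real.exp (-(r * p.toReal) * ‖x‖ ^ 2)) := fun x => by
    rw [enorm_eq_self, ENNReal.ofReal_rpow_of_pos (Real.exp_pos _), ← Real.exp_mul]
    ring_nf
  simp only [h1]
  exact (integrable_gauss (ι := ι) (by positivity : 0 < r * p.toReal)).lintegral_lt_top.ne

theorem ennMixed_gauss_ne_top {p q : ℝ≥0∞} (hp : 1 ≤ p) (hq : 1 ≤ q) {r : ℝ} (hr : 0 < r) :
    ennMixed p q (fun z : E ι × E κ =>
      ENNReal.ofReal (Real.exp (-r * (‖z.1‖ ^ 2 + ‖z.2‖ ^ 2)))) ≠ ∞ := by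
  have h : ∀ b : E κ, eLpNorm (fun a : E ι => ENNReal.ofReal (Real.exp
      (-r * (‖a‖ ^ 2 + ‖b‖ ^ 2)))) p volume =
      eLpNorm (fun a : E ι => ENNReal.ofReal (Real.exp (-r * ‖a‖ ^ 2))) p volume *
        ENNReal.ofReal (Real.exp (-r * ‖b‖ ^ 2)) := by
    intro b
    rw [mul_comm, ← eLpNorm_const_mul_enn p _ ENNReal.ofReal_ne_top]
    congr 1
    funext a
    rw [← ENNReal.ofReal_mul (Real.exp_pos _).le, ← Real.exp_add]
    ring_nf
  simp only [ennMixed, h]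
  rw [eLpNorm_const_mul_enn q _ (eLpNorm_gauss_ne_top hp hr)]
  exact ENNReal.mul_ne_top (eLpNorm_gauss_ne_top hp hr) (eLpNorm_gauss_ne_top hq hr)

theorem ennMixed_ne_top_of_le_gauss {p q : ℝ≥0∞} (hp : 1 ≤ p) (hq : 1 ≤ q) {r M : ℝ} (hr : 0 < r)
    (hM : 0 ≤ M) {F : E ι × E κ → ℝ≥0∞}
    (hF : ∀ z, F z ≤ ENNReal.ofReal (M * Real.exp (-r * (‖z.1‖ ^ 2 + ‖z.2‖ ^ 2)))) :
    ennMixed p q F ≠ ∞ := by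
  refine ne_top_of_le_ne_top ?_ (ennMixed_mono p q hF)
  simp only [ENNReal.ofReal_mul hM]
  rw [ennMixed_const_mul _ _ _ ENNReal.ofReal_ne_top]
  exact ENNReal.mul_ne_top ENNReal.ofReal_ne_top (ennMixed_gauss_ne_top hp hq hr)

/-- A weight as a function of `(x, ξ)` with values in `[0, ∞]`. -/
def ennWeight (ω : E (ι ⊕ κ) → ℝ) (z : E ι × E κ) : ℝ≥0∞ := ENNReal.ofReal (ω (join z.1 z.2))

theorem SubgaussianWeight.aemeasurable_ennWeight {ω : E (ι ⊕ κ) → ℝ} (h : SubgaussianWeight ω) :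
    AEMeasurable (ennWeight ω) volume := h.aemeasurable_join.ennreal_ofReal

theorem SubgaussianWeight.ennWeight_mul_inv {ω : E (ι ⊕ κ) → ℝ} (h : SubgaussianWeight ω)
    (z : E ι × E κ) : ennWeight ω z * ennWeight (fun X => (ω X)⁻¹) z = 1 := by
  rw [ennWeight, ennWeight, ← ENNReal.ofReal_mul (h.pos _).le, mul_inv_cancel₀ (h.pos _).ne',
    ENNReal.ofReal_one]

theorem SubgaussianWeight.ennMixed_mul_ne_top {p q : ℝ≥0∞} (hp : 1 ≤ p) (hq : 1 ≤ q)
    {ω : E (ι ⊕ ι) → ℝ} (h : SubgaussianWeight ω) {F : E ι × E ι → ℝ≥0∞} {r M : ℝ} (hr : 0 < r)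
    (hM : 0 ≤ M) (hF : ∀ z, F z ≤ ENNReal.ofReal (M * Real.exp (-r * nsq z))) :
    ennMixed p q (fun z => F z * ennWeight ω z) ≠ ∞ := by
  obtain ⟨C, C0, hC⟩ := h.exists_le (by positivity : 0 < r / 2)
  refine ennMixed_ne_top_of_le_gauss hp hq (by positivity : 0 < r / 2)
    (by positivity : 0 ≤ M * C) fun z => ?_
  refine (mul_le_mul' (hF z) (ENNReal.ofReal_le_ofReal (hC z))).trans ?_
  rw [← ENNReal.ofReal_mul (by positivity)]
  refine ENNReal.ofReal_le_ofReal (le_of_eq ?_)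
  rw [mul_mul_mul_comm, ← Real.exp_add]
  unfold nsq
  ring_nf

theorem enorm_le_ofReal_of_norm_le {z : ℂ} {M : ℝ} (h : ‖z‖ ≤ M) : ‖z‖ₑ ≤ ENNReal.ofReal M := by
  rw [← ofReal_norm]
  exact ENNReal.ofReal_le_ofReal h

theorem enorm_wstft {ω : E (ι ⊕ ι) → ℝ} (hω : ∀ x, 0 < ω x) (u : GSDual ι) (z : E ι × E ι) :
    ‖wstft ω u z‖ₑ = ‖stft u z‖ₑ * ennWeight ω z := by
  rw [wstft, enorm_mul, ennWeight, ← ofReal_norm (((ω (join z.1 z.2) : ℝ) : ℂ)), Complex.norm_real,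
    Real.norm_of_nonneg (hω _).le]

theorem mixedNorm_wstft {p q : ℝ≥0∞} {ω : E (ι ⊕ ι) → ℝ} (hω : ∀ x, 0 < ω x) (u : GSDual ι) :
    mixedNorm p q (wstft ω u) = ennMixed p q fun z => ‖stft u z‖ₑ * ennWeight ω z := by
  simp only [mixedNorm_eq_ennMixed, enorm_wstft hω]

theorem SubgaussianWeight.aestronglyMeasurable_wstft {ω : E (ι ⊕ ι) → ℝ}
    (h : SubgaussianWeight ω) (u : GSDual ι) : AEStronglyMeasurable (wstft ω u) volume :=
  (continuous_stft u).aestronglyMeasurable.mul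
    (Complex.measurable_ofReal.comp_aemeasurable h.aemeasurable_join).aestronglyMeasurable

theorem SubgaussianWeight.memMod_iff {p q : ℝ≥0∞} {ω : E (ι ⊕ ι) → ℝ} (h : SubgaussianWeight ω)
    {u : GSDual ι} :
    MemMod p q ω u ↔ ennMixed p q (fun z => ‖stft u z‖ₑ * ennWeight ω z) ≠ ∞ := by
  rw [MemMod, MemMixed, mixedNorm_wstft h.pos, lt_top_iff_ne_top]
  exact ⟨fun h' => h'.2, fun h' => ⟨h.aestronglyMeasurable_wstft u, h'⟩⟩

theorem SubgaussianWeight.ennMixed_stft_ofGS_ne_top {p q : ℝ≥0∞} (hp : 1 ≤ p) (hq : 1 ≤ q)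
    {ω : E (ι ⊕ ι) → ℝ} (h : SubgaussianWeight ω) (f : GS ι) :
    ennMixed p q (fun z => ‖stft (ofGS f) z‖ₑ * ennWeight ω z) ≠ ∞ := by
  obtain ⟨r, M, r0, M0, hM⟩ := exists_stft_ofGS_decay f
  exact h.ennMixed_mul_ne_top hp hq r0 M0.le fun z => enorm_le_ofReal_of_norm_le (hM z)

/-- The Gelfand-Shilov space is contained in every modulation space. -/
theorem SubgaussianWeight.memMod_ofGS {p q : ℝ≥0∞} (hp : 1 ≤ p) (hq : 1 ≤ q)
    {ω : E (ι ⊕ ι) → ℝ} (h : SubgaussianWeight ω) (f : GS ι) : MemMod p q ω (ofGS f) :=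
  h.memMod_iff.2 (h.ennMixed_stft_ofGS_ne_top hp hq f)

/-! ### Operators given by kernels in the time-frequency plane -/

/-- The operator with kernel `|H|` is bounded by `C` between weighted mixed norm spaces. -/
def KernelBound (H : E ι × E ι → E ι × E ι → ℂ) (p₁ q₁ : ℝ≥0∞) (ω₁ : E (ι ⊕ ι) → ℝ) (p₂ q₂ : ℝ≥0∞)
    (ω₂ : E (ι ⊕ ι) → ℝ) (C : ℝ≥0∞) : Prop :=
  ∀ F : E ι × E ι → ℝ≥0∞, AEMeasurable F volume →
    ennMixed p₁ q₁ (fun w => F w * ennWeight ω₁ w) ≠ ∞ →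
    ennMixed p₂ q₂ (fun z => (∫⁻ w, ‖H z w‖ₑ * F w) * ennWeight ω₂ z) ≤
      C * ennMixed p₁ q₁ (fun w => F w * ennWeight ω₁ w)

/-- The function `z ↦ ∫ H(z, w) V_φ u(w) dw`. -/
def kernelApply (H : E ι × E ι → E ι × E ι → ℂ) (u : GSDual ι) (z : E ι × E ι) : ℂ :=
  ∫ w, H z w * stft u w

section KernelOperator

variable {H : E ι × E ι → E ι × E ι → ℂ} {p₁ q₁ p₂ q₂ C : ℝ≥0∞} {ω₁ ω₂ : E (ι ⊕ ι) → ℝ}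

/-- Hölder's inequality between the weighted target space, where the kernel bound places `∫ |H| |V_φ
u|`, and its dual, where `G` lies. Every exchange of integrals for kernel operators rests on this.
-/
theorem KernelBound.integrable_mul [Fact (1 ≤ p₂)] [Fact (1 ≤ q₂)]
    (hH : Continuous fun v : (E ι × E ι) × (E ι × E ι) => H v.1 v.2)
    (hB : KernelBound H p₁ q₁ ω₁ p₂ q₂ ω₂ C) (hC : C ≠ ∞) (hω₁ : SubgaussianWeight ω₁)
    (hω₂ : SubgaussianWeight ω₂) {u : GSDual ι} (hu : MemMod p₁ q₁ ω₁ u) {G : E ι × E ι → ℂ}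
    (hGm : AEStronglyMeasurable G volume)
    (hG : ennMixed p₂.conjExponent q₂.conjExponent
      (fun z => ‖G z‖ₑ * ennWeight (fun X => (ω₂ X)⁻¹) z) ≠ ∞) :
    Integrable (fun v : (E ι × E ι) × (E ι × E ι) => H v.1 v.2 * stft u v.2 * G v.1)
      (volume.prod volume) := by
  have hu' := hω₁.memMod_iff.1 hu
  have hst := continuous_stft u
  have hmeas : AEStronglyMeasurable (fun v : (E ι × E ι) × (E ι × E ι) =>
      H v.1 v.2 * stft u v.2 * G v.1) (volume.prod volume) :=
    (hH.mul (hst.comp continuous_snd)).aestronglyMeasurable.mul hGm.comp_fst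
  refine ⟨hmeas, ?_⟩
  rw [HasFiniteIntegral, lintegral_prod _ hmeas.enorm]
  have hinner : Measurable fun z => ∫⁻ w, ‖H z w‖ₑ * ‖stft u w‖ₑ := by
    refine Measurable.lintegral_prod_right' (f := fun v : (E ι × E ι) × (E ι × E ι) =>
      ‖H v.1 v.2‖ₑ * ‖stft u v.2‖ₑ) ?_
    exact hH.enorm.measurable.mul (hst.comp continuous_snd).enorm.measurable
  have e : ∀ z, ∫⁻ w, ‖H z w * stft u w * G z‖ₑ =
      ((∫⁻ w, ‖H z w‖ₑ * ‖stft u w‖ₑ) * ennWeight ω₂ z) *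
        (‖G z‖ₑ * ennWeight (fun X => (ω₂ X)⁻¹) z) := by
    intro z
    simp only [enorm_mul]
    rw [lintegral_mul_const' _ _ enorm_ne_top, mul_mul_mul_comm, hω₂.ennWeight_mul_inv, mul_one]
  simp only [e]
  refine (lintegral_mul_le_ennMixed_mul (p := p₂) (q := q₂) (p' := p₂.conjExponent)
    (q' := q₂.conjExponent) (hinner.aemeasurable.mul hω₂.aemeasurable_ennWeight)
    (hGm.enorm.mul hω₂.inv.aemeasurable_ennWeight)).trans_lt ?_
  exact ENNReal.mul_lt_top ((hB _ hst.enorm.measurable.aemeasurable hu').trans_lt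
    (ENNReal.mul_lt_top hC.lt_top hu'.lt_top)) hG.lt_top

theorem one_le_conjExponent (p : ℝ≥0∞) : 1 ≤ p.conjExponent := le_self_add

/-- A Gaussian of any rate lies in every dual space, since `1/ω₂` is subgaussian. This is the growth
condition that lets `mkDual` be applied to `kernelApply`. -/
theorem KernelBound.integrable_kernelApply_mul_exp [Fact (1 ≤ p₂)] [Fact (1 ≤ q₂)]
    (hH : Continuous fun v : (E ι × E ι) × (E ι × E ι) => H v.1 v.2)
    (hB : KernelBound H p₁ q₁ ω₁ p₂ q₂ ω₂ C) (hC : C ≠ ∞) (hω₁ : SubgaussianWeight ω₁)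
    (hω₂ : SubgaussianWeight ω₂) {u : GSDual ι} (hu : MemMod p₁ q₁ ω₁ u) (ε : ℝ) (hε : 0 < ε) :
    Integrable (fun z => ‖kernelApply H u z‖ * Real.exp (-ε * nsq z)) volume := by
  have hc : Continuous fun z : E ι × E ι => ((Real.exp (-ε * nsq z) : ℝ) : ℂ) := by
    have := continuous_nsq (ι := ι)
    fun_prop
  have h := (hB.integrable_mul hH hC hω₁ hω₂ hu (G := fun z => ((Real.exp (-ε * nsq z) : ℝ) : ℂ))
    hc.aestronglyMeasurable (hω₂.inv.ennMixed_mul_ne_top (one_le_conjExponent _)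
      (one_le_conjExponent _) hε zero_le_one fun z => enorm_le_ofReal_of_norm_le (by
        rw [Complex.norm_real, Real.norm_of_nonneg (Real.exp_pos _).le, one_mul]))).integral_prod_left
  refine h.norm.congr (ae_of_all _ fun z => ?_)
  simp only [integral_mul_const, norm_mul, Complex.norm_real]
  rw [Real.norm_of_nonneg (Real.exp_pos _).le, kernelApply]

theorem aestronglyMeasurable_kernelApply
    (hH : Continuous fun v : (E ι × E ι) × (E ι × E ι) => H v.1 v.2) (u : GSDual ι) :
    AEStronglyMeasurable (kernelApply H u) volume :=
  (hH.mul ((continuous_stft u).comp continuous_snd)).aestronglyMeasurable.integral_prod_right'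

/-- The reproducing property of a kernel. -/
def Reproducing (H : E ι × E ι → E ι × E ι → ℂ) : Prop :=
  ∀ z₀ w, H z₀ w = ∫ z, H z w * stft (ofGS ⟨stftAtom z₀, stftAtom_mem z₀⟩) (flipFreq z)

theorem SubgaussianWeight.ennMixed_stft_ofGS_flip_ne_top {p q : ℝ≥0∞} (hp : 1 ≤ p) (hq : 1 ≤ q)
    {ω : E (ι ⊕ ι) → ℝ} (h : SubgaussianWeight ω) (f : GS ι) :
    ennMixed p q (fun z => ‖stft (ofGS f) (flipFreq z)‖ₑ * ennWeight ω z) ≠ ∞ := by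
  obtain ⟨r, M, r0, M0, hM⟩ := exists_stft_ofGS_decay f
  refine h.ennMixed_mul_ne_top hp hq r0 M0.le fun z => enorm_le_ofReal_of_norm_le ?_
  have := hM (flipFreq z)
  rwa [nsq_flipFreq] at this

/-- The operator with kernel `H` between modulation spaces. -/
theorem KernelBound.exists_operator [Fact (1 ≤ p₁)] [Fact (1 ≤ q₁)] [Fact (1 ≤ p₂)] [Fact (1 ≤ q₂)]
    (hH : Continuous fun v : (E ι × E ι) × (E ι × E ι) => H v.1 v.2) (hR : Reproducing H)
    (hB : KernelBound H p₁ q₁ ω₁ p₂ q₂ ω₂ C) (hC : C ≠ ∞) (hω₁ : SubgaussianWeight ω₁)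
    (hω₂ : SubgaussianWeight ω₂) :
    ∃ T : ModSpace p₁ q₁ ω₁ →L[ℂ] ModSpace p₂ q₂ ω₂,
      (∀ u, stft (T u : GSDual ι) = kernelApply H (u : GSDual ι)) ∧ ‖T‖ ≤ C.toReal := by
  -- A general function on phase space is not a short-time Fourier transform; here the reproducing
  -- property, with Fubini, shows that the function used to build the distribution is its transform.
  have hstft : ∀ u : ModSpace p₁ q₁ ω₁, stft (mkDual (kernelApply H (u : GSDual ι))
      (aestronglyMeasurable_kernelApply hH u)
      (hB.integrable_kernelApply_mul_exp hH hC hω₁ hω₂ u.2)) = kernelApply H (u : GSDual ι) := by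
    intro u
    funext z₀
    have h1 := pair_mkDual (aestronglyMeasurable_kernelApply hH (u : GSDual ι))
      (hB.integrable_kernelApply_mul_exp hH hC hω₁ hω₂ u.2) ⟨stftAtom z₀, stftAtom_mem z₀⟩
    have hint := hB.integrable_mul hH hC hω₁ hω₂ u.2
      ((continuous_stft (ofGS ⟨stftAtom z₀, stftAtom_mem z₀⟩)).comp
        continuous_flipFreq).aestronglyMeasurable
      (hω₂.inv.ennMixed_stft_ofGS_flip_ne_top (one_le_conjExponent _) (one_le_conjExponent _) _)
    rw [stft, h1]
    simp only [kernelApply, ← integral_mul_const]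
    refine (integral_integral_swap hint).trans ?_
    congr 1
    funext w
    rw [hR z₀ w, ← integral_mul_const]
    congr 1
    funext z
    ring
  have hle : ∀ u : ModSpace p₁ q₁ ω₁,
      mixedNorm p₂ q₂ (wstft ω₂ (mkDual (kernelApply H (u : GSDual ι))
        (aestronglyMeasurable_kernelApply hH u)
        (hB.integrable_kernelApply_mul_exp hH hC hω₁ hω₂ u.2))) ≤
      C * mixedNorm p₁ q₁ (wstft ω₁ (u : GSDual ι)) := by
    intro u
    have hu := hω₁.memMod_iff.1 u.2
    rw [mixedNorm_wstft hω₂.pos, mixedNorm_wstft hω₁.pos, hstft u]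
    refine (ennMixed_mono _ _ fun z => ?_).trans
      (hB _ (continuous_stft (u : GSDual ι)).enorm.measurable.aemeasurable hu)
    gcongr
    refine (enorm_integral_le_lintegral_enorm _).trans (le_of_eq ?_)
    simp only [enorm_mul]
  -- The integrals converge only for almost every `z`, so additivity is asserted almost everywhere;
  -- that is enough, as distributions with almost everywhere equal transforms coincide.
  have hadd : ∀ (u v : ModSpace p₁ q₁ ω₁), kernelApply H ((u + v : ModSpace p₁ q₁ ω₁) : GSDual ι)
      =ᵐ[volume] kernelApply H (u : GSDual ι) + kernelApply H (v : GSDual ι) := by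
    intro u v
    have hfin : ∀ u : ModSpace p₁ q₁ ω₁, ∀ᵐ z, Integrable (fun w => H z w * stft (u : GSDual ι) w)
        volume := by
      intro u
      have hc : Continuous fun z : E ι × E ι => ((Real.exp (-1 * nsq z) : ℝ) : ℂ) := by
        have := continuous_nsq (ι := ι)
        fun_prop
      have h := (hB.integrable_mul hH hC hω₁ hω₂ u.2
        (G := fun z => ((Real.exp (-1 * nsq z) : ℝ) : ℂ)) hc.aestronglyMeasurable
        (hω₂.inv.ennMixed_mul_ne_top (one_le_conjExponent _)
          (one_le_conjExponent _) one_pos zero_le_one fun z => enorm_le_ofReal_of_norm_le (by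
          rw [Complex.norm_real, Real.norm_of_nonneg (Real.exp_pos _).le, one_mul]))).prod_right_ae
      filter_upwards [h] with z hz
      refine (hz.mul_const ((Real.exp (-1 * nsq z) : ℝ) : ℂ)⁻¹).congr (ae_of_all _ fun w => ?_)
      simp only
      rw [mul_assoc, mul_inv_cancel₀ (Complex.ofReal_ne_zero.2 (Real.exp_pos _).ne'), mul_one]
    filter_upwards [hfin u, hfin v] with z h1 h2
    simp only [kernelApply, Pi.add_apply, Submodule.coe_add, stft_add, mul_add]
    exact integral_add h1 h2
  have hex : ∀ u : ModSpace p₁ q₁ ω₁, ∃ v : ModSpace p₂ q₂ ω₂,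
      stft (v : GSDual ι) = kernelApply H (u : GSDual ι) ∧
      mixedNorm p₂ q₂ (wstft ω₂ (v : GSDual ι)) ≤ C * mixedNorm p₁ q₁ (wstft ω₁ (u : GSDual ι)) :=
    fun u => ⟨⟨_, hω₂.aestronglyMeasurable_wstft _,
      (hle u).trans_lt (ENNReal.mul_lt_top hC.lt_top u.2.2)⟩, hstft u, hle u⟩
  choose S hS hSle using hex
  let L : ModSpace p₁ q₁ ω₁ →ₗ[ℂ] ModSpace p₂ q₂ ω₂ :=
    { toFun := S
      map_add' := fun u v => by
        refine Subtype.ext (GSDual.ext_stft ?_)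
        rw [Submodule.coe_add, stft_add, hS, hS, hS]
        exact hadd u v
      map_smul' := fun c u => by
        refine Subtype.ext (GSDual.ext_stft (EventuallyEq.of_eq ?_))
        rw [RingHom.id_apply, Submodule.coe_smul, stft_smul, hS, hS]
        funext z
        simp only [kernelApply, Pi.smul_apply, Submodule.coe_smul, stft_smul, smul_eq_mul]
        rw [← integral_const_mul]
        congr 1
        funext w
        ring }
  have hL : ∀ u, ‖L u‖ ≤ C.toReal * ‖u‖ := by
    intro u
    rw [ModSpace.norm_def, ModSpace.norm_def, ← ENNReal.toReal_mul]
    exact ENNReal.toReal_mono (ENNReal.mul_ne_top hC u.2.2.ne) (hSle u)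
  exact ⟨L.mkContinuous C.toReal hL, hS, L.mkContinuous_norm_le ENNReal.toReal_nonneg hL⟩

end KernelOperator

/-! ### Weyl operators on modulation spaces -/

theorem toReal_inv_conjExponent {p : ℝ≥0∞} (hp : 1 ≤ p) :
    p.conjExponent⁻¹.toReal = 1 - p⁻¹.toReal := by
  have h : p.HolderConjugate p.conjExponent := ENNReal.HolderConjugate.conjExponent hp
  have h1 := h.inv_add_inv_eq_one
  have h2 : p⁻¹ ≠ ∞ := ENNReal.inv_ne_top.2 (one_pos.trans_le hp).ne'
  have h3 : p.conjExponent⁻¹ ≠ ∞ :=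
    ENNReal.inv_ne_top.2 (one_pos.trans_le (one_le_conjExponent p)).ne'
  have := congrArg ENNReal.toReal h1
  rw [ENNReal.toReal_add h2 h3, ENNReal.toReal_one] at this
  linarith

/-- `1 - 1/p₁ = 1/p + 1/q - 1/p₂` is the reflection of `1/p₂` in the midpoint of `[1/p, 1/q]`, so it
lies in the same interval; likewise for `q₁` and `q₂`. -/
theorem WeylExponents.adjoint {p q p₁ q₁ p₂ q₂ : ℝ≥0∞} (h : WeylExponents p q p₁ q₁ p₂ q₂) :
    WeylExponents p q p₂.conjExponent q₂.conjExponent p₁.conjExponent q₁.conjExponent := by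
  have e1 := toReal_inv_conjExponent h.hp₁
  have e2 := toReal_inv_conjExponent h.hq₁
  have e3 := toReal_inv_conjExponent h.hp₂
  have e4 := toReal_inv_conjExponent h.hq₂
  have := h.hexp₁
  have := h.hexp₂
  have := h.hqp₂
  have := h.hqq₂
  have := h.hp₂p
  have := h.hq₂p
  refine ⟨h.hp, h.hq, one_le_conjExponent _, one_le_conjExponent _, one_le_conjExponent _,
    one_le_conjExponent _, ?_, ?_, ?_, ?_, ?_, ?_⟩ <;> linarith

theorem SubgaussianWeight.aestronglyMeasurable_wsymplStft {ω : E ((ι ⊕ ι) ⊕ (ι ⊕ ι)) → ℝ}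
    (h : SubgaussianWeight ω) (a : GSDual (ι ⊕ ι)) :
    AEStronglyMeasurable (wsymplStft ω a) volume :=
  (continuous_pair_symplAtom a).aestronglyMeasurable.mul
    (Complex.measurable_ofReal.comp_aemeasurable h.aemeasurable_join).aestronglyMeasurable

theorem symplPoint_fst_sub_snd (z w : E ι × E ι) :
    (symplPoint z w).1 - (symplPoint z w).2 = join z.1 z.2 := by
  simp only [symplPoint]; module

theorem symplPoint_fst_add_snd (z w : E ι × E ι) :
    (symplPoint z w).1 + (symplPoint z w).2 = join w.1 w.2 := by
  simp only [symplPoint]; module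

/-- The compatibility condition between the weight of the symbol and the weights of the modulation
spaces. -/
def WeightBound (ω : E ((ι ⊕ ι) ⊕ (ι ⊕ ι)) → ℝ) (ω₁ ω₂ : E (ι ⊕ ι) → ℝ) (C : ℝ) : Prop :=
  ∀ X Y : E (ι ⊕ ι), ω₂ (X - Y) / ω₁ (X + Y) ≤ C * ω (join X Y)

/-- The constant in the norm estimate of Weyl operators. -/
def weylBoundConst (ι : Type) [Fintype ι] (C : ℝ) : ℝ≥0∞ :=
  ‖kernelConst ι‖ₑ * ENNReal.ofReal C * dilConst ι

theorem weylBoundConst_ne_top (C : ℝ) : weylBoundConst ι C ≠ ∞ :=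
  ENNReal.mul_ne_top (ENNReal.mul_ne_top enorm_ne_top ENNReal.ofReal_ne_top) dilConst_ne_top

section Bounds

variable {p q p₁ q₁ p₂ q₂ : ℝ≥0∞} {ω : E ((ι ⊕ ι) ⊕ (ι ⊕ ι)) → ℝ} {ω₁ ω₂ : E (ι ⊕ ι) → ℝ} {C : ℝ}

/-- At `symplPoint z w` one has `X - Y = z` and `X + Y = w`, so the weight condition reads `ω₂(z) ≤
C ω(X, Y) ω₁(w)`. -/
theorem weylKernel_mul_weight_le (hω : SubgaussianWeight ω) (hω₁ : SubgaussianWeight ω₁)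
    (hC : 0 < C) (hW : WeightBound ω ω₁ ω₂ C)
    (a : GSDual (ι ⊕ ι)) (z w : E ι × E ι) :
    ‖weylKernel a z w‖ₑ * ennWeight ω₂ z ≤ ‖kernelConst ι‖ₑ * ENNReal.ofReal C *
      (‖wsymplStft ω a (symplPoint z w)‖ₑ * ennWeight ω₁ w) := by
  have h1 : ‖weylKernel a z w‖ₑ =
      ‖kernelConst ι‖ₑ * ‖pair a (symplAtom (symplPoint z w))‖ₑ := by
    rw [← ofReal_norm, norm_weylKernel, ENNReal.ofReal_mul (norm_nonneg _), ofReal_norm, ofReal_norm]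
  have h2 : ‖wsymplStft ω a (symplPoint z w)‖ₑ = ‖pair a (symplAtom (symplPoint z w))‖ₑ *
      ENNReal.ofReal (ω (join (symplPoint z w).1 (symplPoint z w).2)) := by
    rw [wsymplStft, enorm_mul, ← ofReal_norm (Complex.ofReal _), Complex.norm_real,
      Real.norm_of_nonneg (hω.pos _).le]
  have h3 : ennWeight ω₂ z ≤ ENNReal.ofReal C *
      ENNReal.ofReal (ω (join (symplPoint z w).1 (symplPoint z w).2)) * ennWeight ω₁ w := by
    rw [ennWeight, ennWeight, ← ENNReal.ofReal_mul hC.le,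
      ← ENNReal.ofReal_mul (mul_nonneg hC.le (hω.pos _).le)]
    refine ENNReal.ofReal_le_ofReal ?_
    have := hW (symplPoint z w).1 (symplPoint z w).2
    rwa [symplPoint_fst_sub_snd, symplPoint_fst_add_snd, div_le_iff₀ (hω₁.pos _)] at this
  rw [h1, h2]
  calc _ ≤ ‖kernelConst ι‖ₑ * ‖pair a (symplAtom (symplPoint z w))‖ₑ * (ENNReal.ofReal C *
      ENNReal.ofReal (ω (join (symplPoint z w).1 (symplPoint z w).2)) * ennWeight ω₁ w) := by gcongr
    _ = _ := by ring

theorem kernelBound_of_le (h : WeylExponents p q p₁ q₁ p₂ q₂) (hω₁ : SubgaussianWeight ω₁)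
    {H : E ι × E ι → E ι × E ι → ℂ} {K : E (ι ⊕ ι) × E (ι ⊕ ι) → ℝ≥0∞} {D : ℝ≥0∞}
    (hD : D ≠ ∞) (hK : AEMeasurable K volume) (hKN : ennMixed p q K ≠ ∞)
    (hle : ∀ z w, ‖H z w‖ₑ * ennWeight ω₂ z ≤ D * (K (symplPoint z w) * ennWeight ω₁ w)) :
    KernelBound H p₁ q₁ ω₁ p₂ q₂ ω₂ (D * dilConst ι * ennMixed p q K) := by
  intro F hF hFN
  calc _ ≤ ennMixed p₂ q₂ (fun z => D * ∫⁻ w, K (symplPoint z w) * (F w * ennWeight ω₁ w)) := by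
        refine ennMixed_mono _ _ fun z => ?_
        rw [← lintegral_const_mul' _ _ hD, ← lintegral_mul_const' _ _
          (show ennWeight ω₂ z ≠ ∞ from ENNReal.ofReal_ne_top)]
        refine lintegral_mono fun w => ?_
        calc ‖H z w‖ₑ * F w * ennWeight ω₂ z = (‖H z w‖ₑ * ennWeight ω₂ z) * F w := by ring
          _ ≤ (D * (K (symplPoint z w) * ennWeight ω₁ w)) * F w := mul_le_mul' (hle z w) le_rfl
          _ = _ := by ring
    _ = D * ennMixed p₂ q₂ (fun z => ∫⁻ w, K (symplPoint z w) * (F w * ennWeight ω₁ w)) :=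
        ennMixed_const_mul _ _ _ hD _
    _ ≤ D * (dilConst ι * (ennMixed p q K * ennMixed p₁ q₁ (fun w => F w * ennWeight ω₁ w))) := by
        gcongr
        exact ennMixed_kernel_le h hK (hF.mul hω₁.aemeasurable_ennWeight) hKN hFN
    _ = _ := by ring

/-- The Weyl kernel is bounded between weighted mixed norm spaces. -/
theorem kernelBound_weylKernel (h : WeylExponents p q p₁ q₁ p₂ q₂) (hω : SubgaussianWeight ω)
    (hω₁ : SubgaussianWeight ω₁) (hC : 0 < C) (hW : WeightBound ω ω₁ ω₂ C) {a : GSDual (ι ⊕ ι)}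
    (ha : symbolNorm p q ω a ≠ ∞) :
    KernelBound (weylKernel a) p₁ q₁ ω₁ p₂ q₂ ω₂ (weylBoundConst ι C * symbolNorm p q ω a) := by
  rw [symbolNorm, mixedNorm_eq_ennMixed] at ha ⊢
  exact kernelBound_of_le h hω₁ (ENNReal.mul_ne_top enorm_ne_top ENNReal.ofReal_ne_top)
    (hω.aestronglyMeasurable_wsymplStft a).enorm ha
    (weylKernel_mul_weight_le hω hω₁ hC hW a)

theorem ennMixed_neg_snd {A B : Type} [MeasureSpace A] [MeasureSpace B] [AddGroup B]
    [MeasurableNeg B] [(volume : Measure B).IsNegInvariant] (p q : ℝ≥0∞) (F : A × B → ℝ≥0∞) :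
    ennMixed p q (fun z => F (z.1, -z.2)) = ennMixed p q F := by
  unfold ennMixed
  have h := (MeasurableEquiv.neg B).measurableEmbedding.eLpNorm_map_measure
    (μ := (volume : Measure B)) (p := q)
    (g := fun b => eLpNorm (fun a => F (a, b)) p (volume : Measure A))
  have h2 : Measure.map (⇑(MeasurableEquiv.neg B)) (volume : Measure B) = volume :=
    (Measure.measurePreserving_neg (volume : Measure B)).map_eq
  rw [h2] at h
  exact h.symm

theorem symplPoint_swap (z w : E ι × E ι) :
    symplPoint z w = ((symplPoint w z).1, -(symplPoint w z).2) := by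
  simp only [symplPoint]
  refine Prod.ext ?_ ?_
  · simp only; module
  · simp only; module

/-- The adjoint of the Weyl kernel. -/
def weylKernelAdj (a : GSDual (ι ⊕ ι)) (w z : E ι × E ι) : ℂ :=
  (starRingEnd ℂ) (weylKernel a z w)

theorem continuous_weylKernelAdj (a : GSDual (ι ⊕ ι)) :
    Continuous fun v : (E ι × E ι) × (E ι × E ι) => weylKernelAdj a v.1 v.2 := by
  have h : Continuous fun v : (E ι × E ι) × (E ι × E ι) => weylKernel a v.2 v.1 :=
    (continuous_weylKernel a).comp (f := fun v : (E ι × E ι) × (E ι × E ι) => (v.2, v.1))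
      (by fun_prop)
  unfold weylKernelAdj
  exact Complex.continuous_conj.comp h

/-- The adjoint of the Weyl kernel is bounded between the dual weighted mixed norm spaces. -/
theorem kernelBound_weylKernelAdj (h : WeylExponents p q p₁ q₁ p₂ q₂) (hω : SubgaussianWeight ω)
    (hω₁ : SubgaussianWeight ω₁) (hω₂ : SubgaussianWeight ω₂) (hC : 0 < C)
    (hW : WeightBound ω ω₁ ω₂ C) {a : GSDual (ι ⊕ ι)} (ha : symbolNorm p q ω a ≠ ∞) :
    KernelBound (weylKernelAdj a) p₂.conjExponent q₂.conjExponent (fun X => (ω₂ X)⁻¹)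
      p₁.conjExponent q₁.conjExponent (fun X => (ω₁ X)⁻¹)
      (weylBoundConst ι C * symbolNorm p q ω a) := by
  rw [symbolNorm, mixedNorm_eq_ennMixed] at ha ⊢
  -- Exchanging `z` and `w` changes the sign of `Y` only, and the mixed norm is invariant under this
  -- reflection.
  rw [← ennMixed_neg_snd] at ha ⊢
  have hm : AEMeasurable (fun Z : E (ι ⊕ ι) × E (ι ⊕ ι) => ‖wsymplStft ω a (Z.1, -Z.2)‖ₑ) volume := by
    have hq : MeasurePreserving (fun Z : E (ι ⊕ ι) × E (ι ⊕ ι) => (Z.1, -Z.2)) volume volume :=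
      measurePreserving_flipFreq
    exact (hω.aestronglyMeasurable_wsymplStft a).enorm.comp_quasiMeasurePreserving
      hq.quasiMeasurePreserving
  refine kernelBound_of_le h.adjoint hω₂.inv
    (ENNReal.mul_ne_top enorm_ne_top ENNReal.ofReal_ne_top) hm ha fun w z => ?_
  have h1 := weylKernel_mul_weight_le hω hω₁ hC hW a z w
  rw [← symplPoint_swap z w]
  have h2 : ‖weylKernelAdj a w z‖ₑ = ‖weylKernel a z w‖ₑ := by
    rw [weylKernelAdj, ← ofReal_norm, ← ofReal_norm, RCLike.norm_conj]
  rw [h2]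
  calc ‖weylKernel a z w‖ₑ * ennWeight (fun X => (ω₁ X)⁻¹) w
      = ‖weylKernel a z w‖ₑ * ennWeight ω₂ z * (ennWeight (fun X => (ω₂ X)⁻¹) z *
        ennWeight (fun X => (ω₁ X)⁻¹) w) := by
        rw [mul_assoc, ← mul_assoc (ennWeight ω₂ z), hω₂.ennWeight_mul_inv, one_mul]
    _ ≤ ‖kernelConst ι‖ₑ * ENNReal.ofReal C *
      (‖wsymplStft ω a (symplPoint z w)‖ₑ * ennWeight ω₁ w) * (ennWeight (fun X => (ω₂ X)⁻¹) z *
        ennWeight (fun X => (ω₁ X)⁻¹) w) := by gcongr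
    _ = ‖kernelConst ι‖ₑ * ENNReal.ofReal C * (‖wsymplStft ω a (symplPoint z w)‖ₑ *
        ennWeight (fun X => (ω₂ X)⁻¹) z) * (ennWeight ω₁ w * ennWeight (fun X => (ω₁ X)⁻¹) w) := by
        ring
    _ = _ := by rw [hω₁.ennWeight_mul_inv, mul_one]

end Bounds

theorem conj_stftAtom (z : E ι × E ι) (y : E ι) :
    (starRingEnd ℂ) (stftAtom z y) = stftAtom (flipFreq z) y := by
  simp only [stftAtom, flipFreq, map_mul, Complex.conj_ofReal, ← Complex.exp_conj, map_neg,
    Complex.conj_I, inner_neg_right, Complex.ofReal_neg]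
  ring_nf

theorem conj_stft_ofGS_stftAtom (z w : E ι × E ι) :
    (starRingEnd ℂ) (stft (ofGS ⟨stftAtom z, stftAtom_mem z⟩) w) =
      stft (ofGS ⟨stftAtom (flipFreq z), stftAtom_mem (flipFreq z)⟩) (flipFreq w) := by
  rw [stft, stft, pair_ofGS _ (stftAtom_mem _), pair_ofGS _ (stftAtom_mem _), ← integral_conj]
  simp only [map_mul, conj_stftAtom]

theorem reproducing_weylKernel (a : GSDual (ι ⊕ ι)) : Reproducing (weylKernel a) :=
  weylKernel_eq_integral_left a

theorem reproducing_weylKernelAdj (a : GSDual (ι ⊕ ι)) : Reproducing (weylKernelAdj a) := by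
  intro w₀ z
  rw [weylKernelAdj, weylKernel_eq_integral_right, ← integral_conj]
  congr 1
  funext w
  rw [map_mul, conj_stft_ofGS_stftAtom, flipFreq_flipFreq, weylKernelAdj]

/-- Fubini's theorem, justified by `KernelBound.integrable_mul` with `G` the conjugate of `V_φ g`.
-/
theorem l2Form_kernelApply {H : E ι × E ι → E ι × E ι → ℂ} {p₁ q₁ p₂ q₂ C : ℝ≥0∞}
    {ω₁ ω₂ : E (ι ⊕ ι) → ℝ} [Fact (1 ≤ p₂)] [Fact (1 ≤ q₂)]
    (hH : Continuous fun v : (E ι × E ι) × (E ι × E ι) => H v.1 v.2)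
    (hB : KernelBound H p₁ q₁ ω₁ p₂ q₂ ω₂ C) (hC : C ≠ ∞) (hω₁ : SubgaussianWeight ω₁)
    (hω₂ : SubgaussianWeight ω₂) {u g v k : GSDual ι} (hu : MemMod p₁ q₁ ω₁ u)
    (hg : MemMod p₂.conjExponent q₂.conjExponent (fun X => (ω₂ X)⁻¹) g)
    (hv : stft v = kernelApply H u)
    (hk : stft k = kernelApply (fun w z => (starRingEnd ℂ) (H z w)) g) :
    l2Form v g = l2Form u k := by
  have hg' := hω₂.inv.memMod_iff.1 hg
  have hnorm : ∀ c : ℂ, ‖(starRingEnd ℂ) c‖ₑ = ‖c‖ₑ := fun c => by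
    rw [← ofReal_norm, ← ofReal_norm, RCLike.norm_conj]
  have hint := hB.integrable_mul hH hC hω₁ hω₂ hu (G := fun z => (starRingEnd ℂ) (stft g z))
    (Complex.continuous_conj.comp (continuous_stft g)).aestronglyMeasurable (by
      simp only [hnorm]; exact hg')
  simp only [l2Form, hv, hk, kernelApply]
  simp only [← integral_mul_const]
  refine (integral_integral_swap hint).trans ?_
  congr 1
  funext w
  rw [← integral_conj, ← integral_const_mul]
  congr 1
  funext z
  rw [map_mul, Complex.conj_conj]
  ring

theorem continuous_weakTopology_l2Form {p q : ℝ≥0∞} [Fact (1 ≤ p)] [Fact (1 ≤ q)]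
    {ω : E (ι ⊕ ι) → ℝ} {g : GSDual ι}
    (hg : MemMod p.conjExponent q.conjExponent (fun X => (ω X)⁻¹) g) :
    Continuous[weakTopology p q ω, inferInstance] fun u : ModSpace p q ω =>
      l2Form (u : GSDual ι) g :=
  @Continuous.comp _ _ _ (weakTopology p q ω) _ _
    (fun (f : ModSpace p q ω)
      (g : {g : GSDual ι // MemMod p.conjExponent q.conjExponent (fun X => (ω X)⁻¹) g}) =>
        l2Form (f : GSDual ι) (g : GSDual ι)) (fun F => F ⟨g, hg⟩) (continuous_apply _)
    continuous_induced_dom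

/-- The extension of a Weyl operator to modulation spaces. -/
theorem exists_weyl_extension {p q p₁ q₁ p₂ q₂ : ℝ≥0∞} {ω : E ((ι ⊕ ι) ⊕ (ι ⊕ ι)) → ℝ}
    {ω₁ ω₂ : E (ι ⊕ ι) → ℝ} {C : ℝ} [Fact (1 ≤ p₁)] [Fact (1 ≤ q₁)] [Fact (1 ≤ p₂)] [Fact (1 ≤ q₂)]
    (h : WeylExponents p q p₁ q₁ p₂ q₂) (hω : SubgaussianWeight ω)
    (hω₁ : SubgaussianWeight ω₁) (hω₂ : SubgaussianWeight ω₂) (hC : 0 < C)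
    (hW : WeightBound ω ω₁ ω₂ C) {a : GSDual (ι ⊕ ι)} (ha : symbolNorm p q ω a ≠ ∞) :
    ∃ T : ModSpace p₁ q₁ ω₁ →L[ℂ] ModSpace p₂ q₂ ω₂,
      (∀ u, stft (T u : GSDual ι) = kernelApply (weylKernel a) (u : GSDual ι)) ∧
      ‖T‖ ≤ (weylBoundConst ι C * symbolNorm p q ω a).toReal ∧
      ExtendsWeyl a T ∧ Continuous[weakTopology p₁ q₁ ω₁, weakTopology p₂ q₂ ω₂] T := by
  have hN : weylBoundConst ι C * symbolNorm p q ω a ≠ ∞ :=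
    ENNReal.mul_ne_top (weylBoundConst_ne_top C) ha
  have hB := kernelBound_weylKernel h hω hω₁ hC hW ha
  have hB' := kernelBound_weylKernelAdj h hω hω₁ hω₂ hC hW ha
  obtain ⟨T, hT, hTn⟩ := hB.exists_operator (continuous_weylKernel a) (reproducing_weylKernel a)
    hN hω₁ hω₂
  have : Fact (1 ≤ p₁.conjExponent) := ⟨one_le_conjExponent _⟩
  have : Fact (1 ≤ q₁.conjExponent) := ⟨one_le_conjExponent _⟩
  have : Fact (1 ≤ p₂.conjExponent) := ⟨one_le_conjExponent _⟩
  have : Fact (1 ≤ q₂.conjExponent) := ⟨one_le_conjExponent _⟩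
  -- The adjoint maps the test space of the weak topology of the target into that of the source, so
  -- each form `u ↦ (T u, g) = (u, S g)` is weakly continuous.
  obtain ⟨S, hS, -⟩ := hB'.exists_operator (continuous_weylKernelAdj a)
    (reproducing_weylKernelAdj a) hN hω₂.inv hω₁.inv
  refine ⟨T, hT, hTn, fun f => ⟨hω₁.memMod_ofGS h.hp₁ h.hq₁ f, fun g => ?_⟩, ?_⟩
  · rw [← pair_coe, pair_eq_integral_stft, hT, weylForm_eq_integral]
    rfl
  · refine continuous_induced_rng.2
      (@continuous_pi _ _ _ (weakTopology p₁ q₁ ω₁) _ _ fun g => ?_)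
    have e : ∀ u : ModSpace p₁ q₁ ω₁, l2Form (T u : GSDual ι) (g : GSDual ι) =
        l2Form (u : GSDual ι) (S ⟨g.1, g.2⟩ : GSDual ι) := fun u =>
      l2Form_kernelApply (continuous_weylKernel a) hB hN hω₁ hω₂ u.2 g.2 (hT u) (hS _)
    have hc := continuous_weakTopology_l2Form (S ⟨g.1, g.2⟩).2
    rw [← funext e] at hc
    exact hc

/-! ### Regularization by dilations of the short-time Fourier transform -/

/-- The Gaussian factor that accompanies the dilation by `lam` of a short-time Fourier transform. -/
def dilFactor (lam : ℝ) (z : E ι × E ι) : ℂ :=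
  Complex.exp (((-(1 - lam ^ 2) * nsq z / 4 : ℝ) : ℂ) +
    Complex.I * ((-(1 - lam ^ 2) * inner ℝ z.1 z.2 / 2 : ℝ) : ℂ))

theorem norm_dilFactor (lam : ℝ) (z : E ι × E ι) :
    ‖dilFactor lam z‖ = Real.exp (-(1 - lam ^ 2) * nsq z / 4) := by
  rw [dilFactor, Complex.norm_exp]
  congr 1
  simp only [Complex.add_re, Complex.ofReal_re, Complex.mul_re, Complex.I_re, Complex.I_im,
    Complex.ofReal_im]
  ring

theorem continuous_dilFactor : Continuous fun v : ℝ × (E ι × E ι) => dilFactor v.1 v.2 := by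
  unfold dilFactor nsq
  fun_prop

/-- The product of the two Gaussians in the integration variable is a Gaussian of rate `b = s + 1/2`
about the weighted mean of their centres, which is `λy + (1-λ²)x/2`. The relation `b(1-λ²) = 1`
makes the remaining quadratic form in `(x, y)` that of an atom at `λx`, up to factors in `x` alone
and in `y` alone. -/
theorem mehler_integrand {lam s b : ℝ} (hb : b * (1 - lam ^ 2) = 1) (hs : s + 1 / 2 = b)
    (hs0 : s ≠ 0) (y x ξ t : E ι) :
    gAtom s ((b * lam / s) • y) 0 (t + (lam • y + ((1 - lam ^ 2) / 2) • x)) *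
      gAtom (1 / 2) x (-ξ) (t + (lam • y + ((1 - lam ^ 2) / 2) • x)) =
    Complex.exp (((s - b ^ 2 * lam ^ 2 / s) * ‖y‖ ^ 2 : ℝ) : ℂ) * dilFactor lam (x, ξ) *
      gAtom (1 / 2) (lam • x) (-(lam • ξ)) y * Complex.exp ((((1 - lam ^ 2) / 4 * ‖ξ‖ ^ 2 : ℝ) : ℂ)) *
      Complex.exp (-(b : ℂ) * (‖t‖ : ℂ) ^ 2 + Complex.I * ((inner ℝ (-ξ) t : ℝ) : ℂ)) := by
  simp only [gAtom, dilFactor, ← Complex.exp_add, nsq]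
  congr 1
  have key : ∀ a b c d : ℝ, a = c → b = d → (a : ℂ) + Complex.I * b = c + Complex.I * d := by
    rintro a b c d rfl rfl; rfl
  obtain rfl : b = s + 1 / 2 := hs.symm
  have hsl : s * (1 - lam ^ 2) = (1 + lam ^ 2) / 2 := by linarith
  have h1 : (-s * ‖t + (lam • y + ((1 - lam ^ 2) / 2) • x) - ((s + 1 / 2) * lam / s) • y‖ ^ 2 +
      -(1 / 2) * ‖t + (lam • y + ((1 - lam ^ 2) / 2) • x) - x‖ ^ 2 : ℝ) =
      (s - (s + 1 / 2) ^ 2 * lam ^ 2 / s) * ‖y‖ ^ 2 + -(1 - lam ^ 2) * (‖x‖ ^ 2 + ‖ξ‖ ^ 2) / 4 +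
      -(1 / 2) * ‖y - lam • x‖ ^ 2 + (1 - lam ^ 2) / 4 * ‖ξ‖ ^ 2 + -(s + 1 / 2) * ‖t‖ ^ 2 := by
    simp only [← real_inner_self_eq_norm_sq, inner_add_left, inner_add_right, inner_sub_left,
      inner_sub_right, real_inner_smul_left, real_inner_smul_right]
    rw [real_inner_comm x t, real_inner_comm y t, real_inner_comm x y]
    have hc : s * ((s + 1 / 2) * lam / s) = (s + 1 / 2) * lam := by field_simp
    have hc2 : (s + 1 / 2) ^ 2 * lam ^ 2 / s = s * ((s + 1 / 2) * lam / s) ^ 2 := by field_simp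
    rw [hc2]
    generalize (s + 1 / 2) * lam / s = c at hc
    linear_combination (2 * inner ℝ y t + 2 * lam * inner ℝ y y +
      (1 - lam ^ 2) * inner ℝ x y) * hc + (-inner ℝ x t - inner ℝ y y -
      (1 - lam ^ 2) / 4 * inner ℝ x x) * hsl
  have h2 : (inner ℝ (0 : E ι) (t + (lam • y + ((1 - lam ^ 2) / 2) • x)) +
      inner ℝ (-ξ) (t + (lam • y + ((1 - lam ^ 2) / 2) • x)) : ℝ) =
      -(1 - lam ^ 2) * inner ℝ x ξ / 2 + inner ℝ (-(lam • ξ)) y + inner ℝ (-ξ) t := by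
    simp only [inner_add_right, inner_neg_left, inner_zero_left,
      real_inner_smul_left, real_inner_smul_right]
    rw [real_inner_comm x ξ]
    ring
  have := key _ _ _ _ h1 h2
  push_cast at this ⊢
  linear_combination this

/-- Dilating the atoms: the function `z ↦ φ_{λ z}(y)` is, up to a Gaussian factor, the short-time
Fourier transform of a Gaussian. -/
theorem exists_mehler {lam : ℝ} (h0 : 0 < lam) (h1 : lam < 1) (y : E ι) :
    ∃ k : GS ι, ∀ z, stft (ofGS k) z = dilFactor lam z * stftAtom (lam • z) y := by
  have hl : 0 < 1 - lam ^ 2 := by nlinarith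
  set b : ℝ := 1 / (1 - lam ^ 2) with hb
  set s : ℝ := b - 1 / 2 with hs
  have hbl : b * (1 - lam ^ 2) = 1 := by rw [hb]; field_simp
  have hb0 : 0 < b := by positivity
  have hs0 : 0 < s := by
    rw [hs]
    have : 1 / 2 < b := by rw [hb, div_lt_div_iff₀ (by norm_num) hl]; nlinarith
    linarith
  set c : ℂ := ((Real.pi : ℂ) / b) ^ ((Fintype.card ι : ℂ) / 2) *
    Complex.exp (((s - b ^ 2 * lam ^ 2 / s) * ‖y‖ ^ 2 : ℝ) : ℂ) with hc
  have hc0 : c ≠ 0 := by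
    refine mul_ne_zero ?_ (Complex.exp_ne_zero _)
    rw [Ne, Complex.cpow_eq_zero_iff, not_and_or]
    left
    exact div_ne_zero (Complex.ofReal_ne_zero.2 Real.pi_ne_zero) (Complex.ofReal_ne_zero.2 hb0.ne')
  refine ⟨⟨c⁻¹ • gAtom s ((b * lam / s) • y) 0, (GS ι).smul_mem _ (gAtom_mem_GS hs0 _ _)⟩,
    fun z => ?_⟩
  have hG := GaussianFourier.integral_cexp_neg_mul_sq_norm_add_of_euclideanSpace
    (b := (b : ℂ)) (by simpa using hb0) Complex.I (-z.2)
  have hI : ∫ t, gAtom s ((b * lam / s) • y) 0 t * gAtom (1 / 2) z.1 (-z.2) t =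
      c * (dilFactor lam z * gAtom (1 / 2) (lam • z.1) (-(lam • z.2)) y) := by
    rw [← integral_add_right_eq_self _ (lam • y + ((1 - lam ^ 2) / 2) • z.1)]
    simp_rw [mehler_integrand hbl (by rw [hs]; ring) hs0.ne' y z.1 z.2, integral_const_mul]
    rw [hG, hc]
    have e : Complex.exp ((((1 - lam ^ 2) / 4 * ‖z.2‖ ^ 2 : ℝ) : ℂ)) *
        Complex.exp (Complex.I ^ 2 * (‖-z.2‖ : ℂ) ^ 2 / (4 * (b : ℂ))) = 1 := by
      rw [← Complex.exp_add, ← Complex.exp_zero]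
      congr 1
      have hb' : ((1 : ℂ) - (lam : ℂ) ^ 2) ≠ 0 := by
        have := Complex.ofReal_ne_zero.2 hl.ne'
        push_cast at this
        exact this
      rw [Complex.I_sq, norm_neg, hb]
      push_cast
      field_simp
      ring
    linear_combination (((Real.pi : ℂ) / b) ^ ((Fintype.card ι : ℂ) / 2) *
      Complex.exp (((s - b ^ 2 * lam ^ 2 / s) * ‖y‖ ^ 2 : ℝ) : ℂ) * dilFactor lam z *
      gAtom (1 / 2) (lam • z.1) (-(lam • z.2)) y) * e
  rw [stft_eq, pair_ofGS _ (gAtom_mem_GS (by norm_num) _ _), stftAtom_eq]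
  simp only [Pi.smul_apply, smul_eq_mul, mul_assoc, integral_const_mul, hI, Prod.smul_fst,
    Prod.smul_snd]
  field_simp

theorem nsq_smul (lam : ℝ) (z : E ι × E ι) : nsq (lam • z) = lam ^ 2 * nsq z := by
  simp only [nsq, Prod.smul_fst, Prod.smul_snd, norm_smul, mul_pow, Real.norm_eq_abs, sq_abs]
  ring

theorem pair_ofGS_comm (f g : GS ι) : pair (ofGS f) (g : E ι → ℂ) = pair (ofGS g) f := by
  rw [pair_ofGS f g.2, pair_ofGS g f.2]
  simp only [mul_comm]

/-- For `0 < λ < 1`, the dilation by `λ` of the short-time Fourier transform of a distribution is,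
up to a Gaussian factor, the short-time Fourier transform of a function in `𝒮_{1/2}`. -/
theorem exists_dilation (u : GSDual ι) {lam : ℝ} (h0 : 0 < lam) (h1 : lam < 1) :
    ∃ f : GS ι, ∀ z, stft (ofGS f) z = dilFactor lam z * stft u (lam • z) := by
  have hl : 0 < 1 - lam ^ 2 := by nlinarith
  have hcd : Continuous fun z : E ι × E ι => dilFactor lam z :=
    continuous_dilFactor.comp (f := fun z : E ι × E ι => (lam, z)) (by fun_prop)
  have hcu : Continuous fun z : E ι × E ι => stft u (lam • z) :=
    (continuous_stft u).comp (continuous_const_smul lam)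
  set A : E ι × E ι → ℂ := fun z => (stftConst ι : ℂ) * (dilFactor lam z * stft u (lam • z)) with hA
  have hAc : Continuous A := continuous_const.mul (hcd.mul hcu)
  -- `|dilFactor|` decays at rate `4ε`; the growth of `V_φ u` and the factor required for
  -- superpositions cost at most `ε` each.
  set ε : ℝ := (1 - lam ^ 2) / 16 with hε
  have ε0 : 0 < ε := by positivity
  have hAI : Integrable (fun z => ‖A z‖ * Real.exp (ε * (‖z.1‖ ^ 2 + ‖z.2‖ ^ 2))) volume := by
    obtain ⟨M, M0, hM⟩ := exists_norm_stft_le u ε0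
    refine ((integrable_exp_nsq (ι := ι) ε0).const_mul (stftConst ι * M)).mono'
      (Continuous.aestronglyMeasurable (by fun_prop)) (ae_of_all _ fun z => ?_)
    have hM' := hM (lam • z)
    rw [norm_mul, norm_norm, Real.norm_of_nonneg (Real.exp_pos _).le, hA, norm_mul, norm_mul,
      norm_dilFactor, Complex.norm_real, Real.norm_of_nonneg stftConst_pos.le]
    rw [nsq_smul] at hM'
    have hz := nsq_nonneg z
    have := (stftConst_pos (ι := ι)).le
    calc _ ≤ stftConst ι * (Real.exp (-(1 - lam ^ 2) * nsq z / 4) *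
          (M * Real.exp (ε * (lam ^ 2 * nsq z)))) * Real.exp (ε * nsq z) := by
          unfold nsq at *
          gcongr
      _ = stftConst ι * M * Real.exp (-(1 - lam ^ 2) * nsq z / 4 + ε * (lam ^ 2 * nsq z) +
          ε * nsq z) := by rw [Real.exp_add, Real.exp_add]; ring
      _ ≤ _ := by
          refine mul_le_mul_of_nonneg_left (Real.exp_le_exp.2 ?_) (by positivity)
          have : ε * (lam ^ 2 * nsq z) ≤ ε * nsq z := by
            refine mul_le_mul_of_nonneg_left (mul_le_of_le_one_left hz (by nlinarith)) ε0.le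
          have : -(1 - lam ^ 2) * nsq z / 4 = - 4 * (ε * nsq z) := by rw [hε]; ring
          have : 0 ≤ ε * nsq z := by positivity
          linarith
  have hAm := hAc.aestronglyMeasurable (μ := volume)
  have hmem := superpos_mem_GS (by norm_num : (0 : ℝ) < 1 / 2) ε0 measurable_fst measurable_snd hAm hAI
  refine ⟨⟨_, hmem⟩, fun z₀ => ?_⟩
  set g : GS ι := ⟨stftAtom z₀, stftAtom_mem z₀⟩ with hg
  have e1 : stft (ofGS ⟨_, hmem⟩) z₀ = ∫ z, A z * pair (ofGS g) (gAtom (1 / 2) z.1 z.2) := by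
    have := pair_ofGS_comm ⟨_, hmem⟩ g
    rw [stft]
    refine this.trans ?_
    exact pair_superpos (ofGS g) (by norm_num) ε0 measurable_fst measurable_snd hAm hAI
  -- The transform at `z₀` is read as `u` applied to a superposition of the dilated atoms at `λz`,
  -- with the coefficients `B`.
  set B : E ι × E ι → ℂ := fun z =>
    (stftConst ι : ℂ) * (dilFactor lam z * stft (ofGS g) (flipFreq z)) with hB
  have hcg : Continuous fun z : E ι × E ι => stft (ofGS g) (flipFreq z) :=
    (continuous_stft _).comp continuous_flipFreq
  have hBc : Continuous B := continuous_const.mul (hcd.mul hcg)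
  obtain ⟨r, M, r0, M0, hM⟩ := exists_stft_ofGS_decay g
  have hBI : Integrable (fun z => ‖B z‖ * Real.exp (r / 2 * (‖lam • z.1‖ ^ 2 +
      ‖-(lam • z.2)‖ ^ 2))) volume := by
    refine ((integrable_exp_nsq (ι := ι) (by positivity : 0 < r / 2)).const_mul
      (stftConst ι * M)).mono' (Continuous.aestronglyMeasurable (by fun_prop))
      (ae_of_all _ fun z => ?_)
    have hz := nsq_nonneg z
    have hM' := hM (flipFreq z)
    rw [nsq_flipFreq] at hM'
    have h2 : ‖lam • z.1‖ ^ 2 + ‖-(lam • z.2)‖ ^ 2 = lam ^ 2 * nsq z := by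
      rw [norm_neg]; exact nsq_smul lam z
    have h3 : ‖dilFactor lam z‖ ≤ 1 := by
      rw [norm_dilFactor, Real.exp_le_one_iff]
      have : 0 ≤ (1 - lam ^ 2) * nsq z := by positivity
      linarith
    rw [norm_mul, norm_norm, Real.norm_of_nonneg (Real.exp_pos _).le, hB, norm_mul, norm_mul,
      Complex.norm_real, Real.norm_of_nonneg stftConst_pos.le, h2]
    have := (stftConst_pos (ι := ι)).le
    calc _ ≤ stftConst ι * (1 * (M * Real.exp (-r * nsq z))) * Real.exp (r / 2 * (1 * nsq z)) := by
          gcongr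
          nlinarith
      _ = stftConst ι * M * (Real.exp (-r * nsq z) * Real.exp (r / 2 * (1 * nsq z))) := by ring
      _ = _ := by rw [← Real.exp_add]; ring_nf
  -- For each fixed `y` the dilated atoms, times `dilFactor`, are a short-time Fourier transform in
  -- `z`, so the reproducing formula collapses the superposition to a single dilated atom.
  have e2 : superpos (1 / 2) volume B (fun z => lam • z.1) (fun z => -(lam • z.2)) =
      dilFactor lam z₀ • stftAtom (lam • z₀) := by
    funext y
    obtain ⟨k, hk⟩ := exists_mehler h0 h1 y
    have h3 := pair_eq_integral_stft (ofGS k) g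
    rw [Pi.smul_apply, smul_eq_mul, ← hk z₀]
    refine Eq.trans ?_ h3.symm
    rw [superpos]
    congr 1
    funext z
    rw [hk z, stftAtom_eq]
    simp only [hB, Pi.smul_apply, smul_eq_mul, Prod.smul_fst, Prod.smul_snd]
    ring
  have hmB : Measurable fun z : E ι × E ι => lam • z.1 := by fun_prop
  have hmB' : Measurable fun z : E ι × E ι => -(lam • z.2) := by fun_prop
  have e3 := pair_superpos u (by norm_num : (0 : ℝ) < 1 / 2) (by positivity : 0 < r / 2)
    hmB hmB' (hBc.aestronglyMeasurable (μ := volume)) hBI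
  rw [e2, pair_smul_right u _ (stftAtom_mem _)] at e3
  rw [e1, stft, e3]
  congr 1
  funext z
  simp only [hA, hB]
  rw [stft_eq u, stft_flipFreq]
  simp only [Prod.smul_fst, Prod.smul_snd]
  ring

/-! ### Dominated convergence and dilations in mixed norm spaces -/

theorem tendsto_eLpNorm_zero_of_dominated {α : Type*} [MeasurableSpace α] {μ : Measure α} {p : ℝ≥0∞}
    (hp : 1 ≤ p) (hp' : p ≠ ∞) {f : ℕ → α → ℝ≥0∞} {g : α → ℝ≥0∞} (hf : ∀ n, AEMeasurable (f n) μ)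
    (hle : ∀ n, ∀ᵐ x ∂μ, f n x ≤ g x) (hg : eLpNorm g p μ ≠ ∞)
    (hlim : ∀ᵐ x ∂μ, Tendsto (fun n => f n x) atTop (𝓝 0)) :
    Tendsto (fun n => eLpNorm (f n) p μ) atTop (𝓝 0) := by
  have h0 : p ≠ 0 := (one_pos.trans_le hp).ne'
  have hp0 := ENNReal.toReal_pos h0 hp'
  simp only [eLpNorm_eq_lintegral_rpow_enorm_toReal h0 hp', enorm_eq_self] at hg ⊢
  have hg' : ∫⁻ x, g x ^ p.toReal ∂μ ≠ ∞ := by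
    intro h
    rw [h, ENNReal.top_rpow_of_pos (by positivity)] at hg
    exact hg rfl
  have h := tendsto_lintegral_of_dominated_convergence' (μ := μ) (F := fun n x => f n x ^ p.toReal)
    (f := fun _ => 0) (fun x => g x ^ p.toReal) (fun n => (hf n).pow_const _)
    (fun n => by
      filter_upwards [hle n] with x hx
      exact ENNReal.rpow_le_rpow hx hp0.le) hg'
    (by
      filter_upwards [hlim] with x hx
      have := (ENNReal.continuous_rpow_const (y := p.toReal)).tendsto 0 |>.comp hx
      rwa [ENNReal.zero_rpow_of_pos hp0] at this)
  rw [lintegral_zero] at h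
  have h2 := (ENNReal.continuous_rpow_const (y := 1 / p.toReal)).tendsto 0 |>.comp h
  rwa [ENNReal.zero_rpow_of_pos (by positivity)] at h2

section

variable {A B : Type} [MeasureSpace A] [MeasureSpace B]
  [SFinite (volume : Measure A)] [SFinite (volume : Measure B)]

/-- Dominated convergence is used on almost every slice, and again for the outer norm with the slice
norms of `G` as majorant. -/
theorem tendsto_ennMixed_zero_of_dominated {p q : ℝ≥0∞} (hp : 1 ≤ p) (hp' : p ≠ ∞) (hq : 1 ≤ q)
    (hq' : q ≠ ∞) {F : ℕ → A × B → ℝ≥0∞} {G : A × B → ℝ≥0∞}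
    (hF : ∀ n, AEMeasurable (F n) volume) (hGm : AEMeasurable G volume)
    (hle : ∀ n, ∀ᵐ z, F n z ≤ G z) (hG : ennMixed p q G ≠ ∞)
    (hlim : ∀ᵐ z, Tendsto (fun n => F n z) atTop (𝓝 0)) :
    Tendsto (fun n => ennMixed p q (F n)) atTop (𝓝 0) := by
  have m1 := fun n => (hF n).measurable_mk
  have m2 := hGm.measurable_mk
  have hle' : ∀ n, ∀ᵐ z, (hF n).mk (F n) z ≤ hGm.mk G z := fun n => by
    filter_upwards [hle n, (hF n).ae_eq_mk, hGm.ae_eq_mk] with z h1 h2 h3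
    rwa [← h2, ← h3]
  have hlim' : ∀ᵐ z, Tendsto (fun n => (hF n).mk (F n) z) atTop (𝓝 0) := by
    filter_upwards [hlim, ae_all_iff.2 fun n => (hF n).ae_eq_mk] with z h1 h2
    exact h1.congr h2
  simp only [fun n => ennMixed_congr_ae p q (hF n).ae_eq_mk]
  rw [ennMixed_congr_ae p q hGm.ae_eq_mk] at hG
  have hfin := ae_ne_top_of_eLpNorm_ne_top hq (measurable_eLpNorm_inner m2) hG
  refine tendsto_eLpNorm_zero_of_dominated hq hq'
    (fun n => (measurable_eLpNorm_inner (m1 n)).aemeasurable) (fun n => ?_) hG ?_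
  · filter_upwards [ae_ae_of_ae_prod_right (hle' n)] with b hb
    exact eLpNorm_mono_enorm_ae hb
  · filter_upwards [hfin, ae_ae_of_ae_prod_right hlim',
      ae_ae_of_ae_prod_right (ae_all_iff.2 hle')] with b h1 h2 h3
    refine tendsto_eLpNorm_zero_of_dominated hp hp'
      (fun n => ((m1 n).comp measurable_prodMk_right).aemeasurable) (fun n => ?_) h1 h2
    filter_upwards [h3] with a ha
    exact ha n

theorem ennMixed_add_le {p q : ℝ≥0∞} (hp : 1 ≤ p) (hq : 1 ≤ q) {F G : A × B → ℝ≥0∞}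
    (hF : AEMeasurable F volume) (hG : AEMeasurable G volume) :
    ennMixed p q (fun z => F z + G z) ≤ ennMixed p q F + ennMixed p q G := by
  have m1 := hF.measurable_mk
  have m2 := hG.measurable_mk
  have e : (fun z => F z + G z) =ᵐ[volume] fun z => hF.mk F z + hG.mk G z := by
    filter_upwards [hF.ae_eq_mk, hG.ae_eq_mk] with z h1 h2
    rw [h1, h2]
  rw [ennMixed_congr_ae p q e, ennMixed_congr_ae p q hF.ae_eq_mk, ennMixed_congr_ae p q hG.ae_eq_mk]
  refine le_trans ?_ (eLpNorm_add_le (measurable_eLpNorm_inner m1).aestronglyMeasurable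
    (measurable_eLpNorm_inner m2).aestronglyMeasurable hq)
  refine eLpNorm_mono_enorm fun b => ?_
  exact eLpNorm_add_le (m1.comp measurable_prodMk_right).aestronglyMeasurable
    (m2.comp measurable_prodMk_right).aestronglyMeasurable hp

end

/-! ### Dilations and tails in mixed norms -/

/-- The constant in the estimate of the dilations by `lam ∈ [1/2, 1]`. -/
def halfConst (ι : Type) [Fintype ι] : ℝ≥0∞ := 2 ^ Module.finrank ℝ (E ι)

theorem halfConst_ne_top : halfConst ι ≠ ∞ := by simp [halfConst]

theorem eLpNorm_comp_smul_le {p : ℝ≥0∞} (hp : 1 ≤ p) {lam : ℝ} (h1 : 1 / 2 ≤ lam)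
    (f : E ι → ℝ≥0∞) :
    eLpNorm (fun x => f (lam • x)) p volume ≤ halfConst ι * eLpNorm f p volume := by
  have h0 : lam ≠ 0 := by positivity
  have hl0 : 0 < lam := by positivity
  have hemb : MeasurableEmbedding fun x : E ι => lam • x :=
    (MeasurableEquiv.smul₀ lam h0).measurableEmbedding
  have e1 : eLpNorm (fun x => f (lam • x)) p volume =
      eLpNorm f p ((volume : Measure (E ι)).map (lam • ·)) :=
    (hemb.eLpNorm_map_measure (g := f) (p := p) (μ := volume)).symm
  set c : ℝ≥0∞ := ENNReal.ofReal |(lam ^ Module.finrank ℝ (E ι))⁻¹| with hc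
  have hc0 : c ≠ 0 := by
    rw [hc, Ne, ENNReal.ofReal_eq_zero, not_le]
    positivity
  have hcle : c ≤ halfConst ι := by
    rw [hc, abs_of_nonneg (by positivity), halfConst, ← inv_pow, ENNReal.ofReal_pow (by positivity)]
    gcongr
    rw [← ENNReal.ofReal_ofNat]
    refine ENNReal.ofReal_le_ofReal ?_
    rw [inv_le_comm₀ hl0 two_pos]
    linarith
  have hone : (1 : ℝ≥0∞) ≤ halfConst ι := one_le_pow₀ one_le_two
  rw [e1, Measure.map_addHaar_smul _ h0, eLpNorm_smul_measure_of_ne_zero hc0, smul_eq_mul]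
  gcongr
  have hr : (1 / p).toReal ≤ 1 := by
    rw [one_div]
    exact toReal_inv_le_one hp
  calc c ^ (1 / p).toReal ≤ halfConst ι ^ (1 / p).toReal :=
        ENNReal.rpow_le_rpow hcle ENNReal.toReal_nonneg
    _ ≤ halfConst ι ^ (1 : ℝ) := ENNReal.rpow_le_rpow_of_exponent_le hone hr
    _ = _ := ENNReal.rpow_one _

theorem ennMixed_comp_smul_le {p q : ℝ≥0∞} (hp : 1 ≤ p) (hq : 1 ≤ q) {lam : ℝ}
    (h1 : 1 / 2 ≤ lam) (F : E ι × E κ → ℝ≥0∞) :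
    ennMixed p q (fun z => F (lam • z)) ≤ halfConst ι * halfConst κ * ennMixed p q F := by
  calc ennMixed p q (fun z => F (lam • z))
      ≤ eLpNorm (fun b : E κ => halfConst ι * eLpNorm (fun a => F (a, lam • b)) p volume) q
        volume := eLpNorm_mono_enorm fun b =>
          eLpNorm_comp_smul_le hp h1 fun a => F (a, lam • b)
    _ = halfConst ι * eLpNorm (fun b : E κ => eLpNorm (fun a => F (a, lam • b)) p volume) q
        volume := eLpNorm_const_mul_enn _ _ halfConst_ne_top _
    _ ≤ halfConst ι * (halfConst κ * ennMixed p q F) := by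
        gcongr
        exact eLpNorm_comp_smul_le hq h1 fun b => eLpNorm (fun a => F (a, b)) p volume
    _ = _ := by ring

/-- The part of a function outside of the ball of radius `R`. -/
def tail {V : Type*} [Norm V] (R : ℝ) (F : V → ℝ≥0∞) : V → ℝ≥0∞ := {z | R < ‖z‖}.indicator F

theorem tail_of_lt {V : Type*} [Norm V] {R : ℝ} (F : V → ℝ≥0∞) {z : V} (h : R < ‖z‖) :
    tail R F z = F z := Set.indicator_of_mem (s := {z | R < ‖z‖}) h F

theorem tail_of_le {V : Type*} [Norm V] {R : ℝ} (F : V → ℝ≥0∞) {z : V} (h : ‖z‖ ≤ R) :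
    tail R F z = 0 := Set.indicator_of_notMem (s := {z | R < ‖z‖}) (not_lt.2 h) F

theorem tail_le {V : Type*} [Norm V] (R : ℝ) (F : V → ℝ≥0∞) (z : V) : tail R F z ≤ F z :=
  Set.indicator_le_self _ _ _

theorem tendsto_tail {V : Type*} [Norm V] (F : V → ℝ≥0∞) (z : V) :
    Tendsto (fun n : ℕ => tail (n : ℝ) F z) atTop (𝓝 0) := by
  refine tendsto_const_nhds.congr' ?_
  filter_upwards [eventually_ge_atTop ⌈‖z‖⌉₊] with n hn
  rw [tail_of_le F (Nat.ceil_le.1 hn)]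

theorem aemeasurable_tail {V : Type*} [NormedAddCommGroup V] [MeasurableSpace V]
    [OpensMeasurableSpace V] {μ : Measure V} {F : V → ℝ≥0∞} (hF : AEMeasurable F μ) (R : ℝ) :
    AEMeasurable (tail R F) μ :=
  hF.indicator (measurableSet_lt measurable_const measurable_norm)

theorem tendsto_ennMixed_tail {p q : ℝ≥0∞} (hp : 1 ≤ p) (hp' : p ≠ ∞) (hq : 1 ≤ q)
    (hq' : q ≠ ∞) {F : E ι × E κ → ℝ≥0∞} (hF : AEMeasurable F volume) (hN : ennMixed p q F ≠ ∞) :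
    Tendsto (fun n : ℕ => ennMixed p q (tail (n : ℝ) F)) atTop (𝓝 0) :=
  tendsto_ennMixed_zero_of_dominated hp hp' hq hq' (fun _ => aemeasurable_tail hF _) hF
    (fun _ => ae_of_all _ (tail_le _ F)) hN (ae_of_all _ (tendsto_tail F))

theorem tail_comp_smul_le {V : Type*} [NormedAddCommGroup V] [NormedSpace ℝ V] {lam : ℝ}
    (h1 : 1 / 2 ≤ lam) (F : V → ℝ≥0∞) (R : ℝ) (z : V) :
    tail (2 * R) (fun z => F (lam • z)) z ≤ tail R F (lam • z) := by
  rcases lt_or_ge (2 * R) ‖z‖ with h | h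
  · have hl0 : 0 < lam := by positivity
    rw [tail_of_lt _ h, tail_of_lt]
    rw [norm_smul, Real.norm_of_nonneg hl0.le]
    nlinarith [norm_nonneg z]
  · rw [tail_of_le _ h]
    exact zero_le

/-! ### Uniform smallness of tails -/

/-- The integrals of `F(λ z) G(z)` over the complement of a large ball are small, uniformly in
`λ ≥ 1/2`. -/
def UniformTail (F G : E ι × E ι → ℝ≥0∞) : Prop :=
  ∀ ε : ℝ≥0∞, 0 < ε → ∃ R : ℝ, ∀ lam : ℝ, 1 / 2 ≤ lam →
    ∫⁻ z, tail R (fun z => F (lam • z)) z * G z ≤ ε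

theorem AEMeasurable.comp_smul_prod {F : E ι × E ι → ℝ≥0∞} (hF : AEMeasurable F volume) {lam : ℝ}
    (h : 1 / 2 ≤ lam) : AEMeasurable (fun z => F (lam • z)) volume := by
  have h0 : lam ≠ 0 := by positivity
  exact hF.comp_quasiMeasurePreserving (Measure.quasiMeasurePreserving_smul volume h0)

theorem exists_mul_le_of_tendsto_zero {a : ℕ → ℝ≥0∞} (ha : Tendsto a atTop (𝓝 0)) {c : ℝ≥0∞}
    (hc : c ≠ ∞) {ε : ℝ≥0∞} (hε : 0 < ε) : ∃ n, c * a n ≤ ε := by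
  have h : Tendsto (fun n => c * a n) atTop (𝓝 (c * 0)) :=
    ENNReal.Tendsto.const_mul ha (Or.inr hc)
  rw [mul_zero] at h
  exact (ENNReal.tendsto_nhds_zero.1 h ε hε).exists

/-- For finite exponents the tail of `F` is small in norm, and dilation by `λ ≥ 1/2` enlarges norms
by a bounded factor. -/
theorem uniformTail_of_ne_top {p q : ℝ≥0∞} [Fact (1 ≤ p)] [Fact (1 ≤ q)] (hp : p ≠ ∞) (hq : q ≠ ∞)
    {F G : E ι × E ι → ℝ≥0∞} (hF : AEMeasurable F volume) (hG : AEMeasurable G volume)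
    (hFN : ennMixed p q F ≠ ∞) (hGN : ennMixed p.conjExponent q.conjExponent G ≠ ∞) :
    UniformTail F G := by
  intro ε hε
  obtain ⟨n, hn⟩ := exists_mul_le_of_tendsto_zero
    (tendsto_ennMixed_tail Fact.out hp Fact.out hq hF hFN)
    (ENNReal.mul_ne_top (ENNReal.mul_ne_top (halfConst_ne_top (ι := ι)) (halfConst_ne_top (ι := ι)))
      hGN) hε
  refine ⟨2 * n, fun lam hlam => ?_⟩
  calc _ ≤ ∫⁻ z, tail (n : ℝ) F (lam • z) * G z := by
        gcongr with z
        exact tail_comp_smul_le hlam F n z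
    _ ≤ ennMixed p q (fun z => tail (n : ℝ) F (lam • z)) *
        ennMixed p.conjExponent q.conjExponent G :=
        lintegral_mul_le_ennMixed_mul (AEMeasurable.comp_smul_prod (aemeasurable_tail hF _) hlam) hG
    _ ≤ (halfConst ι * halfConst ι * ennMixed p q (tail (n : ℝ) F)) *
        ennMixed p.conjExponent q.conjExponent G := by
        gcongr
        exact ennMixed_comp_smul_le Fact.out Fact.out hlam _
    _ ≤ ε := by rwa [mul_right_comm]

/-- For finite conjugate exponents the smallness comes from the tail of `G`, which is not dilated;
the dilates of `F` only have to stay bounded. -/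
theorem uniformTail_of_conj_ne_top {p q : ℝ≥0∞} [Fact (1 ≤ p)] [Fact (1 ≤ q)]
    (hp : p.conjExponent ≠ ∞) (hq : q.conjExponent ≠ ∞)
    {F G : E ι × E ι → ℝ≥0∞} (hF : AEMeasurable F volume) (hG : AEMeasurable G volume)
    (hFN : ennMixed p q F ≠ ∞) (hGN : ennMixed p.conjExponent q.conjExponent G ≠ ∞) :
    UniformTail F G := by
  intro ε hε
  obtain ⟨n, hn⟩ := exists_mul_le_of_tendsto_zero
    (tendsto_ennMixed_tail (one_le_conjExponent p) hp (one_le_conjExponent q) hq hG hGN)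
    (ENNReal.mul_ne_top (ENNReal.mul_ne_top (halfConst_ne_top (ι := ι)) (halfConst_ne_top (ι := ι)))
      hFN) hε
  refine ⟨n, fun lam hlam => ?_⟩
  calc _ = ∫⁻ z, F (lam • z) * tail (n : ℝ) G z := by
        congr 1
        funext z
        rcases lt_or_ge (n : ℝ) ‖z‖ with h | h
        · rw [tail_of_lt _ h, tail_of_lt _ h]
        · rw [tail_of_le _ h, tail_of_le _ h, zero_mul, mul_zero]
    _ ≤ ennMixed p q (fun z => F (lam • z)) *
        ennMixed p.conjExponent q.conjExponent (tail (n : ℝ) G) :=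
        lintegral_mul_le_ennMixed_mul (AEMeasurable.comp_smul_prod hF hlam) (aemeasurable_tail hG _)
    _ ≤ (halfConst ι * halfConst ι * ennMixed p q F) *
        ennMixed p.conjExponent q.conjExponent (tail (n : ℝ) G) := by
        gcongr
        exact ennMixed_comp_smul_le Fact.out Fact.out hlam _
    _ ≤ ε := hn

theorem lintegral_comp_smul_le {lam : ℝ} (hlam : 1 / 2 ≤ lam) (f : E ι → ℝ≥0∞) :
    ∫⁻ x, f (lam • x) ≤ halfConst ι * ∫⁻ x, f x := by
  have h := eLpNorm_comp_smul_le le_rfl hlam f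
  simpa only [eLpNorm_one_eq_lintegral_enorm, enorm_eq_self] using h

/-- The tail of neither function has to be small in norm, so both are used. The slice norms `n(y)`
of `F` are integrable, and the slice tails `m R y` of `G` tend to `0` boundedly. Off the set `A N`,
where `n` and `‖y‖` are at most `N`, the integral of `n` is small and `m R` is bounded. If `λy ∈ A
N`, then `y` is in the ball of radius `2N`, over which the integral of `m R` tends to `0`. `N` is
fixed before `R`, and neither depends on `λ`. -/
theorem uniformTail_top_one_of_measurable {F G : E ι × E ι → ℝ≥0∞} (hF : Measurable F)
    (hG : Measurable G) (hFN : ennMixed ∞ 1 F ≠ ∞) (hGN : ennMixed 1 ∞ G ≠ ∞) :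
    UniformTail F G := by
  intro ε hε
  set n : E ι → ℝ≥0∞ := fun y => eLpNorm (fun x => F (x, y)) ∞ (volume : Measure (E ι)) with hn
  have hnm : Measurable n := measurable_eLpNorm_inner hF
  have hn1 : ∫⁻ y, n y ≠ ∞ := by
    have : ennMixed ∞ 1 F = ∫⁻ y, n y := by
      rw [ennMixed, eLpNorm_one_eq_lintegral_enorm]; rfl
    rwa [← this]
  set M : ℝ≥0∞ := ennMixed 1 ∞ G with hM
  set m : ℕ → E ι → ℝ≥0∞ := fun R y => ∫⁻ x, tail (R : ℝ) G (x, y) with hm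
  have htm : ∀ R : ℕ, Measurable (tail (R : ℝ) G) := fun R =>
    hG.indicator (measurableSet_lt measurable_const measurable_norm)
  have hmm : ∀ R, Measurable (m R) := fun R => Measurable.lintegral_prod_left' (htm R)
  have hGle : ∀ᵐ y, ∫⁻ x, G (x, y) ≤ M := by
    have h := ae_le_essSup (μ := (volume : Measure (E ι)))
      (f := fun y => eLpNorm (fun x => G (x, y)) 1 volume)
    simp only [eLpNorm_one_eq_lintegral_enorm, enorm_eq_self] at h
    have e : M = essSup (fun y => ∫⁻ x, G (x, y)) volume := by
      rw [hM, ennMixed, eLpNorm_exponent_top, eLpNormEssSup]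
      simp only [eLpNorm_one_eq_lintegral_enorm, enorm_eq_self]
    rw [e]
    exact h
  have hmle : ∀ᵐ y, ∀ R, m R y ≤ M := by
    filter_upwards [hGle] with y hy R
    exact (lintegral_mono fun x => tail_le _ G (x, y)).trans hy
  have hmlim : ∀ᵐ y, Tendsto (fun R => m R y) atTop (𝓝 0) := by
    filter_upwards [hGle] with y hy
    have h := tendsto_eLpNorm_zero_of_dominated (μ := (volume : Measure (E ι))) (p := 1) le_rfl
      ENNReal.one_ne_top (f := fun (R : ℕ) x => tail (R : ℝ) G (x, y)) (g := fun x => G (x, y))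
      (fun R => ((htm R).comp measurable_prodMk_right).aemeasurable)
      (fun R => ae_of_all _ fun x => tail_le _ G (x, y))
      (by
        simp only [eLpNorm_one_eq_lintegral_enorm, enorm_eq_self]
        exact (hy.trans_lt hGN.lt_top).ne)
      (ae_of_all _ fun x => tendsto_tail G (x, y))
    simpa only [eLpNorm_one_eq_lintegral_enorm, enorm_eq_self] using h
  -- cutting off the outer function
  set A : ℕ → Set (E ι) := fun N => {y | n y ≤ N ∧ ‖y‖ ≤ N} with hA
  have hAm : ∀ N, MeasurableSet (A N) := fun N =>
    (measurableSet_le hnm measurable_const).inter (measurableSet_le measurable_norm measurable_const)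
  have hcut : Tendsto (fun N => ∫⁻ y, (A N)ᶜ.indicator n y) atTop (𝓝 0) := by
    have h := tendsto_eLpNorm_zero_of_dominated (μ := (volume : Measure (E ι))) (p := 1) le_rfl
      ENNReal.one_ne_top (f := fun N => (A N)ᶜ.indicator n) (g := n)
      (fun N => (hnm.indicator (hAm N).compl).aemeasurable)
      (fun N => ae_of_all _ fun y => Set.indicator_le_self _ _ y)
      (by simpa only [eLpNorm_one_eq_lintegral_enorm, enorm_eq_self] using hn1)
      (by
        filter_upwards [ae_lt_top hnm hn1] with y hy
        refine tendsto_const_nhds.congr' ?_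
        obtain ⟨k, hk⟩ := ENNReal.exists_nat_gt hy.ne
        filter_upwards [eventually_ge_atTop (max k ⌈‖y‖⌉₊)] with N hN
        rw [Set.indicator_of_notMem]
        rw [Set.notMem_compl_iff]
        refine ⟨hk.le.trans ?_, ?_⟩
        · exact_mod_cast (le_max_left _ _).trans hN
        · exact Nat.ceil_le.1 ((le_max_right _ _).trans hN))
    simpa only [eLpNorm_one_eq_lintegral_enorm, enorm_eq_self] using h
  have hε2 : 0 < ε / 2 := ENNReal.half_pos hε.ne'
  obtain ⟨N, hN⟩ := exists_mul_le_of_tendsto_zero hcut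
    (ENNReal.mul_ne_top (ENNReal.mul_ne_top (halfConst_ne_top (ι := ι)) (halfConst_ne_top (ι := ι)))
      hGN) hε2
  set D : Set (E ι) := Metric.closedBall 0 (2 * N) with hD
  have hDm : MeasurableSet D := Metric.isClosed_closedBall.measurableSet
  have hDfin : volume D ≠ ∞ := measure_closedBall_lt_top.ne
  have hin : Tendsto (fun R => ∫⁻ y in D, m R y) atTop (𝓝 0) := by
    have h := tendsto_eLpNorm_zero_of_dominated (μ := (volume : Measure (E ι)).restrict D) (p := 1)
      le_rfl ENNReal.one_ne_top (f := m) (g := fun _ => M) (fun R => (hmm R).aemeasurable)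
      (fun R => by
        filter_upwards [ae_restrict_of_ae hmle] with y hy
        exact hy R)
      (by
        simp only [eLpNorm_one_eq_lintegral_enorm, enorm_eq_self, lintegral_const,
          Measure.restrict_apply_univ]
        exact ENNReal.mul_ne_top hGN hDfin)
      (ae_restrict_of_ae hmlim)
    simpa only [eLpNorm_one_eq_lintegral_enorm, enorm_eq_self] using h
  obtain ⟨R, hR⟩ := exists_mul_le_of_tendsto_zero hin
    (ENNReal.mul_ne_top (halfConst_ne_top (ι := ι)) (ENNReal.natCast_ne_top N)) hε2
  refine ⟨R, fun lam hlam => ?_⟩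
  have hl0 : 0 < lam := by positivity
  have hsplit : ∀ᵐ y, n (lam • y) * m R y ≤
      (A N)ᶜ.indicator n (lam • y) * M + D.indicator (fun y => N * m R y) y := by
    filter_upwards [hmle] with y hy
    by_cases hyA : lam • y ∈ A N
    · have hyD : y ∈ D := by
        rw [hD, mem_closedBall_zero_iff]
        have h2 := hyA.2
        rw [norm_smul, Real.norm_of_nonneg hl0.le] at h2
        nlinarith [norm_nonneg y]
      rw [Set.indicator_of_mem hyD]
      exact (mul_le_mul' hyA.1 le_rfl).trans le_add_self
    · rw [Set.indicator_of_mem (Set.mem_compl hyA)]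
      exact (mul_le_mul' le_rfl (hy R)).trans le_self_add
  have hslice : ∀ y, ∫⁻ x, tail (R : ℝ) (fun z => F (lam • z)) (x, y) * G (x, y) ≤
      halfConst ι * (n (lam • y) * m R y) := by
    intro y
    calc _ = ∫⁻ x, F (lam • x, lam • y) * tail (R : ℝ) G (x, y) := by
          congr 1
          funext x
          rcases lt_or_ge (R : ℝ) ‖(x, y)‖ with h | h
          · rw [tail_of_lt _ h, tail_of_lt _ h]; rfl
          · rw [tail_of_le _ h, tail_of_le _ h, zero_mul, mul_zero]
      _ ≤ eLpNorm (fun x => F (lam • x, lam • y)) ∞ volume *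
          eLpNorm (fun x => tail (R : ℝ) G (x, y)) 1 volume :=
          lintegral_mul_le_eLpNorm_mul
            (hF.comp ((measurable_const_smul lam).prodMk measurable_const)).aemeasurable
            ((htm R).comp measurable_prodMk_right).aemeasurable
      _ ≤ (halfConst ι * n (lam • y)) * m R y := by
          refine mul_le_mul' (eLpNorm_comp_smul_le le_top hlam fun x => F (x, lam • y)) ?_
          rw [eLpNorm_one_eq_lintegral_enorm]
          exact le_rfl
      _ = _ := by ring
  have hmF : Measurable fun z => F (lam • z) := hF.comp (measurable_const_smul lam)
  have e1 : ∫⁻ z, tail (R : ℝ) (fun z => F (lam • z)) z * G z =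
      ∫⁻ y, ∫⁻ x, tail (R : ℝ) (fun z => F (lam • z)) (x, y) * G (x, y) :=
    lintegral_prod_symm _ ((hmF.indicator (measurableSet_lt measurable_const
      measurable_norm)).mul hG).aemeasurable
  have hc := halfConst_ne_top (ι := ι)
  calc _ ≤ ∫⁻ y, halfConst ι * (n (lam • y) * m R y) := by
        rw [e1]; exact lintegral_mono hslice
    _ = halfConst ι * ∫⁻ y, n (lam • y) * m R y := lintegral_const_mul' _ _ hc
    _ ≤ halfConst ι * ∫⁻ y, ((A N)ᶜ.indicator n (lam • y) * M +
        D.indicator (fun y => N * m R y) y) := by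
        gcongr 1
        exact lintegral_mono_ae hsplit
    _ = halfConst ι * ((∫⁻ y, (A N)ᶜ.indicator n (lam • y)) * M + N * ∫⁻ y in D, m R y) := by
        rw [lintegral_add_right _ (((hmm R).const_mul _).indicator hDm),
          lintegral_mul_const' _ _ hGN, lintegral_indicator hDm,
          lintegral_const_mul' _ _ (ENNReal.natCast_ne_top N)]
    _ ≤ halfConst ι * ((halfConst ι * ∫⁻ y, (A N)ᶜ.indicator n y) * M + N * ∫⁻ y in D, m R y) := by
        gcongr
        exact lintegral_comp_smul_le hlam _
    _ = halfConst ι * halfConst ι * M * (∫⁻ y, (A N)ᶜ.indicator n y) +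
        halfConst ι * N * ∫⁻ y in D, m R y := by ring
    _ ≤ ε / 2 + ε / 2 := add_le_add hN hR
    _ = ε := ENNReal.add_halves ε

theorem uniformTail_top_one {F G : E ι × E ι → ℝ≥0∞} (hF : AEMeasurable F volume)
    (hG : AEMeasurable G volume) (hFN : ennMixed ∞ 1 F ≠ ∞) (hGN : ennMixed 1 ∞ G ≠ ∞) :
    UniformTail F G := by
  rw [ennMixed_congr_ae _ _ hF.ae_eq_mk] at hFN
  rw [ennMixed_congr_ae _ _ hG.ae_eq_mk] at hGN
  intro ε hε
  obtain ⟨R, hR⟩ := uniformTail_top_one_of_measurable hF.measurable_mk hG.measurable_mk hFN hGN ε hε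
  refine ⟨R, fun lam hlam => ?_⟩
  have h0 : lam ≠ 0 := by positivity
  refine (lintegral_mono_ae ?_).trans (hR lam hlam)
  filter_upwards [hG.ae_eq_mk, (Measure.quasiMeasurePreserving_smul (volume : Measure (E ι × E ι))
    h0).ae hF.ae_eq_mk] with z h1 h2
  rw [h1]
  refine mul_le_mul' ?_ le_rfl
  rcases lt_or_ge R ‖z‖ with h | h
  · rw [tail_of_lt _ h, tail_of_lt _ h, h2]
  · rw [tail_of_le _ h, tail_of_le _ h]

/-! ### Density of the Gelfand-Shilov space -/

/-- The dilation quotient is evaluated at `z/√2`, which turns its factor `e^{-(1-λ²)|x|²/2}` into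
the modulus `e^{-(1-λ²)|z|²/4}` of `dilFactor`. -/
theorem DilatedSuitable.norm_dilFactor_mul_le {ω : E (ι ⊕ ι) → ℝ} (h : DilatedSuitable ω 1) :
    ∃ C θ : ℝ, 0 < C ∧ 0 < θ ∧ θ < 1 ∧ ∀ lam : ℝ, 1 - θ < lam → lam < 1 → ∀ z : E ι × E ι,
      ‖dilFactor lam z‖ * ω (join z.1 z.2) ≤ C * ω (join (lam • z).1 (lam • z).2) := by
  obtain ⟨hω, C, θ, C0, θ0, θ1, hQ⟩ := h
  refine ⟨C, θ, C0, θ0, θ1, fun lam h1 h2 z => ?_⟩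
  have hs : Real.sqrt 2 * (Real.sqrt 2)⁻¹ = 1 := mul_inv_cancel₀ (by positivity)
  have hs2 : Real.sqrt 2 ^ 2 = 2 := Real.sq_sqrt (by norm_num)
  have hq := hQ lam h1 h2 ((Real.sqrt 2)⁻¹ • join z.1 z.2)
  have e1 : Real.sqrt 2 • (Real.sqrt 2)⁻¹ • join z.1 z.2 = join z.1 z.2 := by
    rw [smul_smul, hs, one_smul]
  have e2 : (Real.sqrt 2 * lam) • (Real.sqrt 2)⁻¹ • join z.1 z.2 =
      join (lam • z).1 (lam • z).2 := by
    rw [smul_smul, mul_right_comm, hs, one_mul, Prod.smul_fst, Prod.smul_snd, join_smul]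
  have e3 : ‖(Real.sqrt 2)⁻¹ • join z.1 z.2‖ ^ 2 = nsq z / 2 := by
    rw [norm_smul, mul_pow, norm_sq_join, norm_inv, inv_pow, Real.norm_eq_abs, sq_abs, hs2, nsq]
    ring
  rw [dilationQuotient, e1, e2, e3, div_le_iff₀ (hω.pos _)] at hq
  rw [norm_dilFactor, mul_comm]
  refine le_of_eq_of_le ?_ hq
  congr 2
  ring

/-- A sequence in `𝒮_{1/2}` that approximates a distribution by dilations of its short-time Fourier
transform. -/
structure DilationApprox (ω : E (ι ⊕ ι) → ℝ) (u : GSDual ι) (f : ℕ → GS ι) (lam : ℕ → ℝ)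
    (C : ℝ≥0∞) : Prop where
  ne_top : C ≠ ∞
  half_le : ∀ n, 1 / 2 ≤ lam n
  lt_one : ∀ n, lam n < 1
  norm_le : ∀ n z, ‖stft (ofGS (f n)) z‖ ≤ ‖stft u (lam n • z)‖
  weight_le : ∀ n z, ‖stft (ofGS (f n)) z‖ₑ * ennWeight ω z ≤
    C * (‖stft u (lam n • z)‖ₑ * ennWeight ω (lam n • z))
  tendsto : ∀ z, Tendsto (fun n => stft (ofGS (f n)) z) atTop (𝓝 (stft u z))

theorem DilatedSuitable.exists_dilationApprox {ω : E (ι ⊕ ι) → ℝ} (h : DilatedSuitable ω 1)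
    (u : GSDual ι) : ∃ f lam C, DilationApprox ω u f lam C := by
  obtain ⟨C, θ, C0, θ0, θ1, hC⟩ := h.norm_dilFactor_mul_le
  -- Both `1 - θ < lam n` and `1/2 ≤ lam n` are wanted: the first for the weight, the second for the
  -- norms of dilations. The shift by `2` makes the inequalities strict from `n = 0` on.
  set lam : ℕ → ℝ := fun n => 1 - min θ (1 / 2) / ((n : ℝ) + 2) with hlam
  have hm0 : 0 < min θ (1 / 2) := lt_min θ0 (by norm_num)
  have hpos : ∀ n : ℕ, 0 < min θ (1 / 2) / ((n : ℝ) + 2) := fun n => by positivity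
  have hlt : ∀ n : ℕ, min θ (1 / 2) / ((n : ℝ) + 2) < min θ (1 / 2) := fun n =>
    div_lt_self hm0 (by have := Nat.cast_nonneg (α := ℝ) n; linarith)
  have h1 : ∀ n, lam n < 1 := fun n => by have := hpos n; simp only [hlam]; linarith
  have hθ : ∀ n, 1 - θ < lam n := fun n => by
    have := hlt n; have := min_le_left θ (1 / 2); simp only [hlam]; linarith
  have hhalf : ∀ n, 1 / 2 ≤ lam n := fun n => by
    have := hlt n; have := min_le_right θ (1 / 2); simp only [hlam]; linarith
  have hlim : Tendsto lam atTop (𝓝 1) := by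
    have e : Tendsto (fun n : ℕ => min θ (1 / 2) / ((n : ℝ) + 2)) atTop (𝓝 0) :=
      tendsto_const_nhds.div_atTop (tendsto_atTop_add_const_right _ _ tendsto_natCast_atTop_atTop)
    simpa [hlam] using e.const_sub 1
  choose f hf using fun n => exists_dilation u ((by norm_num : (0 : ℝ) < 1 / 2).trans_le (hhalf n))
    (h1 n)
  refine ⟨f, lam, ENNReal.ofReal C, ENNReal.ofReal_ne_top, hhalf, h1, fun n z => ?_, fun n z => ?_,
    fun z => ?_⟩
  · rw [hf, norm_mul]
    refine mul_le_of_le_one_left (norm_nonneg _) ?_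
    rw [norm_dilFactor, Real.exp_le_one_iff]
    have : 0 ≤ (1 - lam n ^ 2) * nsq z := by
      refine mul_nonneg ?_ (by unfold nsq; positivity)
      nlinarith [h1 n, hhalf n]
    linarith
  · rw [hf, enorm_mul, ← ofReal_norm (dilFactor _ _), ennWeight, ennWeight, mul_right_comm,
      ← ENNReal.ofReal_mul (norm_nonneg _)]
    refine (mul_le_mul' (ENNReal.ofReal_le_ofReal (hC _ (hθ n) (h1 n) z)) le_rfl).trans_eq ?_
    rw [ENNReal.ofReal_mul C0.le]
    ring
  · simp only [hf]
    have hc : Continuous fun t : ℝ => dilFactor t z * stft u (t • z) :=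
      (continuous_dilFactor.comp (f := fun t : ℝ => (t, z)) (by fun_prop)).mul
        ((continuous_stft u).comp (f := fun t : ℝ => t • z) (by fun_prop))
    have e : stft u z = dilFactor 1 z * stft u ((1 : ℝ) • z) := by
      simp [dilFactor]
    rw [e]
    exact (hc.tendsto 1).comp hlim

/-- The part of a function in a ball. -/
def head {V : Type*} [Norm V] (R : ℝ) (F : V → ℝ≥0∞) : V → ℝ≥0∞ := {z | ‖z‖ ≤ R}.indicator F

theorem head_add_tail {V : Type*} [Norm V] (R : ℝ) (F : V → ℝ≥0∞) (z : V) :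
    head R F z + tail R F z = F z := by
  rcases le_or_gt ‖z‖ R with h | h
  · rw [tail_of_le F h, add_zero]
    exact Set.indicator_of_mem (s := {z | ‖z‖ ≤ R}) h F
  · rw [tail_of_lt F h, head, Set.indicator_of_notMem (s := {z | ‖z‖ ≤ R}) (not_le.2 h), zero_add]

theorem aemeasurable_head {V : Type*} [NormedAddCommGroup V] [MeasurableSpace V]
    [OpensMeasurableSpace V] {μ : Measure V} {F : V → ℝ≥0∞} (hF : AEMeasurable F μ) (R : ℝ) :
    AEMeasurable (head R F) μ :=
  hF.indicator (measurableSet_le measurable_norm measurable_const)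

theorem tail_le_tail {V : Type*} [Norm V] {R R' : ℝ} (h : R' ≤ R) (F : V → ℝ≥0∞) (z : V) :
    tail R F z ≤ tail R' F z :=
  Set.indicator_le_indicator_of_subset (fun _ hz => h.trans_lt hz) (fun _ => zero_le) z

section Approx

variable {ω : E (ι ⊕ ι) → ℝ} {u : GSDual ι} {f : ℕ → GS ι} {lam : ℕ → ℝ} {C : ℝ≥0∞}

/-- The modulus of the difference of the short-time Fourier transforms. -/
def stftDist (u v : GSDual ι) (z : E ι × E ι) : ℝ≥0∞ := ‖stft u z - stft v z‖ₑ

theorem continuous_stftDist (u v : GSDual ι) : Continuous (stftDist u v) :=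
  ((continuous_stft u).sub (continuous_stft v)).enorm

theorem DilationApprox.tendsto_stftDist (h : DilationApprox ω u f lam C) (z : E ι × E ι) :
    Tendsto (fun n => stftDist (ofGS (f n)) u z) atTop (𝓝 0) := by
  have := (h.tendsto z).sub_const (stft u z)
  rw [sub_self] at this
  simpa [stftDist] using this.enorm

/-- In a fixed ball a constant would dominate; writing it as a Gaussian gives a majorant that
belongs to every mixed norm space with subgaussian weight. -/
theorem DilationApprox.exists_head_le (h : DilationApprox ω u f lam C) (R : ℝ) :
    ∃ K : ℝ, 0 ≤ K ∧ ∀ n z, head R (stftDist (ofGS (f n)) u) z ≤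
      ENNReal.ofReal (K * Real.exp (-1 * nsq z)) := by
  obtain ⟨M, M0, hM⟩ := exists_norm_stft_le u one_pos
  refine ⟨2 * M * Real.exp (4 * R ^ 2), by positivity, fun n z => ?_⟩
  rcases le_or_gt ‖z‖ R with hz | hz
  · rw [head, Set.indicator_of_mem (s := {z | ‖z‖ ≤ R}) hz]
    refine enorm_le_ofReal_of_norm_le ?_
    have hn : 0 ≤ nsq z := by unfold nsq; positivity
    have hl : nsq (lam n • z) ≤ nsq z := by
      rw [nsq_smul]
      refine mul_le_of_le_one_left hn ?_
      nlinarith [h.half_le n, h.lt_one n]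
    have hR : nsq z ≤ 2 * R ^ 2 := by
      have h1 := (norm_fst_le z).trans hz
      have h2 := (norm_snd_le z).trans hz
      unfold nsq
      nlinarith [norm_nonneg z.1, norm_nonneg z.2]
    have b1 : ‖stft (ofGS (f n)) z‖ ≤ M * Real.exp (nsq z) := by
      refine (h.norm_le n z).trans ((hM _).trans ?_)
      rw [one_mul]
      gcongr
    have b2 : ‖stft u z‖ ≤ M * Real.exp (nsq z) := by simpa using hM z
    have b3 : Real.exp (nsq z) ≤ Real.exp (4 * R ^ 2) * Real.exp (-1 * nsq z) := by
      rw [← Real.exp_add]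
      gcongr
      linarith
    calc ‖stft (ofGS (f n)) z - stft u z‖ ≤ 2 * M * Real.exp (nsq z) := by
          have := norm_sub_le (stft (ofGS (f n)) z) (stft u z)
          linarith
      _ ≤ 2 * M * (Real.exp (4 * R ^ 2) * Real.exp (-1 * nsq z)) := by gcongr
      _ = _ := by ring
  · rw [head, Set.indicator_of_notMem (s := {z | ‖z‖ ≤ R}) (not_le.2 hz)]
    exact zero_le

theorem DilationApprox.tendsto_head (h : DilationApprox ω u f lam C) (R : ℝ) (z : E ι × E ι) :
    Tendsto (fun n => head R (stftDist (ofGS (f n)) u) z) atTop (𝓝 0) :=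
  tendsto_of_tendsto_of_tendsto_of_le_of_le tendsto_const_nhds (h.tendsto_stftDist z)
    (fun _ => zero_le) fun _ => Set.indicator_le_self _ _ _

theorem DilationApprox.tail_le (h : DilationApprox ω u f lam C) (R : ℝ) (n : ℕ) (z : E ι × E ι) :
    tail R (stftDist (ofGS (f n)) u) z * ennWeight ω z ≤
      C * tail R (fun z => ‖stft u (lam n • z)‖ₑ * ennWeight ω (lam n • z)) z +
        tail R (fun z => ‖stft u z‖ₑ * ennWeight ω z) z := by
  rcases lt_or_ge R ‖z‖ with hz | hz
  · rw [tail_of_lt _ hz, tail_of_lt _ hz, tail_of_lt _ hz]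
    refine (mul_le_mul' enorm_sub_le le_rfl).trans ?_
    rw [add_mul]
    exact add_le_add (h.weight_le n z) le_rfl
  · rw [tail_of_le _ hz, zero_mul]
    exact zero_le

theorem aemeasurable_stft_mul (hω : SubgaussianWeight ω) (u : GSDual ι) :
    AEMeasurable (fun z => ‖stft u z‖ₑ * ennWeight ω z) volume :=
  (continuous_stft u).enorm.measurable.aemeasurable.mul hω.aemeasurable_ennWeight

/-- The tails are small uniformly in `n`, because `weight_le` bounds the weighted approximants by
dilates of the weighted transform of `u`; inside the ball dominated convergence applies. -/
theorem DilationApprox.tendsto_norm (h : DilationApprox ω u f lam C) (hω : SubgaussianWeight ω)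
    {p q : ℝ≥0∞} (hp : 1 ≤ p) (hq : 1 ≤ q) (hp' : p ≠ ∞) (hq' : q ≠ ∞) (hu : MemMod p q ω u) :
    Tendsto (fun n => ennMixed p q fun z => stftDist (ofGS (f n)) u z * ennWeight ω z) atTop
      (𝓝 0) := by
  set F : E ι × E ι → ℝ≥0∞ := fun z => ‖stft u z‖ₑ * ennWeight ω z with hF
  have hFm : AEMeasurable F volume := aemeasurable_stft_mul hω u
  have hFN : ennMixed p q F ≠ ∞ := hω.memMod_iff.1 hu
  have hWm := hω.aemeasurable_ennWeight
  have hDm : ∀ n, AEMeasurable (stftDist (ofGS (f n)) u) volume := fun n =>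
    (continuous_stftDist _ _).measurable.aemeasurable
  set D : ℝ≥0∞ := C * (halfConst ι * halfConst ι) + 1 with hD
  have hDtop : D ≠ ∞ := ENNReal.add_ne_top.2
    ⟨ENNReal.mul_ne_top h.ne_top (ENNReal.mul_ne_top halfConst_ne_top halfConst_ne_top),
      ENNReal.one_ne_top⟩
  rw [ENNReal.tendsto_nhds_zero]
  intro ε hε
  obtain ⟨m, hm⟩ := exists_mul_le_of_tendsto_zero (tendsto_ennMixed_tail hp hp' hq hq' hFm hFN)
    hDtop (ENNReal.half_pos hε.ne')
  have htail : ∀ n, ennMixed p q (fun z => tail (2 * m : ℝ) (stftDist (ofGS (f n)) u) z *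
      ennWeight ω z) ≤ ε / 2 := fun n => by
    have hm0 : (m : ℝ) ≤ 2 * m := by have := Nat.cast_nonneg (α := ℝ) m; linarith
    calc _ ≤ ennMixed p q (fun z => C * tail (m : ℝ) F (lam n • z) + tail (m : ℝ) F z) := by
          refine ennMixed_mono _ _ fun z => (h.tail_le _ n z).trans (add_le_add ?_ ?_)
          · exact mul_le_mul' le_rfl (tail_comp_smul_le (h.half_le n) F m z)
          · exact tail_le_tail hm0 F z
      _ ≤ ennMixed p q (fun z => C * tail (m : ℝ) F (lam n • z)) + ennMixed p q (tail (m : ℝ) F) :=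
          ennMixed_add_le hp hq ((AEMeasurable.comp_smul_prod (aemeasurable_tail hFm _)
            (h.half_le n)).const_mul C) (aemeasurable_tail hFm _)
      _ ≤ C * (halfConst ι * halfConst ι * ennMixed p q (tail (m : ℝ) F)) +
          ennMixed p q (tail (m : ℝ) F) := by
          rw [ennMixed_const_mul p q C h.ne_top]
          exact add_le_add (mul_le_mul' le_rfl (ennMixed_comp_smul_le hp hq (h.half_le n) _)) le_rfl
      _ = D * ennMixed p q (tail (m : ℝ) F) := by rw [hD]; ring
      _ ≤ ε / 2 := hm
  obtain ⟨K, K0, hK⟩ := h.exists_head_le (2 * m : ℝ)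
  have hgm : AEMeasurable (fun z : E ι × E ι => ENNReal.ofReal (K * Real.exp (-1 * nsq z)))
      volume := by
    have := continuous_nsq (ι := ι)
    exact (by fun_prop : Continuous fun z : E ι × E ι =>
      K * Real.exp (-1 * nsq z)).measurable.ennreal_ofReal.aemeasurable
  have hhead := tendsto_ennMixed_zero_of_dominated hp hp' hq hq'
    (F := fun n z => head (2 * m : ℝ) (stftDist (ofGS (f n)) u) z * ennWeight ω z)
    (fun n => (aemeasurable_head (hDm n) _).mul hWm) (hgm.mul hWm)
    (fun n => ae_of_all _ fun z => mul_le_mul' (hK n z) le_rfl)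
    (hω.ennMixed_mul_ne_top hp hq one_pos K0 fun z => le_rfl)
    (ae_of_all _ fun z => by
      have := ENNReal.Tendsto.mul_const (h.tendsto_head (2 * m : ℝ) z)
        (Or.inr (show ennWeight ω z ≠ ∞ from ENNReal.ofReal_ne_top))
      rwa [zero_mul] at this)
  filter_upwards [ENNReal.tendsto_nhds_zero.1 hhead (ε / 2) (ENNReal.half_pos hε.ne')] with n hn
  calc _ = ennMixed p q (fun z => head (2 * m : ℝ) (stftDist (ofGS (f n)) u) z * ennWeight ω z +
        tail (2 * m : ℝ) (stftDist (ofGS (f n)) u) z * ennWeight ω z) := by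
        simp only [← add_mul, head_add_tail]
    _ ≤ _ := ennMixed_add_le hp hq ((aemeasurable_head (hDm n) _).mul hWm)
        ((aemeasurable_tail (hDm n) _).mul hWm)
    _ ≤ ε / 2 + ε / 2 := add_le_add hn (htail n)
    _ = ε := ENNReal.add_halves ε

/-- The splitting is the same as for the norm, but the smallness of the tails is the hypothesis
`hT`: with `lam n` for the approximants and with `1` for `u` itself. -/
theorem DilationApprox.tendsto_lintegral (h : DilationApprox ω u f lam C)
    (hω : SubgaussianWeight ω) {p q : ℝ≥0∞} [Fact (1 ≤ p)] [Fact (1 ≤ q)] {g : GSDual ι}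
    (hg : MemMod p.conjExponent q.conjExponent (fun X => (ω X)⁻¹) g)
    (hT : UniformTail (fun z => ‖stft u z‖ₑ * ennWeight ω z)
      (fun z => ‖stft g z‖ₑ * ennWeight (fun X => (ω X)⁻¹) z)) :
    Tendsto (fun n => ∫⁻ z, stftDist (ofGS (f n)) u z * ‖stft g z‖ₑ) atTop (𝓝 0) := by
  set G : E ι × E ι → ℝ≥0∞ := fun z => ‖stft g z‖ₑ * ennWeight (fun X => (ω X)⁻¹) z with hG
  set F : E ι × E ι → ℝ≥0∞ := fun z => ‖stft u z‖ₑ * ennWeight ω z with hF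
  have hGm : AEMeasurable G volume := aemeasurable_stft_mul hω.inv g
  have hFm : AEMeasurable F volume := aemeasurable_stft_mul hω u
  have hgm : Measurable fun z => ‖stft g z‖ₑ := (continuous_stft g).enorm.measurable
  have hGN : ennMixed p.conjExponent q.conjExponent G ≠ ∞ := hω.inv.memMod_iff.1 hg
  have hsplit : ∀ z, ‖stft g z‖ₑ = ennWeight ω z * G z := fun z => by
    rw [hG]
    simp only
    rw [mul_left_comm, hω.ennWeight_mul_inv, mul_one]
  have hDm : ∀ n, Measurable (stftDist (ofGS (f n)) u) := fun n =>
    (continuous_stftDist _ _).measurable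
  have hDtop : C + 1 ≠ ∞ := ENNReal.add_ne_top.2 ⟨h.ne_top, ENNReal.one_ne_top⟩
  rw [ENNReal.tendsto_nhds_zero]
  intro ε hε
  obtain ⟨R, hR⟩ := hT (ε / 2 / (C + 1)) (ENNReal.div_pos (ENNReal.half_pos hε.ne').ne' hDtop)
  have htail : ∀ n, ∫⁻ z, tail R (stftDist (ofGS (f n)) u) z * ‖stft g z‖ₑ ≤ ε / 2 := fun n => by
    have hm1 : AEMeasurable (fun z => tail R (fun z => F (lam n • z)) z * G z) volume :=
      (aemeasurable_tail (AEMeasurable.comp_smul_prod hFm (h.half_le n)) R).mul hGm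
    calc _ ≤ ∫⁻ z, (C * (tail R (fun z => F (lam n • z)) z * G z) +
          tail R (fun z => F ((1 : ℝ) • z)) z * G z) := by
          refine lintegral_mono fun z => ?_
          simp only
          rw [hsplit, ← mul_assoc]
          refine (mul_le_mul' (h.tail_le R n z) le_rfl).trans_eq ?_
          simp only [one_smul, hF]
          ring
      _ = C * (∫⁻ z, tail R (fun z => F (lam n • z)) z * G z) +
          ∫⁻ z, tail R (fun z => F ((1 : ℝ) • z)) z * G z := by
          rw [lintegral_add_left' (hm1.const_mul C), lintegral_const_mul' _ _ h.ne_top]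
      _ ≤ C * (ε / 2 / (C + 1)) + ε / 2 / (C + 1) :=
          add_le_add (mul_le_mul' le_rfl (hR _ (h.half_le n))) (hR 1 (by norm_num))
      _ = (C + 1) * (ε / 2 / (C + 1)) := by ring
      _ ≤ ε / 2 := ENNReal.mul_div_le
  obtain ⟨K, K0, hK⟩ := h.exists_head_le R
  have hhead : Tendsto (fun n => ∫⁻ z, head R (stftDist (ofGS (f n)) u) z * ‖stft g z‖ₑ) atTop
      (𝓝 0) := by
    have hbd : ∫⁻ z, ENNReal.ofReal (K * Real.exp (-1 * nsq z)) * ‖stft g z‖ₑ ≠ ∞ := by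
      have hgs : AEMeasurable (fun z : E ι × E ι => ENNReal.ofReal (K * Real.exp (-1 * nsq z)) *
          ennWeight ω z) volume := by
        have := continuous_nsq (ι := ι)
        exact (by fun_prop : Continuous fun z : E ι × E ι => K * Real.exp (-1 * nsq z)
          ).measurable.ennreal_ofReal.aemeasurable.mul hω.aemeasurable_ennWeight
      simp only [hsplit, ← mul_assoc]
      exact ne_top_of_le_ne_top (ENNReal.mul_ne_top
        (hω.ennMixed_mul_ne_top Fact.out Fact.out one_pos K0 fun z => le_rfl) hGN)
        (lintegral_mul_le_ennMixed_mul (p := p) (q := q) hgs hGm)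
    have := tendsto_lintegral_of_dominated_convergence (μ := (volume : Measure (E ι × E ι)))
      (F := fun n z => head R (stftDist (ofGS (f n)) u) z * ‖stft g z‖ₑ) (f := fun _ => 0)
      (fun z => ENNReal.ofReal (K * Real.exp (-1 * nsq z)) * ‖stft g z‖ₑ)
      (fun n => ((hDm n).indicator (measurableSet_le measurable_norm measurable_const)).mul hgm)
      (fun n => ae_of_all _ fun z => mul_le_mul' (hK n z) le_rfl) hbd
      (ae_of_all _ fun z => by
        have := ENNReal.Tendsto.mul_const (h.tendsto_head R z)
          (Or.inr (enorm_ne_top (x := stft g z)))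
        rwa [zero_mul] at this)
    simpa using this
  filter_upwards [ENNReal.tendsto_nhds_zero.1 hhead (ε / 2) (ENNReal.half_pos hε.ne')] with n hn
  calc _ = ∫⁻ z, (head R (stftDist (ofGS (f n)) u) z * ‖stft g z‖ₑ +
        tail R (stftDist (ofGS (f n)) u) z * ‖stft g z‖ₑ) := by
        simp only [← add_mul, head_add_tail]
    _ = _ := lintegral_add_left' ((aemeasurable_head (hDm n).aemeasurable _).mul
        hgm.aemeasurable) _
    _ ≤ ε / 2 + ε / 2 := add_le_add hn (htail n)
    _ = ε := ENNReal.add_halves ε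

theorem SubgaussianWeight.integrable_stft_mul_conj (hω : SubgaussianWeight ω) {p q : ℝ≥0∞}
    [Fact (1 ≤ p)] [Fact (1 ≤ q)] (hu : MemMod p q ω u) {g : GSDual ι}
    (hg : MemMod p.conjExponent q.conjExponent (fun X => (ω X)⁻¹) g) :
    Integrable (fun z => stft u z * (starRingEnd ℂ) (stft g z)) volume := by
  refine ⟨((continuous_stft u).mul
    (Complex.continuous_conj.comp (continuous_stft g))).aestronglyMeasurable, ?_⟩
  have h := lintegral_mul_le_ennMixed_mul (p := p) (q := q) (p' := p.conjExponent)
    (q' := q.conjExponent) (aemeasurable_stft_mul hω u) (aemeasurable_stft_mul hω.inv g)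
  refine lt_of_le_of_lt ?_ (h.trans_lt (ENNReal.mul_lt_top (hω.memMod_iff.1 hu).lt_top
    (hω.inv.memMod_iff.1 hg).lt_top))
  refine lintegral_mono fun z => le_of_eq ?_
  have := hω.ennWeight_mul_inv z
  simp only [enorm_mul, RCLike.enorm_conj]
  rw [mul_mul_mul_comm, this, mul_one]

theorem DilationApprox.tendsto_l2Form (h : DilationApprox ω u f lam C)
    (hω : SubgaussianWeight ω) {p q : ℝ≥0∞} [Fact (1 ≤ p)] [Fact (1 ≤ q)] (hu : MemMod p q ω u)
    {g : GSDual ι} (hg : MemMod p.conjExponent q.conjExponent (fun X => (ω X)⁻¹) g)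
    (hT : UniformTail (fun z => ‖stft u z‖ₑ * ennWeight ω z)
      (fun z => ‖stft g z‖ₑ * ennWeight (fun X => (ω X)⁻¹) z)) :
    Tendsto (fun n => l2Form (ofGS (f n)) g) atTop (𝓝 (l2Form u g)) := by
  refine tendsto_integral_of_L1 _ (hω.integrable_stft_mul_conj hu hg).aestronglyMeasurable
    (Eventually.of_forall fun n => hω.integrable_stft_mul_conj
      (hω.memMod_ofGS Fact.out Fact.out (f n)) hg) ?_
  refine (h.tendsto_lintegral hω hg hT).congr fun n => lintegral_congr fun z => ?_
  rw [← sub_mul, enorm_mul, RCLike.enorm_conj, stftDist]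

end Approx

theorem FeasiblePair.dilatedSuitable {p q : ℝ≥0∞} {ω : E ι → ℝ} (h : FeasiblePair p q ω) :
    DilatedSuitable ω 1 := by
  rcases h with h | h | h
  exacts [h.2, h.2, h.2.1]

theorem conjExponent_ne_top {p : ℝ≥0∞} (hp : 1 < p) : p.conjExponent ≠ ∞ := by
  rw [ENNReal.conjExponent]
  refine ENNReal.add_ne_top.2 ⟨ENNReal.one_ne_top, ENNReal.inv_ne_top.2 ?_⟩
  exact (tsub_pos_of_lt hp).ne'

/-- The three kinds of exponents correspond to three sources of smallness: the tail of `G` if `p, q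
> 1`, the tail of `F` if `p, q < ∞`, and the two combined for `(∞, 1)`. -/
theorem FeasiblePair.uniformTail {p q : ℝ≥0∞} [Fact (1 ≤ p)] [Fact (1 ≤ q)] {ω : E (ι ⊕ ι) → ℝ}
    (h : FeasiblePair p q ω) {F G : E ι × E ι → ℝ≥0∞} (hF : AEMeasurable F volume)
    (hG : AEMeasurable G volume) (hFN : ennMixed p q F ≠ ∞)
    (hGN : ennMixed p.conjExponent q.conjExponent G ≠ ∞) : UniformTail F G := by
  rcases h with ⟨h, -⟩ | ⟨h, -⟩ | ⟨⟨rfl, rfl⟩, -⟩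
  · exact uniformTail_of_conj_ne_top (conjExponent_ne_top h.1) (conjExponent_ne_top h.2) hF hG
      hFN hGN
  · exact uniformTail_of_ne_top h.1.ne h.2.ne hF hG hFN hGN
  · refine uniformTail_top_one hF hG hFN ?_
    simpa [ENNReal.conjExponent] using hGN

/-- The Gelfand-Shilov space is sequentially dense for the weak topology. -/
theorem FeasiblePair.exists_tendsto_l2Form {p q : ℝ≥0∞} [Fact (1 ≤ p)] [Fact (1 ≤ q)]
    {ω : E (ι ⊕ ι) → ℝ} (h : FeasiblePair p q ω) {u : GSDual ι} (hu : MemMod p q ω u) :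
    ∃ f : ℕ → GS ι, ∀ g : GSDual ι,
      MemMod p.conjExponent q.conjExponent (fun X => (ω X)⁻¹) g →
      Tendsto (fun n => l2Form (ofGS (f n)) g) atTop (𝓝 (l2Form u g)) := by
  have hω := h.dilatedSuitable.1.subgaussianWeight
  obtain ⟨f, lam, C, hf⟩ := h.dilatedSuitable.exists_dilationApprox u
  exact ⟨f, fun g hg => hf.tendsto_l2Form hω hu hg (h.uniformTail (aemeasurable_stft_mul hω u)
    (aemeasurable_stft_mul hω.inv g) (hω.memMod_iff.1 hu) (hω.inv.memMod_iff.1 hg))⟩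

theorem stft_sub (u v : GSDual ι) : stft (u - v) = stft u - stft v := by
  rw [sub_eq_add_neg, ← neg_one_smul ℂ v, stft_add, stft_smul, neg_one_smul, sub_eq_add_neg]

/-- The Gelfand-Shilov space is dense for the norm if both exponents are finite. -/
theorem FeasiblePair.exists_tendsto_norm {p q : ℝ≥0∞} [Fact (1 ≤ p)] [Fact (1 ≤ q)]
    {ω : E (ι ⊕ ι) → ℝ} (h : FeasiblePair p q ω) (hp : p ≠ ∞) (hq : q ≠ ∞)
    (u : ModSpace p q ω) (hGS : ∀ f : GS ι, ofGS f ∈ ModSpace p q ω) :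
    ∃ f : ℕ → GS ι, Tendsto (fun n => (⟨ofGS (f n), hGS (f n)⟩ : ModSpace p q ω)) atTop (𝓝 u) := by
  have hω := h.dilatedSuitable.1.subgaussianWeight
  obtain ⟨f, lam, C, hf⟩ := h.dilatedSuitable.exists_dilationApprox (u : GSDual ι)
  refine ⟨f, tendsto_iff_norm_sub_tendsto_zero.2 ?_⟩
  have h1 := hf.tendsto_norm hω Fact.out Fact.out hp hq u.2
  have h2 := (ENNReal.tendsto_toReal ENNReal.zero_ne_top).comp h1
  refine h2.congr fun n => ?_
  rw [ModSpace.norm_def, mixedNorm_wstft hω.pos]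
  simp only [Function.comp, Submodule.coe_sub, stft_sub, Pi.sub_apply, stftDist]

/-! ### Uniqueness -/

theorem ModSpace.eq_of_norm_sub_eq_zero {p q : ℝ≥0∞} [Fact (1 ≤ p)] [Fact (1 ≤ q)]
    {ω : E (ι ⊕ ι) → ℝ} (hω : SubgaussianWeight ω) {u v : ModSpace p q ω} (h : ‖u - v‖ = 0) :
    u = v := by
  refine Subtype.ext (GSDual.ext_stft ?_)
  have hm := aemeasurable_stft_mul hω ((u - v : ModSpace p q ω) : GSDual ι)
  have h0 : ennMixed p q (fun z => ‖stft ((u - v : ModSpace p q ω) : GSDual ι) z‖ₑ *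
      ennWeight ω z) = 0 := by
    have hne := hω.memMod_iff.1 (u - v).2
    rw [ModSpace.norm_def, mixedNorm_wstft hω.pos, ENNReal.toReal_eq_zero_iff] at h
    exact h.resolve_right hne
  -- The factorization bounds the function almost everywhere by its norm times a function, so norm
  -- zero forces it to vanish almost everywhere.
  obtain ⟨g, n, -, -, -, -, hle⟩ := exists_mixed_factor Fact.out Fact.out hm
    (by rw [h0]; exact ENNReal.zero_ne_top)
  filter_upwards [hle] with z hz
  rw [h0, zero_mul, nonpos_iff_eq_zero, mul_eq_zero] at hz
  rcases hz with hz | hz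
  · rw [Submodule.coe_sub, stft_sub, enorm_eq_zero, Pi.sub_apply, sub_eq_zero] at hz
    exact hz
  · exact absurd hz (ENNReal.ofReal_pos.2 (hω.pos _)).ne'

/-- Point evaluation of the short-time Fourier transform is one of the forms that define the weak
topology, since atoms belong to every dual space. Hence weak limits determine the transform, and so
the distribution. -/
theorem l2Form_stftAtom (u : GSDual ι) (z : E ι × E ι) :
    l2Form u (ofGS ⟨stftAtom (flipFreq z), stftAtom_mem (flipFreq z)⟩) = stft u z := by
  have h := pair_eq_integral_stft u ⟨stftAtom z, stftAtom_mem z⟩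
  rw [stft, h, l2Form]
  congr 1
  funext w
  rw [conj_stft_ofGS_stftAtom, flipFreq_flipFreq]

section Uniqueness

variable {p₁ q₁ p₂ q₂ : ℝ≥0∞} [Fact (1 ≤ p₁)] [Fact (1 ≤ q₁)] [Fact (1 ≤ p₂)] [Fact (1 ≤ q₂)]
  {ω₁ ω₂ : E (ι ⊕ ι) → ℝ} {a : GSDual (ι ⊕ ι)} {S T : ModSpace p₁ q₁ ω₁ → ModSpace p₂ q₂ ω₂}

theorem ExtendsWeyl.eq_ofGS (hS : ExtendsWeyl a S) (hT : ExtendsWeyl a T) (f : GS ι)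
    (hf : ofGS f ∈ ModSpace p₁ q₁ ω₁) : S ⟨ofGS f, hf⟩ = T ⟨ofGS f, hf⟩ := by
  obtain ⟨_, h1⟩ := hS f
  obtain ⟨_, h2⟩ := hT f
  refine Subtype.ext (Subtype.ext (LinearMap.ext fun g => ?_))
  rw [h1, h2]

theorem ExtendsWeyl.eq_of_continuous (hS : ExtendsWeyl a S) (hT : ExtendsWeyl a T)
    (h : FeasiblePair p₁ q₁ ω₁) (hω₂ : SubgaussianWeight ω₂) (hp : p₁ ≠ ∞) (hq : q₁ ≠ ∞)
    (hSc : Continuous S) (hTc : Continuous T) : S = T := by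
  funext u
  have hGS : ∀ f : GS ι, ofGS f ∈ ModSpace p₁ q₁ ω₁ := fun f => (hS f).1
  obtain ⟨f, hf⟩ := h.exists_tendsto_norm hp hq u hGS
  have h1 := (hSc.tendsto u).comp hf
  have h2 := (hTc.tendsto u).comp hf
  refine ModSpace.eq_of_norm_sub_eq_zero hω₂ ?_
  have h3 := (h1.sub h2).norm
  refine tendsto_nhds_unique h3 (tendsto_const_nhds.congr fun n => ?_)
  simp only [Function.comp, hS.eq_ofGS hT, sub_self, norm_zero]

theorem FeasiblePair.tendsto_weak (h : FeasiblePair p₁ q₁ ω₁) (u : ModSpace p₁ q₁ ω₁)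
    (hGS : ∀ f : GS ι, ofGS f ∈ ModSpace p₁ q₁ ω₁) :
    ∃ f : ℕ → GS ι, Tendsto (fun n => (⟨ofGS (f n), hGS (f n)⟩ : ModSpace p₁ q₁ ω₁)) atTop
      (@nhds _ (weakTopology p₁ q₁ ω₁) u) := by
  obtain ⟨f, hf⟩ := h.exists_tendsto_l2Form u.2
  refine ⟨f, ?_⟩
  rw [nhds_induced, tendsto_comap_iff, tendsto_pi_nhds]
  exact fun g => hf g g.2

theorem ExtendsWeyl.eq_of_continuous_weak (hS : ExtendsWeyl a S) (hT : ExtendsWeyl a T)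
    (h : FeasiblePair p₁ q₁ ω₁) (hω₂ : SubgaussianWeight ω₂)
    (hSc : Continuous[weakTopology p₁ q₁ ω₁, weakTopology p₂ q₂ ω₂] S)
    (hTc : Continuous[weakTopology p₁ q₁ ω₁, weakTopology p₂ q₂ ω₂] T) : S = T := by
  funext u
  have hGS : ∀ f : GS ι, ofGS f ∈ ModSpace p₁ q₁ ω₁ := fun f => (hS f).1
  obtain ⟨f, hf⟩ := h.tendsto_weak u hGS
  refine Subtype.ext (GSDual.ext_stft (Eventually.of_forall fun z => ?_))
  rw [← l2Form_stftAtom, ← l2Form_stftAtom]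
  have hl := continuous_weakTopology_l2Form (p := p₂) (q := q₂) (ω := ω₂)
    (hω₂.inv.memMod_ofGS (one_le_conjExponent p₂) (one_le_conjExponent q₂)
      ⟨stftAtom (flipFreq z), stftAtom_mem (flipFreq z)⟩)
  have c1 := @Continuous.comp _ _ _ (weakTopology p₁ q₁ ω₁) (weakTopology p₂ q₂ ω₂) _ _ _ hl hSc
  have c2 := @Continuous.comp _ _ _ (weakTopology p₁ q₁ ω₁) (weakTopology p₂ q₂ ω₂) _ _ _ hl hTc
  have t1 := (@Continuous.tendsto _ _ (weakTopology p₁ q₁ ω₁) _ _ c1 u).comp hf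
  have t2 := (@Continuous.tendsto _ _ (weakTopology p₁ q₁ ω₁) _ _ c2 u).comp hf
  refine tendsto_nhds_unique t1 (t2.congr fun n => ?_)
  simp only [Function.comp, hS.eq_ofGS hT]

end Uniqueness

/-! ### Completeness of the modulation spaces -/

/-- Fatou's lemma; positive powers are order isomorphisms of `[0, ∞]` and so commute with `liminf`.
-/
theorem eLpNorm_liminf_le {α : Type*} [MeasurableSpace α] {μ : Measure α} {p : ℝ≥0∞} (hp : 1 ≤ p)
    {f : ℕ → α → ℝ≥0∞} (hf : ∀ n, Measurable (f n)) :
    eLpNorm (fun x => liminf (fun n => f n x) atTop) p μ ≤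
      liminf (fun n => eLpNorm (f n) p μ) atTop := by
  have h0 : p ≠ 0 := (one_pos.trans_le hp).ne'
  rcases eq_or_ne p ∞ with rfl | htop
  · simp only [eLpNorm_exponent_top, eLpNormEssSup, enorm_eq_self]
    exact ENNReal.essSup_liminf_le _
  have hp0 := ENNReal.toReal_pos h0 htop
  have hpow : ∀ {r : ℝ}, 0 < r → ∀ a : ℕ → ℝ≥0∞,
      liminf a atTop ^ r = liminf (fun n => a n ^ r) atTop := fun {r} hr a => by
    refine ((ENNReal.strictMono_rpow_of_pos hr).orderIsoOfSurjective _
      (ENNReal.rpow_left_bijective hr.ne').2).liminf_apply ?_ ?_ ?_ ?_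
    all_goals isBoundedDefault
  simp only [eLpNorm_eq_lintegral_rpow_enorm_toReal h0 htop, enorm_eq_self]
  rw [← hpow (by positivity)]
  refine ENNReal.rpow_le_rpow ?_ (by positivity)
  simp only [hpow hp0]
  exact lintegral_liminf_le fun n => (hf n).pow_const _

theorem ennMixed_liminf_le {A B : Type} [MeasureSpace A] [MeasureSpace B]
    [SFinite (volume : Measure A)] [SFinite (volume : Measure B)] {p q : ℝ≥0∞} (hp : 1 ≤ p)
    (hq : 1 ≤ q) {F : ℕ → A × B → ℝ≥0∞} (hF : ∀ n, Measurable (F n)) :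
    ennMixed p q (fun z => liminf (fun n => F n z) atTop) ≤
      liminf (fun n => ennMixed p q (F n)) atTop := by
  refine le_trans (eLpNorm_mono_enorm fun b => ?_)
    (eLpNorm_liminf_le hq fun n => measurable_eLpNorm_inner (p := p) (hF n))
  exact eLpNorm_liminf_le hp fun n => (hF n).comp measurable_prodMk_right

section Complete

variable {p q : ℝ≥0∞} [Fact (1 ≤ p)] [Fact (1 ≤ q)] {ω : E (ι ⊕ ι) → ℝ}

theorem ModSpace.ofReal_norm_eq (hω : SubgaussianWeight ω) (u : ModSpace p q ω) :
    ENNReal.ofReal ‖u‖ = ennMixed p q fun z => ‖stft (u : GSDual ι) z‖ₑ * ennWeight ω z := by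
  rw [ModSpace.norm_def, mixedNorm_wstft hω.pos, ENNReal.ofReal_toReal (hω.memMod_iff.1 u.2)]

/-- Hölder's inequality with the Gaussian decay of `V_φ f`, uniform in `𝒮_{1/2,h}`. So a Cauchy
sequence converges on each test function, and the limit is again bounded on every `𝒮_{1/2,h}`. -/
theorem ModSpace.exists_norm_pair_le (p q : ℝ≥0∞) [Fact (1 ≤ p)] [Fact (1 ≤ q)]
    (hω : SubgaussianWeight ω) {h : ℝ} (h0 : 0 < h) :
    ∃ M : ℝ, 0 ≤ M ∧ ∀ (u : ModSpace p q ω) (f : GS ι) (C : ℝ), GSBound h C (f : E ι → ℂ) →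
      ‖pair (u : GSDual ι) f‖ ≤ M * C * ‖u‖ := by
  obtain ⟨r, M, r0, M0, hM⟩ := exists_stft_decay (ι := ι) h0
  set N : ℝ≥0∞ := ennMixed p.conjExponent q.conjExponent fun z : E ι × E ι =>
    ENNReal.ofReal (M * Real.exp (-r * nsq z)) * ennWeight (fun X => (ω X)⁻¹) z with hN
  have hNtop : N ≠ ∞ := hω.inv.ennMixed_mul_ne_top (one_le_conjExponent p) (one_le_conjExponent q)
    r0 M0.le fun z => le_rfl
  refine ⟨N.toReal, ENNReal.toReal_nonneg, fun u f C hC => ?_⟩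
  have hgm : AEMeasurable (fun z : E ι × E ι =>
      ENNReal.ofReal (M * Real.exp (-r * nsq z)) * ennWeight (fun X => (ω X)⁻¹) z) volume := by
    have := continuous_nsq (ι := ι)
    exact (by fun_prop : Continuous fun z : E ι × E ι => M * Real.exp (-r * nsq z)
      ).measurable.ennreal_ofReal.aemeasurable.mul hω.inv.aemeasurable_ennWeight
  have key : ‖pair (u : GSDual ι) f‖ₑ ≤ ENNReal.ofReal C * (ENNReal.ofReal ‖u‖ * N) := by
    rw [pair_eq_integral_stft, ModSpace.ofReal_norm_eq hω]
    calc _ ≤ ∫⁻ z, ‖stft (u : GSDual ι) z * stft (ofGS f) (flipFreq z)‖ₑ :=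
          enorm_integral_le_lintegral_enorm _
      _ ≤ ∫⁻ z, ENNReal.ofReal C * ((‖stft (u : GSDual ι) z‖ₑ * ennWeight ω z) *
          (ENNReal.ofReal (M * Real.exp (-r * nsq z)) * ennWeight (fun X => (ω X)⁻¹) z)) := by
          refine lintegral_mono fun z => ?_
          have hb : ‖stft (ofGS f) (flipFreq z)‖ₑ ≤
              ENNReal.ofReal C * ENNReal.ofReal (M * Real.exp (-r * nsq z)) := by
            rw [← ENNReal.ofReal_mul hC.nonneg]
            refine enorm_le_ofReal_of_norm_le ((hM f C hC _).trans_eq ?_)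
            rw [nsq_flipFreq]
            ring
          have hw := hω.ennWeight_mul_inv z
          rw [enorm_mul, mul_mul_mul_comm, hw, mul_one, mul_left_comm]
          exact mul_le_mul' le_rfl hb
      _ = ENNReal.ofReal C * ∫⁻ z, (‖stft (u : GSDual ι) z‖ₑ * ennWeight ω z) *
          (ENNReal.ofReal (M * Real.exp (-r * nsq z)) * ennWeight (fun X => (ω X)⁻¹) z) :=
          lintegral_const_mul' _ _ ENNReal.ofReal_ne_top
      _ ≤ _ := mul_le_mul' le_rfl
          (lintegral_mul_le_ennMixed_mul (aemeasurable_stft_mul hω _) hgm)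
  have := ENNReal.toReal_mono (by finiteness) key
  rw [toReal_enorm, ENNReal.toReal_mul, ENNReal.toReal_mul, ENNReal.toReal_ofReal hC.nonneg,
    ENNReal.toReal_ofReal (norm_nonneg _)] at this
  linarith

theorem pair_sub (u v : GSDual ι) (F : E ι → ℂ) : pair (u - v) F = pair u F - pair v F := by
  rw [sub_eq_add_neg, ← neg_one_smul ℂ v, pair_add, pair_smul, neg_one_mul, sub_eq_add_neg]

theorem ModSpace.exists_pair_tendsto (hω : SubgaussianWeight ω) {u : ℕ → ModSpace p q ω}
    (hu : CauchySeq u) : ∃ L : GSDual ι, ∀ f : GS ι,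
      Tendsto (fun n => pair (u n : GSDual ι) f) atTop (𝓝 (pair L f)) := by
  have hlim : ∀ f : GS ι, ∃ l : ℂ, Tendsto (fun n => pair (u n : GSDual ι) f) atTop (𝓝 l) := by
    intro f
    obtain ⟨h, C, h0, hC⟩ := f.2.2
    obtain ⟨M, M0, hM⟩ := ModSpace.exists_norm_pair_le p q hω h0
    refine cauchySeq_tendsto_of_complete (Metric.cauchySeq_iff.2 fun ε hε => ?_)
    have hMC : 0 ≤ M * C := mul_nonneg M0 hC.nonneg
    obtain ⟨N, hN⟩ := Metric.cauchySeq_iff.1 hu (ε / (M * C + 1)) (by positivity)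
    refine ⟨N, fun m hm n hn => ?_⟩
    have h1 := hN m hm n hn
    rw [dist_eq_norm] at h1 ⊢
    rw [← pair_sub]
    calc _ ≤ M * C * ‖u m - u n‖ := hM (u m - u n) f C hC
      _ ≤ (M * C + 1) * ‖u m - u n‖ := by gcongr; linarith
      _ < (M * C + 1) * (ε / (M * C + 1)) := by gcongr
      _ = ε := by field_simp
  choose l hl using hlim
  have hbd : ∃ B : ℝ, ∀ n, ‖u n‖ ≤ B := by
    obtain ⟨R, -, hR⟩ := cauchySeq_bdd hu
    refine ⟨R + ‖u 0‖, fun n => ?_⟩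
    have h1 := (hR n 0).le
    rw [dist_eq_norm] at h1
    have := norm_add_le (u n - u 0) (u 0)
    rw [sub_add_cancel] at this
    linarith
  obtain ⟨B, hB⟩ := hbd
  have hB0 : 0 ≤ B := (norm_nonneg _).trans (hB 0)
  let L : GS ι →ₗ[ℂ] ℂ :=
    { toFun := l
      map_add' := fun f g => tendsto_nhds_unique (hl (f + g)) (((hl f).add (hl g)).congr fun n => by
        rw [pair_coe, pair_coe, pair_coe, map_add])
      map_smul' := fun c f => tendsto_nhds_unique (hl (c • f)) (((hl f).const_mul c).congr fun n => by
        rw [pair_coe, pair_coe, map_smul, smul_eq_mul]) }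
  refine ⟨⟨L, fun h h0 => ?_⟩, fun f => ?_⟩
  · obtain ⟨M, M0, hM⟩ := ModSpace.exists_norm_pair_le p q hω h0
    refine ⟨M * B, fun f C hC => ?_⟩
    refine le_of_tendsto (hl f).norm (Eventually.of_forall fun n => (hM (u n) f C hC).trans ?_)
    have : 0 ≤ M * C := mul_nonneg M0 hC.nonneg
    calc M * C * ‖u n‖ ≤ M * C * B := by gcongr; exact hB n
      _ = M * B * C := by ring
  · rw [pair_coe]
    exact hl f

theorem ModSpace.ennMixed_sub_le_of_tendsto (hω : SubgaussianWeight ω) {u : ℕ → ModSpace p q ω}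
    {v L : GSDual ι} (hL : ∀ z, Tendsto (fun n => stft (u n : GSDual ι) z) atTop (𝓝 (stft L z)))
    {ε : ℝ≥0∞} (hε : ∀ᶠ n in atTop,
      ennMixed p q (fun z => ‖stft (v - (u n : GSDual ι)) z‖ₑ * ennWeight ω z) ≤ ε) :
    ennMixed p q (fun z => ‖stft (v - L) z‖ₑ * ennWeight ω z) ≤ ε := by
  have hW := hω.aemeasurable_ennWeight
  -- Fatou's lemma is applied to measurable functions, so the weight is replaced by a measurable
  -- representative.
  set W := hW.mk (ennWeight ω) with hWdef
  have hWW : ∀ F : E ι × E ι → ℝ≥0∞, ennMixed p q (fun z => F z * ennWeight ω z) =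
      ennMixed p q (fun z => F z * W z) := fun F => by
    refine ennMixed_congr_ae _ _ ?_
    filter_upwards [hW.ae_eq_mk] with z hz
    rw [hz]
  rw [hWW]
  simp only [hWW] at hε
  have hfin : ∀ᵐ z, W z ≠ ∞ := by
    filter_upwards [hW.ae_eq_mk] with z hz
    rw [hWdef, ← hz]
    exact ENNReal.ofReal_ne_top
  have hlim : ∀ z, Tendsto (fun n => ‖stft (v - (u n : GSDual ι)) z‖ₑ) atTop
      (𝓝 ‖stft (v - L) z‖ₑ) := fun z => by
    simp only [stft_sub, Pi.sub_apply]
    exact ((hL z).const_sub (stft v z)).enorm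
  have h := ennMixed_liminf_le (p := p) (q := q) Fact.out Fact.out
    (F := fun n z => ‖stft (v - (u n : GSDual ι)) z‖ₑ * W z)
    (fun n => (continuous_stft _).enorm.measurable.mul hW.measurable_mk)
  refine le_trans (ennMixed_mono_ae p q ?_) (h.trans ?_)
  · filter_upwards [hfin] with z hz
    exact (ENNReal.Tendsto.mul_const (hlim z) (Or.inr hz)).liminf_eq.ge
  · exact liminf_le_of_frequently_le' hε.frequently

/-- Modulation spaces are complete. -/
theorem ModSpace.completeSpace (hω : SubgaussianWeight ω) : CompleteSpace (ModSpace p q ω) := by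
  refine Metric.complete_of_cauchySeq_tendsto fun u hu => ?_
  obtain ⟨L, hL⟩ := ModSpace.exists_pair_tendsto hω hu
  have hstft : ∀ z, Tendsto (fun n => stft (u n : GSDual ι) z) atTop (𝓝 (stft L z)) := fun z =>
    hL ⟨stftAtom z, stftAtom_mem z⟩
  have key : ∀ ε : ℝ, 0 < ε → ∃ N, ∀ n ≥ N,
      ennMixed p q (fun z => ‖stft ((u n : GSDual ι) - L) z‖ₑ * ennWeight ω z) ≤
        ENNReal.ofReal ε := by
    intro ε hε
    obtain ⟨N, hN⟩ := Metric.cauchySeq_iff.1 hu ε hε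
    refine ⟨N, fun n hn => ModSpace.ennMixed_sub_le_of_tendsto hω hstft ?_⟩
    filter_upwards [eventually_ge_atTop N] with m hm
    have h1 := hN n hn m hm
    rw [dist_eq_norm] at h1
    have h2 := ModSpace.ofReal_norm_eq hω (u n - u m)
    rw [Submodule.coe_sub] at h2
    rw [← h2]
    exact ENNReal.ofReal_le_ofReal h1.le
  obtain ⟨N, hN⟩ := key 1 one_pos
  have hmem : (u N : GSDual ι) - L ∈ ModSpace p q ω :=
    hω.memMod_iff.2 (ne_top_of_le_ne_top ENNReal.ofReal_ne_top (hN N le_rfl))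
  have hLmem : L ∈ ModSpace p q ω := by
    have := (ModSpace p q ω).sub_mem (u N).2 hmem
    rwa [sub_sub_cancel] at this
  refine ⟨⟨L, hLmem⟩, tendsto_iff_norm_sub_tendsto_zero.2 (Metric.tendsto_atTop.2 fun ε hε => ?_)⟩
  obtain ⟨N, hN⟩ := key (ε / 2) (by positivity)
  refine ⟨N, fun n hn => ?_⟩
  have h1 := hN n hn
  have h2 := ModSpace.ofReal_norm_eq hω (u n - ⟨L, hLmem⟩)
  rw [Submodule.coe_sub] at h2
  rw [← h2, ENNReal.ofReal_le_ofReal_iff (by positivity)] at h1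
  rw [Real.dist_0_eq_abs, abs_norm]
  linarith

theorem ModSpace.t2Space (hω : SubgaussianWeight ω) : T2Space (ModSpace p q ω) := by
  have : T0Space (ModSpace p q ω) := ⟨fun u v h => ModSpace.eq_of_norm_sub_eq_zero hω (by
    rw [← dist_eq_norm]
    exact Metric.inseparable_iff.1 h)⟩
  infer_instance

end Complete

/-! ### Weyl operators of Gaussian symbols -/

/-- The constant in `pair_gAtom_gAtom`. -/
def atomConst (ι : Type) [Fintype ι] : ℂ := ((Real.pi : ℂ) / 2) ^ ((Fintype.card ι : ℂ) / 2)

theorem gAtom_mul_gAtom (X Ξ Y H t : E ι) :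
    gAtom 1 X Ξ (t + (1 / 2 : ℝ) • (X + Y)) * gAtom 1 Y H (t + (1 / 2 : ℝ) • (X + Y)) =
      Complex.exp (((-(1 / 2) * ‖X - Y‖ ^ 2 : ℝ) : ℂ) +
        Complex.I * ((inner ℝ (Ξ + H) (X + Y) / 2 : ℝ) : ℂ)) *
      Complex.exp (-(2 : ℂ) * (‖t‖ : ℂ) ^ 2 + Complex.I * ((inner ℝ (Ξ + H) t : ℝ) : ℂ)) := by
  simp only [gAtom, ← Complex.exp_add]
  congr 1
  have h1 : (-1 * ‖t + (1 / 2 : ℝ) • (X + Y) - X‖ ^ 2 +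
      -1 * ‖t + (1 / 2 : ℝ) • (X + Y) - Y‖ ^ 2 : ℝ) = -(1 / 2) * ‖X - Y‖ ^ 2 + -2 * ‖t‖ ^ 2 := by
    simp only [← real_inner_self_eq_norm_sq, inner_add_left, inner_add_right, inner_sub_left,
      inner_sub_right, real_inner_smul_left, real_inner_smul_right]
    rw [real_inner_comm X t, real_inner_comm Y t, real_inner_comm X Y]
    ring
  have h2 : (inner ℝ Ξ (t + (1 / 2 : ℝ) • (X + Y)) + inner ℝ H (t + (1 / 2 : ℝ) • (X + Y)) : ℝ) =
      inner ℝ (Ξ + H) (X + Y) / 2 + inner ℝ (Ξ + H) t := by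
    simp only [inner_add_left, inner_add_right, real_inner_smul_right]
    ring
  have e1 := congrArg (fun r : ℝ => (r : ℂ)) h1
  have e2 := congrArg (fun r : ℝ => (r : ℂ)) h2
  push_cast at e1 e2 ⊢
  linear_combination e1 + Complex.I * e2

theorem pair_gAtom_gAtom (X Ξ Y H : E ι) :
    pair (ofGS ⟨gAtom 1 X Ξ, gAtom_mem_GS one_pos X Ξ⟩) (gAtom 1 Y H) = atomConst ι *
      Complex.exp (((-(1 / 2) * ‖X - Y‖ ^ 2 - 1 / 8 * ‖Ξ + H‖ ^ 2 : ℝ) : ℂ) +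
        Complex.I * ((inner ℝ (Ξ + H) (X + Y) / 2 : ℝ) : ℂ)) := by
  rw [pair_ofGS _ (gAtom_mem_GS one_pos Y H),
    ← integral_add_right_eq_self _ ((1 / 2 : ℝ) • (X + Y))]
  simp only [gAtom_mul_gAtom, integral_const_mul]
  have h := GaussianFourier.integral_cexp_neg_mul_sq_norm_add_of_euclideanSpace
    (b := 2) (by norm_num) Complex.I (Ξ + H)
  rw [h, atomConst, mul_left_comm, ← Complex.exp_add]
  congr 2
  rw [Complex.I_sq]
  push_cast
  ring

section RankOne

variable (X Ξ : E (ι ⊕ ι))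

/-- The exponent in `weylKernel_gAtom`. -/
def atomExponent (x ξ y η : E ι) : ℂ :=
  ((-(1 / 2) * (‖left X - (1 / 2 : ℝ) • (x + y)‖ ^ 2 + ‖right X - (1 / 2 : ℝ) • (ξ - η)‖ ^ 2) -
      1 / 8 * (‖left Ξ + (ξ + η)‖ ^ 2 + ‖right Ξ + (y - x)‖ ^ 2) : ℝ) : ℂ) +
    Complex.I * (((inner ℝ (left Ξ + (ξ + η)) (left X + (1 / 2 : ℝ) • (x + y)) +
      inner ℝ (right Ξ + (y - x)) (right X + (1 / 2 : ℝ) • (ξ - η))) / 2 +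
      inner ℝ (y - x) (η - ξ) / 2 : ℝ) : ℂ)

/-- All mixed terms between `(x, ξ)` and `(y, η)` cancel: in the real part those of the position
term against those of the frequency term, in the imaginary part against the Weyl phase. The exponent
is thus a sum of one function of each pair, so the kernel is a product. -/
theorem atomExponent_eq (x ξ y η : E ι) :
    atomExponent X Ξ x ξ y η =
      atomExponent X Ξ x ξ 0 0 + (atomExponent X Ξ 0 0 y η - atomExponent X Ξ 0 0 0 0) := by
  unfold atomExponent
  generalize left X = a, right X = b, left Ξ = c, right Ξ = e
  have key : ∀ r s r₁ s₁ r₂ s₂ r₃ s₃ : ℝ, r = r₁ + (r₂ - r₃) → s = s₁ + (s₂ - s₃) →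
      (r : ℂ) + Complex.I * s = (r₁ + Complex.I * s₁) + ((r₂ + Complex.I * s₂) -
        (r₃ + Complex.I * s₃)) := by
    rintro r s r₁ s₁ r₂ s₂ r₃ s₃ rfl rfl
    push_cast
    ring
  refine key _ _ _ _ _ _ _ _ ?_ ?_
  · simp only [← real_inner_self_eq_norm_sq, inner_add_left, inner_add_right, inner_sub_left,
      inner_sub_right, real_inner_smul_left, real_inner_smul_right, inner_zero_left,
      inner_zero_right]
    rw [real_inner_comm x a, real_inner_comm y a, real_inner_comm ξ b, real_inner_comm η b,
      real_inner_comm ξ c, real_inner_comm η c, real_inner_comm x e, real_inner_comm y e,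
      real_inner_comm x y, real_inner_comm ξ η]
    ring
  · simp only [inner_add_left, inner_add_right, inner_sub_left, inner_sub_right,
      real_inner_smul_right, inner_zero_left, inner_zero_right]
    rw [real_inner_comm y ξ, real_inner_comm x ξ, real_inner_comm y η, real_inner_comm x η]
    ring

theorem weylKernel_gAtom (z w : E ι × E ι) :
    weylKernel (ofGS ⟨gAtom 1 X Ξ, gAtom_mem_GS one_pos X Ξ⟩) z w =
      (stftConst ι : ℂ) * (stftConst ι : ℂ) * weylConst ι * atomConst (ι ⊕ ι) *
        Complex.exp (atomExponent X Ξ w.1 w.2 z.1 (-z.2)) := by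
  rw [weylKernel_eq_gAtom, weylTest_gAtom, pair_smul_right _ _ (gAtom_mem_GS one_pos _ _),
    pair_gAtom_gAtom, weylPhase, norm_sq_eq_left_right (X - _), norm_sq_eq_left_right (Ξ + _),
    inner_eq_left_right (Ξ + _)]
  have e : atomExponent X Ξ w.1 w.2 z.1 (-z.2) =
      (((-(1 / 2) * (‖left (X - weylCenter w.1 w.2 z.1 (-z.2))‖ ^ 2 +
        ‖right (X - weylCenter w.1 w.2 z.1 (-z.2))‖ ^ 2) -
        1 / 8 * (‖left (Ξ + weylFreq w.1 w.2 z.1 (-z.2))‖ ^ 2 +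
          ‖right (Ξ + weylFreq w.1 w.2 z.1 (-z.2))‖ ^ 2) : ℝ) : ℂ) +
      Complex.I * (((inner ℝ (left (Ξ + weylFreq w.1 w.2 z.1 (-z.2)))
        (left (X + weylCenter w.1 w.2 z.1 (-z.2))) +
        inner ℝ (right (Ξ + weylFreq w.1 w.2 z.1 (-z.2)))
        (right (X + weylCenter w.1 w.2 z.1 (-z.2)))) / 2 : ℝ) : ℂ)) +
      Complex.I * ((inner ℝ (z.1 - w.1) (-z.2 - w.2) / 2 : ℝ) : ℂ) := by
    rw [add_assoc, ← mul_add, ← Complex.ofReal_add]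
    rfl
  rw [e, Complex.exp_add _ (Complex.I * ((inner ℝ (z.1 - w.1) (-z.2 - w.2) / 2 : ℝ) : ℂ))]
  ring

/-- The kernel of the Weyl operator with a Gaussian symbol is a product. -/
theorem exists_weylKernel_gAtom_eq_mul : ∃ P Q : E ι × E ι → ℂ, ∀ z w,
    weylKernel (ofGS ⟨gAtom 1 X Ξ, gAtom_mem_GS one_pos X Ξ⟩) z w = P z * Q w := by
  refine ⟨fun z => (stftConst ι : ℂ) * (stftConst ι : ℂ) * weylConst ι * atomConst (ι ⊕ ι) *
    Complex.exp (atomExponent X Ξ 0 0 z.1 (-z.2) - atomExponent X Ξ 0 0 0 0),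
    fun w => Complex.exp (atomExponent X Ξ w.1 w.2 0 0), fun z w => ?_⟩
  rw [weylKernel_gAtom, atomExponent_eq, Complex.exp_add]
  ring

end RankOne

/-! ### Weyl operators as functions of the symbol -/

section WeylOperator

variable {p q p₁ q₁ p₂ q₂ : ℝ≥0∞} [Fact (1 ≤ p₁)] [Fact (1 ≤ q₁)] [Fact (1 ≤ p₂)] [Fact (1 ≤ q₂)]
  {ω : E ((ι ⊕ ι) ⊕ (ι ⊕ ι)) → ℝ} {ω₁ ω₂ : E (ι ⊕ ι) → ℝ} {C : ℝ}

/-- The operator `T` is given by the kernel of the Weyl operator with symbol `a`. -/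
def IsWeylOperator (a : GSDual (ι ⊕ ι)) (T : ModSpace p₁ q₁ ω₁ →L[ℂ] ModSpace p₂ q₂ ω₂) : Prop :=
  ∀ u, stft (T u : GSDual ι) =ᵐ[volume] kernelApply (weylKernel a) (u : GSDual ι)

theorem IsWeylOperator.unique {a : GSDual (ι ⊕ ι)}
    {S T : ModSpace p₁ q₁ ω₁ →L[ℂ] ModSpace p₂ q₂ ω₂} (hS : IsWeylOperator a S)
    (hT : IsWeylOperator a T) : S = T :=
  ContinuousLinearMap.ext fun u => Subtype.ext (GSDual.ext_stft ((hS u).trans (hT u).symm))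

theorem IsWeylOperator.smul {a : GSDual (ι ⊕ ι)}
    {T : ModSpace p₁ q₁ ω₁ →L[ℂ] ModSpace p₂ q₂ ω₂} (hT : IsWeylOperator a T) (c : ℂ) :
    IsWeylOperator (c • a) (c • T) := by
  intro u
  filter_upwards [hT u] with z hz
  have e : stft ((c • T) u : GSDual ι) = c • stft (T u : GSDual ι) := stft_smul c _
  rw [e, Pi.smul_apply, hz, smul_eq_mul, kernelApply, kernelApply, ← integral_const_mul]
  simp only [weylKernel, pair_smul, mul_assoc]

theorem KernelBound.ae_integrable {H : E ι × E ι → E ι × E ι → ℂ} {D : ℝ≥0∞}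
    (hH : Continuous fun v : (E ι × E ι) × (E ι × E ι) => H v.1 v.2)
    (hB : KernelBound H p₁ q₁ ω₁ p₂ q₂ ω₂ D) (hD : D ≠ ∞) (hω₁ : SubgaussianWeight ω₁)
    (hω₂ : SubgaussianWeight ω₂) (u : ModSpace p₁ q₁ ω₁) :
    ∀ᵐ z, Integrable (fun w => H z w * stft (u : GSDual ι) w) volume := by
  have hc : Continuous fun z : E ι × E ι => ((Real.exp (-1 * nsq z) : ℝ) : ℂ) := by
    have := continuous_nsq (ι := ι)
    fun_prop
  have h := hB.integrable_mul hH hD hω₁ hω₂ u.2 (G := fun z => ((Real.exp (-1 * nsq z) : ℝ) : ℂ))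
    hc.aestronglyMeasurable (hω₂.inv.ennMixed_mul_ne_top (one_le_conjExponent p₂)
      (one_le_conjExponent q₂) (r := 1) (M := 1) one_pos zero_le_one fun z =>
        enorm_le_ofReal_of_norm_le (by
          rw [Complex.norm_real, Real.norm_of_nonneg (Real.exp_pos _).le, one_mul]))
  rw [Measure.volume_eq_prod] at h
  filter_upwards [h.prod_right_ae] with z hz
  have h0 : ((Real.exp (-1 * nsq z) : ℝ) : ℂ) ≠ 0 := Complex.ofReal_ne_zero.2 (Real.exp_pos _).ne'
  refine (hz.mul_const (((Real.exp (-1 * nsq z) : ℝ) : ℂ))⁻¹).congr (ae_of_all _ fun w => ?_)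
  simp only
  rw [mul_assoc, mul_inv_cancel₀ h0, mul_one]

theorem ae_integrable_weylKernel (h : WeylExponents p q p₁ q₁ p₂ q₂) (hω : SubgaussianWeight ω)
    (hω₁ : SubgaussianWeight ω₁) (hω₂ : SubgaussianWeight ω₂) (hC : 0 < C)
    (hW : WeightBound ω ω₁ ω₂ C) {a : GSDual (ι ⊕ ι)} (ha : symbolNorm p q ω a ≠ ∞)
    (u : ModSpace p₁ q₁ ω₁) :
    ∀ᵐ z, Integrable (fun w => weylKernel a z w * stft (u : GSDual ι) w) volume :=
  (kernelBound_weylKernel h hω hω₁ hC hW ha).ae_integrable (continuous_weylKernel a)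
    (ENNReal.mul_ne_top (weylBoundConst_ne_top C) ha) hω₁ hω₂ u

theorem IsWeylOperator.add {a b : GSDual (ι ⊕ ι)}
    {S T : ModSpace p₁ q₁ ω₁ →L[ℂ] ModSpace p₂ q₂ ω₂} (hS : IsWeylOperator a S)
    (hT : IsWeylOperator b T) (h : WeylExponents p q p₁ q₁ p₂ q₂) (hω : SubgaussianWeight ω)
    (hω₁ : SubgaussianWeight ω₁) (hω₂ : SubgaussianWeight ω₂) (hC : 0 < C)
    (hW : WeightBound ω ω₁ ω₂ C) (ha : symbolNorm p q ω a ≠ ∞) (hb : symbolNorm p q ω b ≠ ∞) :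
    IsWeylOperator (a + b) (S + T) := by
  intro u
  filter_upwards [hS u, hT u, ae_integrable_weylKernel h hω hω₁ hω₂ hC hW ha u,
    ae_integrable_weylKernel h hω hω₁ hω₂ hC hW hb u] with z h1 h2 i1 i2
  have e : stft ((S + T) u : GSDual ι) = stft (S u : GSDual ι) + stft (T u : GSDual ι) :=
    stft_add _ _
  rw [e, Pi.add_apply, h1, h2, kernelApply, kernelApply, kernelApply, ← integral_add i1 i2]
  simp only [weylKernel, pair_add, add_mul]

theorem wsymplStft_add (ω : E ((ι ⊕ ι) ⊕ (ι ⊕ ι)) → ℝ) (a b : GSDual (ι ⊕ ι)) :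
    wsymplStft ω (a + b) = wsymplStft ω a + wsymplStft ω b := by
  funext Z
  simp [wsymplStft, pair_add, add_mul]

theorem symbolNorm_add_le (hp : 1 ≤ p) (hq : 1 ≤ q) (hω : SubgaussianWeight ω)
    (a b : GSDual (ι ⊕ ι)) :
    symbolNorm p q ω (a + b) ≤ symbolNorm p q ω a + symbolNorm p q ω b := by
  rw [symbolNorm, wsymplStft_add]
  exact mixedNorm_add_le hp hq (hω.aestronglyMeasurable_wsymplStft a)
    (hω.aestronglyMeasurable_wsymplStft b)

/-- The operator of the symbol `a - b` exists with the stated bound; adding `T` to it gives an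
operator for `a`, which is `S` by uniqueness. -/
theorem IsWeylOperator.norm_sub_le {a b : GSDual (ι ⊕ ι)}
    {S T : ModSpace p₁ q₁ ω₁ →L[ℂ] ModSpace p₂ q₂ ω₂} (hS : IsWeylOperator a S)
    (hT : IsWeylOperator b T) (h : WeylExponents p q p₁ q₁ p₂ q₂) (hω : SubgaussianWeight ω)
    (hω₁ : SubgaussianWeight ω₁) (hω₂ : SubgaussianWeight ω₂) (hC : 0 < C)
    (hW : WeightBound ω ω₁ ω₂ C) (hb : symbolNorm p q ω b ≠ ∞)
    (hab : symbolNorm p q ω (a - b) ≠ ∞) :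
    ‖S - T‖ ≤ (weylBoundConst ι C * symbolNorm p q ω (a - b)).toReal := by
  obtain ⟨R, hR, hRn, -, -⟩ := exists_weyl_extension h hω hω₁ hω₂ hC hW hab
  have hR' : IsWeylOperator (a - b) R := fun u => (hR u).eventuallyEq
  have h1 := hR'.add hT h hω hω₁ hω₂ hC hW hab hb
  rw [sub_add_cancel] at h1
  rw [hS.unique h1, add_sub_cancel_right]
  exact hRn

end WeylOperator

/-! ### Compactness -/

/-- If `T u = c • v` and `‖T u‖ < ‖v‖`, then `|c| ≤ 1`, so a neighbourhood of `0` is mapped into the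
image of a closed disc. The separation axiom ensures `‖v‖ > 0` for `v ≠ 0`, the spaces being only
seminormed. -/
theorem isCompactOperator_of_eq_smul {V W : Type*} [SeminormedAddCommGroup V] [NormedSpace ℂ V]
    [SeminormedAddCommGroup W] [NormedSpace ℂ W] [T2Space W] (T : V →L[ℂ] W) (v : W)
    (h : ∀ u, ∃ c : ℂ, T u = c • v) : IsCompactOperator T := by
  refine ⟨(fun c : ℂ => c • v) '' Metric.closedBall 0 1,
    (isCompact_closedBall 0 1).image (by fun_prop), ?_⟩
  rcases eq_or_ne v 0 with rfl | hv
  · refine univ_mem' fun u => ⟨0, by simp, ?_⟩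
    obtain ⟨c, hc⟩ := h u
    simp [hc]
  have hv0 : 0 < ‖v‖ := by
    refine (norm_nonneg v).lt_of_ne' fun h0 => hv ?_
    refine (Metric.inseparable_iff.2 ?_).eq
    rw [dist_zero_right, h0]
  have hcont : Continuous fun u => ‖T u‖ := T.continuous.norm
  have hmem : {u | ‖T u‖ < ‖v‖} ∈ 𝓝 (0 : V) :=
    (isOpen_lt hcont continuous_const).mem_nhds (by simpa using hv0)
  filter_upwards [hmem] with u hu
  obtain ⟨c, hc⟩ := h u
  refine ⟨c, ?_, hc.symm⟩
  rw [hc, norm_smul] at hu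
  rw [mem_closedBall_zero_iff]
  nlinarith

section Compactness

variable {p q p₁ q₁ p₂ q₂ : ℝ≥0∞} [Fact (1 ≤ p₁)] [Fact (1 ≤ q₁)] [Fact (1 ≤ p₂)] [Fact (1 ≤ q₂)]
  {ω : E ((ι ⊕ ι) ⊕ (ι ⊕ ι)) → ℝ} {ω₁ ω₂ : E (ι ⊕ ι) → ℝ} {C : ℝ}

/-- Approximation in one fixed `𝒮_{1/2,h}` is thereby approximation in the symbol norm. -/
theorem SubgaussianWeight.exists_symbolNorm_ofGS_le (hp : 1 ≤ p) (hq : 1 ≤ q)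
    (hω : SubgaussianWeight ω) {h : ℝ} (h0 : 0 < h) :
    ∃ N : ℝ≥0∞, N ≠ ∞ ∧ ∀ (b : GS (ι ⊕ ι)) (D : ℝ), GSBound h D (b : E (ι ⊕ ι) → ℂ) →
      symbolNorm p q ω (ofGS b) ≤ ENNReal.ofReal D * N := by
  obtain ⟨r, M, r0, M0, hM⟩ := exists_symplStft_decay (ι := ι) h0
  refine ⟨ennMixed p q fun Z : E (ι ⊕ ι) × E (ι ⊕ ι) =>
    ENNReal.ofReal (M * Real.exp (-r * nsq Z)) * ennWeight ω Z,
    hω.ennMixed_mul_ne_top hp hq r0 M0.le fun _ => le_rfl, fun b D hD => ?_⟩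
  rw [symbolNorm, mixedNorm_eq_ennMixed, ← ennMixed_const_mul _ _ _ ENNReal.ofReal_ne_top]
  refine ennMixed_mono _ _ fun Z => ?_
  rw [wsymplStft, enorm_mul, ← mul_assoc, ← ENNReal.ofReal_mul hD.nonneg]
  refine mul_le_mul' (enorm_le_ofReal_of_norm_le ((hM b D hD Z).trans_eq (by ring))) ?_
  rw [ennWeight, ← ofReal_norm, Complex.norm_real, Real.norm_of_nonneg (hω.pos _).le]

theorem SubgaussianWeight.symbolNorm_ofGS_ne_top (hp : 1 ≤ p) (hq : 1 ≤ q)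
    (hω : SubgaussianWeight ω) (b : GS (ι ⊕ ι)) : symbolNorm p q ω (ofGS b) ≠ ∞ := by
  obtain ⟨h, D, h0, hD⟩ := b.2.2
  obtain ⟨N, hN, hle⟩ := hω.exists_symbolNorm_ofGS_le hp hq h0
  exact ne_top_of_le_ne_top (ENNReal.mul_ne_top ENNReal.ofReal_ne_top hN) (hle b D hD)

/-- The kernel is a product, so the transform of `T u` is `ℓ(u) P` with a scalar `ℓ(u)`. Either `ℓ`
vanishes and `T = 0`, or the range is spanned by `T u₀` for some `u₀` with `ℓ(u₀) ≠ 0`; this avoids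
asking separately whether `P` is a transform. -/
theorem isCompactOperator_of_isWeylOperator_gAtom (hω₂ : SubgaussianWeight ω₂) (X Ξ : E (ι ⊕ ι))
    {T : ModSpace p₁ q₁ ω₁ →L[ℂ] ModSpace p₂ q₂ ω₂}
    (hT : IsWeylOperator (ofGS ⟨gAtom 1 X Ξ, gAtom_mem_GS one_pos X Ξ⟩) T) :
    IsCompactOperator T := by
  have := ModSpace.t2Space (p := p₂) (q := q₂) hω₂
  obtain ⟨P, Q, hPQ⟩ := exists_weylKernel_gAtom_eq_mul X Ξ
  have hval : ∀ u, stft (T u : GSDual ι) =ᵐ[volume]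
      (∫ w, Q w * stft (u : GSDual ι) w) • P := fun u => by
    filter_upwards [hT u] with z hz
    rw [hz, kernelApply, Pi.smul_apply, smul_eq_mul, mul_comm, ← integral_const_mul]
    simp only [hPQ, mul_assoc]
  by_cases h : ∀ u : ModSpace p₁ q₁ ω₁, ∫ w, Q w * stft (u : GSDual ι) w = 0
  · refine isCompactOperator_of_eq_smul T 0 fun u => ⟨0, ?_⟩
    rw [smul_zero]
    refine Subtype.ext (GSDual.ext_stft ?_)
    filter_upwards [hval u] with z hz
    have e : stft ((0 : ModSpace p₂ q₂ ω₂) : GSDual ι) = 0 := by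
      have := stft_smul 0 (0 : GSDual ι)
      rwa [zero_smul, zero_smul] at this
    rw [hz, h u, zero_smul, e]
  · push Not at h
    obtain ⟨u₀, hu₀⟩ := h
    refine isCompactOperator_of_eq_smul T (T u₀) fun u =>
      ⟨(∫ w, Q w * stft (u : GSDual ι) w) / ∫ w, Q w * stft (u₀ : GSDual ι) w, ?_⟩
    refine Subtype.ext (GSDual.ext_stft ?_)
    rw [Submodule.coe_smul, stft_smul]
    filter_upwards [hval u, hval u₀] with z h1 h2
    rw [Pi.smul_apply, h1, h2, Pi.smul_apply, Pi.smul_apply, smul_smul, div_mul_cancel₀ _ hu₀]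

/-- Limits of symbols with compact Weyl operators have compact Weyl operators. -/
theorem IsWeylOperator.isCompactOperator_of_approx (h : WeylExponents p q p₁ q₁ p₂ q₂)
    (hω : SubgaussianWeight ω) (hω₁ : SubgaussianWeight ω₁) (hω₂ : SubgaussianWeight ω₂)
    (hC : 0 < C) (hW : WeightBound ω ω₁ ω₂ C) {a : GSDual (ι ⊕ ι)}
    {T : ModSpace p₁ q₁ ω₁ →L[ℂ] ModSpace p₂ q₂ ω₂} (hT : IsWeylOperator a T)
    (happ : ∀ ε : ℝ≥0∞, 0 < ε → ∃ b : GS (ι ⊕ ι), symbolNorm p q ω (a - ofGS b) < ε ∧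
      ∀ S : ModSpace p₁ q₁ ω₁ →L[ℂ] ModSpace p₂ q₂ ω₂, IsWeylOperator (ofGS b) S →
        IsCompactOperator S) : IsCompactOperator T := by
  have := ModSpace.t2Space (p := p₂) (q := q₂) hω₂
  have := ModSpace.completeSpace (p := p₂) (q := q₂) hω₂
  choose b hb hbc using fun n : ℕ => happ ((n : ℝ≥0∞) + 1)⁻¹
    (ENNReal.inv_pos.2 (ENNReal.add_ne_top.2 ⟨ENNReal.natCast_ne_top n, ENNReal.one_ne_top⟩))
  have hbn : ∀ n, symbolNorm p q ω (ofGS (b n)) ≠ ∞ := fun n =>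
    hω.symbolNorm_ofGS_ne_top h.hp h.hq (b n)
  choose S hS _ _ _ using fun n => exists_weyl_extension h hω hω₁ hω₂ hC hW (hbn n)
  have hSW : ∀ n, IsWeylOperator (ofGS (b n)) (S n) := fun n u => (hS n u).eventuallyEq
  refine isCompactOperator_of_tendsto (F := S) (l := atTop) ?_
    (Eventually.of_forall fun n => hbc n (S n) (hSW n))
  have hlim : Tendsto (fun n => symbolNorm p q ω (a - ofGS (b n))) atTop (𝓝 0) := by
    have h1 : Tendsto (fun n : ℕ => ((n : ℝ≥0∞) + 1)⁻¹) atTop (𝓝 0) := by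
      have := ENNReal.tendsto_inv_nat_nhds_zero.comp (tendsto_add_atTop_nat 1)
      refine this.congr fun n => ?_
      simp
    exact tendsto_of_tendsto_of_tendsto_of_le_of_le tendsto_const_nhds h1
      (fun _ => zero_le) fun n => (hb n).le
  have hlim2 : Tendsto (fun n => (weylBoundConst ι C *
      symbolNorm p q ω (a - ofGS (b n))).toReal) atTop (𝓝 0) := by
    have h1 := ENNReal.Tendsto.const_mul hlim (Or.inr (weylBoundConst_ne_top (ι := ι) C))
    rw [mul_zero] at h1
    exact (ENNReal.tendsto_toReal ENNReal.zero_ne_top).comp h1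
  rw [tendsto_iff_norm_sub_tendsto_zero]
  refine squeeze_zero (fun n => norm_nonneg _) (fun n => ?_) hlim2
  rw [norm_sub_rev]
  exact hT.norm_sub_le (hSW n) h hω hω₁ hω₂ hC hW (hbn n) (hb n).ne_top

/-- The span of the Gaussian atoms. -/
def atomSpan (ι : Type) [Fintype ι] : Submodule ℂ (GS (ι ⊕ ι)) :=
  Submodule.span ℂ (Set.range fun w : E (ι ⊕ ι) × E (ι ⊕ ι) =>
    (⟨gAtom 1 w.1 w.2, gAtom_mem_GS one_pos w.1 w.2⟩ : GS (ι ⊕ ι)))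

theorem isCompactOperator_of_mem_atomSpan (h : WeylExponents p q p₁ q₁ p₂ q₂)
    (hω : SubgaussianWeight ω) (hω₁ : SubgaussianWeight ω₁) (hω₂ : SubgaussianWeight ω₂)
    (hC : 0 < C) (hW : WeightBound ω ω₁ ω₂ C) {b : GS (ι ⊕ ι)} (hb : b ∈ atomSpan ι) :
    ∀ T : ModSpace p₁ q₁ ω₁ →L[ℂ] ModSpace p₂ q₂ ω₂, IsWeylOperator (ofGS b) T →
      IsCompactOperator T := by
  have hfin : ∀ b : GS (ι ⊕ ι), symbolNorm p q ω (ofGS b) ≠ ∞ :=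
    hω.symbolNorm_ofGS_ne_top h.hp h.hq
  have hex : ∀ b : GS (ι ⊕ ι), ∃ T : ModSpace p₁ q₁ ω₁ →L[ℂ] ModSpace p₂ q₂ ω₂,
      IsWeylOperator (ofGS b) T := fun b => by
    obtain ⟨T, hT, -⟩ := exists_weyl_extension h hω hω₁ hω₂ hC hW (hfin b)
    exact ⟨T, fun u => (hT u).eventuallyEq⟩
  induction hb using Submodule.span_induction with
  | mem b hb =>
    obtain ⟨w, rfl⟩ := hb
    exact fun T hT => isCompactOperator_of_isWeylOperator_gAtom hω₂ w.1 w.2 hT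
  | zero =>
    intro T hT
    obtain ⟨S, hS⟩ := hex 0
    have h1 := hS.smul 0
    rw [← ofGS_smul, smul_zero, zero_smul] at h1
    rw [hT.unique h1]
    exact isCompactOperator_zero
  | add b c _ _ hb hc =>
    intro T hT
    obtain ⟨S, hS⟩ := hex b
    obtain ⟨R, hR⟩ := hex c
    have h1 := hS.add hR h hω hω₁ hω₂ hC hW (hfin b) (hfin c)
    rw [← ofGS_add] at h1
    rw [hT.unique h1]
    exact (hb S hS).add (hc R hR)
  | smul c b _ hb =>
    intro T hT
    obtain ⟨S, hS⟩ := hex b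
    have h1 := hS.smul c
    rw [← ofGS_smul] at h1
    rw [hT.unique h1]
    exact (hb S hS).smul c

theorem ofGS_sub (f g : GS ι) : ofGS (f - g) = ofGS f - ofGS g := by
  rw [sub_eq_add_neg, ← neg_one_smul ℂ g, ofGS_add, ofGS_smul, neg_one_smul ℂ (ofGS g),
    sub_eq_add_neg]

/-- The inversion formula with `s = 1` writes `b` as a superposition of the atoms that give rank-one
operators, and its simple-function approximations are finite sums of them. -/
theorem exists_mem_atomSpan_symbolNorm_lt (hp : 1 ≤ p) (hq : 1 ≤ q) (hω : SubgaussianWeight ω)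
    (b : GS (ι ⊕ ι)) {ε : ℝ≥0∞} (hε : 0 < ε) :
    ∃ c ∈ atomSpan ι, symbolNorm p q ω (ofGS b - ofGS c) < ε := by
  obtain ⟨δ, δ0, hI⟩ := integrable_gCoeff_mul_exp one_pos b
  have hm := (continuous_gCoeff one_pos b).aestronglyMeasurable (μ := volume)
  obtain ⟨h, S, D, h0, hD, hbd, -, -⟩ := exists_approx_superpos (s := 1) one_pos δ0 measurable_fst
    measurable_snd hm hI
  obtain ⟨N, hN, hle⟩ := hω.exists_symbolNorm_ofGS_le hp hq h0
  have hlim : Tendsto (fun n => ENNReal.ofReal (D n) * N) atTop (𝓝 0) := by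
    have h1 := ENNReal.Tendsto.mul_const (ENNReal.tendsto_ofReal hD) (Or.inr hN)
    rwa [ENNReal.ofReal_zero, zero_mul] at h1
  obtain ⟨n, hn⟩ := (hlim.eventually_lt_const hε).exists
  set c : GS (ι ⊕ ι) := ∑ w ∈ (S n).range, (∫ z in S n ⁻¹' {w}, gCoeff 1 b z) •
    (⟨gAtom 1 w.1 w.2, gAtom_mem_GS one_pos w.1 w.2⟩ : GS (ι ⊕ ι)) with hc
  have hcmem : c ∈ atomSpan ι := Submodule.sum_mem _ fun w _ =>
    Submodule.smul_mem _ _ (Submodule.subset_span ⟨w, rfl⟩)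
  refine ⟨c, hcmem, ?_⟩
  rw [← ofGS_sub]
  refine (hle (b - c) (D n) ?_).trans_lt hn
  have e := hbd n
  rw [superpos_gCoeff one_pos b, superpos_simpleFunc (integrable_of_mul_exp δ0 hm hI)] at e
  have e2 : ((b - c : GS (ι ⊕ ι)) : E (ι ⊕ ι) → ℂ) = (b : E (ι ⊕ ι) → ℂ) -
      ∑ w ∈ (S n).range, (∫ z in S n ⁻¹' {w}, gCoeff 1 b z) • gAtom 1 w.1 w.2 := by
    rw [Submodule.coe_sub, hc, Submodule.coe_sum]
    rfl
  rw [e2]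
  exact e

/-- Weyl operators with symbols in the closure of `𝒮_{1/2}` are compact. -/
theorem IsWeylOperator.isCompactOperator (h : WeylExponents p q p₁ q₁ p₂ q₂)
    (hω : SubgaussianWeight ω) (hω₁ : SubgaussianWeight ω₁) (hω₂ : SubgaussianWeight ω₂)
    (hC : 0 < C) (hW : WeightBound ω ω₁ ω₂ C) {a : GSDual (ι ⊕ ι)}
    {T : ModSpace p₁ q₁ ω₁ →L[ℂ] ModSpace p₂ q₂ ω₂} (hT : IsWeylOperator a T)
    (happ : ∀ ε : ℝ≥0∞, 0 < ε → ∃ b : GS (ι ⊕ ι), symbolNorm p q ω (a - ofGS b) < ε) :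
    IsCompactOperator T := by
  refine hT.isCompactOperator_of_approx h hω hω₁ hω₂ hC hW fun ε hε => ?_
  obtain ⟨b, hb⟩ := happ (ε / 2) (ENNReal.half_pos hε.ne')
  obtain ⟨c, hc, hbc⟩ := exists_mem_atomSpan_symbolNorm_lt h.hp h.hq hω b
    (ENNReal.half_pos hε.ne')
  refine ⟨c, ?_, isCompactOperator_of_mem_atomSpan h hω hω₁ hω₂ hC hW hc⟩
  have e := symbolNorm_add_le h.hp h.hq hω (a - ofGS b) (ofGS b - ofGS c)
  rw [sub_add_sub_cancel] at e
  exact e.trans_lt ((ENNReal.add_lt_add hb hbc).trans_eq (ENNReal.add_halves ε))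

end Compactness

end WeylMod

end

open WeylMod in
theorem mainTheorem11 (d : ℕ) (p q p₁ q₁ p₂ q₂ : ℝ≥0∞)
    (hp : 1 ≤ p) (hq : 1 ≤ q) [Fact (1 ≤ p₁)] [Fact (1 ≤ q₁)] [Fact (1 ≤ p₂)] [Fact (1 ≤ q₂)]
    (hexp₁ : p₂⁻¹.toReal - p₁⁻¹.toReal = p⁻¹.toReal + q⁻¹.toReal - 1)
    (hexp₂ : q₂⁻¹.toReal - q₁⁻¹.toReal = p⁻¹.toReal + q⁻¹.toReal - 1)
    (hqp₂ : q ≤ p₂) (hqq₂ : q ≤ q₂) (hp₂p : p₂ ≤ p) (hq₂p : q₂ ≤ p)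
    (ω : E ((Fin d ⊕ Fin d) ⊕ (Fin d ⊕ Fin d)) → ℝ) (ω₁ ω₂ : E (Fin d ⊕ Fin d) → ℝ)
    (hω : IsWeaklySubgaussian ω) (hω₁ : IsWeaklySubgaussian ω₁) (hω₂ : IsWeaklySubgaussian ω₂)
    (hfeas : FeasiblePair p q ω) (hfeas₁ : FeasiblePair p₁ q₁ ω₁)
    (hfeas₂ : FeasiblePair p₂ q₂ ω₂)
    (hωω : ∃ C : ℝ, 0 < C ∧ ∀ X Y : E (Fin d ⊕ Fin d), ω₂ (X - Y) / ω₁ (X + Y) ≤ C * ω (join X Y))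
    (a : GSDual (Fin d ⊕ Fin d)) (ha : MemSymbol p q ω a) :
    ∃ T : ModSpace p₁ q₁ ω₁ →L[ℂ] ModSpace p₂ q₂ ω₂,
      ExtendsWeyl a T ∧
      Continuous[weakTopology p₁ q₁ ω₁, weakTopology p₂ q₂ ω₂] T ∧
      (p₁ < ∞ → q₁ < ∞ → ∀ S : ModSpace p₁ q₁ ω₁ → ModSpace p₂ q₂ ω₂,
        Continuous S → ExtendsWeyl a S → S = T) ∧
      (∀ S : ModSpace p₁ q₁ ω₁ → ModSpace p₂ q₂ ω₂,
        Continuous[weakTopology p₁ q₁ ω₁, weakTopology p₂ q₂ ω₂] S → ExtendsWeyl a S → S = T) ∧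
      ((∀ ε : ℝ≥0∞, 0 < ε → ∃ b ∈ hermiteSpan (Fin d ⊕ Fin d),
          symbolNorm p q ω (a - ofGS b) < ε) →
        IsCompactOperator T) := by
  obtain ⟨C, hC, hW⟩ := hωω
  have hanti : ∀ {r s : ℝ≥0∞}, 1 ≤ r → r ≤ s → r⁻¹.toReal ≥ s⁻¹.toReal := fun {r s} hr hrs =>
    ENNReal.toReal_mono (ENNReal.inv_ne_top.2 (one_pos.trans_le hr).ne') (ENNReal.inv_le_inv.2 hrs)
  have h : WeylExponents p q p₁ q₁ p₂ q₂ := ⟨hp, hq, Fact.out, Fact.out, Fact.out, Fact.out, hexp₁,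
    hexp₂, hanti hq hqp₂, hanti hq hqq₂, hanti Fact.out hp₂p, hanti Fact.out hq₂p⟩
  obtain ⟨T, hT, -, hext, hweak⟩ := exists_weyl_extension h hω.subgaussianWeight
    hω₁.subgaussianWeight hω₂.subgaussianWeight hC hW ha.2.ne
  refine ⟨T, hext, hweak, fun h1 h2 S hS hSe => ?_, fun S hS hSe => ?_, fun happ => ?_⟩
  · exact hSe.eq_of_continuous hext hfeas₁ hω₂.subgaussianWeight h1.ne h2.ne hS T.continuous
  · exact hSe.eq_of_continuous_weak hext hfeas₁ hω₂.subgaussianWeight hS hweak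
  · have hTW : IsWeylOperator a T := fun u => (hT u).eventuallyEq
    refine hTW.isCompactOperator h hω.subgaussianWeight hω₁.subgaussianWeight
      hω₂.subgaussianWeight hC hW fun ε hε => ?_
    -- Elements of `hermiteSpan` are by type functions in `𝒮_{1/2}`, and compactness holds on the
    -- closure of all of `𝒮_{1/2}`.
    obtain ⟨b, -, hb⟩ := happ ε hε
    exact ⟨b, hb⟩
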